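/- Let $(M^8,g)$ be a compact Riemannian $8$-manifold whose injectivity radius is at least $1$ at every point. An ${\rm Sp}(2){\rm Sp}(1)$-structure inducing $g$ is a $4$-form $\Omega$ on $M$ such that at each point, in some $g$-orthonormal coframe, $\Omega=\frac12(\omega_1\wedge\omega_1+\omega_2\wedge\omega_2+\omega_3\wedge\omega_3)$ with \[\omega_1=e^{12}+e^{34}+e^{56}+e^{78},\quad \omega_2=e^{13}-e^{24}+e^{57}-e^{68},\quad \omega_3=e^{14}+e^{23}+e^{58}+e^{67}.\] For $2$-forms let $\diamond$ be the linear extension of $(\alpha\wedge\beta)\diamond\Omega=\alpha\wedge(\beta^\sharp\lrcorner\,\Omega)-\beta\wedge(\alpha^\sharp\lrcorner\,\Omega)$, and let $\Lambda^2_{15}$ be the orthogonal complement in $\Lambda^2$ of $\ker(\diamond)\cong\mathfrak{sp}(2)\oplus\mathfrak{sp}(1)$. The torsion of $\Omega$ is the $\Lambda^2_{15}$-valued $1$-form $T$ determined by $\nabla_X\Omega=T(X)\diamond\Omega$, where $\nabla$ is the Levi-Civita connection of $g$; its divergence is the trace ${\rm div}\,T=\sum_i(\nabla_{e_i}T)(e_i)$,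 and the energy of $\Omega$ is $E(\Omega)=\frac12\int_M|T|^2\,{\rm vol}$. Fix a smooth function $\phi$ on $\mathbb R^8$ with compact support in the open unit ball $B(0,1)$ and constant on $B(0,1/2)$. Let $\{\Omega(t)\}_{t\in[0,t_0)}$ be a smooth solution of the harmonic flow $\partial_t\Omega=({\rm div}\,T)\diamond\Omega$ by ${\rm Sp}(2){\rm Sp}(1)$-structures inducing $g$, with torsion $T(t)$, and write $E(0)=E(\Omega(0))$. Given $p\in M$ and geodesic normal coordinates $x$ at $p$ on the unit ball $B(p,1)\cong B(0,1)$, set, for $0<t<t_0$, \[Z(t)=(t_0-t)\int_{B(0,1)}|T(t)|^2\,G\,\phi^2\sqrt{\det g}\,dx,\qquad G=\frac{1}{(4\pi(t_0-t))^4}\exp\Big(-\frac{|x|^2}{4(t_0-t)}\Big).\] Then there is a constant $C>0$ depending only on $(M,g)$ and $\phi$ (not on $p$, the normal coordinates, $t_0$ or the solution) such that for any $N>1$ and any $t_1,t_2$ with \[t_0-\min\{1,t_0\}<t_1\le t_2<t_0\] one has \[Z(t_2)\le e^{C(f(t_2)-f(t_1))}Z(t_1)+C\Big(N^4\big(E(0)+\sqrt{E(0)}\big)+\frac1{\log^2N}\Big)(t_2-t_1),\]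 where \[f(t)=(t_0-t)\big\{-26+26\log(t_0-t)-13\log^2(t_0-t)+4\log^3(t_0-t)-\log^4(t_0-t)\big\}.\] -/

import Mathlib

open scoped Manifold ContDiff

noncomputable section

namespace QKFlow

/-- Euclidean space `ℝ⁸`, the model space of all the manifolds below. -/
abbrev E8 : Type := EuclideanSpace ℝ (Fin 8)

/-! ### Pointwise algebra in index notation

`gi` stands for the matrix `g^{ij}` of the inverse metric. A `4`-form is given by its components
`W I = W_{I 0, I 1, I 2, I 3}`, a `2`-form by the skew-symmetric matrix of its components. -/

/-- Components of a covariant `4`-tensor. -/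
abbrev Comp4 : Type := (Fin 4 → Fin 8) → ℝ

/-- The `2`-form `dxᵢ ∧ dxⱼ`, with indices from `0` to `7`. -/
def dx2 (i j : Fin 8) : Matrix (Fin 8) (Fin 8) ℝ :=
  Matrix.single i j 1 - Matrix.single j i 1

/-- The standard triple of `2`-forms `ω₁, ω₂, ω₃` on `ℝ⁸`. -/
def omegaStd : Fin 3 → Matrix (Fin 8) (Fin 8) ℝ :=
  ![dx2 0 1 + dx2 2 3 + dx2 4 5 + dx2 6 7,
    dx2 0 2 - dx2 1 3 + dx2 4 6 - dx2 5 7,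
    dx2 0 3 + dx2 1 2 + dx2 4 7 + dx2 5 6]

/-- The standard `4`-form `½ (ω₁ ∧ ω₁ + ω₂ ∧ ω₂ + ω₃ ∧ ω₃)` on `ℝ⁸`. -/
def OmegaStd : Comp4 := fun I =>
  ∑ r, (omegaStd r (I 0) (I 1) * omegaStd r (I 2) (I 3)
      - omegaStd r (I 0) (I 2) * omegaStd r (I 1) (I 3)
      + omegaStd r (I 0) (I 3) * omegaStd r (I 1) (I 2))

/-- The infinitesimal action `α ⋄ W` of a `2`-form `α` on a `4`-form `W`, the linear extension of
`(α ∧ β) ⋄ W = α ∧ (β♯ ⌟ W) - β ∧ (α♯ ⌟ W)`. -/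
def diamond (gi : Matrix (Fin 8) (Fin 8) ℝ) (α : Matrix (Fin 8) (Fin 8) ℝ) (W : Comp4) : Comp4 :=
  fun I => ∑ a : Fin 4, ∑ j, ∑ k, α (I a) j * gi j k * W (Function.update I a k)

/-- The inner product of `2`-forms (for which the `eⁱ ∧ eʲ`, `i < j`, are orthonormal if `eⁱ` is
an orthonormal coframe). -/
def inner2 (gi : Matrix (Fin 8) (Fin 8) ℝ) (α β : Matrix (Fin 8) (Fin 8) ℝ) : ℝ :=
  (1 / 2) * ∑ i, ∑ j, ∑ k, ∑ l, gi i k * gi j l * α i j * β k l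

/-- `α ∈ Λ²₁₅`: the `2`-form `α` is orthogonal to the stabiliser `{β ∈ Λ² | β ⋄ W = 0}` of `W`,
which is a copy of `𝔰𝔭(2) ⊕ 𝔰𝔭(1)` if `W` is the `4`-form of an `Sp(2)Sp(1)`-structure. -/
def IsLambda15 (gi : Matrix (Fin 8) (Fin 8) ℝ) (W : Comp4) (α : Matrix (Fin 8) (Fin 8) ℝ) : Prop :=
  α.transpose = -α ∧
    ∀ β : Matrix (Fin 8) (Fin 8) ℝ, β.transpose = -β → diamond gi β W = 0 → inner2 gi α β = 0

open Classical in
/-- The inverse of `⋄` on `Λ²₁₅`: the `2`-form `α ∈ Λ²₁₅` with `α ⋄ W = η`. It is unique, as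
`Λ²₁₅` is the orthogonal complement of the kernel of `⋄`. -/
def diamondInv (gi : Matrix (Fin 8) (Fin 8) ℝ) (W η : Comp4) : Matrix (Fin 8) (Fin 8) ℝ :=
  if h : ∃ α, IsLambda15 gi W α ∧ diamond gi α W = η then h.choose else 0

/-! ### Tensor calculus in local coordinates -/

/-- Partial derivative `∂f/∂xᵢ` of a function on `ℝ⁸`. -/
def pderiv (i : Fin 8) (f : E8 → ℝ) (y : E8) : ℝ :=
  fderiv ℝ f y (EuclideanSpace.single i 1)

/-- Christoffel symbols `Γᵏᵢⱼ` of a metric with coefficients `gm`. -/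
def christoffel (gm : E8 → Matrix (Fin 8) (Fin 8) ℝ) (y : E8) (k i j : Fin 8) : ℝ :=
  (1 / 2) * ∑ l, (gm y)⁻¹ k l *
    (pderiv i (fun z => gm z j l) y + pderiv j (fun z => gm z i l) y
      - pderiv l (fun z => gm z i j) y)

/-- Components `(∇ₘ W)_I` of the covariant derivative of a `4`-form. -/
def cov4 (gm : E8 → Matrix (Fin 8) (Fin 8) ℝ) (W : E8 → Comp4) (y : E8) (m : Fin 8) : Comp4 :=
  fun I => pderiv m (fun z => W z I) y
    - ∑ a : Fin 4, ∑ k, christoffel gm y k m (I a) * W y (Function.update I a k)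

/-- The intrinsic torsion `T`, with `T y m i j = T(∂ₘ)ᵢⱼ`: the `1`-form with values in `Λ²₁₅`
determined by `∇ₘ W = T(∂ₘ) ⋄ W`. -/
def torsion (gm : E8 → Matrix (Fin 8) (Fin 8) ℝ) (W : E8 → Comp4) (y : E8) (m : Fin 8) :
    Matrix (Fin 8) (Fin 8) ℝ :=
  diamondInv (gm y)⁻¹ (W y) (cov4 gm W y m)

/-- Components `(∇ₘ T)(∂ₙ)ᵢⱼ` of the covariant derivative of a `2`-form valued `1`-form. -/
def cov12 (gm : E8 → Matrix (Fin 8) (Fin 8) ℝ) (T : E8 → Fin 8 → Matrix (Fin 8) (Fin 8) ℝ)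
    (y : E8) (m n i j : Fin 8) : ℝ :=
  pderiv m (fun z => T z n i j) y
    - ∑ k, (christoffel gm y k m n * T y k i j + christoffel gm y k m i * T y n k j
      + christoffel gm y k m j * T y n i k)

/-- The divergence `(div T)ᵢⱼ = gᵐⁿ (∇ₘ T)(∂ₙ)ᵢⱼ`. -/
def divT (gm : E8 → Matrix (Fin 8) (Fin 8) ℝ) (T : E8 → Fin 8 → Matrix (Fin 8) (Fin 8) ℝ)
    (y : E8) : Matrix (Fin 8) (Fin 8) ℝ :=
  Matrix.of fun i j => ∑ m, ∑ n, (gm y)⁻¹ m n * cov12 gm T y m n i j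

/-- The squared norm `|T|² = gᵐⁿ ⟨T(∂ₘ), T(∂ₙ)⟩` of a `2`-form valued `1`-form. -/
def normSq12 (gi : Matrix (Fin 8) (Fin 8) ℝ) (T : Fin 8 → Matrix (Fin 8) (Fin 8) ℝ) : ℝ :=
  ∑ m, ∑ n, gi m n * inner2 gi (T m) (T n)

/-- The curve `c` in a coordinate domain satisfies the geodesic equation
`c̈ᵏ + Γᵏᵢⱼ ċⁱ ċʲ = 0` on the set `J` of times. -/
def GeodesicEq (gm : E8 → Matrix (Fin 8) (Fin 8) ℝ) (c : ℝ → E8) (J : Set ℝ) : Prop :=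
  ∀ s ∈ J, ∀ k, iteratedDeriv 2 (fun r => c r k) s
    + ∑ i, ∑ j, christoffel gm (c s) k i j * deriv (fun r => c r i) s * deriv (fun r => c r j) s = 0

/-! ### Manifolds -/

section Manifold

variable {M : Type*} [TopologicalSpace M] [ChartedSpace E8 M]

/-- Coordinate vector field `∂ᵢ` of the chart `e` at the point with coordinates `y`. -/
def coordVec (e : OpenPartialHomeomorph M E8) (y : E8) (i : Fin 8) :
    TangentSpace (𝓡 8) (e.symm y) :=
  mfderiv (𝓡 8) (𝓡 8) e.symm y (EuclideanSpace.single i (1 : ℝ) : E8)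

variable (M) in
/-- A field of (not necessarily smooth) `4`-forms on `M`. -/
abbrev FourForm : Type _ := ∀ x : M, TangentSpace (𝓡 8) x [⋀^Fin 4]→ₗ[ℝ] ℝ

/-- Components of a `4`-form in a chart. -/
def comp4 (e : OpenPartialHomeomorph M E8) (Ω : FourForm M) (y : E8) : Comp4 :=
  fun I => Ω (e.symm y) fun a => coordVec e y (I a)

variable [IsManifold (𝓡 8) ∞ M]

variable (M) in
/-- Smooth Riemannian metrics on `M`. -/
abbrev SmoothMetric : Type _ :=
  Bundle.ContMDiffRiemannianMetric (𝓡 8) ∞ E8 (fun x : M => TangentSpace (𝓡 8) x)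

/-- Metric coefficients `gᵢⱼ` in a chart. -/
def metricCoeff (g : SmoothMetric M) (e : OpenPartialHomeomorph M E8) (y : E8) :
    Matrix (Fin 8) (Fin 8) ℝ :=
  Matrix.of fun i j => g.inner (e.symm y) (coordVec e y i) (coordVec e y j)

/-- `Ω` is an `Sp(2)Sp(1)`-structure inducing the metric `g`: at each point there is a
`g`-orthonormal frame in which `Ω` has the components of the standard `4`-form. -/
def IsQKStructure (g : SmoothMetric M) (Ω : FourForm M) : Prop :=
  ∀ x : M, ∃ b : Fin 8 → TangentSpace (𝓡 8) x,
    (∀ i j, g.inner x (b i) (b j) = if i = j then 1 else 0) ∧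
    ∀ I : Fin 4 → Fin 8, Ω x (fun a => b (I a)) = OmegaStd I

/-- Components of the intrinsic torsion of `Ω` in a chart. -/
def torsionIn (g : SmoothMetric M) (e : OpenPartialHomeomorph M E8) (Ω : FourForm M) :
    E8 → Fin 8 → Matrix (Fin 8) (Fin 8) ℝ :=
  torsion (metricCoeff g e) (comp4 e Ω)

/-- The function `|T|²` on `M`, computed at `x` in the preferred chart at `x`. -/
def torsionNormSq (g : SmoothMetric M) (Ω : FourForm M) (x : M) : ℝ :=
  normSq12 (metricCoeff g (chartAt E8 x) (chartAt E8 x x))⁻¹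
    (torsionIn g (chartAt E8 x) Ω (chartAt E8 x x))

/-- A solution on `[0, t₀)` of the harmonic flow `∂Ω/∂t = (div T) ⋄ Ω` of
`Sp(2)Sp(1)`-structures inducing `g`. -/
structure IsQKHarmonicFlow (g : SmoothMetric M) (t₀ : ℝ) (Ω : ℝ → FourForm M) : Prop where
  /-- `Ω` is smooth on `[0, t₀) × M`. -/
  smooth : ∀ e ∈ IsManifold.maximalAtlas (𝓡 8) ∞ M, ∀ I : Fin 4 → Fin 8,
    ContDiffOn ℝ ∞ (fun q : ℝ × E8 => comp4 e (Ω q.1) q.2 I) (Set.Ico 0 t₀ ×ˢ e.target)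
  isQK : ∀ t ∈ Set.Ico 0 t₀, IsQKStructure g (Ω t)
  evolution : ∀ e ∈ IsManifold.maximalAtlas (𝓡 8) ∞ M, ∀ t ∈ Set.Ico 0 t₀, ∀ y ∈ e.target,
    ∀ I : Fin 4 → Fin 8,
      HasDerivWithinAt (fun s => comp4 e (Ω s) y I)
        (diamond (metricCoeff g e y)⁻¹ (divT (metricCoeff g e) (torsionIn g e (Ω t)) y)
          (comp4 e (Ω t) y) I)
        (Set.Ico 0 t₀) t

variable (M) in
/-- A smooth partition of unity subordinate to the sources of the preferred charts of `M`. -/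
def chartPartition [T2Space M] [SigmaCompactSpace M] : SmoothPartitionOfUnity M (𝓡 8) M :=
  (SmoothPartitionOfUnity.exists_isSubordinate_chartAt_source (𝓡 8) M).choose

/-- The integral `∫_M h vol` with respect to the Riemannian volume, for `M` compact: the sum of
the integrals of `ρᵢ h √(det g)` in the chart around `i`, for a partition of unity `(ρᵢ)`. -/
def integralVol [T2Space M] [CompactSpace M] (g : SmoothMetric M) (h : M → ℝ) : ℝ :=
  ∑ᶠ i : M, ∫ y in (chartAt E8 i).target,
    chartPartition M i ((chartAt E8 i).symm y) * h ((chartAt E8 i).symm y)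
      * √(metricCoeff g (chartAt E8 i) y).det

/-- The energy `E(Ω) = ½ ∫_M |T|² vol`. -/
def energy [T2Space M] [CompactSpace M] (g : SmoothMetric M) (Ω : FourForm M) : ℝ :=
  (1 / 2) * integralVol g (torsionNormSq g Ω)

/-- `e` is a system of geodesic normal coordinates at `p` on the ball of radius `r`, that is, the
inverse of `exp_p : B(0, r) → M` for an identification of `T_pM` with `ℝ⁸` by an orthonormal
basis: a smooth chart onto `B(0, r)` centred at `p`, with `gᵢⱼ(0) = δᵢⱼ`, in which the straight
lines through the origin are geodesics. -/
structure IsNormalChart (g : SmoothMetric M) (p : M) (r : ℝ) (e : OpenPartialHomeomorph M E8) :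
    Prop where
  mem_atlas : e ∈ IsManifold.maximalAtlas (𝓡 8) ∞ M
  target_eq : e.target = Metric.ball (0 : E8) r
  mem_source : p ∈ e.source
  map_center : e p = 0
  orthonormal : metricCoeff g e 0 = 1
  geodesic : ∀ v : E8,
    GeodesicEq (metricCoeff g e) (fun s => s • v) {s : ℝ | s • v ∈ Metric.ball (0 : E8) r}

/-- The injectivity radius of `(M, g)` is at least `r`: at every point the exponential map is a
diffeomorphism from the ball of radius `r` onto its image. -/
def InjRadiusGE (g : SmoothMetric M) (r : ℝ) : Prop :=
  ∀ p : M, ∃ e : OpenPartialHomeomorph M E8, IsNormalChart g p r e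

/-- The Euclidean backward heat kernel on `ℝ⁸` with pole at the origin at time `t₀`. -/
def heatKernel (t₀ t : ℝ) (y : E8) : ℝ :=
  1 / (4 * Real.pi * (t₀ - t)) ^ 4 * Real.exp (-‖y‖ ^ 2 / (4 * (t₀ - t)))

/-- `Z(t) = (t₀ - t) ∫ |T(t)|² G φ² √(det g) dx`, in normal coordinates `e` on the unit ball. -/
def localEnergy (g : SmoothMetric M) (e : OpenPartialHomeomorph M E8) (φ : E8 → ℝ) (t₀ : ℝ)
    (Ω : ℝ → FourForm M) (t : ℝ) : ℝ :=
  (t₀ - t) * ∫ y in Metric.ball (0 : E8) 1,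
    torsionNormSq g (Ω t) (e.symm y) * heatKernel t₀ t y * φ y ^ 2 * √(metricCoeff g e y).det

end Manifold

/-- The polylogarithmic weight `f`. -/
def logWeight (t₀ t : ℝ) : ℝ :=
  (t₀ - t) * (-26 + 26 * Real.log (t₀ - t) - 13 * Real.log (t₀ - t) ^ 2
    + 4 * Real.log (t₀ - t) ^ 3 - Real.log (t₀ - t) ^ 4)

end QKFlow

end

/-! ### Linear algebra of pairs (metric, `4`-form): actions, inner products, the inverse of `⋄`, and
the tangent space of the orbit. -/

noncomputable section

namespace QKFlow

open Matrix Finset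

/-! ### Derivatives of matrix-valued and tensor-valued curves -/

/-! This is a local almost-monotonicity formula: differentiate `Z`, add the integral of a
divergence, complete a square, and control what is left. Write `τ = t₀ - t`, `L = log τ`, `ψ = G φ²`
and `D = div T`.

Evolution. Differentiating `∇Ω = T ⋄ Ω` in time determines `∂ₜT` only modulo the stabiliser of `Ω`,
but `T` is orthogonal to that stabiliser, and the commutator `[D, T]` disappears because the trace
form is invariant. Hence `∂ₜ|T|² = 2⟨T, ∇D⟩` (`ChartFlow.hasDerivAt_enDensity`). Differentiating the
same equation in space and antisymmetrising gives a Bianchi identity modulo the stabiliser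
(`ChartMetric.bianchi`, `ChartFlow.br_bianchi`): paired with `T`, the derivatives `∇ₙTₖ` and `∇ₖTₙ`
may be exchanged at the price of a curvature term. Testing the evolution with the constant `1` shows
that the energy decreases (`IsQKHarmonicFlow.energy_le`).

The square. `monoField` is the vector field `ψ⟨T, x⌟T - 2τD⟩ - ½ψ|T|²x`, a density in coordinates.
Adding its divergence, whose integral is zero, to the time derivative of the integrand leaves `-2τG
|φD - (φ/2τ) x⌟T + ∇φ⌟T|²` and errors (`NormalMetric.sum_pderiv_monoField`,
`BoundedNormalMetric.localDeriv_add_le`). The Gauss lemma enters here: the Riemannian gradient of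
`G` is exactly `-Gx/2τ`. The errors are of three kinds: terms with `∇φ`, supported in `|x| ≥ 1/2`
where `G` is bounded, of size `|T|²`; radial derivatives of the metric, of size `|x|²|T|²ψ`; and the
curvature term, of size `|x||T|ψ`.

Uniformity. The second kind needs a bound for the radial derivative of the metric in normal
coordinates that depends only on a curvature bound and on the radius. It satisfies a matrix Riccati
equation along rays, which is reduced to scalar Riccati inequalities (`exists_radial_bound`,
`exists_normal_bound`). Compactness of `M` bounds the curvature (`exists_curvature_bound`).

Closing. One has `|x|²G ≤ 16 L² τ G + e⁴` (`sq_mul_heatKernel_le`), so the quadratic errors cost `L²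
Z` and the energy. For the curvature term, if `τ < 1/N`, Young's inequality with weight `L²τ` and
`∫|x|²G ≤ 64τ` gives a multiple of `L² Z + 1/L²`, and `1/L² ≤ 1/log² N`; if `τ ≥ 1/N`, then `G ≤
N⁴`, and `∫|T|` over the ball is bounded by a multiple of `√E(0)`. So `Z' ≤ a (L² + L⁴) Z + a R`
(`exists_deriv_le`), and `f` is a primitive of `L² + L⁴`, bounded on the range of times, so that
Gronwall's argument concludes (`le_of_hasDerivAt_le_logWeight`).

Foundations. The torsion is defined pointwise by a choice, so that neither its defining equation nor
its smoothness is automatic. The equation holds because `∇Ω` is tangent to the orbit of the standard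
form, proved by compactness of its isotropy group and without a smooth choice of frames
(`exists_act_eq_of_tendsto`, `exists_diamond_eq`). Smoothness holds because the inverse of `⋄` on
`Λ²₁₅` is given by one universal polynomial formula (`diamondPinv`). Everything is computed in
charts and shown to be independent of the chart (`FlowChange`). -/

/-- Real `8 × 8` matrices. -/
abbrev Mat : Type := Matrix (Fin 8) (Fin 8) ℝ

/-- The curve of matrices `F` has the derivative `F'` at `s`, entry by entry. -/
def MatDeriv (F : ℝ → Mat) (F' : Mat) (s : ℝ) : Prop :=
  ∀ i j, HasDerivAt (fun r => F r i j) (F' i j) s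

/-- The curve of `4`-tensors `V` has the derivative `V'` at `s`, component by component. -/
def CompDeriv (V : ℝ → Comp4) (V' : Comp4) (s : ℝ) : Prop :=
  ∀ I, HasDerivAt (fun r => V r I) (V' I) s

section MatDeriv

variable {F G : ℝ → Mat} {F' G' : Mat} {s : ℝ}

lemma matDeriv_const (A : Mat) (s : ℝ) : MatDeriv (fun _ => A) 0 s :=
  fun _ _ => hasDerivAt_const _ _

lemma MatDeriv.neg (hF : MatDeriv F F' s) : MatDeriv (fun r => -F r) (-F') s :=
  fun i j => (hF i j).neg

lemma MatDeriv.transpose (hF : MatDeriv F F' s) : MatDeriv (fun r => (F r)ᵀ) F'ᵀ s :=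
  fun i j => hF j i

lemma MatDeriv.smul {f : ℝ → ℝ} {f' : ℝ} (hf : HasDerivAt f f' s) (hF : MatDeriv F F' s) :
    MatDeriv (fun r => f r • F r) (f' • F s + f s • F') s := fun i j => by
  simpa using hf.fun_mul (hF i j)

lemma MatDeriv.sum {ι : Type*} {u : Finset ι} {H : ι → ℝ → Mat} {H' : ι → Mat}
    (h : ∀ k ∈ u, MatDeriv (H k) (H' k) s) :
    MatDeriv (fun r => ∑ k ∈ u, H k r) (∑ k ∈ u, H' k) s := fun i j => by
  simp only [Matrix.sum_apply]
  exact HasDerivAt.fun_sum fun k hk => h k hk i j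

lemma MatDeriv.mul (hF : MatDeriv F F' s) (hG : MatDeriv G G' s) :
    MatDeriv (fun r => F r * G r) (F' * G s + F s * G') s := fun i j => by
  simp only [Matrix.mul_apply, Matrix.add_apply, ← sum_add_distrib]
  exact HasDerivAt.fun_sum fun k _ => (hF i k).mul (hG k j)

lemma MatDeriv.trace (hF : MatDeriv F F' s) :
    HasDerivAt (fun r => (F r).trace) F'.trace s := by
  simp only [Matrix.trace, Matrix.diag]
  exact HasDerivAt.fun_sum fun k _ => hF k k

lemma MatDeriv.unique (h₁ : MatDeriv F F' s) (h₂ : MatDeriv F G' s) : F' = G' := by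
  ext i j; exact (h₁ i j).unique (h₂ i j)

lemma MatDeriv.congr_of_eventuallyEq (hF : MatDeriv F F' s) (h : ∀ᶠ r in nhds s, G r = F r) :
    MatDeriv G F' s := fun i j =>
  (hF i j).congr_of_eventuallyEq (h.mono fun r hr => by simp [hr])

/-- The unsimplified product rule. What matters is that the value depends only on `F s` and `F'`, so
that another curve with the same first-order data may be used to evaluate it. -/
lemma MatDeriv.hasDerivAt_det_sum (hF : MatDeriv F F' s) :
    HasDerivAt (fun r => (F r).det)
      (∑ σ : Equiv.Perm (Fin 8), (Equiv.Perm.sign σ : ℝ) *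
        ∑ i, (∏ j ∈ univ.erase i, F s (σ j) j) * F' (σ i) i) s := by
  simp only [Matrix.det_apply']
  refine HasDerivAt.fun_sum fun σ _ => ?_
  have := HasDerivAt.fun_finsetProd (u := univ) (x := s) (fun i _ => hF (σ i) i)
  simpa only [smul_eq_mul] using this.const_mul (Equiv.Perm.sign σ : ℝ)

/-- Jacobi's formula. The curve may be replaced by the affine one with the same value and
derivative, which factors as `F s * (1 + (r - s) • (F s)⁻¹ F')`; the expansion of `det (1 + r • A)`
to first order is then `1 + r tr A`. -/
lemma MatDeriv.det (hF : MatDeriv F F' s) (h : IsUnit (F s).det) :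
    HasDerivAt (fun r => (F r).det) ((F s).det * ((F s)⁻¹ * F').trace) s := by
  have h1 := hF.hasDerivAt_det_sum
  let H : ℝ → Mat := fun r => F s + (r - s) • F'
  have hH : MatDeriv H F' s := fun i j => by
    have := (((hasDerivAt_id s).sub_const s).mul_const (F' i j)).const_add (F s i j)
    simpa [H] using this
  have h2 := hH.hasDerivAt_det_sum
  have hHs : H s = F s := by simp [H]
  rw [hHs] at h2
  have h3 : HasDerivAt (fun r => (H r).det) ((F s).det * ((F s)⁻¹ * F').trace) s := by
    have e : ∀ r, H r = F s * (1 + (r - s) • ((F s)⁻¹ * F')) := fun r => by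
      simp only [H, mul_add, mul_one, Matrix.mul_smul, ← Matrix.mul_assoc,
        Matrix.mul_nonsing_inv _ h, Matrix.one_mul]
    have e2 : (fun r => (H r).det) = fun r => (F s).det * (1 + ((F s)⁻¹ * F').trace * (r - s)
        + (Matrix.det (1 + (Polynomial.X : Polynomial ℝ) •
          ((F s)⁻¹ * F').map Polynomial.C)).divX.divX.eval (r - s) * (r - s) ^ 2) := by
      ext r; rw [e, Matrix.det_mul, Matrix.det_one_add_smul]
    rw [e2]
    have d1 := (hasDerivAt_id s).sub_const s
    have d2 : HasDerivAt (fun r => (Matrix.det (1 + (Polynomial.X : Polynomial ℝ) •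
          ((F s)⁻¹ * F').map Polynomial.C)).divX.divX.eval (r - s)) _ s :=
      HasDerivAt.comp (h₂ := fun x => Polynomial.eval x _) s (Polynomial.hasDerivAt _ (s - s)) d1
    have d3 := ((((d1.const_mul ((F s)⁻¹ * F').trace).const_add 1).add
      (d2.mul (d1.pow 2))).const_mul (F s).det)
    refine (d3.congr_deriv ?_)
    simp
  rwa [h3.unique h2]

/-- Cramer's rule shows that the entries of the inverse are differentiable; differentiating `F F⁻¹ =
1` then forces the value. -/
lemma MatDeriv.inv (hF : MatDeriv F F' s) (h : IsUnit (F s).det) :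
    MatDeriv (fun r => (F r)⁻¹) (-((F s)⁻¹ * F' * (F s)⁻¹)) s := by
  have hdet := hF.hasDerivAt_det_sum
  have hdiff : ∀ i j, ∃ d, HasDerivAt (fun r => (F r)⁻¹ i j) d s := fun i j => by
    have hadj : ∃ d, HasDerivAt (fun r => (F r).adjugate i j) d s := by
      have : MatDeriv (fun r => (F r).updateRow j (Pi.single i 1)) (F'.updateRow j 0) s := by
        intro k l
        by_cases hk : k = j
        · subst hk; simpa using hasDerivAt_const s _
        · simpa [Matrix.updateRow_apply, hk] using hF k l
      exact ⟨_, by simpa only [Matrix.adjugate_apply] using this.hasDerivAt_det_sum⟩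
    obtain ⟨d, hd⟩ := hadj
    refine ⟨_, ((hdet.inv h.ne_zero).mul hd).congr_of_eventuallyEq (.of_forall fun r => ?_)⟩
    simp [Matrix.inv_def, Ring.inverse_eq_inv']
  choose D hD using hdiff
  have hM : MatDeriv (fun r => (F r)⁻¹) (Matrix.of D) s := fun i j => hD i j
  have h1 := hF.mul hM
  have hev : ∀ᶠ r in nhds s, (F r).det ≠ 0 := hdet.continuousAt.eventually_ne h.ne_zero
  have h2 : MatDeriv (fun r => F r * (F r)⁻¹) 0 s :=
    (matDeriv_const 1 s).congr_of_eventuallyEq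
      (hev.mono fun r hr => Matrix.mul_nonsing_inv _ hr.isUnit)
  have h3 := h1.unique h2
  have h4 : Matrix.of D = -((F s)⁻¹ * F' * (F s)⁻¹) := by
    have : (F s)⁻¹ * (F' * (F s)⁻¹ + F s * Matrix.of D) = 0 := by rw [h3, mul_zero]
    rw [mul_add, ← Matrix.mul_assoc, ← Matrix.mul_assoc, Matrix.nonsing_inv_mul _ h,
      Matrix.one_mul] at this
    exact (neg_eq_of_add_eq_zero_right this).symm
  exact h4 ▸ hM

lemma compDeriv_const (W : Comp4) (s : ℝ) : CompDeriv (fun _ => W) 0 s :=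
  fun _ => hasDerivAt_const _ _

lemma CompDeriv.unique {V : ℝ → Comp4} {V' V'' : Comp4} (h₁ : CompDeriv V V' s)
    (h₂ : CompDeriv V V'' s) : V' = V'' := by
  ext I; exact (h₁ I).unique (h₂ I)

end MatDeriv

/-! ### The actions of matrices on `4`-tensors -/

/-- The infinitesimal action of a matrix on covariant `4`-tensors. -/
def act (a : Mat) (W : Comp4) : Comp4 := fun I =>
  ∑ p : Fin 4, ∑ k, a (I p) k * W (Function.update I p k)

/-- The action of a matrix on covariant `4`-tensors. -/
def pull (J : Mat) (W : Comp4) : Comp4 := fun I => ∑ A : Fin 4 → Fin 8, (∏ p, J (I p) (A p)) * W A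

lemma diamond_eq_act (gi α : Mat) (W : Comp4) : diamond gi α W = act (α * gi) W := by
  ext I
  simp only [diamond, act, Matrix.mul_apply, sum_mul]
  exact sum_congr rfl fun a _ => sum_comm

lemma act_add_left (a b : Mat) (W : Comp4) : act (a + b) W = act a W + act b W := by
  ext I; simp [act, add_mul, sum_add_distrib]

lemma act_sub_left (a b : Mat) (W : Comp4) : act (a - b) W = act a W - act b W := by
  ext I; simp [act, sub_mul, sum_sub_distrib]

lemma act_neg_left (a : Mat) (W : Comp4) : act (-a) W = -act a W := by
  ext I; simp [act]

lemma act_smul_left (c : ℝ) (a : Mat) (W : Comp4) : act (c • a) W = c • act a W := by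
  ext I; simp [act, mul_sum, mul_assoc]

lemma act_zero_left (W : Comp4) : act 0 W = 0 := by
  ext I; simp [act]

lemma act_sum_left {ι : Type*} (u : Finset ι) (a : ι → Mat) (W : Comp4) :
    act (∑ k ∈ u, a k) W = ∑ k ∈ u, act (a k) W := by
  classical
  induction u using Finset.induction_on with
  | empty => simp [act_zero_left]
  | insert k u hk ih => rw [sum_insert hk, sum_insert hk, act_add_left, ih]

lemma act_sub_right (a : Mat) (V W : Comp4) : act a (V - W) = act a V - act a W := by
  ext I; simp [act, mul_sub, sum_sub_distrib]

lemma pull_add (J : Mat) (V W : Comp4) : pull J (V + W) = pull J V + pull J W := by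
  ext I; simp [pull, mul_add, sum_add_distrib]

lemma pull_sub (J : Mat) (V W : Comp4) : pull J (V - W) = pull J V - pull J W := by
  ext I; simp [pull, mul_sub, sum_sub_distrib]

lemma pull_smul (J : Mat) (c : ℝ) (W : Comp4) : pull J (c • W) = c • pull J W := by
  ext I; simp [pull, mul_sum, mul_left_comm]

lemma pull_zero (J : Mat) : pull J 0 = 0 := by
  ext I; simp [pull]

lemma pull_one (W : Comp4) : pull 1 W = W := by
  ext I
  rw [pull, sum_eq_single I]
  · simp
  · intro A _ hA
    obtain ⟨p, hp⟩ := Function.ne_iff.1 hA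
    rw [prod_eq_zero (mem_univ p), zero_mul]
    exact Matrix.one_apply_ne (Ne.symm hp)
  · simp

lemma pull_mul (J K : Mat) (W : Comp4) : pull (J * K) W = pull J (pull K W) := by
  ext I
  simp only [pull, Matrix.mul_apply, mul_sum]
  rw [sum_comm]
  refine sum_congr rfl fun A _ => ?_
  rw [prod_univ_sum, sum_mul, Fintype.piFinset_univ]
  exact sum_congr rfl fun B _ => by rw [prod_mul_distrib, mul_assoc]

/-- The derivative of `pull (J s) (V s)`. -/
lemma CompDeriv.pull {J : ℝ → Mat} {J' c : Mat} {V : ℝ → Comp4} {V' : Comp4} {s : ℝ}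
    (hJ : MatDeriv J J' s) (hc : J' = c * J s) (hV : CompDeriv V V' s) :
    CompDeriv (fun r => pull (J r) (V r)) (pull (J s) V' + act c (pull (J s) (V s))) s := by
  intro I
  have h : HasDerivAt (fun r => ∑ A : Fin 4 → Fin 8, (∏ p, J r (I p) (A p)) * V r A)
      (∑ A : Fin 4 → Fin 8, ((∑ p, (∏ q ∈ univ.erase p, J s (I q) (A q)) * J' (I p) (A p)) * V s A
        + (∏ p, J s (I p) (A p)) * V' A)) s := by
    refine HasDerivAt.fun_sum fun A _ => ?_
    have := HasDerivAt.fun_finsetProd (u := univ) (x := s) (fun p _ => hJ (I p) (A p))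
    exact this.mul (hV A)
  refine h.congr_deriv ?_
  rw [sum_add_distrib, add_comm]
  simp only [Pi.add_apply, QKFlow.pull, act]
  congr 1
  have e : ∀ (p : Fin 4) (k : Fin 8) (A : Fin 4 → Fin 8),
      ∏ q, J s (Function.update I p k q) (A q)
        = (∏ q ∈ univ.erase p, J s (I q) (A q)) * J s k (A p) := by
    intro p k A
    rw [← mul_prod_erase univ _ (mem_univ p), Function.update_self, mul_comm]
    congr 1
    exact prod_congr rfl fun q hq => by rw [Function.update_of_ne (ne_of_mem_erase hq)]
  simp only [e, hc, Matrix.mul_apply, mul_sum, sum_mul]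
  rw [sum_comm]
  refine sum_congr rfl fun p _ => ?_
  rw [sum_comm]
  exact sum_congr rfl fun k _ => sum_congr rfl fun A _ => by ring

lemma matDeriv_one_add_smul (a : Mat) : MatDeriv (fun r => 1 + r • a) a 0 := fun i j => by
  simpa using ((hasDerivAt_id (0 : ℝ)).mul_const (a i j)).const_add ((1 : Mat) i j)

/-- `act` is the differential at the identity of the group action `pull`, so that identities for
`act` follow by differentiating identities for `pull`. -/
lemma compDeriv_pull_one_add_smul (a : Mat) (W : Comp4) :
    CompDeriv (fun r => pull (1 + r • a) W) (act a W) 0 := by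
  have := CompDeriv.pull (matDeriv_one_add_smul a) (c := a) (by simp) (compDeriv_const W 0)
  simpa [pull_zero, pull_one] using this

/-- `pull J` intertwines the infinitesimal actions of `b` and of `c = J b J⁻¹`. -/
lemma pull_act {J b c : Mat} (h : J * b = c * J) (W : Comp4) :
    pull J (act b W) = act c (pull J W) := by
  -- Differentiate `J (1 + r b) = (1 + r c) J`, acting on `W`, at `r = 0`.
  have h1 : CompDeriv (fun r => pull J (pull (1 + r • b) W)) (pull J (act b W)) 0 := by
    intro I
    exact HasDerivAt.fun_sum fun A _ => (compDeriv_pull_one_add_smul b W A).const_mul _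
  have h2 := compDeriv_pull_one_add_smul c (pull J W)
  refine h1.unique ?_
  convert h2 using 2 with r
  rw [← pull_mul, ← pull_mul]
  congr 1
  simp [mul_add, add_mul, h]

/-- In the product of two actions, the terms in which `a` and `b` hit different slots are symmetric
and cancel in the commutator; those in the same slot compose to matrix products. So `act` is a
representation of the Lie algebra of matrices. -/
lemma act_act_sub (a b : Mat) (W : Comp4) :
    act a (act b W) - act b (act a W) = act (a * b - b * a) W := by
  ext I
  have key : ∀ a b : Mat, act a (act b W) I = ∑ p, ∑ q, if q = p then
      ∑ k, (a * b) (I p) k * W (Function.update I p k) else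
      ∑ k, ∑ l, a (I p) k * (b (I q) l * W (Function.update (Function.update I p k) q l)) := by
    intro a b
    simp only [act]
    refine sum_congr rfl fun p _ => ?_
    simp only [mul_sum]
    rw [sum_comm]
    refine sum_congr rfl fun q _ => ?_
    split_ifs with h
    · subst h
      simp only [Function.update_self, Function.update_idem, Matrix.mul_apply, sum_mul]
      rw [sum_comm]
      exact sum_congr rfl fun l _ => sum_congr rfl fun k _ => by ring
    · simp only [Function.update_of_ne h]
  rw [Pi.sub_apply, key a b, key b a]
  have swap : ∑ p : Fin 4, ∑ q, (if q = p then
      ∑ k, (b * a) (I p) k * W (Function.update I p k) else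
      ∑ k, ∑ l, b (I p) k * (a (I q) l * W (Function.update (Function.update I p k) q l)))
      = ∑ p : Fin 4, ∑ q, (if q = p then
      ∑ k, (b * a) (I p) k * W (Function.update I p k) else
      ∑ k, ∑ l, a (I p) k * (b (I q) l * W (Function.update (Function.update I p k) q l))) := by
    rw [sum_comm]
    refine sum_congr rfl fun p _ => sum_congr rfl fun q _ => ?_
    by_cases h : p = q
    · subst h; simp
    · rw [if_neg h, if_neg (Ne.symm h), sum_comm]
      refine sum_congr rfl fun k _ => sum_congr rfl fun l _ => ?_
      rw [Function.update_comm h]; ring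
  rw [swap, ← sum_sub_distrib, act]
  refine sum_congr rfl fun p _ => ?_
  rw [← sum_sub_distrib, sum_eq_single p]
  · simp [sub_mul, sum_sub_distrib]
  · intro q _ hq; simp [hq]
  · simp

lemma CompDeriv.act {a : ℝ → Mat} {a' : Mat} {V : ℝ → Comp4} {V' : Comp4} {s : ℝ}
    (ha : MatDeriv a a' s) (hV : CompDeriv V V' s) :
    CompDeriv (fun r => act (a r) (V r)) (act a' (V s) + act (a s) V') s := by
  intro I
  have : HasDerivAt (fun r => ∑ p : Fin 4, ∑ k, a r (I p) k * V r (Function.update I p k))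
      (∑ p : Fin 4, ∑ k, (a' (I p) k * V s (Function.update I p k)
        + a s (I p) k * V' (Function.update I p k))) s :=
    HasDerivAt.fun_sum fun p _ => HasDerivAt.fun_sum fun k _ => (ha _ _).mul (hV _)
  refine this.congr_deriv ?_
  simp [QKFlow.act, sum_add_distrib]

/-! ### Inner products -/

/-- The invariant inner product `-½ tr (a b)` of infinitesimal isometries. -/
def br (a b : Mat) : ℝ := -(1 / 2) * (a * b).trace

lemma br_comm (a b : Mat) : br a b = br b a := by rw [br, br, Matrix.trace_mul_comm]

lemma br_add_left (a b c : Mat) : br (a + b) c = br a c + br b c := by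
  simp [br, add_mul, mul_add]

lemma br_add_right (a b c : Mat) : br a (b + c) = br a b + br a c := by
  simp [br, mul_add]

lemma br_sub_right (a b c : Mat) : br a (b - c) = br a b - br a c := by
  simp [br, mul_sub]

lemma br_smul_left (r : ℝ) (a b : Mat) : br (r • a) b = r * br a b := by
  simp [br]; ring

lemma br_smul_right (r : ℝ) (a b : Mat) : br a (r • b) = r * br a b := by
  simp [br]; ring

lemma br_sum_left {ι : Type*} (u : Finset ι) (a : ι → Mat) (b : Mat) :
    br (∑ k ∈ u, a k) b = ∑ k ∈ u, br (a k) b := by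
  simp [br, sum_mul, Matrix.trace_sum, mul_sum]

lemma br_sum_right {ι : Type*} (u : Finset ι) (a : Mat) (b : ι → Mat) :
    br a (∑ k ∈ u, b k) = ∑ k ∈ u, br a (b k) := by
  simp [br, mul_sum, Matrix.trace_sum]

/-- Invariance of the trace form. It makes Christoffel terms drop out when inner products are
differentiated. -/
lemma br_commutator_add (c a b : Mat) : br (c * a - a * c) b + br a (c * b - b * c) = 0 := by
  have h1 : (a * (c * b)).trace = (a * c * b).trace := by rw [Matrix.mul_assoc]
  have h2 : (a * (b * c)).trace = (c * a * b).trace := by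
    rw [← Matrix.mul_assoc, Matrix.trace_mul_comm, Matrix.mul_assoc]
  simp [br, mul_sub, sub_mul, h1, h2]

/-- Raising an index turns `2`-forms into endomorphisms, and skewness turns the transpose in the
Euclidean pairing into a sign. From here on all norms of `2`-forms are traces, which are insensitive
to conjugation. -/
lemma inner2_eq_br {gi α β : Mat} (hβ : βᵀ = -β) (hgi : giᵀ = gi) :
    inner2 gi α β = br (α * gi) (β * gi) := by
  have h : ∑ i, ∑ j, ∑ k, ∑ l, gi i k * gi j l * α i j * β k l
      = (α * gi * (gi * β)ᵀ).trace := by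
    simp only [Matrix.trace, Matrix.diag, Matrix.mul_apply, Matrix.transpose_apply, sum_mul, mul_sum]
    refine sum_congr rfl fun i _ => ?_
    calc _ = ∑ j, ∑ l, ∑ k, gi i k * gi j l * α i j * β k l :=
          sum_congr rfl fun j _ => sum_comm
      _ = ∑ l, ∑ j, ∑ k, gi i k * gi j l * α i j * β k l := sum_comm
      _ = ∑ l, ∑ k, ∑ j, gi i k * gi j l * α i j * β k l := sum_congr rfl fun _ _ => sum_comm
      _ = _ := sum_congr rfl fun l _ => sum_congr rfl fun k _ => sum_congr rfl fun j _ => by ring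
  rw [inner2, h, Matrix.transpose_mul, hβ, hgi, br]
  simp only [Matrix.neg_mul, Matrix.mul_neg, Matrix.trace_neg, Matrix.mul_assoc]
  ring

/-- In an orthonormal frame `br` is the Euclidean inner product. -/
lemma br_frame {gi P α β : Mat} (hgi : gi = Pᵀ * P) (hβ : βᵀ = -β) :
    br (α * gi) (β * gi)
      = (1 / 2) * ∑ i, ∑ j, (P * α * Pᵀ) i j * (P * β * Pᵀ) i j := by
  have h1 : (α * gi * (β * gi)).trace = (P * α * Pᵀ * (P * β * Pᵀ)).trace := by
    rw [hgi]
    calc _ = (α * Pᵀ * (P * β * Pᵀ) * P).trace := by simp only [Matrix.mul_assoc]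
      _ = _ := by rw [Matrix.trace_mul_comm]; simp only [Matrix.mul_assoc]
  have h2 : P * β * Pᵀ = -(P * β * Pᵀ)ᵀ := by
    simp [Matrix.transpose_mul, hβ, Matrix.mul_assoc]
  rw [br, h1]
  have h3 : (P * α * Pᵀ * (P * β * Pᵀ)).trace
      = -∑ i, ∑ j, (P * α * Pᵀ) i j * (P * β * Pᵀ) i j := by
    conv_lhs => rw [h2]
    simp only [Matrix.trace, Matrix.diag, Matrix.mul_apply (M := P * α * Pᵀ), Matrix.neg_apply,
      Matrix.transpose_apply, mul_neg, sum_neg_distrib]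
  rw [h3]; ring

lemma br_self_nonneg {gi P α : Mat} (hgi : gi = Pᵀ * P) (hα : αᵀ = -α) :
    0 ≤ br (α * gi) (α * gi) := by
  rw [br_frame hgi hα]
  have : 0 ≤ ∑ i, ∑ j, (P * α * Pᵀ) i j * (P * α * Pᵀ) i j :=
    sum_nonneg fun i _ => sum_nonneg fun j _ => mul_self_nonneg _
  linarith

lemma eq_zero_of_br_self {gi P α : Mat} (hgi : gi = Pᵀ * P) (hP : IsUnit P.det) (hα : αᵀ = -α)
    (h : br (α * gi) (α * gi) = 0) : α = 0 := by
  rw [br_frame hgi hα] at h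
  have h0 : ∑ i, ∑ j, (P * α * Pᵀ) i j * (P * α * Pᵀ) i j = 0 := by linarith
  have h1 : P * α * Pᵀ = 0 := by
    ext i j
    have := (sum_eq_zero_iff_of_nonneg (fun i _ => sum_nonneg fun j _ => mul_self_nonneg _)).1 h0 i
      (mem_univ i)
    have := (sum_eq_zero_iff_of_nonneg (fun j _ => mul_self_nonneg _)).1 this j (mem_univ j)
    simpa using this
  have hPt : IsUnit Pᵀ.det := by rwa [Matrix.det_transpose]
  calc α = P⁻¹ * (P * α * Pᵀ) * (Pᵀ)⁻¹ := by
        rw [Matrix.mul_assoc P, ← Matrix.mul_assoc P⁻¹, Matrix.nonsing_inv_mul _ hP,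
          Matrix.one_mul, Matrix.mul_assoc, Matrix.mul_nonsing_inv _ hPt, Matrix.mul_one]
    _ = 0 := by rw [h1]; simp

/-! ### Standard pairs of a metric and a `4`-form -/

/-- In a suitable frame, given by the rows of `P`, the metric `g` is Euclidean and `W` is the
standard `4`-form. -/
def IsStdFrame (g : Mat) (W : Comp4) (P : Mat) : Prop :=
  P * g * Pᵀ = 1 ∧ pull P W = OmegaStd

lemma IsStdFrame.isUnit_det {g : Mat} {W : Comp4} {P : Mat} (h : IsStdFrame g W P) :
    IsUnit P.det := by
  have := congrArg Matrix.det h.1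
  rw [Matrix.det_mul, Matrix.det_mul, Matrix.det_one, mul_assoc] at this
  exact IsUnit.of_mul_eq_one _ this

lemma inv_eq_of_frame {g P : Mat} (h : P * g * Pᵀ = 1) : g⁻¹ = Pᵀ * P := by
  have hP : Pᵀ * (P * g) = 1 := mul_eq_one_comm.1 h
  exact Matrix.inv_eq_left_inv (by rw [Matrix.mul_assoc, hP])

lemma isUnit_det_of_frame {g P : Mat} (h : P * g * Pᵀ = 1) : IsUnit g.det := by
  have := congrArg Matrix.det h
  rw [Matrix.det_mul, Matrix.det_mul, Matrix.det_one, mul_comm, ← mul_assoc] at this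
  exact IsUnit.of_mul_eq_one_right _ this

/-- The form in which orthogonality to the stabiliser is used: every identity known only after
acting on `W` becomes an identity after pairing with the torsion. -/
lemma IsLambda15.br_eq_zero {gi : Mat} {W : Comp4} {α X : Mat} (h : IsLambda15 gi W α)
    (hgi : giᵀ = gi) {β : Mat} (hX : X = β * gi) (hβ : βᵀ = -β) (hW : act X W = 0) :
    br (α * gi) X = 0 := by
  subst hX
  rw [← inner2_eq_br hβ hgi]
  exact h.2 β hβ (by rw [diamond_eq_act, hW])

lemma IsLambda15.sub {gi : Mat} {W : Comp4} {α β : Mat} (hα : IsLambda15 gi W α)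
    (hβ : IsLambda15 gi W β) : IsLambda15 gi W (α - β) := by
  refine ⟨by rw [Matrix.transpose_sub, hα.1, hβ.1]; abel, fun ξ hξ h => ?_⟩
  have h1 := hα.2 ξ hξ h
  have h2 := hβ.2 ξ hξ h
  simp only [inner2, Matrix.sub_apply, mul_sub, sub_mul, sum_sub_distrib] at *
  linarith

/-- The difference lies both in the stabiliser and in its orthogonal complement, hence is orthogonal
to itself. -/
lemma IsLambda15.eq_of_diamond_eq {gi P : Mat} {W : Comp4} {α β : Mat} (hgi : gi = Pᵀ * P)
    (hP : IsUnit P.det) (hα : IsLambda15 gi W α) (hβ : IsLambda15 gi W β)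
    (h : diamond gi α W = diamond gi β W) : α = β := by
  have hs := hα.sub hβ
  have hgt : giᵀ = gi := by rw [hgi]; simp
  refine sub_eq_zero.1 (eq_zero_of_br_self hgi hP hs.1 ?_)
  refine hs.br_eq_zero hgt rfl hs.1 ?_
  rw [sub_mul, act_sub_left, ← diamond_eq_act, ← diamond_eq_act, h, sub_self]

lemma diamondInv_spec {gi : Mat} {W η : Comp4}
    (h : ∃ α, IsLambda15 gi W α ∧ diamond gi α W = η) :
    IsLambda15 gi W (diamondInv gi W η) ∧ diamond gi (diamondInv gi W η) W = η := by
  rw [diamondInv, dif_pos h]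
  exact h.choose_spec

end QKFlow

end

noncomputable section

namespace QKFlow

open Matrix Finset

/-! ### A polynomial formula for the inverse of `⋄` on `Λ²₁₅` -/

/-- The skew-symmetric part of a matrix. -/
def skewPart (α : Mat) : Mat := (1 / 2 : ℝ) • (α - αᵀ)

lemma skewPart_transpose (α : Mat) : (skewPart α)ᵀ = -skewPart α := by
  rw [skewPart, Matrix.transpose_smul, Matrix.transpose_sub, Matrix.transpose_transpose, ← smul_neg]
  congr 1; abel

lemma skewPart_of_skew {α : Mat} (h : αᵀ = -α) : skewPart α = α := by
  rw [skewPart, h]; ext i j; simp; ring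

lemma skewPart_conj (X α : Mat) : X * skewPart α * Xᵀ = skewPart (X * α * Xᵀ) := by
  simp [skewPart, Matrix.mul_assoc, mul_sub, sub_mul]

/-- The Euclidean pairing of matrices. -/
def pair2 (α β : Mat) : ℝ := ∑ i, ∑ j, α i j * β i j

/-- The Euclidean pairing of `4`-tensors. -/
def pair4 (V W : Comp4) : ℝ := ∑ I, V I * W I

lemma pair2_eq_trace (α β : Mat) : pair2 α β = (αᵀ * β).trace := by
  simp only [pair2, Matrix.trace, Matrix.diag, Matrix.mul_apply, Matrix.transpose_apply]
  exact sum_comm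

lemma pair2_conj (X Y α β : Mat) : pair2 (X * α * Y) β = pair2 α (Xᵀ * β * Yᵀ) := by
  rw [pair2_eq_trace, pair2_eq_trace, Matrix.transpose_mul, Matrix.transpose_mul,
    Matrix.mul_assoc, Matrix.trace_mul_comm]
  simp only [Matrix.mul_assoc]

lemma pair2_skewPart (α β : Mat) : pair2 (skewPart α) β = pair2 α (skewPart β) := by
  have h : (α * β).trace = (αᵀ * βᵀ).trace := by
    rw [← Matrix.trace_transpose, Matrix.transpose_mul, Matrix.trace_mul_comm]
  simp only [pair2_eq_trace, skewPart, Matrix.transpose_smul, Matrix.transpose_sub,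
    Matrix.transpose_transpose, Matrix.smul_mul, Matrix.mul_smul, sub_mul, mul_sub,
    Matrix.trace_smul, Matrix.trace_sub, h]

lemma pair2_single (β : Mat) (i j : Fin 8) : pair2 (Matrix.single i j 1) β = β i j := by
  rw [pair2, sum_eq_single i, sum_eq_single j]
  · simp
  · intro k _ hk; simp [Ne.symm hk]
  · simp
  · intro k _ hk; simp [Ne.symm hk]
  · simp

lemma eq_of_pair2 {α β : Mat} (h : ∀ ξ, pair2 ξ α = pair2 ξ β) : α = β := by
  ext i j; rw [← pair2_single α, ← pair2_single β, h]

lemma pair4_comm (V W : Comp4) : pair4 V W = pair4 W V := by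
  simp only [pair4, mul_comm]

lemma pair4_pull (J : Mat) (V W : Comp4) : pair4 (pull J V) W = pair4 V (pull Jᵀ W) := by
  simp only [pair4, pull, sum_mul, mul_sum, Matrix.transpose_apply]
  rw [sum_comm]
  exact sum_congr rfl fun A _ => sum_congr rfl fun I _ => by ring

lemma eq_zero_of_pair4_self {V : Comp4} (h : pair4 V V = 0) : V = 0 := by
  ext I
  simpa using (sum_eq_zero_iff_of_nonneg (fun I _ => mul_self_nonneg (V I))).1 h I (mem_univ I)

lemma eq_zero_of_pair2_self {α : Mat} (h : pair2 α α = 0) : α = 0 := by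
  ext i j
  have := (sum_eq_zero_iff_of_nonneg (fun i _ => sum_nonneg fun j _ => mul_self_nonneg (α i j))).1 h
    i (mem_univ i)
  simpa using (sum_eq_zero_iff_of_nonneg (fun j _ => mul_self_nonneg (α i j))).1 this j (mem_univ j)

/-- The map `α ↦ α ⋄ W`, extended by zero to symmetric matrices `α`. -/
def diamondLin (gi : Mat) (W : Comp4) : Mat →ₗ[ℝ] Comp4 where
  toFun α := diamond gi (skewPart α) W
  map_add' α β := by
    have : skewPart (α + β) = skewPart α + skewPart β := by
      simp only [skewPart, Matrix.transpose_add, ← smul_add]; congr 1; abel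
    simp only [diamond_eq_act, this, add_mul, act_add_left]
  map_smul' c α := by
    have : skewPart (c • α) = c • skewPart α := by
      simp only [skewPart, Matrix.transpose_smul, ← smul_sub, smul_comm c]
    simp only [diamond_eq_act, this, Matrix.smul_mul, act_smul_left, RingHom.id_apply]

/-- The Euclidean adjoint of `diamondLin`. -/
def diamondAdj (gi : Mat) (W η : Comp4) : Mat :=
  Matrix.of fun i j => pair4 η (diamondLin gi W (Matrix.single i j 1))

lemma pair2_diamondAdj (gi α : Mat) (W η : Comp4) :
    pair2 α (diamondAdj gi W η) = pair4 η (diamondLin gi W α) := by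
  have h : diamondLin gi W α = ∑ i, ∑ j, α i j • diamondLin gi W (Matrix.single i j 1) := by
    conv_lhs => rw [Matrix.matrix_eq_sum_single α]
    simp only [map_sum]
    refine sum_congr rfl fun i _ => sum_congr rfl fun j _ => ?_
    rw [← map_smul, Matrix.smul_single, smul_eq_mul, mul_one]
  rw [h]
  simp only [pair2, pair4, diamondAdj, Matrix.of_apply, Finset.sum_apply, Pi.smul_apply, smul_eq_mul,
    mul_sum]
  calc _ = ∑ i, ∑ I, ∑ j, α i j * (η I * diamondLin gi W (Matrix.single i j 1) I) :=
        sum_congr rfl fun i _ => sum_comm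
    _ = ∑ I, ∑ i, ∑ j, α i j * (η I * diamondLin gi W (Matrix.single i j 1) I) := sum_comm
    _ = _ := sum_congr rfl fun I _ => sum_congr rfl fun i _ => sum_congr rfl fun j _ => by ring

/-- The adjoint of `diamondLin` for the inner products given by the metric `g`, with inverse `gi`. -/
def diamondDag (g gi : Mat) (W : Comp4) : Comp4 →ₗ[ℝ] Mat where
  toFun η := g * diamondAdj gi W (pull gi η) * g
  map_add' V V' := by
    have : diamondAdj gi W (pull gi (V + V'))
        = diamondAdj gi W (pull gi V) + diamondAdj gi W (pull gi V') := by
      ext i j; simp [diamondAdj, pull_add, pair4, add_mul, sum_add_distrib]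
    rw [this, mul_add, add_mul]
  map_smul' c V := by
    have : diamondAdj gi W (pull gi (c • V)) = c • diamondAdj gi W (pull gi V) := by
      ext i j; simp [diamondAdj, pull_smul, pair4, mul_sum, mul_assoc]
    rw [this]; simp

/-- The nonnegative symmetric operator `⋄† ⋄`. -/
def diamondSq (g gi : Mat) (W : Comp4) : Mat →ₗ[ℝ] Mat :=
  diamondDag g gi W ∘ₗ diamondLin gi W

section Frame

variable {g P : Mat} {W : Comp4}

lemma frame_mul_inv (h : P * g * Pᵀ = 1) : g * Pᵀ = P⁻¹ ∧ P * g = (P⁻¹)ᵀ ∧ IsUnit P.det := by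
  have hP : IsUnit P.det := by
    have := congrArg Matrix.det h
    rw [Matrix.det_mul, Matrix.det_mul, Matrix.det_one, mul_assoc] at this
    exact IsUnit.of_mul_eq_one _ this
  have h1 : P⁻¹ = g * Pᵀ := Matrix.inv_eq_right_inv (by rw [← Matrix.mul_assoc, h])
  refine ⟨h1.symm, ?_, hP⟩
  rw [Matrix.transpose_nonsing_inv]
  exact (Matrix.inv_eq_left_inv h).symm

lemma diamondLin_frame (h : P * g * Pᵀ = 1) (α : Mat) :
    pull P (diamondLin g⁻¹ W α) = diamondLin 1 (pull P W) (P * α * Pᵀ) := by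
  simp only [diamondLin, LinearMap.coe_mk, AddHom.coe_mk, diamond_eq_act, ← skewPart_conj]
  refine pull_act ?_ W
  rw [inv_eq_of_frame h]; simp [Matrix.mul_assoc]

lemma diamondDag_frame (h : P * g * Pᵀ = 1) (η : Comp4) :
    P * diamondDag g g⁻¹ W η * Pᵀ = diamondDag 1 1 (pull P W) (pull P η) := by
  obtain ⟨h1, h2, hP⟩ := frame_mul_inv h
  simp only [diamondDag, LinearMap.coe_mk, AddHom.coe_mk, pull_one, Matrix.one_mul, Matrix.mul_one]
  have e : P * (g * diamondAdj g⁻¹ W (pull g⁻¹ η) * g) * Pᵀ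
      = (P⁻¹)ᵀ * diamondAdj g⁻¹ W (pull g⁻¹ η) * P⁻¹ := by
    rw [← h2, ← h1]; simp only [Matrix.mul_assoc]
  rw [e]
  refine eq_of_pair2 fun ξ => ?_
  have e1 := pair2_conj P⁻¹ (P⁻¹)ᵀ ξ (diamondAdj g⁻¹ W (pull g⁻¹ η))
  rw [Matrix.transpose_transpose] at e1
  rw [← e1, pair2_diamondAdj, pair2_diamondAdj]
  conv_lhs => rw [inv_eq_of_frame h, pull_mul, pair4_pull, Matrix.transpose_transpose,
    ← inv_eq_of_frame h, diamondLin_frame h]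
  congr 2
  have hPt : Pᵀ.det ≠ 0 := by rw [Matrix.det_transpose]; exact hP.ne_zero
  rw [Matrix.transpose_nonsing_inv]
  simp only [Matrix.mul_assoc]
  rw [Matrix.nonsing_inv_mul _ hPt.isUnit, Matrix.mul_one, ← Matrix.mul_assoc,
    Matrix.mul_nonsing_inv _ hP, Matrix.one_mul]

lemma diamondSq_frame (h : P * g * Pᵀ = 1) (α : Mat) :
    P * diamondSq g g⁻¹ W α * Pᵀ = diamondSq 1 1 (pull P W) (P * α * Pᵀ) := by
  simp only [diamondSq, LinearMap.comp_apply]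
  rw [diamondDag_frame h, diamondLin_frame h]

/-- All ingredients are equivariant under changes of frame, so a polynomial chosen once for the
standard `4`-form serves at every point of every manifold. -/
lemma aeval_diamondSq_frame (h : P * g * Pᵀ = 1) (q : Polynomial ℝ) (α : Mat) :
    P * (Polynomial.aeval (diamondSq g g⁻¹ W) q α) * Pᵀ
      = Polynomial.aeval (diamondSq 1 1 (pull P W)) q (P * α * Pᵀ) := by
  induction q using Polynomial.induction_on' generalizing α with
  | add p q hp hq => simp [mul_add, add_mul, hp, hq]
  | monomial n c =>
    have : ∀ n α, P * (diamondSq g g⁻¹ W ^ n) α * Pᵀ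
        = (diamondSq 1 1 (pull P W) ^ n) (P * α * Pᵀ) := by
      intro n
      induction n with
      | zero => intro α; simp
      | succ n ih => intro α; rw [pow_succ, pow_succ, Module.End.mul_apply, Module.End.mul_apply, ih,
          diamondSq_frame h]
    simp [Polynomial.aeval_monomial, Module.algebraMap_end_apply, this]

end Frame

/-- The hypothesis says that `X²` does not divide the minimal polynomial `m`: otherwise removing one
factor `X` would give a smaller annihilating polynomial. Hence `gcd (X², m)` divides `X`, and Bézout
writes `X` as `X² q` plus a multiple of `m`; evaluate at `B`. -/
lemma exists_polynomial_of_ker_sq {V : Type*} [AddCommGroup V] [Module ℝ V] [FiniteDimensional ℝ V]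
    (B : V →ₗ[ℝ] V) (hB : ∀ x, B (B x) = 0 → B x = 0) :
    ∃ q : Polynomial ℝ, ∀ x, B (Polynomial.aeval B q (B x)) = B x := by
  classical
  set m := minpoly ℝ B with hm
  have hm0 : m ≠ 0 := minpoly.ne_zero (Algebra.IsIntegral.isIntegral B)
  have hX : ¬ (Polynomial.X ^ 2 ∣ m) := by
    rintro ⟨k, hk⟩
    have hk0 : k ≠ 0 := by rintro rfl; simp [hk] at hm0
    have h1 : Polynomial.aeval B (Polynomial.X * k) = 0 := by
      ext x
      have h2 : Polynomial.aeval B m x = 0 := by rw [hm, minpoly.aeval]; rfl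
      rw [hk, pow_two, mul_assoc, map_mul, Polynomial.aeval_X, map_mul, Polynomial.aeval_X] at h2
      rw [map_mul, Polynomial.aeval_X]
      exact hB _ h2
    have h3 := Polynomial.natDegree_le_of_dvd (minpoly.dvd ℝ B h1)
      (mul_ne_zero Polynomial.X_ne_zero hk0)
    rw [← hm, hk, Polynomial.natDegree_mul (by simp) hk0, Polynomial.natDegree_mul (by simp) hk0]
      at h3
    simp at h3
  have hg : EuclideanDomain.gcd (Polynomial.X ^ 2) m ∣ Polynomial.X := by
    obtain ⟨i, hi, ha⟩ := (dvd_prime_pow Polynomial.prime_X 2).1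
      (EuclideanDomain.gcd_dvd_left (Polynomial.X ^ 2) m)
    rcases Nat.lt_or_ge i 2 with h | h
    · refine ha.dvd.trans ?_
      interval_cases i <;> simp
    · exact absurd ((ha.symm.dvd.trans (EuclideanDomain.gcd_dvd_right _ _))) (by
        rwa [show i = 2 by omega])
  obtain ⟨c, hc⟩ := hg
  rw [EuclideanDomain.gcd_eq_gcd_ab] at hc
  refine ⟨EuclideanDomain.gcdA (Polynomial.X ^ 2) m * c, fun x => ?_⟩
  have h1 := congrArg (fun p => Polynomial.aeval B p x) hc
  simp only [Polynomial.aeval_X] at h1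
  rw [add_mul, map_add, LinearMap.add_apply] at h1
  have h2 : Polynomial.aeval B (m * EuclideanDomain.gcdB (Polynomial.X ^ 2) m * c) = 0 := by
    rw [mul_assoc, map_mul, hm, minpoly.aeval, zero_mul]
  have h3 : (Polynomial.X ^ 2 * EuclideanDomain.gcdA (Polynomial.X ^ 2) m * c : Polynomial ℝ)
      = Polynomial.X * (EuclideanDomain.gcdA (Polynomial.X ^ 2) m * c) * Polynomial.X := by ring
  rw [h2, LinearMap.zero_apply, add_zero, h3, map_mul, map_mul, Polynomial.aeval_X] at h1
  exact h1.symm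

lemma pair4_diamondLin_one (W η : Comp4) (α : Mat) :
    pair4 η (diamondLin 1 W α) = pair2 α (diamondDag 1 1 W η) := by
  rw [← pair2_diamondAdj]; simp [diamondDag, pull_one]

/-- `B = ⋄† ⋄` is symmetric, so `⟨Bα, Bα⟩ = ⟨α, B²α⟩` and `B²α = 0` implies `Bα = 0`. -/
lemma exists_stdPolynomial : ∃ q : Polynomial ℝ, ∀ α,
    diamondSq 1 1 OmegaStd (Polynomial.aeval (diamondSq 1 1 OmegaStd) q (diamondSq 1 1 OmegaStd α))
      = diamondSq 1 1 OmegaStd α := by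
  refine exists_polynomial_of_ker_sq _ fun α h => eq_zero_of_pair2_self ?_
  conv_lhs => rw [diamondSq, LinearMap.comp_apply, ← pair4_diamondLin_one]
  rw [pair4_comm, ← LinearMap.comp_apply, pair4_diamondLin_one] 
  change pair2 _ (diamondSq 1 1 OmegaStd (diamondSq 1 1 OmegaStd α)) = 0
  rw [h]; simp [pair2]

/-- A polynomial `q` for which `q(⋄† ⋄) ⋄†` is the inverse of `⋄` on `Λ²₁₅`. -/
def stdPolynomial : Polynomial ℝ := exists_stdPolynomial.choose

/-- The inverse of `⋄` on `Λ²₁₅`, in a form polynomial in the metric, its inverse and `W`. -/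
def diamondPinv (g gi : Mat) (W η : Comp4) : Mat :=
  Polynomial.aeval (diamondSq g gi W) stdPolynomial (diamondDag g gi W η)

/-- The candidate `α = q(B) B β` also equals `B q(B) β`, so it is in the range of `⋄†` and hence
orthogonal to the kernel of `⋄`. Moreover `B (α - β) = 0` by the choice of `q`, and `B` has the same
kernel as `⋄` because `⟨Bγ, γ⟩ = |⋄γ|²`. -/
lemma diamondPinv_std {β : Mat} (hβ : βᵀ = -β) :
    IsLambda15 1 OmegaStd (diamondPinv 1 1 OmegaStd (diamond 1 β OmegaStd)) ∧
      diamond 1 (diamondPinv 1 1 OmegaStd (diamond 1 β OmegaStd)) OmegaStd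
        = diamond 1 β OmegaStd := by
  set B := diamondSq 1 1 OmegaStd with hB
  have hβ' : diamond 1 β OmegaStd = diamondLin 1 OmegaStd β := by
    simp [diamondLin, skewPart_of_skew hβ]
  have hq : diamondPinv 1 1 OmegaStd (diamond 1 β OmegaStd)
      = Polynomial.aeval B stdPolynomial (B β) := by
    rw [hβ']; rfl
  have hcomm : Polynomial.aeval B stdPolynomial (B β) = B (Polynomial.aeval B stdPolynomial β) := by
    have : Polynomial.aeval B (stdPolynomial * Polynomial.X)
        = Polynomial.aeval B (Polynomial.X * stdPolynomial) := by rw [mul_comm]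
    rw [map_mul, map_mul, Polynomial.aeval_X] at this
    exact congrArg (fun f => f β) this
  rw [hq]
  set α := Polynomial.aeval B stdPolynomial (B β) with hα
  have hskew : αᵀ = -α := by
    rw [hcomm]
    set y := diamondLin 1 OmegaStd (Polynomial.aeval B stdPolynomial β) with hy
    change (diamondDag 1 1 OmegaStd y)ᵀ = -diamondDag 1 1 OmegaStd y
    have hs : diamondDag 1 1 OmegaStd y = skewPart (diamondDag 1 1 OmegaStd y) := by
      refine eq_of_pair2 fun ξ => ?_
      rw [← pair2_skewPart, ← pair4_diamondLin_one, ← pair4_diamondLin_one]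
      simp [diamondLin, skewPart_of_skew (skewPart_transpose ξ)]
    rw [hs, skewPart_transpose]
  have hαL : diamond 1 α OmegaStd = diamondLin 1 OmegaStd α := by
    simp [diamondLin, skewPart_of_skew hskew]
  refine ⟨⟨hskew, fun ξ hξ h => ?_⟩, ?_⟩
  · have h0 : pair2 ξ α = 0 := by
      rw [hcomm]
      change pair2 ξ (diamondDag 1 1 OmegaStd _) = 0
      rw [← pair4_diamondLin_one]
      simp [diamondLin, skewPart_of_skew hξ, h, pair4]
    rw [inner2_eq_br hξ (by simp), br, Matrix.mul_one, Matrix.mul_one]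
    rw [pair2_eq_trace, hξ] at h0
    rw [Matrix.trace_mul_comm]
    simp at h0
    simp [h0]
  · have hx : B (α - β) = 0 := by
      rw [map_sub, hα, hB]
      exact sub_eq_zero.2 (exists_stdPolynomial.choose_spec β)
    have h0 : diamondLin 1 OmegaStd (α - β) = 0 := by
      refine eq_zero_of_pair4_self ?_
      rw [pair4_diamondLin_one]
      change pair2 _ (B (α - β)) = 0
      rw [hx]; simp [pair2]
    rw [hβ', hαL]
    exact sub_eq_zero.1 (by rw [← map_sub, h0])

lemma diamondPinv_frame {g P : Mat} {W : Comp4} (h : P * g * Pᵀ = 1) (η : Comp4) :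
    P * diamondPinv g g⁻¹ W η * Pᵀ = diamondPinv 1 1 (pull P W) (pull P η) := by
  rw [diamondPinv, aeval_diamondSq_frame h, diamondDag_frame h]; rfl

/-- Transport of `Λ²₁₅` along a change of frame. -/
lemma IsLambda15.conj {g g' J : Mat} {W α : _} (hJ : IsUnit J.det) (hgt : gᵀ = g) (hg' : g' = J * g * Jᵀ)
    (h : IsLambda15 g⁻¹ W α) : IsLambda15 g'⁻¹ (pull J W) (J * α * Jᵀ) := by
  have hJt : IsUnit Jᵀ.det := by rwa [Matrix.det_transpose]
  have hgi : g'⁻¹ = (J⁻¹)ᵀ * g⁻¹ * J⁻¹ := by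
    rw [hg', Matrix.mul_inv_rev, Matrix.mul_inv_rev, Matrix.transpose_nonsing_inv, Matrix.mul_assoc]
  have hgit : (g⁻¹)ᵀ = g⁻¹ := by rw [Matrix.transpose_nonsing_inv, hgt]
  have hgit' : (g'⁻¹)ᵀ = g'⁻¹ := by
    rw [hgi]; simp [Matrix.transpose_mul, hgit, Matrix.mul_assoc]
  have hJJ : J⁻¹ * J = 1 := Matrix.nonsing_inv_mul _ hJ
  have hJJ' : J * J⁻¹ = 1 := Matrix.mul_nonsing_inv _ hJ
  have hJJt : Jᵀ * (J⁻¹)ᵀ = 1 := by rw [← Matrix.transpose_mul, hJJ, Matrix.transpose_one]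
  have hJJt' : (J⁻¹)ᵀ * Jᵀ = 1 := by rw [← Matrix.transpose_mul, hJJ', Matrix.transpose_one]
  refine ⟨by simp [Matrix.transpose_mul, h.1, Matrix.mul_assoc], fun ξ hξ hz => ?_⟩
  set β := J⁻¹ * ξ * (J⁻¹)ᵀ with hβ
  have hβs : βᵀ = -β := by simp [hβ, Matrix.transpose_mul, hξ, Matrix.mul_assoc]
  have e1 : J * (β * g⁻¹) = ξ * g'⁻¹ * J := by
    rw [hβ, hgi]
    simp only [← Matrix.mul_assoc, hJJ', Matrix.one_mul]
    rw [Matrix.mul_assoc _ J⁻¹ J, hJJ, Matrix.mul_one]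
  have e2 : J * (α * g⁻¹) = J * α * Jᵀ * g'⁻¹ * J := by
    rw [hgi]
    simp only [Matrix.mul_assoc, hJJ, Matrix.mul_one]
    simp only [← Matrix.mul_assoc]
    rw [Matrix.mul_assoc (J * α), hJJt, Matrix.mul_one]
  have hz' : diamond g⁻¹ β W = 0 := by
    rw [diamond_eq_act] at hz ⊢
    rw [← pull_act e1] at hz
    rw [← pull_one (act _ _), ← hJJ, pull_mul, hz, pull_zero]
  have h2 := h.2 β hβs hz'
  rw [inner2_eq_br hβs hgit] at h2
  rw [inner2_eq_br hξ hgit']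
  rw [br] at h2 ⊢
  rw [← h2]
  congr 1
  calc (J * α * Jᵀ * g'⁻¹ * (ξ * g'⁻¹)).trace
      = (J * α * Jᵀ * g'⁻¹ * (J * J⁻¹) * (ξ * g'⁻¹)).trace := by rw [hJJ', Matrix.mul_one]
    _ = (J * (α * g⁻¹) * (J⁻¹ * (ξ * g'⁻¹))).trace := by rw [e2]; simp only [Matrix.mul_assoc]
    _ = (α * g⁻¹ * (J⁻¹ * (ξ * g'⁻¹ * J))).trace := by
        rw [Matrix.mul_assoc J, Matrix.trace_mul_comm]; simp only [Matrix.mul_assoc]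
    _ = _ := by rw [← e1, ← Matrix.mul_assoc J⁻¹, hJJ, Matrix.one_mul]

/-- Equivariance moves the claim to the standard frame, where it is `diamondPinv_std`, and
`IsLambda15.conj` brings it back. -/
lemma diamondPinv_spec {g P β : Mat} {W : Comp4} (h : IsStdFrame g W P) (hβ : βᵀ = -β) :
    IsLambda15 g⁻¹ W (diamondPinv g g⁻¹ W (diamond g⁻¹ β W)) ∧
      diamond g⁻¹ (diamondPinv g g⁻¹ W (diamond g⁻¹ β W)) W = diamond g⁻¹ β W := by
  obtain ⟨h1, h2, hP⟩ := frame_mul_inv h.1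
  set β' := P * β * Pᵀ with hβ'
  have hβs : β'ᵀ = -β' := by simp [hβ', Matrix.transpose_mul, hβ, Matrix.mul_assoc]
  have hd : ∀ ξ : Mat, pull P (diamond g⁻¹ ξ W) = diamond 1 (P * ξ * Pᵀ) OmegaStd := by
    intro ξ
    rw [diamond_eq_act, diamond_eq_act, ← h.2]
    refine pull_act ?_ W
    rw [inv_eq_of_frame h.1]; simp [Matrix.mul_assoc]
  have hf := diamondPinv_frame (W := W) h.1 (diamond g⁻¹ β W)
  rw [h.2, hd] at hf
  obtain ⟨s1, s2⟩ := diamondPinv_std hβs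
  set α := diamondPinv g g⁻¹ W (diamond g⁻¹ β W)
  have hPP : P⁻¹ * P = 1 := Matrix.nonsing_inv_mul _ hP
  have hPPt : Pᵀ * (P⁻¹)ᵀ = 1 := by rw [← Matrix.transpose_mul, hPP, Matrix.transpose_one]
  have hα : α = P⁻¹ * (P * α * Pᵀ) * (P⁻¹)ᵀ := by
    simp only [← Matrix.mul_assoc, hPP, Matrix.one_mul]
    rw [Matrix.mul_assoc, hPPt, Matrix.mul_one]
  have hWP : W = pull P⁻¹ OmegaStd := by rw [← h.2, ← pull_mul, hPP, pull_one]
  constructor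
  · have hg : g = P⁻¹ * 1 * (P⁻¹)ᵀ := by
      rw [Matrix.mul_one, ← h2, ← h1, Matrix.mul_assoc, ← Matrix.mul_assoc Pᵀ]
      rw [show Pᵀ * P = g⁻¹ from (inv_eq_of_frame h.1).symm,
        Matrix.nonsing_inv_mul _ (isUnit_det_of_frame h.1), Matrix.mul_one]
    have := IsLambda15.conj (g := 1) (J := P⁻¹) (W := OmegaStd) (α := P * α * Pᵀ)
      (Matrix.isUnit_nonsing_inv_det _ hP) (by simp) hg (by rw [inv_one, hf]; exact s1)
    rwa [← hα, ← hWP] at this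
  · have e : pull P (diamond g⁻¹ α W) = pull P (diamond g⁻¹ β W) := by
      rw [hd, hd, hf, s2]
    have := congrArg (pull P⁻¹) e
    simpa only [← pull_mul, hPP, pull_one] using this

end QKFlow

end

noncomputable section

namespace QKFlow

open Matrix Finset

/-! ### Derivatives of curves in the orbit of the standard `4`-form -/

section Orbit

open Filter Topology Asymptotics
open scoped Matrix.Norms.Operator

lemma matDeriv_exp_smul (k : Mat) (r : ℝ) :
    MatDeriv (fun t : ℝ => NormedSpace.exp (t • k)) (k * NormedSpace.exp (r • k)) r := by
  have h := hasDerivAt_exp_smul_const' (𝕂 := ℝ) k r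
  intro i j
  let L : Mat →L[ℝ] ℝ := LinearMap.toContinuousLinearMap (Matrix.entryLinearMap ℝ ℝ i j)
  exact L.hasFDerivAt.comp_hasDerivAt r h

/-- The isotropy group of the standard `4`-form in the orthogonal group. -/
def stdIsotropy : Set Mat := {h | h * hᵀ = 1 ∧ pull h OmegaStd = OmegaStd}

/-- The derivative of `pull (exp (t k)) Ω` is `act k` of it; as `exp (t k)` commutes with `k`, this
is `pull (exp (t k)) (act k Ω) = 0`. -/
lemma exp_mem_stdIsotropy {k : Mat} (hk : kᵀ = -k) (h : act k OmegaStd = 0) (t : ℝ) :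
    NormedSpace.exp (t • k) ∈ stdIsotropy := by
  constructor
  · rw [← Matrix.exp_transpose, Matrix.transpose_smul, hk, smul_neg, Matrix.exp_neg]
    exact Matrix.mul_nonsing_inv _ ((Matrix.isUnit_iff_isUnit_det _).1 (Matrix.isUnit_exp _))
  · ext I
    have hd : ∀ r, HasDerivAt (fun t : ℝ => pull (NormedSpace.exp (t • k)) OmegaStd I) 0 r := by
      intro r
      have h1 := CompDeriv.pull (matDeriv_exp_smul k r) rfl (compDeriv_const OmegaStd r) I
      have h2 : act k (pull (NormedSpace.exp (r • k)) OmegaStd) = 0 := by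
        have hc : Commute (NormedSpace.exp (r • k)) k := by
          exact ((Commute.refl k).smul_left r).exp_left
        rw [← pull_act hc.eq, h, pull_zero]
      simpa [h2, pull_zero] using h1
    have := is_const_of_deriv_eq_zero (fun r => (hd r).differentiableAt) (fun r => (hd r).deriv) t 0
    simpa [pull_one] using this

lemma continuous_pull (W : Comp4) : Continuous fun J : Mat => pull J W := by
  unfold pull
  refine continuous_pi fun I => continuous_finsetSum _ fun A _ => ?_
  exact (continuous_finsetProd _ fun p _ => continuous_id.matrix_elem _ _).mul continuous_const

lemma abs_entry_le_of_mul_transpose {A : Mat} {C : ℝ} (h : ∀ i, (A * Aᵀ) i i ≤ C) (i j : Fin 8) :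
    |A i j| ≤ C + 1 := by
  have h1 : A i j ^ 2 ≤ C := by
    refine le_trans ?_ (h i)
    rw [Matrix.mul_apply]
    refine le_trans ?_ (single_le_sum (f := fun k => A i k * Aᵀ k i)
      (fun k _ => by simpa using mul_self_nonneg (A i k)) (mem_univ j))
    simp [pow_two]
  have h2 : 0 ≤ C := (sq_nonneg _).trans h1
  exact abs_le_of_sq_le_sq (by nlinarith) (by linarith)

lemma isBounded_of_entries (C : ℝ) : Bornology.IsBounded {A : Mat | ∀ i j, |A i j| ≤ C} := by
  refine (isBounded_iff_forall_norm_le.2 ⟨8 * |C|, fun A hA => ?_⟩)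
  rw [Matrix.linfty_opNorm_def]
  have : ((univ : Finset (Fin 8)).sup fun i => ∑ j, ‖A i j‖₊) ≤ 8 * Real.toNNReal |C| := by
    refine Finset.sup_le fun i _ => ?_
    refine (Finset.sum_le_card_nsmul univ _ (Real.toNNReal |C|) fun j _ => ?_).trans (by simp)
    rw [← NNReal.coe_le_coe, Real.coe_toNNReal _ (abs_nonneg _)]
    exact (hA i j).trans (le_abs_self C)
  refine (NNReal.coe_le_coe.2 this).trans ?_
  simp

lemma isCompact_stdIsotropy : IsCompact stdIsotropy := by
  refine Metric.isCompact_of_isClosed_isBounded ?_ ?_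
  · refine IsClosed.inter ?_ ?_
    · exact isClosed_eq (continuous_id.matrix_mul continuous_id.matrix_transpose) continuous_const
    · exact isClosed_eq (continuous_pull OmegaStd) continuous_const
  · refine (isBounded_of_entries 2).subset fun h hh i j => ?_
    have := abs_entry_le_of_mul_transpose (A := h) (C := 1) (fun i => by simp [hh.1]) i j
    linarith

lemma hasFDerivAt_pull_one (W : Comp4) :
    ∃ L : Mat →L[ℝ] Comp4, (∀ a, L a = act a W) ∧ HasFDerivAt (fun J : Mat => pull J W) L 1 := by
  have hdiff : DifferentiableAt ℝ (fun J : Mat => pull J W) 1 := by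
    unfold pull
    refine differentiableAt_pi.2 fun I => DifferentiableAt.fun_sum fun A _ => ?_
    refine DifferentiableAt.mul ?_ (differentiableAt_const _)
    let l : Fin 4 → Mat →L[ℝ] ℝ := fun p => LinearMap.toContinuousLinearMap
      (Matrix.entryLinearMap ℝ ℝ (I p) (A p))
    exact (HasFDerivAt.finsetProd (g' := l) fun p _ => (l p).hasFDerivAt).differentiableAt
  refine ⟨_, fun a => ?_, hdiff.hasFDerivAt⟩
  have h1 : HasDerivAt (fun r : ℝ => 1 + r • a) a 0 := by
    exact (((hasDerivAt_id (0 : ℝ)).smul_const a).const_add (1 : Mat)).congr_deriv (one_smul _ _)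
  have h2 : HasDerivAt (fun r : ℝ => pull (1 + r • a) W)
      (fderiv ℝ (fun J : Mat => pull J W) 1 a) 0 := by
    have h3 : HasFDerivAt (fun J : Mat => pull J W) (fderiv ℝ (fun J : Mat => pull J W) 1)
      (1 + (0 : ℝ) • a) := by simpa using hdiff.hasFDerivAt
    exact h3.comp_hasDerivAt (0 : ℝ) h1
  ext I
  exact ((hasDerivAt_pi.1 h2) I).unique (compDeriv_pull_one_add_smul a W I)

/-- The limit of difference quotients of a sequence in the orbit of the standard `4`-form under
nearly orthogonal matrices is tangent to the orbit. -/
lemma exists_act_eq_of_tendsto {s : ℕ → ℝ} (hs0 : ∀ n, s n ≠ 0) (hs : Tendsto s atTop (𝓝 0))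
    {M : ℕ → Mat} {η : Comp4}
    (hη : Tendsto (fun n => (s n)⁻¹ • (pull (M n) OmegaStd - OmegaStd)) atTop (𝓝 η))
    (hM : Tendsto (fun n => (s n)⁻¹ • (M n * (M n)ᵀ - 1)) atTop (𝓝 0)) :
    ∃ β : Mat, βᵀ = -β ∧ act β OmegaStd = η := by
  -- asymptotics of the data
  have hMo : (fun n => M n * (M n)ᵀ - 1) =o[atTop] s := by
    have h1 : (fun n => (s n)⁻¹ • (M n * (M n)ᵀ - 1)) =o[atTop] (fun _ => (1 : ℝ)) :=
      (isLittleO_one_iff ℝ).2 hM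
    have h2 := (isBigO_refl s atTop).smul_isLittleO h1
    simpa [smul_smul, hs0] using h2
  have hcO : (fun n => pull (M n) OmegaStd - OmegaStd) =O[atTop] s := by
    have h1 := hη.isBigO_one ℝ
    have h2 := (isBigO_refl s atTop).smul h1
    simpa [smul_smul, hs0] using h2
  have hMM : Tendsto (fun n => M n * (M n)ᵀ) atTop (𝓝 1) := by
    have := (hMo.isBigO.trans_tendsto hs).add_const 1
    simp only [sub_add_cancel, zero_add] at this
    exact this
  have hc0 : Tendsto (fun n => pull (M n) OmegaStd) atTop (𝓝 OmegaStd) := by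
    have := (hcO.trans_tendsto hs).add_const OmegaStd
    simpa using this
  -- a convergent subsequence
  obtain ⟨C, hC⟩ : ∃ C, ∀ n i, (M n * (M n)ᵀ) i i ≤ C := by
    have h : ∀ i, ∃ C, ∀ n, (M n * (M n)ᵀ) i i ≤ C := fun i => by
      have : Tendsto (fun n => (M n * (M n)ᵀ) i i) atTop (𝓝 ((1 : Mat) i i)) :=
        ((continuous_id.matrix_elem i i).tendsto (1 : Mat)).comp hMM
      obtain ⟨C, hC⟩ := this.bddAbove_range
      exact ⟨C, fun n => hC ⟨n, rfl⟩⟩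
    choose C hC using h
    refine ⟨∑ i, |C i|, fun n i => (hC i n).trans ((le_abs_self _).trans ?_)⟩
    exact single_le_sum (f := fun i => |C i|) (fun i _ => abs_nonneg _) (mem_univ i)
  obtain ⟨Minf, -, φ, hφ, hMφ⟩ := tendsto_subseq_of_bounded (isBounded_of_entries (C + 1))
    (fun n i j => abs_entry_le_of_mul_transpose (hC n) i j)
  have hφt := hφ.tendsto_atTop
  have hinf1 : Minf * Minfᵀ = 1 := by
    refine tendsto_nhds_unique ?_ (hMM.comp hφt)
    exact ((continuous_id.matrix_mul continuous_id.matrix_transpose).tendsto Minf).comp hMφ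
  have hinf2 : pull Minf OmegaStd = OmegaStd :=
    tendsto_nhds_unique (((continuous_pull OmegaStd).tendsto Minf).comp hMφ) (hc0.comp hφt)
  have hinf : Minfᵀ ∈ stdIsotropy := by
    have h1 : Minfᵀ * Minf = 1 := mul_eq_one_comm.1 hinf1
    refine ⟨by rw [Matrix.transpose_transpose, h1], ?_⟩
    conv_lhs => rw [← hinf2, ← pull_mul, h1, pull_one]
  -- adjust by the isotropy group
  have hex : ∀ n, ∃ h ∈ stdIsotropy, ∀ h' ∈ stdIsotropy,
      (M (φ n) * h').trace ≤ (M (φ n) * h).trace := fun n => by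
    have := isCompact_stdIsotropy.exists_isMaxOn ⟨_, hinf⟩
      (f := fun h => (M (φ n) * h).trace)
      ((continuous_const.matrix_mul continuous_id).matrix_trace.continuousOn)
    obtain ⟨h, hh, hmax⟩ := this
    exact ⟨h, hh, fun h' hh' => hmax hh'⟩
  choose h hh hmax using hex
  -- Multiplying by the isotropy element of maximal trace replaces `M` by the representative of its
  -- coset closest to the identity. This is what makes `E` small, with skew part in `Λ²₁₅`; on that
  -- space `act` is injective and can be inverted.
  set E : ℕ → Mat := fun n => M (φ n) * h n - 1 with hE
  -- The symmetric part of `E` is governed by the defect from orthogonality, up to a quadratic term.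
  have hEE : ∀ n, E n + (E n)ᵀ + E n * (E n)ᵀ = M (φ n) * (M (φ n))ᵀ - 1 := fun n => by
    have h1 : M (φ n) * h n * (M (φ n) * h n)ᵀ = M (φ n) * (M (φ n))ᵀ := by
      rw [Matrix.transpose_mul, Matrix.mul_assoc, ← Matrix.mul_assoc (h n), (hh n).1, Matrix.one_mul]
    have h2 : M (φ n) * h n = 1 + E n := by simp [hE]
    rw [h2, Matrix.transpose_add, Matrix.transpose_one, add_mul, mul_add, mul_add] at h1
    rw [← h1]; simp; abel
  -- Comparing the maximal trace with that for the competitor `Minfᵀ` bounds `tr (E Eᵀ)` by a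
  -- quantity which tends to zero, since `M` tends to `Minf` along the subsequence.
  have hE0 : Tendsto E atTop (𝓝 0) := by
    have hub : ∀ n, (E n * (E n)ᵀ).trace ≤
        (M (φ n) * (M (φ n))ᵀ).trace + 8 - 2 * (M (φ n) * Minfᵀ).trace := fun n => by
      have h1 := congrArg Matrix.trace (hEE n)
      have h2 := hmax n _ hinf
      have h3 : (E n).trace = (M (φ n) * h n).trace - 8 := by
        simp [hE, Matrix.trace_sub, Matrix.trace_one]
      simp only [Matrix.trace_add, Matrix.trace_transpose, Matrix.trace_sub, Matrix.trace_one,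
        Fintype.card_fin] at h1
      push_cast at h1
      linarith
    have hlim : Tendsto (fun n => (M (φ n) * (M (φ n))ᵀ).trace + 8 - 2 * (M (φ n) * Minfᵀ).trace)
        atTop (𝓝 0) := by
      have t1 : Tendsto (fun n => (M (φ n) * (M (φ n))ᵀ).trace) atTop (𝓝 (1 : Mat).trace) :=
        (continuous_id.matrix_trace.tendsto (1 : Mat)).comp (hMM.comp hφt)
      have t2 : Tendsto (fun n => (M (φ n) * Minfᵀ).trace) atTop (𝓝 (Minf * Minfᵀ).trace) :=
        ((continuous_id.matrix_mul continuous_const).matrix_trace.tendsto Minf).comp hMφ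
      have := (t1.add_const 8).sub (t2.const_mul 2)
      rw [hinf1] at this
      simp only [Matrix.trace_one, Fintype.card_fin] at this
      convert this using 2; norm_num
    have hent : ∀ n i j, E n i j ^ 2 ≤ (E n * (E n)ᵀ).trace := fun n i j => by
      have : (E n * (E n)ᵀ).trace = ∑ i, ∑ j, E n i j ^ 2 := by
        simp [Matrix.trace, Matrix.mul_apply, pow_two]
      rw [this]
      refine le_trans ?_ (single_le_sum (f := fun i => ∑ j, E n i j ^ 2)
        (fun i _ => sum_nonneg fun j _ => sq_nonneg _) (mem_univ i))
      exact single_le_sum (f := fun j => E n i j ^ 2) (fun j _ => sq_nonneg _) (mem_univ j)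
    refine tendsto_pi_nhds.2 fun i => tendsto_pi_nhds.2 fun j => ?_
    have hsq : Tendsto (fun n => E n i j ^ 2) atTop (𝓝 0) :=
      tendsto_of_tendsto_of_tendsto_of_le_of_le tendsto_const_nhds hlim (fun n => sq_nonneg _)
        (fun n => (hent n i j).trans (hub n))
    have := (Real.continuous_sqrt.tendsto 0).comp hsq
    rw [Real.sqrt_zero] at this
    refine (tendsto_zero_iff_abs_tendsto_zero _).2 (this.congr fun n => ?_)
    simp [Real.sqrt_sq_eq_abs]
  -- first variation
  have hvar : ∀ n (k : Mat), kᵀ = -k → act k OmegaStd = 0 → (E n * k).trace = 0 := by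
    intro n k hk hk0
    have hd : HasDerivAt (fun t : ℝ => (M (φ n) * (h n * NormedSpace.exp (t • k))).trace)
        (M (φ n) * (h n * k)).trace 0 := by
      have := ((matDeriv_const (M (φ n)) 0).mul ((matDeriv_const (h n) 0).mul
        (matDeriv_exp_smul k 0))).trace
      simpa using this
    have hmem : ∀ t : ℝ, h n * NormedSpace.exp (t • k) ∈ stdIsotropy := fun t => by
      obtain ⟨e1, e2⟩ := exp_mem_stdIsotropy hk hk0 t
      refine ⟨?_, by rw [pull_mul, e2, (hh n).2]⟩
      rw [Matrix.transpose_mul, Matrix.mul_assoc, ← Matrix.mul_assoc (NormedSpace.exp _), e1,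
        Matrix.one_mul, (hh n).1]
    have hloc : IsLocalMax (fun t : ℝ => (M (φ n) * (h n * NormedSpace.exp (t • k))).trace) 0 := by
      refine Filter.Eventually.of_forall fun t => ?_
      simpa using hmax n _ (hmem t)
    have h1 := hloc.hasDerivAt_eq_zero hd
    have h2 : k.trace = 0 := by
      have := Matrix.trace_transpose k
      rw [hk, Matrix.trace_neg] at this
      linarith
    rw [hE]
    simp only [sub_mul, Matrix.trace_sub, Matrix.one_mul, h2, sub_zero]
    rwa [Matrix.mul_assoc]
  -- the skew part of `E`
  set A : ℕ → Mat := fun n => skewPart (E n) with hA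
  have hAΛ : ∀ n, IsLambda15 1 OmegaStd (A n) := fun n => by
    refine ⟨skewPart_transpose _, fun k hk hk0 => ?_⟩
    rw [diamond_eq_act, Matrix.mul_one] at hk0
    rw [inner2_eq_br hk (by simp), br, Matrix.mul_one, Matrix.mul_one]
    have h1 := hvar n k hk hk0
    have h2 : ((E n)ᵀ * k).trace = 0 := by
      rw [← Matrix.trace_transpose, Matrix.transpose_mul, Matrix.transpose_transpose, hk,
        Matrix.neg_mul, Matrix.trace_neg, Matrix.trace_mul_comm, h1, neg_zero]
    simp [hA, skewPart, sub_mul, Matrix.trace_sub, h1, h2]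
  -- A linear left inverse of `act` on `Λ²₁₅`; it recovers the skew part `A` of `E` from the change
  -- of the `4`-form.
  let Λ : Comp4 →L[ℝ] Mat := LinearMap.toContinuousLinearMap
    ((Polynomial.aeval (diamondSq 1 1 OmegaStd) stdPolynomial : Mat →ₗ[ℝ] Mat)
      ∘ₗ diamondDag 1 1 OmegaStd)
  have hΛ : ∀ n, A n = Λ (act (A n) OmegaStd) := fun n => by
    obtain ⟨h1, h2⟩ := diamondPinv_std (hAΛ n).1
    have := (hAΛ n).eq_of_diamond_eq (P := 1) (by simp) (by simp) h1 h2.symm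
    rw [diamond_eq_act, Matrix.mul_one] at this
    exact this
  -- estimates
  obtain ⟨L, hL, hLd⟩ := hasFDerivAt_pull_one OmegaStd
  have hE1 : Tendsto (fun n => M (φ n) * h n) atTop (𝓝 1) := by
    have := hE0.add_const 1
    simpa [hE] using this
  have hr : (fun n => pull (M (φ n)) OmegaStd - OmegaStd - L (E n)) =o[atTop] E := by
    have := hLd.isLittleO.comp_tendsto hE1
    refine this.congr (fun n => ?_) (fun n => rfl)
    simp only [Function.comp, pull_one, pull_mul, (hh n).2, hE]
    rfl
  have hEsq : (fun n => E n * (E n)ᵀ) =o[atTop] E := by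
    have h1 : (fun n => (E n)ᵀ) =O[atTop] E :=
      (LinearMap.toContinuousLinearMap
        (Matrix.transposeLinearEquiv (Fin 8) (Fin 8) ℝ ℝ).toLinearMap).isBigO_comp E atTop
    have h2 := ((isLittleO_one_iff ℝ).2 hE0).mul_isBigO h1.norm_right
    simpa using h2
  set S : ℕ → Mat := fun n => (1 / 2 : ℝ) • (E n + (E n)ᵀ) with hS
  have hES : ∀ n, E n = A n + S n := fun n => by
    ext i j; simp [hA, hS, skewPart]; ring
  have hsφ : Tendsto (s ∘ φ) atTop (𝓝 0) := hs.comp hφt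
  have hMoφ : (fun n => M (φ n) * (M (φ n))ᵀ - 1) =o[atTop] (s ∘ φ) := hMo.comp_tendsto hφt
  have hSe : ∀ n, S n = (1 / 2 : ℝ) • (M (φ n) * (M (φ n))ᵀ - 1)
      - (1 / 2 : ℝ) • (E n * (E n)ᵀ) := fun n => by
    rw [← smul_sub, hS, ← hEE n, add_sub_cancel_right]
  have hcOφ : (fun n => pull (M (φ n)) OmegaStd - OmegaStd) =O[atTop] (s ∘ φ) :=
    hcO.comp_tendsto hφt
  -- `act (A n) Ω = (c n - Ω) - r n - L (S n)`
  have hact : ∀ n, act (A n) OmegaStd = (pull (M (φ n)) OmegaStd - OmegaStd)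
      - (pull (M (φ n)) OmegaStd - OmegaStd - L (E n)) - L (S n) := fun n => by
    have : A n = E n - S n := by rw [hES n]; abel
    rw [this, ← hL, map_sub]; abel
  have hEO : E =O[atTop] (s ∘ φ) := by
    -- `E = Λ(c - Ω) + ½ (M Mᵀ - 1) - ½ Λ L (M Mᵀ - 1) + o(E)`
    have hrem : (fun n => -Λ (pull (M (φ n)) OmegaStd - OmegaStd - L (E n))
        + Λ (L ((1 / 2 : ℝ) • (E n * (E n)ᵀ))) - (1 / 2 : ℝ) • (E n * (E n)ᵀ)) =o[atTop] E := by
      refine IsLittleO.sub (IsLittleO.add ?_ ?_) (hEsq.const_smul_left (1 / 2 : ℝ))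
      · exact ((Λ.isBigO_comp _ atTop).trans_isLittleO hr).neg_left
      · exact (((Λ.comp L).isBigO_comp _ atTop).trans_isLittleO (hEsq.const_smul_left (1 / 2 : ℝ)))
    -- Subtracting a term that is `o(E)` does not change the order of `E`, so the remainder is
    -- absorbed and only the explicit terms need to be `O(s)`.
    refine hrem.right_isBigO_sub.trans ?_
    have hmain : (fun n => Λ (pull (M (φ n)) OmegaStd - OmegaStd)
        - Λ (L ((1 / 2 : ℝ) • (M (φ n) * (M (φ n))ᵀ - 1)))
        + (1 / 2 : ℝ) • (M (φ n) * (M (φ n))ᵀ - 1)) =O[atTop] (s ∘ φ) := by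
      refine IsBigO.add (IsBigO.sub ?_ ?_) (hMoφ.isBigO.const_smul_left (1 / 2 : ℝ))
      · exact (Λ.isBigO_comp _ atTop).trans hcOφ
      · exact ((Λ.comp L).isBigO_comp _ atTop).trans (hMoφ.isBigO.const_smul_left (1 / 2 : ℝ))
    refine hmain.congr_left fun n => ?_
    have e1 : E n = Λ (act (A n) OmegaStd) + S n := by rw [← hΛ n, ← hES n]
    have e2 : Λ (act (A n) OmegaStd) = Λ (pull (M (φ n)) OmegaStd - OmegaStd)
        - Λ (pull (M (φ n)) OmegaStd - OmegaStd - L (E n)) - Λ (L (S n)) := by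
      rw [hact n, map_sub, map_sub]
    rw [e2] at e1
    have e3 : Λ (L (S n)) = Λ (L ((1 / 2 : ℝ) • (M (φ n) * (M (φ n))ᵀ - 1)))
        - Λ (L ((1 / 2 : ℝ) • (E n * (E n)ᵀ))) := by rw [hSe n, map_sub, map_sub]
    rw [e3, hSe n] at e1
    nth_rewrite 1 [e1]
    abel
  have hlim : Tendsto (fun n => (s (φ n))⁻¹ • act (A n) OmegaStd) atTop (𝓝 η) := by
    have h1 : (fun n => (pull (M (φ n)) OmegaStd - OmegaStd - L (E n)) + L (S n))
        =o[atTop] (s ∘ φ) := by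
      refine (hr.trans_isBigO hEO).add ((L.isBigO_comp S atTop).trans_isLittleO ?_)
      refine (IsLittleO.sub (hMoφ.const_smul_left (1 / 2 : ℝ))
        ((hEsq.trans_isBigO hEO).const_smul_left (1 / 2 : ℝ))).congr_left fun n => (hSe n).symm
    have h2 : Tendsto (fun n => (s (φ n))⁻¹ • ((pull (M (φ n)) OmegaStd - OmegaStd - L (E n))
        + L (S n))) atTop (𝓝 0) := by
      have h3 := (isBigO_refl (fun n => (s (φ n))⁻¹) atTop).smul_isLittleO h1
      have h4 : (fun n => (s (φ n))⁻¹ • (s ∘ φ) n) = fun _ => (1 : ℝ) := by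
        ext n; simp [hs0]
      rw [h4] at h3
      exact (isLittleO_one_iff ℝ).1 h3
    have h5 := (hη.comp hφt).sub h2
    rw [sub_zero] at h5
    refine h5.congr fun n => ?_
    simp only [Function.comp]
    rw [← smul_sub, hact n]; congr 1; abel
  -- Since `A = Λ (act A Ω)`, convergence of the quotients of `act A Ω` gives that of the quotients
  -- of `A`; their limit `Λ η` is the required tangent vector.
  have hlim2 : Tendsto (fun n => (s (φ n))⁻¹ • A n) atTop (𝓝 (Λ η)) := by
    refine ((Λ.continuous.tendsto η).comp hlim).congr fun n => ?_
    simp only [Function.comp]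
    rw [map_smul, ← hΛ n]
  refine ⟨Λ η, ?_, ?_⟩
  · refine tendsto_nhds_unique
      ((continuous_id.matrix_transpose.tendsto (Λ η)).comp hlim2) (hlim2.neg.congr fun n => ?_)
    simp only [Function.comp, id, Matrix.transpose_smul, (hAΛ n).1, smul_neg]
  · rw [← hL]
    refine tendsto_nhds_unique ((L.continuous.tendsto (Λ η)).comp hlim2) (hlim.congr fun n => ?_)
    simp only [Function.comp]
    rw [map_smul, hL]

end Orbit

open Filter Topology in
/-- The covariant derivative, along a curve, of the `4`-form of an `Sp(2)Sp(1)`-structure lies in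
the image of `⋄`. -/
lemma exists_diamond_eq {g : ℝ → Mat} {g' γ : Mat} {W : ℝ → Comp4} {W' : Comp4}
    (hg : MatDeriv g g' 0) (hγ : g' = γ * g 0 + g 0 * γᵀ) (hW : CompDeriv W W' 0)
    (hstd : ∀ᶠ s in 𝓝 0, ∃ P, IsStdFrame (g s) (W s) P) :
    ∃ β : Mat, βᵀ = -β ∧ diamond (g 0)⁻¹ β (W 0) = W' - act γ (W 0) := by
  obtain ⟨P₀, hP₀⟩ := hstd.self_of_nhds
  obtain ⟨h1, h2, hP⟩ := frame_mul_inv hP₀.1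
  have hPP : P₀⁻¹ * P₀ = 1 := Matrix.nonsing_inv_mul _ hP
  have hPP' : P₀ * P₀⁻¹ = 1 := Matrix.mul_nonsing_inv _ hP
  -- Parallel transport to first order: in the frame `N s` the metric has zero derivative at `0`,
  -- and the derivative of the `4`-form is the covariant one.
  let N : ℝ → Mat := fun s => P₀ * (1 + s • γ)⁻¹
  have hN0 : N 0 = P₀ := by simp [N]
  have hN : MatDeriv N (-(P₀ * γ)) 0 := by
    have := (matDeriv_const P₀ 0).mul ((matDeriv_one_add_smul γ).inv (by simp))
    simpa [N] using this
  have hNg : MatDeriv (fun s => N s * g s * (N s)ᵀ) 0 0 := by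
    have := (hN.mul hg).mul hN.transpose
    convert this using 1
    rw [hN0, hγ]
    simp [Matrix.transpose_mul, mul_add, Matrix.mul_assoc]
  have hNW : CompDeriv (fun s => pull (N s) (W s)) (pull P₀ (W' - act γ (W 0))) 0 := by
    have := CompDeriv.pull hN (c := -(P₀ * γ * P₀⁻¹))
      (by rw [hN0, Matrix.neg_mul, Matrix.mul_assoc _ P₀⁻¹, hPP, Matrix.mul_one]) hW
    rw [hN0, act_neg_left, ← pull_act (b := γ) (by
      rw [Matrix.mul_assoc _ P₀⁻¹, hPP, Matrix.mul_one]), ← sub_eq_add_neg, ← pull_sub] at this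
    exact this
  obtain ⟨ε, hε, hball⟩ := Metric.eventually_nhds_iff.1 (hstd.and
    ((matDeriv_one_add_smul γ).hasDerivAt_det_sum.continuousAt.eventually_ne
      (by simp : Matrix.det (1 + (0 : ℝ) • γ) ≠ 0)))
  let s : ℕ → ℝ := fun n => ε / 2 * (1 / ((n : ℝ) + 1))
  have hspos : ∀ n, 0 < s n := fun n => by positivity
  have hs0 : Tendsto s atTop (𝓝 0) := by
    simpa [s] using tendsto_one_div_add_atTop_nhds_zero_nat.const_mul (ε / 2)
  have hs0' : Tendsto s atTop (𝓝[≠] 0) :=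
    tendsto_nhdsWithin_iff.2 ⟨hs0, .of_forall fun n => (hspos n).ne'⟩
  have hsε : ∀ n, dist (s n) 0 < ε := fun n => by
    rw [Real.dist_0_eq_abs, abs_of_pos (hspos n)]
    have : 1 / ((n : ℝ) + 1) ≤ 1 := by
      rw [div_le_one (by positivity)]; linarith [Nat.cast_nonneg (α := ℝ) n]
    have : s n ≤ ε / 2 * 1 := mul_le_mul_of_nonneg_left this (by positivity)
    linarith
  choose P hPs using fun n => (hball (hsε n)).1
  have hdet : ∀ n, IsUnit (1 + s n • γ).det := fun n => (hball (hsε n)).2.isUnit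
  -- Measured against an arbitrary standard frame `P n` at each time, the `4`-form in the frame `N`
  -- lies in the orbit under `M n`. No regularity of `n ↦ P n` is used.
  let M : ℕ → Mat := fun n => N (s n) * (P n)⁻¹
  have hMW : ∀ n, pull (M n) OmegaStd = pull (N (s n)) (W (s n)) := fun n => by
    rw [pull_mul, ← (hPs n).2, ← pull_mul (P n)⁻¹,
      Matrix.nonsing_inv_mul _ (hPs n).isUnit_det, pull_one]
  have hMM : ∀ n, M n * (M n)ᵀ = N (s n) * g (s n) * (N (s n))ᵀ := fun n => by
    obtain ⟨e1, e2, e3⟩ := frame_mul_inv (hPs n).1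
    have : (P n)⁻¹ * ((P n)⁻¹)ᵀ = g (s n) := by
      rw [← e2, ← Matrix.mul_assoc, Matrix.nonsing_inv_mul _ e3, Matrix.one_mul]
    rw [Matrix.transpose_mul, ← this]; simp only [M, Matrix.mul_assoc]
  have hN00 : N 0 * g 0 * (N 0)ᵀ = 1 := by rw [hN0]; exact hP₀.1
  obtain ⟨β, hβ, hβη⟩ := exists_act_eq_of_tendsto (M := M)
    (η := pull P₀ (W' - act γ (W 0))) (fun n => (hspos n).ne') hs0
    (by
      refine tendsto_pi_nhds.2 fun I => ?_
      refine ((hasDerivAt_iff_tendsto_slope_zero.1 (hNW I)).comp hs0').congr fun n => ?_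
      have : pull (N 0) (W 0) = OmegaStd := by rw [hN0]; exact hP₀.2
      simp [hMW, this])
    (by
      refine tendsto_pi_nhds.2 fun i => tendsto_pi_nhds.2 fun j => ?_
      refine ((hasDerivAt_iff_tendsto_slope_zero.1 (hNg i j)).comp hs0').congr fun n => ?_
      simp [hMM, hN00])
  refine ⟨P₀⁻¹ * β * (P₀⁻¹)ᵀ, by simp [Matrix.transpose_mul, hβ, Matrix.mul_assoc], ?_⟩
  rw [diamond_eq_act]
  have e : P₀ * (P₀⁻¹ * β * (P₀⁻¹)ᵀ * (g 0)⁻¹) = β * P₀ := by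
    rw [inv_eq_of_frame hP₀.1]
    have : (P₀⁻¹)ᵀ * P₀ᵀ = 1 := by rw [← Matrix.transpose_mul, hPP', Matrix.transpose_one]
    simp only [← Matrix.mul_assoc, hPP', Matrix.one_mul]
    rw [Matrix.mul_assoc β, this, Matrix.mul_one]
  have h3 := pull_act e (W 0)
  rw [hP₀.2, hβη] at h3
  have := congrArg (pull P₀⁻¹) h3
  simpa only [← pull_mul, hPP, pull_one] using this

end QKFlow

end

/-! ### Tensor calculus in one chart: Levi-Civita connection, torsion identities, and the evolution
of the energy density. -/

noncomputable section

namespace QKFlow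

open Matrix Finset

/-! ### Smooth families of matrices and tensors -/

section Smooth

variable {E : Type*} [NormedAddCommGroup E] [NormedSpace ℝ E] {s : Set E}

/-- The entries of the family `F` of matrices are smooth on `s`. -/
def MatSmooth (s : Set E) (F : E → Mat) : Prop := ∀ i j, ContDiffOn ℝ ∞ (fun z => F z i j) s

/-- The components of the family `W` of tensors are smooth on `s`. -/
def CompSmooth (s : Set E) (W : E → Comp4) : Prop := ∀ I, ContDiffOn ℝ ∞ (fun z => W z I) s

variable {F G : E → Mat} {V W : E → Comp4}

lemma matSmooth_const (A : Mat) : MatSmooth s (fun _ => A) := fun _ _ => contDiffOn_const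

lemma MatSmooth.sub (hF : MatSmooth s F) (hG : MatSmooth s G) : MatSmooth s (fun z => F z - G z) :=
  fun i j => (hF i j).sub (hG i j)

lemma MatSmooth.smul {f : E → ℝ} (hf : ContDiffOn ℝ ∞ f s) (hF : MatSmooth s F) :
    MatSmooth s (fun z => f z • F z) := fun i j => by
  simpa using hf.mul (hF i j)

lemma MatSmooth.transpose (hF : MatSmooth s F) : MatSmooth s (fun z => (F z)ᵀ) :=
  fun i j => hF j i

lemma MatSmooth.mul (hF : MatSmooth s F) (hG : MatSmooth s G) : MatSmooth s (fun z => F z * G z) :=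
  fun i j => by
    simp only [Matrix.mul_apply]
    exact ContDiffOn.sum fun k _ => (hF i k).mul (hG k j)

lemma MatSmooth.sum {ι : Type*} {u : Finset ι} {H : ι → E → Mat}
    (h : ∀ k ∈ u, MatSmooth s (H k)) : MatSmooth s (fun z => ∑ k ∈ u, H k z) := fun i j => by
  simp only [Matrix.sum_apply]
  exact ContDiffOn.sum fun k hk => h k hk i j

lemma MatSmooth.trace (hF : MatSmooth s F) : ContDiffOn ℝ ∞ (fun z => (F z).trace) s := by
  simp only [Matrix.trace, Matrix.diag]
  exact ContDiffOn.sum fun k _ => hF k k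

lemma MatSmooth.br (hF : MatSmooth s F) (hG : MatSmooth s G) :
    ContDiffOn ℝ ∞ (fun z => br (F z) (G z)) s :=
  contDiffOn_const.mul (hF.mul hG).trace

lemma MatSmooth.det (hF : MatSmooth s F) : ContDiffOn ℝ ∞ (fun z => (F z).det) s := by
  simp only [Matrix.det_apply']
  exact ContDiffOn.sum fun σ _ => contDiffOn_const.mul (contDiffOn_prod fun i _ => hF _ _)

lemma MatSmooth.inv (hF : MatSmooth s F) (h : ∀ z ∈ s, IsUnit (F z).det) :
    MatSmooth s (fun z => (F z)⁻¹) := fun i j => by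
  have h1 : ContDiffOn ℝ ∞ (fun z => (F z).adjugate i j) s := by
    have : MatSmooth s (fun z => (F z).updateRow j (Pi.single i 1)) := fun k l => by
      by_cases hk : k = j
      · subst hk; simpa using contDiffOn_const
      · simpa [Matrix.updateRow_apply, hk] using hF k l
    simpa only [Matrix.adjugate_apply] using this.det
  refine ((hF.det.inv fun z hz => (h z hz).ne_zero).mul h1).congr fun z _ => ?_
  simp [Matrix.inv_def, Ring.inverse_eq_inv']

lemma MatSmooth.congr (hF : MatSmooth s F) (h : ∀ z ∈ s, G z = F z) : MatSmooth s G :=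
  fun i j => (hF i j).congr fun z hz => by rw [h z hz]

lemma MatSmooth.comp {E' : Type*} [NormedAddCommGroup E'] [NormedSpace ℝ E'] {s' : Set E'}
    {f : E' → E} (hF : MatSmooth s F) (hf : ContDiffOn ℝ ∞ f s') (h : Set.MapsTo f s' s) :
    MatSmooth s' (fun z => F (f z)) := fun i j => (hF i j).comp hf h

lemma CompSmooth.comp {E' : Type*} [NormedAddCommGroup E'] [NormedSpace ℝ E'] {s' : Set E'}
    {f : E' → E} (hW : CompSmooth s W) (hf : ContDiffOn ℝ ∞ f s') (h : Set.MapsTo f s' s) :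
    CompSmooth s' (fun z => W (f z)) := fun I => (hW I).comp hf h

lemma CompSmooth.sub (hV : CompSmooth s V) (hW : CompSmooth s W) :
    CompSmooth s (fun z => V z - W z) := fun I => (hV I).sub (hW I)

lemma CompSmooth.act (hF : MatSmooth s F) (hW : CompSmooth s W) :
    CompSmooth s (fun z => act (F z) (W z)) := fun I => by
  unfold QKFlow.act
  exact ContDiffOn.sum fun p _ => ContDiffOn.sum fun k _ => (hF _ _).mul (hW _)

lemma CompSmooth.pull (hF : MatSmooth s F) (hW : CompSmooth s W) :
    CompSmooth s (fun z => pull (F z) (W z)) := fun I => by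
  unfold QKFlow.pull
  exact ContDiffOn.sum fun A _ => (contDiffOn_prod fun p _ => hF _ _).mul (hW _)

lemma CompSmooth.pair4 (hV : CompSmooth s V) (hW : CompSmooth s W) :
    ContDiffOn ℝ ∞ (fun z => pair4 (V z) (W z)) s := by
  unfold QKFlow.pair4
  exact ContDiffOn.sum fun I _ => (hV I).mul (hW I)

lemma CompSmooth.diamondLin {gi α : E → Mat} (hgi : MatSmooth s gi) (hW : CompSmooth s W)
    (hα : MatSmooth s α) : CompSmooth s (fun z => diamondLin (gi z) (W z) (α z)) := by
  have h : MatSmooth s (fun z => skewPart (α z) * gi z) :=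
    (MatSmooth.smul contDiffOn_const (hα.sub hα.transpose)).mul hgi
  have := CompSmooth.act h hW
  simpa only [QKFlow.diamondLin, LinearMap.coe_mk, AddHom.coe_mk, diamond_eq_act] using this

lemma MatSmooth.diamondDag {g gi : E → Mat} (hg : MatSmooth s g) (hgi : MatSmooth s gi)
    (hW : CompSmooth s W) (hV : CompSmooth s V) :
    MatSmooth s (fun z => diamondDag (g z) (gi z) (W z) (V z)) := by
  have : MatSmooth s (fun z => diamondAdj (gi z) (W z) (QKFlow.pull (gi z) (V z))) := fun i j =>
    CompSmooth.pair4 (CompSmooth.pull hgi hV) (CompSmooth.diamondLin hgi hW (matSmooth_const _))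
  exact (hg.mul this).mul hg

/-- The reason for the polynomial formula: `diamondInv` is a pointwise choice and carries no
regularity, whereas here the dependence on the data is visibly smooth. -/
lemma MatSmooth.diamondPinv {g gi : E → Mat} (hg : MatSmooth s g) (hgi : MatSmooth s gi)
    (hW : CompSmooth s W) (hV : CompSmooth s V) :
    MatSmooth s (fun z => diamondPinv (g z) (gi z) (W z) (V z)) := by
  have hpow : ∀ (n : ℕ) (α : E → Mat), MatSmooth s α →
      MatSmooth s (fun z => (diamondSq (g z) (gi z) (W z) ^ n) (α z)) := by
    intro n
    induction n with
    | zero => intro α hα; simpa using hα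
    | succ n ih =>
      intro α hα
      simp only [pow_succ, Module.End.mul_apply]
      exact ih _ (MatSmooth.diamondDag hg hgi hW (CompSmooth.diamondLin hgi hW hα))
  simp only [QKFlow.diamondPinv, Polynomial.aeval_eq_sum_range, LinearMap.sum_apply,
    LinearMap.smul_apply]
  exact MatSmooth.sum fun n _ => MatSmooth.smul contDiffOn_const
    (hpow n _ (MatSmooth.diamondDag hg hgi hW hV))

end Smooth

/-! ### Partial derivatives -/

/-- The `i`-th coordinate vector of `ℝ⁸`. -/
abbrev stdVec (i : Fin 8) : E8 := EuclideanSpace.single i 1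

/-- Partial derivatives of a family of matrices. -/
def pdMat (i : Fin 8) (F : E8 → Mat) (y : E8) : Mat :=
  Matrix.of fun a b => pderiv i (fun z => F z a b) y

/-- Partial derivatives of a family of `4`-tensors. -/
def pdComp (i : Fin 8) (W : E8 → Comp4) (y : E8) : Comp4 := fun I => pderiv i (fun z => W z I) y

/-- The family `F` of matrices is differentiable at `y`. -/
def MatDiff (F : E8 → Mat) (y : E8) : Prop := ∀ i j, DifferentiableAt ℝ (fun z => F z i j) y

/-- The family `W` of tensors is differentiable at `y`. -/
def CompDiff (W : E8 → Comp4) (y : E8) : Prop := ∀ I, DifferentiableAt ℝ (fun z => W z I) y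

lemma hasDerivAt_line (y v : E8) (r : ℝ) : HasDerivAt (fun r : ℝ => y + r • v) v r :=
  (((hasDerivAt_id r).smul_const v).const_add y).congr_deriv (one_smul _ _)

lemma hasDerivAt_pderiv {f : E8 → ℝ} {y : E8} (h : DifferentiableAt ℝ f y) (i : Fin 8) :
    HasDerivAt (fun r : ℝ => f (y + r • stdVec i)) (pderiv i f y) 0 := by
  have h1 : HasFDerivAt f (fderiv ℝ f y) (y + (0 : ℝ) • stdVec i) := by simpa using h.hasFDerivAt
  exact h1.comp_hasDerivAt (0 : ℝ) (hasDerivAt_line y (stdVec i) 0)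

lemma pderiv_eq_of_hasDerivAt {f : E8 → ℝ} {y : E8} (h : DifferentiableAt ℝ f y) {i : Fin 8} {d : ℝ}
    (hd : HasDerivAt (fun r : ℝ => f (y + r • stdVec i)) d 0) : pderiv i f y = d :=
  (hasDerivAt_pderiv h i).unique hd

lemma MatDiff.matDeriv {F : E8 → Mat} {y : E8} (h : MatDiff F y) (i : Fin 8) :
    MatDeriv (fun r : ℝ => F (y + r • stdVec i)) (pdMat i F y) 0 :=
  fun a b => hasDerivAt_pderiv (h a b) i

lemma CompDiff.compDeriv {W : E8 → Comp4} {y : E8} (h : CompDiff W y) (i : Fin 8) :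
    CompDeriv (fun r : ℝ => W (y + r • stdVec i)) (pdComp i W y) 0 :=
  fun I => hasDerivAt_pderiv (h I) i

lemma pdMat_eq {F : E8 → Mat} {y : E8} (h : MatDiff F y) {i : Fin 8} {D : Mat}
    (hD : MatDeriv (fun r : ℝ => F (y + r • stdVec i)) D 0) : pdMat i F y = D :=
  (h.matDeriv i).unique hD

lemma pdComp_eq {W : E8 → Comp4} {y : E8} (h : CompDiff W y) {i : Fin 8} {D : Comp4}
    (hD : CompDeriv (fun r : ℝ => W (y + r • stdVec i)) D 0) : pdComp i W y = D :=
  (h.compDeriv i).unique hD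

lemma MatSmooth.matDiff {U : Set E8} (hU : IsOpen U) {F : E8 → Mat} (h : MatSmooth U F) {y : E8}
    (hy : y ∈ U) : MatDiff F y := fun i j =>
  ((h i j).contDiffAt (hU.mem_nhds hy)).differentiableAt (by simp)

lemma CompSmooth.compDiff {U : Set E8} (hU : IsOpen U) {W : E8 → Comp4} (h : CompSmooth U W)
    {y : E8} (hy : y ∈ U) : CompDiff W y := fun I =>
  ((h I).contDiffAt (hU.mem_nhds hy)).differentiableAt (by simp)

section Pderiv

variable {U : Set E8} (hU : IsOpen U) {f g : E8 → ℝ} {y : E8}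

include hU in
lemma pderiv_congr (h : ∀ z ∈ U, f z = g z) (hy : y ∈ U) (i : Fin 8) :
    pderiv i f y = pderiv i g y := by
  have : f =ᶠ[nhds y] g := Filter.eventuallyEq_of_mem (hU.mem_nhds hy) h
  rw [pderiv, pderiv, this.fderiv_eq]

lemma pderiv_mul (hf : DifferentiableAt ℝ f y) (hg : DifferentiableAt ℝ g y) (i : Fin 8) :
    pderiv i (fun z => f z * g z) y = pderiv i f y * g y + f y * pderiv i g y := by
  have := (hasDerivAt_pderiv hf i).mul (hasDerivAt_pderiv hg i)
  simp only [zero_smul, add_zero] at this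
  exact pderiv_eq_of_hasDerivAt (hf.mul hg) this

lemma pderiv_add (hf : DifferentiableAt ℝ f y) (hg : DifferentiableAt ℝ g y) (i : Fin 8) :
    pderiv i (fun z => f z + g z) y = pderiv i f y + pderiv i g y :=
  pderiv_eq_of_hasDerivAt (hf.add hg) ((hasDerivAt_pderiv hf i).add (hasDerivAt_pderiv hg i))

lemma pderiv_sub (hf : DifferentiableAt ℝ f y) (hg : DifferentiableAt ℝ g y) (i : Fin 8) :
    pderiv i (fun z => f z - g z) y = pderiv i f y - pderiv i g y :=
  pderiv_eq_of_hasDerivAt (hf.sub hg) ((hasDerivAt_pderiv hf i).sub (hasDerivAt_pderiv hg i))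

lemma pderiv_const_mul (hf : DifferentiableAt ℝ f y) (c : ℝ) (i : Fin 8) :
    pderiv i (fun z => c * f z) y = c * pderiv i f y :=
  pderiv_eq_of_hasDerivAt (hf.const_mul c) ((hasDerivAt_pderiv hf i).const_mul c)

lemma pderiv_sum {ι : Type*} {u : Finset ι} {f : ι → E8 → ℝ}
    (hf : ∀ k ∈ u, DifferentiableAt ℝ (f k) y) (i : Fin 8) :
    pderiv i (fun z => ∑ k ∈ u, f k z) y = ∑ k ∈ u, pderiv i (f k) y :=
  pderiv_eq_of_hasDerivAt (DifferentiableAt.fun_sum hf)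
    (HasDerivAt.fun_sum fun k hk => hasDerivAt_pderiv (hf k hk) i)

lemma pderiv_const (c : ℝ) (i : Fin 8) : pderiv i (fun _ => c) y = 0 := by
  simp [pderiv]

lemma pderiv_coord (i j : Fin 8) : pderiv i (fun z : E8 => z j) y = if i = j then 1 else 0 := by
  have h : DifferentiableAt ℝ (fun z : E8 => z j) y :=
    (EuclideanSpace.proj (𝕜 := ℝ) j).differentiableAt
  refine pderiv_eq_of_hasDerivAt h ?_
  have := ((hasDerivAt_id (0 : ℝ)).mul_const (stdVec i j)).const_add (y j)
  refine (this.congr_deriv ?_)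
  simp [eq_comm]

lemma fderiv_eq_sum_pderiv (f : E8 → ℝ) (y v : E8) :
    fderiv ℝ f y v = ∑ i, v i * pderiv i f y := by
  have hv : v = ∑ i, v i • stdVec i := by
    ext j; simp [Finset.sum_apply, Pi.single_apply]
  conv_lhs => rw [hv, map_sum]
  simp [pderiv]

lemma pderiv_comm {f : E8 → ℝ} (h : ContDiffAt ℝ 2 f y) (i j : Fin 8) :
    pderiv i (pderiv j f) y = pderiv j (pderiv i f) y := by
  have hd : DifferentiableAt ℝ (fderiv ℝ f) y :=
    (h.fderiv_right (m := 1) (by norm_num)).differentiableAt (by simp)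
  have key : ∀ i j, pderiv i (pderiv j f) y = fderiv ℝ (fderiv ℝ f) y (stdVec i) (stdVec j) := by
    intro i j
    have : pderiv j f = fun z => fderiv ℝ f z (stdVec j) := rfl
    rw [pderiv, this, fderiv_clm_apply hd (differentiableAt_const _)]
    simp
  rw [key, key]
  exact (h.isSymmSndFDerivAt (by simp)).eq _ _

include hU in
lemma contDiffOn_pderiv (h : ContDiffOn ℝ ∞ f U) (i : Fin 8) : ContDiffOn ℝ ∞ (pderiv i f) U :=
  (h.fderiv_of_isOpen hU (m := ∞) (by simp)).clm_apply contDiffOn_const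

include hU in
lemma MatSmooth.pdMat {F : E8 → Mat} (h : MatSmooth U F) (i : Fin 8) :
    MatSmooth U (pdMat i F) := fun a b => contDiffOn_pderiv hU (h a b) i

include hU in
lemma CompSmooth.pdComp {W : E8 → Comp4} (h : CompSmooth U W) (i : Fin 8) :
    CompSmooth U (pdComp i W) := fun I => contDiffOn_pderiv hU (h I) i

end Pderiv

lemma MatDiff.mul {F G : E8 → Mat} {y : E8} (hF : MatDiff F y) (hG : MatDiff G y) :
    MatDiff (fun z => F z * G z) y := fun i j => by
  simp only [Matrix.mul_apply]
  exact DifferentiableAt.fun_sum fun k _ => (hF i k).mul (hG k j)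

lemma MatDiff.transpose {F : E8 → Mat} {y : E8} (hF : MatDiff F y) :
    MatDiff (fun z => (F z)ᵀ) y := fun i j => hF j i

lemma MatDiff.trace {F : E8 → Mat} {y : E8} (hF : MatDiff F y) :
    DifferentiableAt ℝ (fun z => (F z).trace) y := by
  simp only [Matrix.trace, Matrix.diag]
  exact DifferentiableAt.fun_sum fun k _ => hF k k

lemma pdMat_mul {F G : E8 → Mat} {y : E8} (hF : MatDiff F y) (hG : MatDiff G y) (i : Fin 8) :
    pdMat i (fun z => F z * G z) y = pdMat i F y * G y + F y * pdMat i G y := by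
  have := (hF.matDeriv i).mul (hG.matDeriv i)
  simp only [zero_smul, add_zero] at this
  exact pdMat_eq (hF.mul hG) this

lemma pdMat_transpose (F : E8 → Mat) (y : E8) (i : Fin 8) :
    pdMat i (fun z => (F z)ᵀ) y = (pdMat i F y)ᵀ := rfl

lemma pderiv_trace {F : E8 → Mat} {y : E8} (hF : MatDiff F y) (i : Fin 8) :
    pderiv i (fun z => (F z).trace) y = (pdMat i F y).trace :=
  pderiv_eq_of_hasDerivAt hF.trace (hF.matDeriv i).trace

lemma pdMat_congr {U : Set E8} (hU : IsOpen U) {F G : E8 → Mat} (h : ∀ z ∈ U, F z = G z) {y : E8}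
    (hy : y ∈ U) (i : Fin 8) : pdMat i F y = pdMat i G y := by
  ext a b
  exact pderiv_congr hU (fun z hz => by rw [h z hz]) hy i

lemma pdComp_congr {U : Set E8} (hU : IsOpen U) {V W : E8 → Comp4} (h : ∀ z ∈ U, V z = W z) {y : E8}
    (hy : y ∈ U) (i : Fin 8) : pdComp i V y = pdComp i W y := by
  ext I
  exact pderiv_congr hU (fun z hz => by rw [h z hz]) hy i

lemma pdComp_act {F : E8 → Mat} {W : E8 → Comp4} {y : E8} (hF : MatDiff F y) (hW : CompDiff W y)
    (i : Fin 8) : pdComp i (fun z => act (F z) (W z)) y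
      = act (pdMat i F y) (W y) + act (F y) (pdComp i W y) := by
  have := CompDeriv.act (hF.matDeriv i) (hW.compDeriv i)
  simp only [zero_smul, add_zero] at this
  refine pdComp_eq (fun I => ?_) this
  unfold act
  exact DifferentiableAt.fun_sum fun p _ => DifferentiableAt.fun_sum fun k _ => (hF _ _).mul (hW _)

/-! ### The Levi-Civita connection in a chart -/

/-- `gm` is a smooth Riemannian metric on the open subset `U` of `ℝ⁸`. -/
structure ChartMetric (U : Set E8) (gm : E8 → Mat) : Prop where
  isOpen : IsOpen U
  smooth : MatSmooth U gm
  symm : ∀ y ∈ U, (gm y)ᵀ = gm y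
  frame : ∀ y ∈ U, ∃ P : Mat, P * gm y * Pᵀ = 1

/-- The connection matrices `(γₘ)ᵢᵏ = Γᵏₘᵢ`. -/
def gam (gm : E8 → Mat) (m : Fin 8) (y : E8) : Mat := Matrix.of fun i k => christoffel gm y k m i

lemma cov4_eq (gm : E8 → Mat) (W : E8 → Comp4) (y : E8) (m : Fin 8) :
    cov4 gm W y m = pdComp m W y - act (gam gm m y) (W y) := rfl

/-- Covariant derivative of a field of endomorphisms. -/
def covMat (gm : E8 → Mat) (m : Fin 8) (a : E8 → Mat) (y : E8) : Mat :=
  pdMat m a y - (gam gm m y * a y - a y * gam gm m y)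

/-- The curvature `F_{mn} = ∂ₘγₙ - ∂ₙγₘ - [γₘ, γₙ]`. -/
def curv (gm : E8 → Mat) (m n : Fin 8) (y : E8) : Mat :=
  pdMat m (gam gm n) y - pdMat n (gam gm m) y
    - (gam gm m y * gam gm n y - gam gm n y * gam gm m y)

namespace ChartMetric

variable {U : Set E8} {gm : E8 → Mat} (h : ChartMetric U gm) {y : E8}

include h

lemma isUnit_det (hy : y ∈ U) : IsUnit (gm y).det := by
  obtain ⟨P, hP⟩ := h.frame y hy
  exact isUnit_det_of_frame hP

lemma smooth_inv : MatSmooth U (fun z => (gm z)⁻¹) :=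
  h.smooth.inv fun _ hz => h.isUnit_det hz

lemma inv_symm (hy : y ∈ U) : ((gm y)⁻¹)ᵀ = (gm y)⁻¹ := by
  rw [Matrix.transpose_nonsing_inv, h.symm y hy]

lemma smooth_gam (m : Fin 8) : MatSmooth U (gam gm m) := fun i k => by
  refine ContDiffOn.mul contDiffOn_const (ContDiffOn.sum fun l _ => ?_)
  exact (h.smooth_inv k l).mul (((contDiffOn_pderiv h.isOpen (h.smooth _ _) _).add
    (contDiffOn_pderiv h.isOpen (h.smooth _ _) _)).sub
    (contDiffOn_pderiv h.isOpen (h.smooth _ _) _))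

lemma pderiv_symm (hy : y ∈ U) (l i j : Fin 8) :
    pderiv l (fun z => gm z i j) y = pderiv l (fun z => gm z j i) y :=
  pderiv_congr h.isOpen (fun z hz => by
    conv_lhs => rw [← h.symm z hz]
    rfl) hy l

lemma gam_comm (hy : y ∈ U) (m i k : Fin 8) : gam gm m y i k = gam gm i y m k := by
  simp only [gam, Matrix.of_apply, christoffel]
  congr 1
  refine sum_congr rfl fun l _ => ?_
  rw [h.pderiv_symm hy l m i]; ring

/-- Koszul's formula: lowering the upper index cancels the inverse metric in the Christoffel
symbols. -/
lemma gam_mul (hy : y ∈ U) (m i j : Fin 8) : (gam gm m y * gm y) i j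
    = (1 / 2) * (pderiv m (fun z => gm z i j) y + pderiv i (fun z => gm z m j) y
      - pderiv j (fun z => gm z m i) y) := by
  have key : ∀ X : Fin 8 → ℝ, ∑ k, (∑ l, (gm y)⁻¹ k l * X l) * gm y k j = X j := by
    intro X
    have h1 : (gm y)ᵀ * (gm y)⁻¹ = 1 := by
      rw [h.symm y hy, Matrix.mul_nonsing_inv _ (h.isUnit_det hy)]
    calc _ = ∑ k, ∑ l, (gm y)ᵀ j k * (gm y)⁻¹ k l * X l := by
          refine sum_congr rfl fun k _ => ?_
          rw [sum_mul]
          exact sum_congr rfl fun l _ => by rw [Matrix.transpose_apply]; ring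
      _ = ∑ l, ((gm y)ᵀ * (gm y)⁻¹) j l * X l := by
          rw [sum_comm]
          exact sum_congr rfl fun l _ => by rw [Matrix.mul_apply, sum_mul]
      _ = X j := by rw [h1]; simp [Matrix.one_apply]
  rw [Matrix.mul_apply, ← key (fun l => pderiv m (fun z => gm z i l) y
    + pderiv i (fun z => gm z m l) y - pderiv l (fun z => gm z m i) y), mul_sum]
  refine sum_congr rfl fun k _ => ?_
  simp only [gam, Matrix.of_apply, christoffel]; ring

/-- Metric compatibility: in the symmetrisation of Koszul's formula the last two terms cancel. -/
lemma pdMat_metric (hy : y ∈ U) (m : Fin 8) :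
    pdMat m gm y = gam gm m y * gm y + gm y * (gam gm m y)ᵀ := by
  have h1 : gm y * (gam gm m y)ᵀ = (gam gm m y * gm y)ᵀ := by
    rw [Matrix.transpose_mul, h.symm y hy]
  ext i j
  rw [h1, Matrix.add_apply, Matrix.transpose_apply, h.gam_mul hy, h.gam_mul hy, pdMat,
    Matrix.of_apply, h.pderiv_symm hy m j i]
  ring

/-- The Levi-Civita connection is the only symmetric metric connection. -/
lemma eq_gam (hy : y ∈ U) {G : Fin 8 → Mat} (hs : ∀ m i k, G m i k = G i m k)
    (hG : ∀ m, pdMat m gm y = G m * gm y + gm y * (G m)ᵀ) (m : Fin 8) : G m = gam gm m y := by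
  have hs' : ∀ m i j, (G m * gm y) i j = (G i * gm y) m j := fun m i j => by
    simp only [Matrix.mul_apply, hs m i]
  have hG' : ∀ m i j, pderiv m (fun z => gm z i j) y
      = (G m * gm y) i j + (G m * gm y) j i := fun m i j => by
    have h1 : gm y * (G m)ᵀ = (G m * gm y)ᵀ := by rw [Matrix.transpose_mul, h.symm y hy]
    have := congrFun (congrFun (hG m) i) j
    rw [h1] at this
    exact this
  have h2 : G m * gm y = gam gm m y * gm y := by
    ext i j
    rw [h.gam_mul hy, hG', hG', hG', hs' i m j, hs' m j i, hs' j i m]; ring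
  calc G m = G m * gm y * (gm y)⁻¹ := by
        rw [Matrix.mul_assoc, Matrix.mul_nonsing_inv _ (h.isUnit_det hy), Matrix.mul_one]
    _ = _ := by rw [h2, Matrix.mul_assoc, Matrix.mul_nonsing_inv _ (h.isUnit_det hy),
                  Matrix.mul_one]

lemma pdMat_inv (hy : y ∈ U) (m : Fin 8) : pdMat m (fun z => (gm z)⁻¹) y
    = -((gm y)⁻¹ * gam gm m y + (gam gm m y)ᵀ * (gm y)⁻¹) := by
  have hd := (h.smooth.matDiff h.isOpen hy).matDeriv m
  have hu : IsUnit (gm (y + (0 : ℝ) • stdVec m)).det := by simpa using h.isUnit_det hy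
  have h1 := hd.inv hu
  rw [pdMat_eq (h.smooth_inv.matDiff h.isOpen hy) h1]
  simp only [zero_smul, add_zero]
  rw [h.pdMat_metric hy, mul_add, add_mul]
  congr 2
  · rw [Matrix.mul_assoc, Matrix.mul_assoc, Matrix.mul_nonsing_inv _ (h.isUnit_det hy),
      Matrix.mul_one]
  · rw [← Matrix.mul_assoc (gm y)⁻¹, Matrix.nonsing_inv_mul _ (h.isUnit_det hy), Matrix.one_mul]

lemma det_pos (hy : y ∈ U) : 0 < (gm y).det := by
  obtain ⟨P, hP⟩ := h.frame y hy
  have h1 := congrArg Matrix.det hP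
  rw [Matrix.det_mul, Matrix.det_mul, Matrix.det_transpose, Matrix.det_one] at h1
  have h2 : 0 < P.det ^ 2 := by
    refine lt_of_le_of_ne (sq_nonneg _) (Ne.symm fun h0 => ?_)
    rw [pow_eq_zero_iff (by norm_num)] at h0
    simp [h0] at h1
  nlinarith

lemma contDiffOn_sqrt_det : ContDiffOn ℝ ∞ (fun z => √(gm z).det) U :=
  h.smooth.det.sqrt fun _ hz => (h.det_pos hz).ne'

lemma pderiv_sqrt_det (hy : y ∈ U) (m : Fin 8) :
    pderiv m (fun z => √(gm z).det) y = √(gm y).det * (gam gm m y).trace := by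
  have hd := (h.smooth.matDiff h.isOpen hy).matDeriv m
  have hu : IsUnit (gm (y + (0 : ℝ) • stdVec m)).det := by simpa using h.isUnit_det hy
  have h1 := (hd.det hu)
  have hp : (gm (y + (0 : ℝ) • stdVec m)).det ≠ 0 := hu.ne_zero
  have h2 := h1.sqrt hp
  refine (pderiv_eq_of_hasDerivAt ((h.contDiffOn_sqrt_det.contDiffAt
    (h.isOpen.mem_nhds hy)).differentiableAt (by simp)) h2).trans ?_
  simp only [zero_smul, add_zero]
  have e : ((gm y)⁻¹ * pdMat m gm y).trace = 2 * (gam gm m y).trace := by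
    rw [h.pdMat_metric hy, mul_add, Matrix.trace_add, Matrix.trace_mul_comm, Matrix.mul_assoc,
      Matrix.mul_nonsing_inv _ (h.isUnit_det hy), Matrix.mul_one, ← Matrix.mul_assoc,
      Matrix.nonsing_inv_mul _ (h.isUnit_det hy), Matrix.one_mul, Matrix.trace_transpose]
    ring
  rw [e]
  have hs := Real.mul_self_sqrt (h.det_pos hy).le
  have hs0 : √(gm y).det ≠ 0 := (Real.sqrt_pos.2 (h.det_pos hy)).ne'
  field_simp
  rw [pow_two, hs, mul_comm]

/-- The divergence of the densitised inverse metric. -/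
lemma sum_pderiv_sqrt_det_inv (hy : y ∈ U) (n : Fin 8) :
    ∑ m, pderiv m (fun z => √(gm z).det * (gm z)⁻¹ m n) y
      = -(√(gm y).det * ∑ m, ∑ l, (gm y)⁻¹ m l * gam gm m y l n) := by
  have hd : DifferentiableAt ℝ (fun z => √(gm z).det) y := (h.contDiffOn_sqrt_det.contDiffAt
    (h.isOpen.mem_nhds hy)).differentiableAt (by simp)
  have hi := h.smooth_inv.matDiff h.isOpen hy
  have e1 : ∀ m, pderiv m (fun z => √(gm z).det * (gm z)⁻¹ m n) y
      = √(gm y).det * (gam gm m y).trace * (gm y)⁻¹ m n - √(gm y).det *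
        ((∑ l, (gm y)⁻¹ m l * gam gm m y l n) + ∑ l, gam gm m y l m * (gm y)⁻¹ l n) := by
    intro m
    rw [pderiv_mul hd (hi m n), h.pderiv_sqrt_det hy]
    have := congrFun (congrFun (h.pdMat_inv hy m) m) n
    simp only [pdMat, Matrix.of_apply, Matrix.neg_apply, Matrix.add_apply, Matrix.mul_apply,
      Matrix.transpose_apply] at this
    rw [this]; ring
  have e2 : ∑ m, ∑ l, gam gm m y l m * (gm y)⁻¹ l n
      = ∑ m, (gam gm m y).trace * (gm y)⁻¹ m n := by
    rw [sum_comm]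
    refine sum_congr rfl fun l _ => ?_
    rw [Matrix.trace, sum_mul]
    exact sum_congr rfl fun m _ => by rw [h.gam_comm hy m l m]; rfl
  simp only [e1, sum_sub_distrib, ← mul_sum, sum_add_distrib, e2, mul_assoc]
  ring

end ChartMetric

end QKFlow

end

noncomputable section

namespace QKFlow

open Matrix Finset

/-! ### Identities for the torsion in a chart -/

lemma two_le_infty : (2 : WithTop ℕ∞) ≤ ∞ := WithTop.coe_le_coe.2 (le_top : (2 : ℕ∞) ≤ ⊤)

/-- The Leibniz rule; the connection terms match because `act` is a representation (`act_act_sub`).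
-/
lemma cov4_act {gm : E8 → Mat} {a : E8 → Mat} {W : E8 → Comp4} {y : E8} (ha : MatDiff a y)
    (hW : CompDiff W y) (m : Fin 8) : cov4 gm (fun z => act (a z) (W z)) y m
      = act (covMat gm m a y) (W y) + act (a y) (cov4 gm W y m) := by
  rw [cov4_eq, cov4_eq, pdComp_act ha hW, covMat, act_sub_left, ← act_act_sub, act_sub_right]
  abel

/-- The commutators with the connection matrix cancel by invariance of the trace form, for any
connection. -/
lemma pderiv_br {gm : E8 → Mat} {a b : E8 → Mat} {y : E8} (ha : MatDiff a y) (hb : MatDiff b y)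
    (m : Fin 8) : pderiv m (fun z => br (a z) (b z)) y
      = br (covMat gm m a y) (b y) + br (a y) (covMat gm m b y) := by
  have h1 : pderiv m (fun z => br (a z) (b z)) y
      = br (pdMat m a y) (b y) + br (a y) (pdMat m b y) := by
    unfold br
    rw [pderiv_const_mul (ha.mul hb).trace, pderiv_trace (ha.mul hb), pdMat_mul ha hb,
      Matrix.trace_add]
    ring
  have h2 := br_commutator_add (gam gm m y) (a y) (b y)
  have h3 : br (covMat gm m a y) (b y) = br (pdMat m a y) (b y)
      - br (gam gm m y * a y - a y * gam gm m y) (b y) := by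
    rw [covMat, br_comm, br_sub_right, br_comm, br_comm (b y)]
  rw [h1, h3, covMat, br_sub_right]
  linarith

lemma MatSmooth.covMat {U : Set E8} {gm : E8 → Mat} (h : ChartMetric U gm) {a : E8 → Mat}
    (ha : MatSmooth U a) (m : Fin 8) : MatSmooth U (covMat gm m a) :=
  (ha.pdMat h.isOpen m).sub (((h.smooth_gam m).mul ha).sub (ha.mul (h.smooth_gam m)))

namespace ChartMetric

variable {U : Set E8} {gm : E8 → Mat} (h : ChartMetric U gm) {y : E8}

include h

/-- The Ricci identity. Second partial derivatives and mixed first-order terms are symmetric in `m,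
n`; what survives is the action of the curvature. Christoffel terms in the form index `n` are left
out on both sides, which is harmless since they are symmetric in `m, n`. -/
lemma cov4_comm {W : E8 → Comp4} (hW : CompSmooth U W) (hy : y ∈ U) (m n : Fin 8) :
    cov4 gm (fun z => cov4 gm W z n) y m - cov4 gm (fun z => cov4 gm W z m) y n
      = -act (curv gm m n y) (W y) := by
  have key : ∀ m n, cov4 gm (fun z => cov4 gm W z n) y m = pdComp m (pdComp n W) y
      - act (pdMat m (gam gm n) y) (W y) - act (gam gm n y) (pdComp m W y)
      - act (gam gm m y) (pdComp n W y) + act (gam gm m y) (act (gam gm n y) (W y)) := by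
    intro m n
    have d1 := (hW.pdComp h.isOpen n).compDiff h.isOpen hy
    have d2 := (CompSmooth.act (h.smooth_gam n) hW).compDiff h.isOpen hy
    have e : pdComp m (fun z => cov4 gm W z n) y = pdComp m (pdComp n W) y
        - (act (pdMat m (gam gm n) y) (W y) + act (gam gm n y) (pdComp m W y)) := by
      rw [← pdComp_act ((h.smooth_gam n).matDiff h.isOpen hy) (hW.compDiff h.isOpen hy)]
      ext I
      exact pderiv_sub (d1 I) (d2 I) m
    rw [cov4_eq, e, cov4_eq, act_sub_right]
    abel
  have hsymm : pdComp m (pdComp n W) y = pdComp n (pdComp m W) y := by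
    ext I
    exact pderiv_comm (((hW I).contDiffAt (h.isOpen.mem_nhds hy)).of_le
      two_le_infty) m n
  rw [key m n, key n m, hsymm, curv, act_sub_left, act_sub_left, ← act_act_sub]
  abel

/-- The first Bianchi-type identity for the torsion. -/
lemma bianchi {W : E8 → Comp4} {a : Fin 8 → E8 → Mat} (hW : CompSmooth U W)
    (ha : ∀ m, MatSmooth U (a m)) (hT : ∀ z ∈ U, ∀ m, cov4 gm W z m = act (a m z) (W z))
    (hy : y ∈ U) (m n : Fin 8) :
    act (covMat gm m (a n) y - covMat gm n (a m) y - (a m y * a n y - a n y * a m y)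
      + curv gm m n y) (W y) = 0 := by
  -- Differentiate `∇ₙW = aₙ · W` once more. The antisymmetric part is compared with the Ricci
  -- identity below.
  have key : ∀ m n, cov4 gm (fun z => cov4 gm W z n) y m
      = act (covMat gm m (a n) y) (W y) + act (a n y) (act (a m y) (W y)) := by
    intro m n
    rw [← hT y hy m, ← cov4_act ((ha n).matDiff h.isOpen hy) (hW.compDiff h.isOpen hy)]
    exact congrArg₂ (fun A B => A - act (gam gm m y) B)
      (pdComp_congr h.isOpen (fun z hz => hT z hz n) hy m) (hT y hy n)
  have h1 := h.cov4_comm hW hy m n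
  rw [key m n, key n m] at h1
  rw [act_add_left, act_sub_left, act_sub_left, ← act_act_sub, ← neg_eq_iff_eq_neg.2 h1]
  abel

/-- Second partial derivatives of the metric commute. Expressing both orders through metric
compatibility leaves exactly `F g + g Fᵀ = 0`. -/
lemma curv_skew (hy : y ∈ U) (m n : Fin 8) :
    (curv gm m n y * gm y)ᵀ = -(curv gm m n y * gm y) := by
  have hg := h.smooth.matDiff h.isOpen hy
  have hγ : ∀ m, MatDiff (gam gm m) y := fun m => (h.smooth_gam m).matDiff h.isOpen hy
  have key : ∀ m n, pdMat m (pdMat n gm) y = pdMat m (gam gm n) y * gm y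
      + gm y * (pdMat m (gam gm n) y)ᵀ + gam gm n y * gam gm m y * gm y
      + gm y * (gam gm n y * gam gm m y)ᵀ + gam gm n y * gm y * (gam gm m y)ᵀ
      + gam gm m y * gm y * (gam gm n y)ᵀ := by
    intro m n
    rw [pdMat_congr h.isOpen (fun z hz => h.pdMat_metric hz n) hy]
    have e : pdMat m (fun z => gam gm n z * gm z + gm z * (gam gm n z)ᵀ) y
        = pdMat m (fun z => gam gm n z * gm z) y + pdMat m (fun z => gm z * (gam gm n z)ᵀ) y := by
      ext i j
      exact pderiv_add (((hγ n).mul hg) i j) ((hg.mul (hγ n).transpose) i j) m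
    rw [e, pdMat_mul (hγ n) hg, pdMat_mul hg (hγ n).transpose, pdMat_transpose, h.pdMat_metric hy,
      Matrix.transpose_mul]
    simp only [mul_add, add_mul, Matrix.mul_assoc]
    abel
  have hsymm : pdMat m (pdMat n gm) y = pdMat n (pdMat m gm) y := by
    ext i j
    exact pderiv_comm (((h.smooth i j).contDiffAt (h.isOpen.mem_nhds hy)).of_le
      two_le_infty) m n
  rw [key m n, key n m] at hsymm
  have h1 : curv gm m n y * gm y + gm y * (curv gm m n y)ᵀ = 0 := by
    simp only [curv, Matrix.transpose_sub, sub_mul, mul_sub]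
    rw [← sub_eq_zero] at hsymm
    rw [← hsymm]
    abel
  rw [Matrix.transpose_mul, h.symm y hy]
  exact eq_neg_of_add_eq_zero_right h1

/-- The covariant derivative of a field of skew endomorphisms is skew. -/
lemma covMat_eq_skew {α : E8 → Mat} (hα : MatSmooth U α) (hs : ∀ z ∈ U, (α z)ᵀ = -α z) (hy : y ∈ U)
    (m : Fin 8) : ∃ β : Mat, βᵀ = -β ∧ covMat gm m (fun z => α z * (gm z)⁻¹) y = β * (gm y)⁻¹ := by
  refine ⟨pdMat m α y - gam gm m y * α y - α y * (gam gm m y)ᵀ, ?_, ?_⟩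
  · have h1 : (pdMat m α y)ᵀ = -pdMat m α y := by
      rw [← pdMat_transpose, pdMat_congr h.isOpen hs hy]
      ext i j
      simp only [pdMat, Matrix.of_apply, Matrix.neg_apply]
      simp [pderiv]
    simp only [Matrix.transpose_sub, Matrix.transpose_mul, Matrix.transpose_transpose, h1, hs y hy]
    simp only [Matrix.neg_mul, Matrix.mul_neg]
    abel
  · rw [covMat, pdMat_mul (hα.matDiff h.isOpen hy) (h.smooth_inv.matDiff h.isOpen hy),
      h.pdMat_inv hy]
    simp only [sub_mul, mul_add, mul_neg, Matrix.mul_assoc]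
    abel

/-- The divergence of an endomorphism valued `1`-form. -/
lemma divT_mul_inv {T : E8 → Fin 8 → Mat} (hT : ∀ n, MatSmooth U (fun z => T z n)) (hy : y ∈ U) :
    divT gm T y * (gm y)⁻¹ = ∑ m, ∑ n, (gm y)⁻¹ m n • (covMat gm m (fun z => T z n * (gm z)⁻¹) y
      - ∑ k, gam gm m y n k • (T y k * (gm y)⁻¹)) := by
  have h1 : ∀ m n, covMat gm m (fun z => T z n * (gm z)⁻¹) y
      = (pdMat m (fun z => T z n) y - gam gm m y * T y n - T y n * (gam gm m y)ᵀ) * (gm y)⁻¹ := by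
    intro m n
    rw [covMat, pdMat_mul ((hT n).matDiff h.isOpen hy) (h.smooth_inv.matDiff h.isOpen hy),
      h.pdMat_inv hy]
    simp only [sub_mul, mul_add, mul_neg, Matrix.mul_assoc]
    abel
  have h2 : divT gm T y = ∑ m, ∑ n, (gm y)⁻¹ m n • (pdMat m (fun z => T z n) y
      - gam gm m y * T y n - T y n * (gam gm m y)ᵀ - ∑ k, gam gm m y n k • T y k) := by
    ext i j
    simp only [divT, Matrix.of_apply, Matrix.sum_apply, Matrix.smul_apply, Matrix.sub_apply,
      smul_eq_mul]
    refine sum_congr rfl fun m _ => sum_congr rfl fun n _ => ?_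
    simp only [cov12, pdMat, Matrix.of_apply, sum_add_distrib, Matrix.mul_apply,
      Matrix.transpose_apply, gam]
    have : ∑ k, T y n i k * christoffel gm y k m j = ∑ k, christoffel gm y k m j * T y n i k :=
      sum_congr rfl fun k _ => mul_comm _ _
    rw [this]
    ring
  rw [h2, sum_mul]
  refine sum_congr rfl fun m _ => ?_
  rw [sum_mul]
  refine sum_congr rfl fun n _ => ?_
  rw [h1, Matrix.smul_mul, sub_mul _ (∑ k, _), sum_mul]
  congr 2
  exact sum_congr rfl fun k _ => by rw [Matrix.smul_mul]

lemma divT_skew {T : E8 → Fin 8 → Mat} (hs : ∀ z ∈ U, ∀ n, (T z n)ᵀ = -T z n) (hy : y ∈ U) :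
    (divT gm T y)ᵀ = -divT gm T y := by
  have hs' : ∀ z ∈ U, ∀ n i j, T z n j i = -T z n i j := fun z hz n i j =>
    congrFun (congrFun (hs z hz n) i) j
  ext i j
  simp only [divT, Matrix.transpose_apply, Matrix.of_apply, Matrix.neg_apply]
  simp only [← sum_neg_distrib]
  refine sum_congr rfl fun m _ => sum_congr rfl fun n _ => ?_
  have h1 : pderiv m (fun z => T z n j i) y = -pderiv m (fun z => T z n i j) y := by
    rw [pderiv_congr h.isOpen (fun z hz => hs' z hz n i j) hy]
    simp [pderiv]
  rw [cov12, cov12, h1, ← mul_neg]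
  congr 1
  rw [neg_sub, sub_eq_add_neg, ← sum_neg_distrib, sub_eq_add_neg, add_comm]
  congr 1
  refine sum_congr rfl fun k _ => ?_
  rw [hs' y hy k i j, hs' y hy n i k, hs' y hy n k j]
  ring

/-- The divergence theorem identity for `⟨a_n, b⟩`. -/
lemma sum_pderiv_br {T : E8 → Fin 8 → Mat} (hT : ∀ n, MatSmooth U (fun z => T z n))
    {b : E8 → Mat} (hb : MatSmooth U b) (hy : y ∈ U) :
    ∑ m, pderiv m (fun z => ∑ n, √(gm z).det * (gm z)⁻¹ m n * br (T z n * (gm z)⁻¹) (b z)) y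
      = √(gm y).det * (br (divT gm T y * (gm y)⁻¹) (b y)
        + ∑ m, ∑ n, (gm y)⁻¹ m n * br (T y n * (gm y)⁻¹) (covMat gm m b y)) := by
  have ha : ∀ n, MatSmooth U (fun z => T z n * (gm z)⁻¹) := fun n => (hT n).mul h.smooth_inv
  have dsg : ∀ m n, DifferentiableAt ℝ (fun z => √(gm z).det * (gm z)⁻¹ m n) y := fun m n =>
    ((h.contDiffOn_sqrt_det.mul (h.smooth_inv m n)).contDiffAt
      (h.isOpen.mem_nhds hy)).differentiableAt (by simp)
  have dbr : ∀ n, DifferentiableAt ℝ (fun z => br (T z n * (gm z)⁻¹) (b z)) y := fun n =>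
    (((ha n).br hb).contDiffAt (h.isOpen.mem_nhds hy)).differentiableAt (by simp)
  have e1 : ∀ m, pderiv m (fun z => ∑ n, √(gm z).det * (gm z)⁻¹ m n
      * br (T z n * (gm z)⁻¹) (b z)) y
      = ∑ n, (pderiv m (fun z => √(gm z).det * (gm z)⁻¹ m n) y * br (T y n * (gm y)⁻¹) (b y)
        + √(gm y).det * (gm y)⁻¹ m n * (br (covMat gm m (fun z => T z n * (gm z)⁻¹) y) (b y)
          + br (T y n * (gm y)⁻¹) (covMat gm m b y))) := by
    intro m
    rw [pderiv_sum (fun n _ => (dsg m n).fun_mul (dbr n))]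
    refine sum_congr rfl fun n _ => ?_
    rw [pderiv_mul (dsg m n) (dbr n), pderiv_br (gm := gm) ((ha n).matDiff h.isOpen hy)
      (hb.matDiff h.isOpen hy)]
  simp only [e1, sum_add_distrib]
  rw [sum_comm]
  simp only [← sum_mul, h.sum_pderiv_sqrt_det_inv hy]
  rw [h.divT_mul_inv hT hy]
  simp only [br_sum_left, br_smul_left, sub_eq_add_neg, br_add_left]
  have e2 : ∀ (c : Mat) (d : Mat), br (-c) d = -br c d := fun c d => by simp [br]
  simp only [e2, br_sum_left, br_smul_left, mul_add, sum_add_distrib, mul_neg, sum_neg_distrib,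
    neg_mul]
  have e3 : ∑ n, √(gm y).det * (∑ m, ∑ l, (gm y)⁻¹ m l * gam gm m y l n)
        * br (T y n * (gm y)⁻¹) (b y)
      = √(gm y).det * ∑ m, ∑ n, (gm y)⁻¹ m n
        * ∑ k, gam gm m y n k * br (T y k * (gm y)⁻¹) (b y) := by
    simp only [mul_sum, sum_mul]
    rw [sum_comm]
    refine sum_congr rfl fun m _ => ?_
    rw [sum_comm]
    exact sum_congr rfl fun l _ => sum_congr rfl fun n _ => by ring
  rw [e3]
  simp only [mul_sum, mul_assoc]
  ring

/-! ### The torsion of a chart representation -/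

/-- Along each coordinate line the `4`-form stays in the orbit of the standard form, so its
covariant derivative is in the image of `⋄` and the choice in `diamondInv` is not the default value.
By uniqueness in `Λ²₁₅` it agrees with the polynomial formula, which supplies smoothness. -/
lemma torsion_spec {W : E8 → Comp4} (hW : CompSmooth U W)
    (hstd : ∀ z ∈ U, ∃ P, IsStdFrame (gm z) (W z) P) (hy : y ∈ U) (m : Fin 8) :
    IsLambda15 (gm y)⁻¹ (W y) (torsion gm W y m) ∧
      act (torsion gm W y m * (gm y)⁻¹) (W y) = cov4 gm W y m ∧
      torsion gm W y m = diamondPinv (gm y) (gm y)⁻¹ (W y) (cov4 gm W y m) := by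
  obtain ⟨P, hP⟩ := hstd y hy
  have hex : ∃ β : Mat, βᵀ = -β ∧ diamond (gm y)⁻¹ β (W y) = cov4 gm W y m := by
    have hev : ∀ᶠ r : ℝ in nhds 0, ∃ P, IsStdFrame (gm (y + r • stdVec m))
        (W (y + r • stdVec m)) P := by
      have hc : ContinuousAt (fun r : ℝ => y + r • stdVec m) 0 :=
        (hasDerivAt_line y (stdVec m) 0).continuousAt
      have : ∀ᶠ r : ℝ in nhds 0, y + r • stdVec m ∈ U :=
        hc.eventually_mem (by simpa using h.isOpen.mem_nhds hy)
      exact this.mono fun r hr => hstd _ hr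
    have := exists_diamond_eq ((h.smooth.matDiff h.isOpen hy).matDeriv m) (γ := gam gm m y)
      (by simpa using h.pdMat_metric hy m) ((hW.compDiff h.isOpen hy).compDeriv m) hev
    simpa [cov4_eq] using this
  obtain ⟨β, hβ, hβW⟩ := hex
  have h1 := diamondPinv_spec hP hβ
  rw [hβW] at h1
  have h2 := diamondInv_spec ⟨_, h1⟩
  have h3 : torsion gm W y m = diamondPinv (gm y) (gm y)⁻¹ (W y) (cov4 gm W y m) :=
    h2.1.eq_of_diamond_eq (inv_eq_of_frame hP.1) hP.isUnit_det h1.1 (h2.2.trans h1.2.symm)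
  refine ⟨h2.1, ?_, h3⟩
  rw [← diamond_eq_act]
  exact h2.2

end ChartMetric

lemma normSq12_eq {gi : Mat} (hgi : giᵀ = gi) {T : Fin 8 → Mat} (hT : ∀ m, (T m)ᵀ = -T m) :
    normSq12 gi T = ∑ m, ∑ n, gi m n * br (T m * gi) (T n * gi) := by
  unfold normSq12
  exact sum_congr rfl fun m _ => sum_congr rfl fun n _ => by rw [inner2_eq_br (hT n) hgi]

end QKFlow

end

noncomputable section

namespace QKFlow

open Matrix Finset

/-! ### Functions of time and position -/

section SpaceTime

variable {S : Set ℝ} {U : Set E8} {F : ℝ → E8 → ℝ}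

lemma contDiffOn_slice (hF : ContDiffOn ℝ ∞ (fun q : ℝ × E8 => F q.1 q.2) (S ×ˢ U)) {t : ℝ}
    (ht : t ∈ S) : ContDiffOn ℝ ∞ (F t) U :=
  hF.comp (f := fun y : E8 => (t, y)) (contDiffOn_const.prodMk contDiffOn_id)
    fun _ hy => ⟨ht, hy⟩

/-- The time set will be the half-open `[0, t₀)`, hence the derivative within the product: joint
smoothness of spatial derivatives then holds up to and including `t = 0`. -/
lemma pderiv_slice_eq (hU : IsOpen U)
    (hF : ContDiffOn ℝ ∞ (fun q : ℝ × E8 => F q.1 q.2) (S ×ˢ U)) (i : Fin 8) {q : ℝ × E8}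
    (hq : q ∈ S ×ˢ U) : pderiv i (F q.1) q.2
      = fderivWithin ℝ (fun q : ℝ × E8 => F q.1 q.2) (S ×ˢ U) q (0, stdVec i) := by
  have hd := (hF.differentiableOn (by simp) q hq).hasFDerivWithinAt
  have h1 : HasFDerivWithinAt (fun y : E8 => (q.1, y)) (ContinuousLinearMap.inr ℝ ℝ E8) U q.2 :=
    (hasFDerivAt_prodMk_right q.1 q.2).hasFDerivWithinAt
  have hmaps : Set.MapsTo (fun y : E8 => (q.1, y)) U (S ×ˢ U) := fun _ hy => ⟨hq.1, hy⟩
  have h2 := (HasFDerivWithinAt.comp (g := fun q : ℝ × E8 => F q.1 q.2) q.2 hd h1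
    hmaps).hasFDerivAt (hU.mem_nhds hq.2)
  have h3 : fderiv ℝ (F q.1) q.2 = _ := h2.fderiv
  rw [pderiv, h3]
  simp

lemma contDiffOn_pderiv_prod (hS : UniqueDiffOn ℝ S) (hU : IsOpen U)
    (hF : ContDiffOn ℝ ∞ (fun q : ℝ × E8 => F q.1 q.2) (S ×ˢ U)) (i : Fin 8) :
    ContDiffOn ℝ ∞ (fun q : ℝ × E8 => pderiv i (F q.1) q.2) (S ×ˢ U) := by
  have h := (hF.fderivWithin (hS.prod hU.uniqueDiffOn) (m := ∞) (by simp)).clm_apply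
    (contDiffOn_const (c := ((0, stdVec i) : ℝ × E8)))
  exact h.congr fun q hq => pderiv_slice_eq hU hF i hq

lemma fderiv_fderiv_comm {E : Type*} [NormedAddCommGroup E] [NormedSpace ℝ E] {f : E → ℝ} {x : E}
    (h : ContDiffAt ℝ 2 f x) (v w : E) :
    fderiv ℝ (fun q => fderiv ℝ f q v) x w = fderiv ℝ (fun q => fderiv ℝ f q w) x v := by
  have hd : DifferentiableAt ℝ (fderiv ℝ f) x :=
    (h.fderiv_right (m := 1) (by norm_num)).differentiableAt (by simp)
  have key : ∀ v w, fderiv ℝ (fun q => fderiv ℝ f q v) x w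
      = fderiv ℝ (fderiv ℝ f) x w v := by
    intro v w
    rw [fderiv_clm_apply hd (differentiableAt_const _)]
    simp
  rw [key, key]
  exact (h.isSymmSndFDerivAt (by simp)).eq _ _

/-- Time derivatives and partial derivatives commute. -/
lemma hasDerivAt_pderiv_time {T : Set ℝ} (hT : IsOpen T) (hU : IsOpen U)
    (hF : ContDiffOn ℝ ∞ (fun q : ℝ × E8 => F q.1 q.2) (T ×ˢ U)) {t : ℝ} (ht : t ∈ T) {y : E8}
    (hy : y ∈ U) {G : E8 → ℝ} (hG : ∀ z ∈ U, HasDerivAt (fun s => F s z) (G z) t) (i : Fin 8) :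
    HasDerivAt (fun s => pderiv i (F s) y) (pderiv i G y) t := by
  set f : ℝ × E8 → ℝ := fun q => F q.1 q.2 with hf
  have hTU : IsOpen (T ×ˢ U) := hT.prod hU
  have hfd : ∀ q ∈ T ×ˢ U, ContDiffAt ℝ ∞ f q := fun q hq => hF.contDiffAt (hTU.mem_nhds hq)
  have hq : (t, y) ∈ T ×ˢ U := ⟨ht, hy⟩
  have hd1 : ∀ v : ℝ × E8, DifferentiableAt ℝ (fun q => fderiv ℝ f q v) (t, y) := fun v =>
    ((((hfd _ hq).of_le two_le_infty).fderiv_right (m := 1) (by norm_num)).differentiableAt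
      (by simp)).clm_apply (differentiableAt_const _)
  have hsl : ∀ s ∈ T, pderiv i (F s) y = fderiv ℝ f (s, y) (0, stdVec i) := fun s hs => by
    rw [pderiv_slice_eq hU hF i (q := (s, y)) ⟨hs, hy⟩,
      fderivWithin_of_isOpen hTU ⟨hs, hy⟩]
  have h1 : HasDerivAt (fun s : ℝ => (s, y)) ((1, 0) : ℝ × E8) t :=
    (hasDerivAt_id t).prodMk (hasDerivAt_const t y)
  have h2 : HasDerivAt (fun s => fderiv ℝ f (s, y) (0, stdVec i))
      (fderiv ℝ (fun q => fderiv ℝ f q (0, stdVec i)) (t, y) (1, 0)) t :=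
    HasFDerivAt.comp_hasDerivAt (l := fun q => fderiv ℝ f q (0, stdVec i)) t
      (hd1 (0, stdVec i)).hasFDerivAt h1
  have h3 : pderiv i G y = fderiv ℝ (fun q => fderiv ℝ f q (1, 0)) (t, y) (0, stdVec i) := by
    have e1 : ∀ z ∈ U, G z = fderiv ℝ f (t, z) (1, 0) := fun z hz => by
      have h4 : HasDerivAt (fun s : ℝ => (s, z)) ((1, 0) : ℝ × E8) t :=
        (hasDerivAt_id t).prodMk (hasDerivAt_const t z)
      exact (hG z hz).unique (HasFDerivAt.comp_hasDerivAt (l := f) t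
        ((hfd (t, z) ⟨ht, hz⟩).differentiableAt (by simp)).hasFDerivAt h4)
    rw [pderiv_congr hU e1 hy]
    have h5 : HasFDerivAt (fun z : E8 => (t, z)) (ContinuousLinearMap.inr ℝ ℝ E8) y :=
      hasFDerivAt_prodMk_right t y
    have h6 := HasFDerivAt.comp y (hd1 (1, 0)).hasFDerivAt h5
    rw [pderiv]
    have h7 := h6.fderiv
    simp only [Function.comp_def] at h7
    rw [h7]
    simp
  rw [h3, ← fderiv_fderiv_comm ((hfd _ hq).of_le two_le_infty)]
  exact h2.congr_of_eventuallyEq (Filter.eventuallyEq_of_mem (hT.mem_nhds ht) hsl)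

end SpaceTime

/-! ### The flow in a chart -/

/-- `[b, ·]` is skew for the trace form, whereas the contraction with `gi` is symmetric. This
removes the terms quadratic in the torsion both from the Bianchi identity and from the evolution of
the density. -/
lemma sum_br_commutator {gi : Mat} (hgi : giᵀ = gi) (a : Fin 8 → Mat) (b : Mat) :
    ∑ m, ∑ n, gi m n * br (a m) (b * a n - a n * b) = 0 := by
  have h1 : ∑ m, ∑ n, gi m n * (a m * (b * a n)).trace
      = ∑ m, ∑ n, gi m n * (a m * (a n * b)).trace := by
    rw [sum_comm]
    refine sum_congr rfl fun n _ => sum_congr rfl fun m _ => ?_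
    have e1 : gi m n = gi n m := by
      conv_lhs => rw [← hgi]
      rfl
    have e2 : (a m * (b * a n)).trace = (a n * (a m * b)).trace := by
      rw [← Matrix.mul_assoc, Matrix.trace_mul_comm]
    rw [e1, e2]
  have h2 : ∀ m n, gi m n * br (a m) (b * a n - a n * b) = -(1 / 2)
      * (gi m n * (a m * (b * a n)).trace - gi m n * (a m * (a n * b)).trace) := fun m n => by
    rw [br, mul_sub, Matrix.trace_sub]; ring
  simp only [h2, ← mul_sum, sum_sub_distrib, h1, sub_self, mul_zero]

/-- The flow of `Sp(2)Sp(1)`-structures in a chart with metric coefficients `gm`. -/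
structure ChartFlow (U : Set E8) (gm : E8 → Mat) (t₀ : ℝ) (W : ℝ → E8 → Comp4) : Prop where
  metric : ChartMetric U gm
  smooth : CompSmooth (Set.Ico 0 t₀ ×ˢ U) (fun q : ℝ × E8 => W q.1 q.2)
  std : ∀ t ∈ Set.Ico 0 t₀, ∀ y ∈ U, ∃ P, IsStdFrame (gm y) (W t y) P
  evol : ∀ t ∈ Set.Ioo 0 t₀, ∀ y ∈ U, CompDeriv (fun s => W s y)
    (diamond (gm y)⁻¹ (divT gm (torsion gm (W t)) y) (W t y)) t

/-- The torsion of the flow as a field of endomorphisms. -/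
def torEnd (gm : E8 → Mat) (W : ℝ → E8 → Comp4) (t : ℝ) (m : Fin 8) (y : E8) : Mat :=
  torsion gm (W t) y m * (gm y)⁻¹

/-- The divergence of the torsion of the flow as a field of endomorphisms. -/
def divEnd (gm : E8 → Mat) (W : ℝ → E8 → Comp4) (t : ℝ) (y : E8) : Mat :=
  divT gm (torsion gm (W t)) y * (gm y)⁻¹

/-- The energy density `|T|²` of the flow. -/
def enDensity (gm : E8 → Mat) (W : ℝ → E8 → Comp4) (t : ℝ) (y : E8) : ℝ :=
  ∑ m, ∑ n, (gm y)⁻¹ m n * br (torEnd gm W t m y) (torEnd gm W t n y)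

lemma uniqueDiffOn_Ico_prod {t₀ : ℝ} : UniqueDiffOn ℝ (Set.Ico 0 t₀) := uniqueDiffOn_Ico 0 t₀

namespace ChartFlow

variable {U : Set E8} {gm : E8 → Mat} {t₀ : ℝ} {W : ℝ → E8 → Comp4} (h : ChartFlow U gm t₀ W)
  {t : ℝ} {y : E8}

include h

lemma slice (ht : t ∈ Set.Ico 0 t₀) : CompSmooth U (W t) := fun I => by
  exact contDiffOn_slice (F := fun t y => W t y I) (h.smooth I) ht

lemma torsion_spec (ht : t ∈ Set.Ico 0 t₀) (hy : y ∈ U) (m : Fin 8) :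
    IsLambda15 (gm y)⁻¹ (W t y) (torsion gm (W t) y m) ∧
      act (torEnd gm W t m y) (W t y) = cov4 gm (W t) y m ∧
      torsion gm (W t) y m = diamondPinv (gm y) (gm y)⁻¹ (W t y) (cov4 gm (W t) y m) :=
  h.metric.torsion_spec (h.slice ht) (h.std t ht) hy m

omit h in
lemma lift_mat {F : E8 → Mat} (hF : MatSmooth U F) :
    MatSmooth (Set.Ico 0 t₀ ×ˢ U) (fun q : ℝ × E8 => F q.2) :=
  hF.comp contDiffOn_snd fun _ hq => hq.2

lemma smooth_torsion (m : Fin 8) :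
    MatSmooth (Set.Ico 0 t₀ ×ˢ U) (fun q : ℝ × E8 => torsion gm (W q.1) q.2 m) := by
  have hcov : CompSmooth (Set.Ico 0 t₀ ×ˢ U) (fun q : ℝ × E8 => cov4 gm (W q.1) q.2 m) := by
    refine CompSmooth.sub (V := fun q : ℝ × E8 => pdComp m (W q.1) q.2) (fun I => ?_)
      (CompSmooth.act (lift_mat (h.metric.smooth_gam m)) h.smooth)
    exact contDiffOn_pderiv_prod (F := fun t y => W t y I) uniqueDiffOn_Ico_prod h.metric.isOpen
      (h.smooth I) m
  refine (MatSmooth.diamondPinv (lift_mat h.metric.smooth) (lift_mat h.metric.smooth_inv)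
    h.smooth hcov).congr fun q hq => ?_
  exact (h.torsion_spec hq.1 hq.2 m).2.2

lemma smooth_torEnd (m : Fin 8) :
    MatSmooth (Set.Ico 0 t₀ ×ˢ U) (fun q : ℝ × E8 => torEnd gm W q.1 m q.2) :=
  (h.smooth_torsion m).mul (lift_mat h.metric.smooth_inv)

lemma smooth_divT :
    MatSmooth (Set.Ico 0 t₀ ×ˢ U) (fun q : ℝ × E8 => divT gm (torsion gm (W q.1)) q.2) := by
  intro i j
  have hγ : ∀ k m n, ContDiffOn ℝ ∞ (fun q : ℝ × E8 => christoffel gm q.2 k m n)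
      (Set.Ico 0 t₀ ×ˢ U) := fun k m n =>
    lift_mat (t₀ := t₀) (h.metric.smooth_gam m) n k
  change ContDiffOn ℝ ∞ (fun q : ℝ × E8 => ∑ m, ∑ n, (gm q.2)⁻¹ m n
    * cov12 gm (torsion gm (W q.1)) q.2 m n i j) _
  refine ContDiffOn.sum fun m _ => ContDiffOn.sum fun n _ => ?_
  refine ContDiffOn.mul (lift_mat h.metric.smooth_inv m n) (ContDiffOn.sub ?_ ?_)
  · exact contDiffOn_pderiv_prod (F := fun t y => torsion gm (W t) y n i j) uniqueDiffOn_Ico_prod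
      h.metric.isOpen (h.smooth_torsion n i j) m
  · refine ContDiffOn.sum fun k _ => ((hγ _ _ _).mul (h.smooth_torsion k i j)).add
      ((hγ _ _ _).mul (h.smooth_torsion n k j)) |>.add ((hγ _ _ _).mul (h.smooth_torsion n i k))

lemma smooth_enDensity :
    ContDiffOn ℝ ∞ (fun q : ℝ × E8 => enDensity gm W q.1 q.2) (Set.Ico 0 t₀ ×ˢ U) :=
  ContDiffOn.sum fun m _ => ContDiffOn.sum fun n _ => ContDiffOn.mul (lift_mat h.metric.smooth_inv m n)
    ((h.smooth_torEnd m).br (h.smooth_torEnd n))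

lemma slice_torsion (ht : t ∈ Set.Ico 0 t₀) (m : Fin 8) :
    MatSmooth U (fun y => torsion gm (W t) y m) := fun i j =>
  contDiffOn_slice (F := fun t y => torsion gm (W t) y m i j) (h.smooth_torsion m i j) ht

lemma slice_torEnd (ht : t ∈ Set.Ico 0 t₀) (m : Fin 8) : MatSmooth U (torEnd gm W t m) :=
  (h.slice_torsion ht m).mul h.metric.smooth_inv

lemma slice_divT (ht : t ∈ Set.Ico 0 t₀) : MatSmooth U (divT gm (torsion gm (W t))) := fun i j =>
  contDiffOn_slice (F := fun t y => divT gm (torsion gm (W t)) y i j) (h.smooth_divT i j) ht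

lemma slice_divEnd (ht : t ∈ Set.Ico 0 t₀) : MatSmooth U (divEnd gm W t) :=
  (h.slice_divT ht).mul h.metric.smooth_inv

lemma torsion_skew (ht : t ∈ Set.Ico 0 t₀) (hy : y ∈ U) (m : Fin 8) :
    (torsion gm (W t) y m)ᵀ = -torsion gm (W t) y m := (h.torsion_spec ht hy m).1.1

lemma divT_skew (ht : t ∈ Set.Ico 0 t₀) (hy : y ∈ U) :
    (divT gm (torsion gm (W t)) y)ᵀ = -divT gm (torsion gm (W t)) y :=
  h.metric.divT_skew (fun _ hz n => h.torsion_skew ht hz n) hy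

lemma normSq12_eq_enDensity (ht : t ∈ Set.Ico 0 t₀) (hy : y ∈ U) :
    normSq12 (gm y)⁻¹ (torsion gm (W t) y) = enDensity gm W t y :=
  normSq12_eq (h.metric.inv_symm hy) fun m => h.torsion_skew ht hy m

/-- `⟨T, X⟩ = 0` for skew `X` in the kernel of the action on the `4`-form. -/
lemma br_torEnd_eq_zero (ht : t ∈ Set.Ico 0 t₀) (hy : y ∈ U) (m : Fin 8) {X β : Mat}
    (hX : X = β * (gm y)⁻¹) (hβ : βᵀ = -β) (hW : act X (W t y) = 0) :
    br (torEnd gm W t m y) X = 0 :=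
  (h.torsion_spec ht hy m).1.br_eq_zero (h.metric.inv_symm hy) hX hβ hW

lemma skew_commutator (hy : y ∈ U) {α β : Mat} (hα : αᵀ = -α) (hβ : βᵀ = -β) :
    ∃ ξ : Mat, ξᵀ = -ξ ∧ α * (gm y)⁻¹ * (β * (gm y)⁻¹) - β * (gm y)⁻¹ * (α * (gm y)⁻¹)
      = ξ * (gm y)⁻¹ := by
  refine ⟨α * (gm y)⁻¹ * β - β * (gm y)⁻¹ * α, ?_, ?_⟩
  · simp only [Matrix.transpose_sub, Matrix.transpose_mul, h.metric.inv_symm hy, hα, hβ]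
    simp only [Matrix.neg_mul, Matrix.mul_neg, neg_neg, Matrix.mul_assoc]
    abel
  · simp only [sub_mul, Matrix.mul_assoc]

/-- The Bianchi identity puts a skew endomorphism into the stabiliser, which `T` does not see; the
commutator `[Tₖ, Tₙ]` in it dies by `sum_br_commutator`. Exchanging the two indices of `∇T`
therefore costs only curvature. -/
lemma br_bianchi (ht : t ∈ Set.Ico 0 t₀) (hy : y ∈ U) (n : Fin 8) :
    ∑ m, ∑ k, (gm y)⁻¹ m k * br (torEnd gm W t m y)
      (covMat gm k (torEnd gm W t n) y - covMat gm n (torEnd gm W t k) y)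
      = -∑ m, ∑ k, (gm y)⁻¹ m k * br (torEnd gm W t m y) (curv gm k n y) := by
  have key : ∀ m k, br (torEnd gm W t m y)
      (covMat gm k (torEnd gm W t n) y - covMat gm n (torEnd gm W t k) y)
      = -br (torEnd gm W t m y) (curv gm k n y) + -br (torEnd gm W t m y)
        (torEnd gm W t n y * torEnd gm W t k y - torEnd gm W t k y * torEnd gm W t n y) := by
    intro m k
    have hb := h.metric.bianchi (h.slice ht) (h.slice_torEnd ht)
      (fun z hz m => (h.torsion_spec ht hz m).2.1.symm) hy k n
    obtain ⟨β₁, hβ₁, e₁⟩ := h.metric.covMat_eq_skew (h.slice_torsion ht n)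
      (fun z hz => h.torsion_skew ht hz n) hy k
    obtain ⟨β₂, hβ₂, e₂⟩ := h.metric.covMat_eq_skew (h.slice_torsion ht k)
      (fun z hz => h.torsion_skew ht hz k) hy n
    obtain ⟨β₃, hβ₃, e₃⟩ := h.skew_commutator hy (h.torsion_skew ht hy k) (h.torsion_skew ht hy n)
    have e₄ : curv gm k n y = curv gm k n y * gm y * (gm y)⁻¹ := by
      rw [Matrix.mul_assoc, Matrix.mul_nonsing_inv _ (h.metric.isUnit_det hy), Matrix.mul_one]
    have h0 := h.br_torEnd_eq_zero ht hy m (β := β₁ - β₂ - β₃ + curv gm k n y * gm y)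
      (X := covMat gm k (torEnd gm W t n) y - covMat gm n (torEnd gm W t k) y
        - (torEnd gm W t k y * torEnd gm W t n y - torEnd gm W t n y * torEnd gm W t k y)
        + curv gm k n y)
      (by rw [add_mul, sub_mul, sub_mul, ← e₁, ← e₂, ← e₃, ← e₄]; rfl)
      (by
        rw [Matrix.transpose_add, Matrix.transpose_sub, Matrix.transpose_sub, hβ₁, hβ₂, hβ₃,
          h.metric.curv_skew hy]
        abel) hb
    simp only [br_add_right, br_sub_right] at h0 ⊢
    linarith
  simp only [key, mul_add, sum_add_distrib, mul_neg, sum_neg_distrib,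
    sum_br_commutator (h.metric.inv_symm hy) (fun k => torEnd gm W t k y), neg_zero, add_zero]

/-- The time derivative of `∇ₙΩ` is computed twice: as `∇ₙ` of `D ⋄ Ω`, and from `∇ₙΩ = Tₙ ⋄ Ω` by
the product rule. Equality after acting on `Ω` determines `∂ₜT` modulo the stabiliser only, hence
the formulation through pairings with `T`. -/
lemma evolution (ht : t ∈ Set.Ioo 0 t₀) (hy : y ∈ U) (n : Fin 8) :
    ∃ A : Mat, MatDeriv (fun s => torEnd gm W s n y) A t ∧ ∀ m, br (torEnd gm W t m y) A
      = br (torEnd gm W t m y) (covMat gm n (divEnd gm W t) y)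
        + br (torEnd gm W t m y) (divEnd gm W t y * torEnd gm W t n y
          - torEnd gm W t n y * divEnd gm W t y) := by
  have ht' : t ∈ Set.Ico 0 t₀ := ⟨ht.1.le, ht.2⟩
  have hsub : Set.Ioo 0 t₀ ×ˢ U ⊆ Set.Ico 0 t₀ ×ˢ U :=
    Set.prod_mono Set.Ioo_subset_Ico_self subset_rfl
  -- the derivative of the torsion
  have hder : ∃ B : Mat, MatDeriv (fun s => torsion gm (W s) y n) B t := by
    have : ∀ i j, DifferentiableAt ℝ (fun s => torsion gm (W s) y n i j) t := fun i j => by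
      have h1 := ((h.smooth_torsion n i j).mono hsub).contDiffAt
        ((isOpen_Ioo.prod h.metric.isOpen).mem_nhds (show (t, y) ∈ Set.Ioo 0 t₀ ×ˢ U from ⟨ht, hy⟩))
      have h2 := h1.differentiableAt (by simp)
      exact h2.comp (f := fun s : ℝ => (s, y)) t (by fun_prop)
    exact ⟨Matrix.of fun i j => deriv (fun s => torsion gm (W s) y n i j) t,
      fun i j => (this i j).hasDerivAt⟩
  obtain ⟨B, hB⟩ := hder
  have hBs : Bᵀ = -B := by
    refine hB.transpose.unique (hB.neg.congr_of_eventuallyEq ?_)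
    exact Filter.eventually_of_mem (isOpen_Ioo.mem_nhds ht)
      fun s hs => h.torsion_skew ⟨hs.1.le, hs.2⟩ hy n
  have hA : MatDeriv (fun s => torEnd gm W s n y) (B * (gm y)⁻¹) t := by
    have := hB.mul (matDeriv_const (gm y)⁻¹ t)
    simpa [torEnd] using this
  refine ⟨_, hA, fun m => ?_⟩
  -- the evolution of `∇Ω`
  have hev : ∀ z ∈ U, CompDeriv (fun s => W s z) (act (divEnd gm W t z) (W t z)) t :=
    fun z hz => by rw [divEnd, ← diamond_eq_act]; exact h.evol t ht z hz
  have hcov : CompDeriv (fun s => cov4 gm (W s) y n)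
      (cov4 gm (fun z => act (divEnd gm W t z) (W t z)) y n) t := by
    intro I
    have h1 := hasDerivAt_pderiv_time (F := fun s z => W s z I)
      (G := fun z => act (divEnd gm W t z) (W t z) I) isOpen_Ioo h.metric.isOpen
      ((h.smooth I).mono hsub) ht hy (fun z hz => hev z hz I) n
    have h2 := CompDeriv.act (matDeriv_const (gam gm n y) t) (hev y hy) I
    refine (h1.sub h2).congr_deriv ?_
    simp [cov4_eq, pdComp, act_zero_left]
  have hact := CompDeriv.act hA (hev y hy)
  have huniq : cov4 gm (fun z => act (divEnd gm W t z) (W t z)) y n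
      = act (B * (gm y)⁻¹) (W t y) + act (torEnd gm W t n y) (act (divEnd gm W t y) (W t y)) := by
    refine hcov.unique fun I => (hact I).congr_of_eventuallyEq ?_
    exact Filter.eventually_of_mem (isOpen_Ioo.mem_nhds ht) fun s hs =>
      (congrFun (h.torsion_spec ⟨hs.1.le, hs.2⟩ hy n).2.1 I).symm
  rw [cov4_act ((h.slice_divEnd ht').matDiff h.metric.isOpen hy)
    ((h.slice ht').compDiff h.metric.isOpen hy), ← (h.torsion_spec ht' hy n).2.1] at huniq
  obtain ⟨β₁, hβ₁, e₁⟩ := h.metric.covMat_eq_skew (h.slice_divT ht')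
    (fun z hz => h.divT_skew ht' hz) hy n
  obtain ⟨β₂, hβ₂, e₂⟩ := h.skew_commutator hy (h.divT_skew ht' hy) (h.torsion_skew ht' hy n)
  have h0 := h.br_torEnd_eq_zero ht' hy m (β := B - β₁ - β₂)
    (X := B * (gm y)⁻¹ - covMat gm n (divEnd gm W t) y
      - (divEnd gm W t y * torEnd gm W t n y - torEnd gm W t n y * divEnd gm W t y))
    (by rw [sub_mul, sub_mul, ← e₁, ← e₂]; rfl)
    (by rw [Matrix.transpose_sub, Matrix.transpose_sub, hBs, hβ₁, hβ₂]; abel)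
    (by
      rw [act_sub_left, act_sub_left, ← act_act_sub, sub_eq_zero, sub_eq_iff_eq_add]
      rw [add_comm, ← sub_eq_iff_eq_add'] at huniq
      rw [← huniq]; abel)
  simp only [br_sub_right] at h0 ⊢
  linarith

/-- The evolution of the energy density. -/
lemma hasDerivAt_enDensity (ht : t ∈ Set.Ioo 0 t₀) (hy : y ∈ U) :
    HasDerivAt (fun s => enDensity gm W s y) (2 * ∑ m, ∑ n, (gm y)⁻¹ m n *
      br (torEnd gm W t m y) (covMat gm n (divEnd gm W t) y)) t := by
  choose A hA hA' using fun n => h.evolution ht hy n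
  have h1 : HasDerivAt (fun s => enDensity gm W s y) (∑ m, ∑ n, (gm y)⁻¹ m n *
      (br (A m) (torEnd gm W t n y) + br (torEnd gm W t m y) (A n))) t := by
    refine HasDerivAt.fun_sum fun m _ => HasDerivAt.fun_sum fun n _ => HasDerivAt.const_mul _ ?_
    have := (((hA m).mul (hA n)).trace).const_mul (-(1 / 2) : ℝ)
    refine this.congr_deriv ?_
    simp only [br, Matrix.trace_add]; ring
  refine h1.congr_deriv ?_
  have e1 : ∑ m, ∑ n, (gm y)⁻¹ m n * br (A m) (torEnd gm W t n y)
      = ∑ m, ∑ n, (gm y)⁻¹ m n * br (torEnd gm W t m y) (A n) := by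
    rw [sum_comm]
    refine sum_congr rfl fun n _ => sum_congr rfl fun m _ => ?_
    rw [br_comm]
    congr 1
    conv_lhs => rw [← h.metric.inv_symm hy]
    rfl
  simp only [mul_add, sum_add_distrib, e1, hA']
  have e2 := sum_br_commutator (h.metric.inv_symm hy) (fun k => torEnd gm W t k y)
    (divEnd gm W t y)
  rw [e2]; ring

end ChartFlow

end QKFlow

end

/-! ### Independence of the chart, and the passage from the manifold to charts. -/

noncomputable section

namespace QKFlow

open Matrix Finset

/-! ### Changes of charts -/

/-- The transposed Jacobian matrix `∂ᵢψᵃ`. -/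
def jac (ψ : E8 → E8) (y : E8) : Mat := Matrix.of fun i a => pderiv i (fun z => ψ z a) y

/-- The `b`-th coordinate as a linear form. -/
abbrev coordL (b : Fin 8) : E8 →L[ℝ] ℝ := EuclideanSpace.proj b

lemma pderiv_comp {ψ : E8 → E8} {f : E8 → ℝ} {y : E8} (hψ : DifferentiableAt ℝ ψ y)
    (hf : DifferentiableAt ℝ f (ψ y)) (m : Fin 8) :
    pderiv m (fun z => f (ψ z)) y = ∑ b, jac ψ y m b * pderiv b f (ψ y) := by
  have h1 := hf.hasFDerivAt.comp y hψ.hasFDerivAt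
  have h2 : fderiv ℝ (fun z => f (ψ z)) y = _ := h1.fderiv
  rw [pderiv, h2, ContinuousLinearMap.comp_apply, fderiv_eq_sum_pderiv]
  refine sum_congr rfl fun b _ => ?_
  congr 1
  have h3 := ((coordL b).hasFDerivAt
    (x := ψ y)).comp y hψ.hasFDerivAt
  have h4 : fderiv ℝ (fun z => ψ z b) y = _ := h3.fderiv
  rw [jac, Matrix.of_apply, pderiv, h4]
  simp

lemma br_conj {J a b a' b' : Mat} (hJ : IsUnit J.det) (ha : J * a = a' * J) (hb : J * b = b' * J) :
    br a' b' = br a b := by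
  have hJJ : J * J⁻¹ = 1 := Matrix.mul_nonsing_inv _ hJ
  have hJJ' : J⁻¹ * J = 1 := Matrix.nonsing_inv_mul _ hJ
  rw [br, br]
  congr 1
  calc (a' * b').trace = (a' * (b' * (J * J⁻¹))).trace := by rw [hJJ, Matrix.mul_one]
    _ = (a' * J * b * J⁻¹).trace := by
        rw [← Matrix.mul_assoc b', ← hb]; simp only [Matrix.mul_assoc]
    _ = (J⁻¹ * J * (a * b)).trace := by
        rw [← ha, Matrix.trace_mul_comm]; simp only [Matrix.mul_assoc]
    _ = _ := by rw [hJJ', Matrix.one_mul]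

/-- The map `ψ : U' → U` is an isometry from the metric `gm'` to the metric `gm`. -/
structure ChartChange (U U' : Set E8) (gm gm' : E8 → Mat) (ψ : E8 → E8) : Prop where
  metric : ChartMetric U gm
  metric' : ChartMetric U' gm'
  smooth : ContDiffOn ℝ ∞ ψ U'
  maps : Set.MapsTo ψ U' U
  isometry : ∀ y ∈ U', gm' y = jac ψ y * gm (ψ y) * (jac ψ y)ᵀ

namespace ChartChange

variable {U U' : Set E8} {gm gm' : E8 → Mat} {ψ : E8 → E8} (h : ChartChange U U' gm gm' ψ) {y : E8}

include h

lemma differentiableAt (hy : y ∈ U') : DifferentiableAt ℝ ψ y :=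
  (h.smooth.contDiffAt (h.metric'.isOpen.mem_nhds hy)).differentiableAt (by simp)

lemma smooth_jac : MatSmooth U' (jac ψ) := fun i a =>
  contDiffOn_pderiv h.metric'.isOpen
    ((coordL a).contDiff.comp_contDiffOn
      h.smooth) i

lemma isUnit_det (hy : y ∈ U') : IsUnit (jac ψ y).det := by
  have h1 := h.metric'.isUnit_det hy
  rw [h.isometry y hy, Matrix.det_mul, Matrix.det_mul, mul_assoc] at h1
  exact isUnit_of_mul_isUnit_left h1

lemma matDiff_comp {F : E8 → Mat} (hF : MatSmooth U F) (hy : y ∈ U') :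
    MatDiff (fun z => F (ψ z)) y :=
  (hF.comp h.smooth h.maps).matDiff h.metric'.isOpen hy

lemma pdMat_comp {F : E8 → Mat} (hF : MatSmooth U F) (hy : y ∈ U') (m : Fin 8) :
    pdMat m (fun z => F (ψ z)) y = ∑ b, jac ψ y m b • pdMat b F (ψ y) := by
  ext i j
  rw [Matrix.sum_apply]
  exact pderiv_comp (f := fun z => F z i j) (h.differentiableAt hy)
    (hF.matDiff h.metric.isOpen (h.maps hy) i j) m

lemma pdComp_comp {W : E8 → Comp4} (hW : CompSmooth U W) (hy : y ∈ U') (m : Fin 8) :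
    pdComp m (fun z => W (ψ z)) y = ∑ b, jac ψ y m b • pdComp b W (ψ y) := by
  ext I
  rw [Finset.sum_apply]
  exact pderiv_comp (f := fun z => W z I) (h.differentiableAt hy)
    (hW.compDiff h.metric.isOpen (h.maps hy) I) m

lemma pdMat_jac_comm (hy : y ∈ U') (m i a : Fin 8) :
    pdMat m (jac ψ) y i a = pdMat i (jac ψ) y m a := by
  have hc : ContDiffAt ℝ 2 (fun z => ψ z a) y :=
    (((coordL a).contDiff.comp_contDiffOn
      h.smooth).contDiffAt (h.metric'.isOpen.mem_nhds hy)).of_le two_le_infty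
  exact pderiv_comm hc m i

/-- The transformation of the Levi-Civita connection. -/
lemma gam_mul_jac (hy : y ∈ U') (m : Fin 8) : gam gm' m y * jac ψ y
    = pdMat m (jac ψ) y + jac ψ y * ∑ b, jac ψ y m b • gam gm b (ψ y) := by
  set J := jac ψ y with hJ
  set G : Fin 8 → Mat := fun m => ∑ b, J m b • gam gm b (ψ y) with hG
  have hJJ : J * J⁻¹ = 1 := Matrix.mul_nonsing_inv _ (h.isUnit_det hy)
  have hJJ' : J⁻¹ * J = 1 := Matrix.nonsing_inv_mul _ (h.isUnit_det hy)
  have hJJt : Jᵀ * (J⁻¹)ᵀ = 1 := by rw [← Matrix.transpose_mul, hJJ', Matrix.transpose_one]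
  have hJJt' : (J⁻¹)ᵀ * Jᵀ = 1 := by rw [← Matrix.transpose_mul, hJJ, Matrix.transpose_one]
  have hψy := h.maps hy
  have hsymm : ∀ m i c, (pdMat m (jac ψ) y + J * G m) i c = (pdMat i (jac ψ) y + J * G i) m c := by
    intro m i c
    have e1 : (J * G m) i c = (J * G i) m c := by
      simp only [hG, Matrix.mul_apply, Matrix.sum_apply, Matrix.smul_apply, smul_eq_mul, mul_sum]
      rw [sum_comm]
      refine sum_congr rfl fun b _ => sum_congr rfl fun a _ => ?_
      rw [h.metric.gam_comm hψy b a c]; ring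
    rw [Matrix.add_apply, Matrix.add_apply, h.pdMat_jac_comm hy, e1]
  have hpd : pdMat m (fun z => jac ψ z * gm (ψ z) * (jac ψ z)ᵀ) y = pdMat m gm' y :=
    pdMat_congr h.metric'.isOpen (fun z hz => (h.isometry z hz).symm) hy m
  -- The right-hand side multiplied by `J⁻¹` is a symmetric connection compatible with `gm'`, so
  -- uniqueness of the Levi-Civita connection identifies it.
  have key := h.metric'.eq_gam hy (G := fun m => (pdMat m (jac ψ) y + J * G m) * J⁻¹)
    (fun m i k => by simp only [Matrix.mul_apply, hsymm m i]) (fun m => ?_) m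
  · rw [← key]
    simp only [Matrix.mul_assoc, hJJ', Matrix.mul_one]
    rfl
  · have hdJ := h.smooth_jac.matDiff h.metric'.isOpen hy
    have hdg := h.matDiff_comp h.metric.smooth hy
    rw [← pdMat_congr h.metric'.isOpen (fun z hz => (h.isometry z hz).symm) hy m,
      pdMat_mul (hdJ.mul hdg) hdJ.transpose, pdMat_mul hdJ hdg, pdMat_transpose,
      h.pdMat_comp h.metric.smooth hy, h.isometry y hy, ← hJ]
    have e2 : ∑ b, J m b • pdMat b gm (ψ y) = G m * gm (ψ y) + gm (ψ y) * (G m)ᵀ := by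
      simp only [h.metric.pdMat_metric hψy, smul_add, sum_add_distrib, hG, sum_mul,
        Matrix.smul_mul, Matrix.transpose_sum, Matrix.transpose_smul, mul_sum, Matrix.mul_smul]
    rw [e2]
    generalize pdMat m (jac ψ) y = A
    generalize G m = B
    generalize gm (ψ y) = g
    have e3 : (A + J * B) * J⁻¹ * (J * g * Jᵀ) = (A + J * B) * g * Jᵀ := by
      simp only [← Matrix.mul_assoc]
      rw [Matrix.mul_assoc _ J⁻¹ J, hJJ', Matrix.mul_one]
    have e4 : J * g * Jᵀ * ((A + J * B) * J⁻¹)ᵀ = J * g * (A + J * B)ᵀ := by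
      rw [Matrix.transpose_mul]
      simp only [← Matrix.mul_assoc]
      rw [Matrix.mul_assoc _ Jᵀ, hJJt, Matrix.mul_one]
    rw [e3, e4]
    simp only [Matrix.transpose_add, Matrix.transpose_mul, add_mul, mul_add, Matrix.mul_assoc]
    abel

/-- The transformation of the curvature. -/
lemma curv_mul_jac (hy : y ∈ U') (m n : Fin 8) : curv gm' m n y * jac ψ y
    = jac ψ y * ∑ a, ∑ b, (jac ψ y m a * jac ψ y n b) • curv gm a b (ψ y) := by
  have hU := h.metric'.isOpen
  set G : Fin 8 → E8 → Mat := fun m z => ∑ b, jac ψ z m b • gam gm b (ψ z) with hG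
  have hGs : ∀ m, MatSmooth U' (G m) := fun m => MatSmooth.sum fun b _ =>
    MatSmooth.smul (h.smooth_jac m b) ((h.metric.smooth_gam b).comp h.smooth h.maps)
  have hJd := h.smooth_jac.matDiff hU hy
  have hgd : ∀ n, MatDiff (gam gm' n) y := fun n => (h.metric'.smooth_gam n).matDiff hU hy
  have hpJs : ∀ n, MatSmooth U' (pdMat n (jac ψ)) := fun n => h.smooth_jac.pdMat hU n
  -- Differentiate the transformation law of the connection. Antisymmetrising in `m, n` will remove
  -- the derivatives of the Jacobian.
  have h1 : ∀ m n, pdMat m (gam gm' n) y * jac ψ y + gam gm' n y * pdMat m (jac ψ) y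
      = pdMat m (pdMat n (jac ψ)) y + (pdMat m (jac ψ) y * G n y + jac ψ y * pdMat m (G n) y) := by
    intro m n
    rw [← pdMat_mul (hgd n) hJd, ← pdMat_mul hJd ((hGs n).matDiff hU hy),
      pdMat_congr hU (fun z hz => h.gam_mul_jac hz n) hy m]
    have hd1 := (hpJs n).matDiff hU hy
    have hd2 := (h.smooth_jac.mul (hGs n)).matDiff hU hy
    ext i j
    exact pderiv_add (hd1 i j) (hd2 i j) m
  have h2 : pdMat m (pdMat n (jac ψ)) y = pdMat n (pdMat m (jac ψ)) y := by
    ext i j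
    exact pderiv_comm (((h.smooth_jac i j).contDiffAt (hU.mem_nhds hy)).of_le two_le_infty) m n
  have h3 : ∀ m n, gam gm' m y * gam gm' n y * jac ψ y = gam gm' m y * pdMat n (jac ψ) y
      + pdMat m (jac ψ) y * G n y + jac ψ y * (G m y * G n y) := by
    intro m n
    rw [Matrix.mul_assoc, h.gam_mul_jac hy n, mul_add, ← Matrix.mul_assoc, h.gam_mul_jac hy m,
      add_mul, Matrix.mul_assoc, add_assoc]
  have h4 : ∀ m n, pdMat m (G n) y = (∑ b, pdMat m (jac ψ) y n b • gam gm b (ψ y))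
      + ∑ a, ∑ b, (jac ψ y m a * jac ψ y n b) • pdMat a (gam gm b) (ψ y) := by
    intro m n
    ext i j
    have hd : ∀ b, DifferentiableAt ℝ (fun z => gam gm b (ψ z) i j) y := fun b =>
      h.matDiff_comp (h.metric.smooth_gam b) hy i j
    have e1 : pdMat m (G n) y i j = ∑ b, (pdMat m (jac ψ) y n b * gam gm b (ψ y) i j
        + jac ψ y n b * ∑ a, jac ψ y m a * pdMat a (gam gm b) (ψ y) i j) := by
      have e2 : pdMat m (G n) y i j
          = pderiv m (fun z => ∑ b, jac ψ z n b * gam gm b (ψ z) i j) y := by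
        rw [pdMat, Matrix.of_apply]
        congr 1
      rw [e2]
      refine (pderiv_sum (f := fun b z => jac ψ z n b * gam gm b (ψ z) i j)
        (fun b _ => (hJd n b).mul (hd b)) m).trans ?_
      refine sum_congr rfl fun b _ => ?_
      rw [pderiv_mul (hJd n b) (hd b)]
      have := congrFun (congrFun (h.pdMat_comp (h.metric.smooth_gam b) hy m) i) j
      simp only [Matrix.sum_apply, Matrix.smul_apply, smul_eq_mul] at this
      rw [← this]
      rfl
    rw [e1, sum_add_distrib]
    simp only [Matrix.add_apply, Matrix.sum_apply, Matrix.smul_apply, smul_eq_mul, mul_sum]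
    rw [sum_comm (f := fun b a => jac ψ y n b * (jac ψ y m a * pdMat a (gam gm b) (ψ y) i j))]
    congr 1
    exact sum_congr rfl fun a _ => sum_congr rfl fun b _ => by ring
  have h5 : ∑ b, pdMat m (jac ψ) y n b • gam gm b (ψ y)
      = ∑ b, pdMat n (jac ψ) y m b • gam gm b (ψ y) :=
    sum_congr rfl fun b _ => by rw [h.pdMat_jac_comm hy]
  have h6 : ∀ m n, G m y * G n y
      = ∑ a, ∑ b, (jac ψ y m a * jac ψ y n b) • (gam gm a (ψ y) * gam gm b (ψ y)) := by
    intro m n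
    simp only [hG, sum_mul, mul_sum, Matrix.smul_mul, Matrix.mul_smul, smul_smul]
    rw [sum_comm]
    exact sum_congr rfl fun a _ => sum_congr rfl fun b _ => by rw [mul_comm]
  have h7 : ∑ a, ∑ b, (jac ψ y m a * jac ψ y n b) • curv gm a b (ψ y)
      = pdMat m (G n) y - pdMat n (G m) y - (G m y * G n y - G n y * G m y) := by
    rw [h4 m n, h4 n m, h5, h6 m n, h6 n m,
      sum_comm (f := fun a b => (jac ψ y n a * jac ψ y m b) • pdMat a (gam gm b) (ψ y)),
      sum_comm (f := fun a b => (jac ψ y n a * jac ψ y m b) • (gam gm a (ψ y) * gam gm b (ψ y)))]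
    simp only [curv, smul_sub, sum_sub_distrib, mul_comm (jac ψ y n _)]
    abel
  have e1 := h1 m n
  have e2 := h1 n m
  rw [h2] at e1
  rw [h7, curv]
  simp only [sub_mul, mul_sub, h3]
  rw [← sub_eq_zero]
  rw [← sub_eq_zero] at e1 e2
  have e3 := congrArg₂ (· - ·) e1 e2
  simp only [sub_zero] at e3
  rw [← e3]
  abel

lemma inv_eq (hy : y ∈ U') :
    (gm (ψ y))⁻¹ = (jac ψ y)ᵀ * (gm' y)⁻¹ * jac ψ y := by
  have hJ := h.isUnit_det hy
  have hJt : IsUnit (jac ψ y)ᵀ.det := by rwa [Matrix.det_transpose]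
  rw [h.isometry y hy, Matrix.mul_inv_rev, Matrix.mul_inv_rev]
  simp only [Matrix.mul_assoc, Matrix.nonsing_inv_mul _ hJ, Matrix.mul_one]
  rw [← Matrix.mul_assoc, Matrix.mul_nonsing_inv _ hJt, Matrix.one_mul]

lemma sum_inv_mul (hy : y ∈ U') (a b : Fin 8) :
    ∑ m, ∑ n, (gm' y)⁻¹ m n * (jac ψ y m a * jac ψ y n b) = (gm (ψ y))⁻¹ a b := by
  rw [h.inv_eq hy, Matrix.mul_apply]
  simp only [Matrix.mul_apply, Matrix.transpose_apply, sum_mul]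
  rw [sum_comm]
  exact sum_congr rfl fun m _ => sum_congr rfl fun n _ => by ring

lemma sqrt_det (hy : y ∈ U') :
    √(gm' y).det = |(jac ψ y).det| * √(gm (ψ y)).det := by
  rw [h.isometry y hy, Matrix.det_mul, Matrix.det_mul, Matrix.det_transpose,
    show (jac ψ y).det * (gm (ψ y)).det * (jac ψ y).det
      = (jac ψ y).det ^ 2 * (gm (ψ y)).det by ring,
    Real.sqrt_mul (sq_nonneg _), Real.sqrt_sq_eq_abs]

/-- The transformation of the covariant derivative of `4`-forms. -/
lemma cov4_pull {W W' : E8 → Comp4} (hW : CompSmooth U W)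
    (hW' : ∀ z ∈ U', W' z = pull (jac ψ z) (W (ψ z))) (hy : y ∈ U') (m : Fin 8) :
    cov4 gm' W' y m = pull (jac ψ y) (∑ b, jac ψ y m b • cov4 gm W (ψ y) b) := by
  have hU := h.metric'.isOpen
  set J := jac ψ y with hJ
  have hJJ' : J⁻¹ * J = 1 := Matrix.nonsing_inv_mul _ (h.isUnit_det hy)
  have hWψ : CompSmooth U' (fun z => W (ψ z)) := hW.comp h.smooth h.maps
  have hJd := h.smooth_jac.matDiff hU hy
  have e1 : pdComp m W' y = pull J (pdComp m (fun z => W (ψ z)) y)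
      + act (pdMat m (jac ψ) y * J⁻¹) (pull J (W (ψ y))) := by
    rw [pdComp_congr hU hW' hy m]
    refine pdComp_eq ((CompSmooth.pull h.smooth_jac hWψ).compDiff hU hy) ?_
    have := CompDeriv.pull (hJd.matDeriv m) (c := pdMat m (jac ψ) y * J⁻¹) (by
      simp only [zero_smul, add_zero]
      rw [← hJ, Matrix.mul_assoc, hJJ', Matrix.mul_one]) ((hWψ.compDiff hU hy).compDeriv m)
    simpa only [zero_smul, add_zero] using this
  have e2 : pull J (act (∑ b, J m b • gam gm b (ψ y)) (W (ψ y)))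
      = act (gam gm' m y - pdMat m (jac ψ) y * J⁻¹) (pull J (W (ψ y))) := by
    refine pull_act ?_ _
    rw [sub_mul, h.gam_mul_jac hy, Matrix.mul_assoc _ J⁻¹, hJJ', Matrix.mul_one,
      add_sub_cancel_left]
  have e3 : ∑ b, J m b • cov4 gm W (ψ y) b = pdComp m (fun z => W (ψ z)) y
      - act (∑ b, J m b • gam gm b (ψ y)) (W (ψ y)) := by
    simp only [cov4_eq, smul_sub, sum_sub_distrib, act_sum_left, act_smul_left,
      h.pdComp_comp hW hy, hJ]
  rw [e3, pull_sub, e2, act_sub_left, cov4_eq, e1, hW' y hy]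
  abel

end ChartChange

end QKFlow

end

noncomputable section

namespace QKFlow

open Matrix Finset

/-! ### The flow under changes of charts -/

lemma sum_comm_4 {ι : Type*} [Fintype ι] (f : ι → ι → ι → ι → ℝ) :
    ∑ m, ∑ n, ∑ a, ∑ b, f m n a b = ∑ a, ∑ b, ∑ m, ∑ n, f m n a b := by
  calc _ = ∑ m, ∑ a, ∑ n, ∑ b, f m n a b := sum_congr rfl fun m _ => sum_comm
    _ = ∑ a, ∑ m, ∑ n, ∑ b, f m n a b := sum_comm
    _ = ∑ a, ∑ m, ∑ b, ∑ n, f m n a b :=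
        sum_congr rfl fun a _ => sum_congr rfl fun m _ => sum_comm
    _ = _ := sum_congr rfl fun a _ => sum_comm

/-- `W'` is the pull-back by `ψ` of the flow `W`. -/
structure FlowChange (U U' : Set E8) (gm gm' : E8 → Mat) (ψ : E8 → E8) (t₀ : ℝ)
    (W W' : ℝ → E8 → Comp4) : Prop where
  change : ChartChange U U' gm gm' ψ
  flow : ChartFlow U gm t₀ W
  flow' : ChartFlow U' gm' t₀ W'
  pull_eq : ∀ t ∈ Set.Ico 0 t₀, ∀ y ∈ U', W' t y = pull (jac ψ y) (W t (ψ y))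

namespace FlowChange

variable {U U' : Set E8} {gm gm' : E8 → Mat} {ψ : E8 → E8} {t₀ : ℝ} {W W' : ℝ → E8 → Comp4}
  (h : FlowChange U U' gm gm' ψ t₀ W W') {t : ℝ} {y : E8}

include h

/-- Both sides lie in `Λ²₁₅` of the pulled-back structure and have the same image under `⋄`, namely
the covariant derivative of the `4`-form. -/
lemma torsion_eq (ht : t ∈ Set.Ico 0 t₀) (hy : y ∈ U') (m : Fin 8) :
    torsion gm' (W' t) y m
      = jac ψ y * (∑ b, jac ψ y m b • torsion gm (W t) (ψ y) b) * (jac ψ y)ᵀ := by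
  have hψy := h.change.maps hy
  obtain ⟨P, hP⟩ := h.flow'.std t ht y hy
  obtain ⟨s1, s2, -⟩ := h.flow'.torsion_spec ht hy m
  have s3 := fun b => h.flow.torsion_spec ht hψy b
  have hlam : IsLambda15 (gm (ψ y))⁻¹ (W t (ψ y)) (∑ b, jac ψ y m b • torsion gm (W t) (ψ y) b) := by
    have hgi := h.flow.metric.inv_symm hψy
    have hskew : (∑ b, jac ψ y m b • torsion gm (W t) (ψ y) b)ᵀ
        = -∑ b, jac ψ y m b • torsion gm (W t) (ψ y) b := by
      simp only [Matrix.transpose_sum, Matrix.transpose_smul, (s3 _).1.1, smul_neg,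
        sum_neg_distrib]
    refine ⟨hskew, fun β hβ hz => ?_⟩
    rw [inner2_eq_br hβ hgi, sum_mul, br_sum_left]
    refine sum_eq_zero fun b _ => ?_
    rw [Matrix.smul_mul, br_smul_left, (s3 b).1.br_eq_zero hgi rfl hβ
      (by rw [← diamond_eq_act]; exact hz), mul_zero]
  have hJ := h.change.isUnit_det hy
  have hlam' := hlam.conj hJ (h.flow.metric.symm _ hψy) (h.change.isometry y hy)
  rw [← h.pull_eq t ht y hy] at hlam'
  refine IsLambda15.eq_of_diamond_eq (inv_eq_of_frame hP.1) hP.isUnit_det s1 hlam' ?_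
  rw [diamond_eq_act, diamond_eq_act]
  have e1 : act (torEnd gm' W' t m y) (W' t y) = cov4 gm' (W' t) y m := s2
  rw [torEnd] at e1
  rw [e1, h.change.cov4_pull (h.flow.slice ht) (h.pull_eq t ht) hy]
  have e2 : ∑ b, jac ψ y m b • cov4 gm (W t) (ψ y) b
      = act ((∑ b, jac ψ y m b • torsion gm (W t) (ψ y) b) * (gm (ψ y))⁻¹) (W t (ψ y)) := by
    rw [sum_mul, act_sum_left]
    refine sum_congr rfl fun b _ => ?_
    rw [Matrix.smul_mul, act_smul_left]
    congr 1
    exact (s3 b).2.1.symm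
  rw [e2, h.pull_eq t ht y hy]
  refine pull_act ?_ _
  rw [h.change.inv_eq hy]
  simp only [Matrix.mul_assoc]

lemma torEnd_mul_jac (ht : t ∈ Set.Ico 0 t₀) (hy : y ∈ U') (m : Fin 8) :
    jac ψ y * (∑ b, jac ψ y m b • torEnd gm W t b (ψ y)) = torEnd gm' W' t m y * jac ψ y := by
  rw [torEnd, h.torsion_eq ht hy]
  have e : ∑ b, jac ψ y m b • torEnd gm W t b (ψ y)
      = (∑ b, jac ψ y m b • torsion gm (W t) (ψ y) b) * (gm (ψ y))⁻¹ := by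
    simp only [torEnd, sum_mul, Matrix.smul_mul]
  rw [e, h.change.inv_eq hy]
  simp only [Matrix.mul_assoc]

lemma enDensity_eq (ht : t ∈ Set.Ico 0 t₀) (hy : y ∈ U') :
    enDensity gm' W' t y = enDensity gm W t (ψ y) := by
  have e : ∀ m n, br (torEnd gm' W' t m y) (torEnd gm' W' t n y)
      = ∑ a, ∑ b, (jac ψ y m a * jac ψ y n b)
        * br (torEnd gm W t a (ψ y)) (torEnd gm W t b (ψ y)) := by
    intro m n
    rw [br_conj (h.change.isUnit_det hy) (h.torEnd_mul_jac ht hy m) (h.torEnd_mul_jac ht hy n),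
      br_sum_left]
    refine sum_congr rfl fun a _ => ?_
    rw [br_sum_right]
    refine sum_congr rfl fun b _ => ?_
    rw [br_smul_left, br_smul_right, mul_assoc]
  simp only [enDensity, e, ← h.change.sum_inv_mul hy, mul_sum, sum_mul]
  rw [sum_comm_4]
  simp only [mul_assoc]

/-- The vector field `⟨T, div T⟩` does not depend on the chart. -/
lemma br_divEnd_eq (ht : t ∈ Set.Ioo 0 t₀) (hy : y ∈ U') (m : Fin 8) :
    br (torEnd gm' W' t m y) (divEnd gm' W' t y)
      = ∑ b, jac ψ y m b * br (torEnd gm W t b (ψ y)) (divEnd gm W t (ψ y)) := by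
  have ht' : t ∈ Set.Ico 0 t₀ := ⟨ht.1.le, ht.2⟩
  have hψy := h.change.maps hy
  have hJ := h.change.isUnit_det hy
  have hJJ' : (jac ψ y)⁻¹ * jac ψ y = 1 := Matrix.nonsing_inv_mul _ hJ
  set X := jac ψ y * divEnd gm W t (ψ y) * (jac ψ y)⁻¹ with hX
  have hXJ : jac ψ y * divEnd gm W t (ψ y) = X * jac ψ y := by
    rw [hX, Matrix.mul_assoc _ (jac ψ y)⁻¹, hJJ', Matrix.mul_one]
  -- The divergence itself is not transformed. By the flow equation its action on the `4`-form is
  -- `∂ₜΩ`, which is evidently independent of the chart; the remaining ambiguity is in the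
  -- stabiliser and is invisible to `T`.
  have e1 : act (divEnd gm' W' t y) (W' t y) = act X (W' t y) := by
    have d1 := h.flow'.evol t ht y hy
    rw [diamond_eq_act] at d1
    refine CompDeriv.unique d1 ?_
    have d2 : CompDeriv (fun s => W s (ψ y)) (act (divEnd gm W t (ψ y)) (W t (ψ y))) t := by
      rw [divEnd, ← diamond_eq_act]
      exact h.flow.evol t ht (ψ y) hψy
    have d3 := CompDeriv.pull (matDeriv_const (jac ψ y) t) (c := 0) (by simp) d2
    rw [act_zero_left, add_zero, pull_act hXJ,
      ← h.pull_eq t ht' y hy] at d3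
    exact fun I => (d3 I).congr_of_eventuallyEq (Filter.eventually_of_mem (isOpen_Ioo.mem_nhds ht)
      fun s hs => congrFun (h.pull_eq s ⟨hs.1.le, hs.2⟩ y hy) I)
  have e2 : X = jac ψ y * divT gm (torsion gm (W t)) (ψ y) * (jac ψ y)ᵀ * (gm' y)⁻¹ := by
    rw [hX, divEnd, h.change.inv_eq hy]
    simp only [Matrix.mul_assoc, Matrix.mul_nonsing_inv _ hJ, Matrix.mul_one]
  have e3 := h.flow'.br_torEnd_eq_zero ht' hy m (X := divEnd gm' W' t y - X)
    (β := divT gm' (torsion gm' (W' t)) y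
      - jac ψ y * divT gm (torsion gm (W t)) (ψ y) * (jac ψ y)ᵀ)
    (by rw [sub_mul, ← e2]; rfl)
    (by
      simp only [Matrix.transpose_sub, Matrix.transpose_mul, Matrix.transpose_transpose,
        h.flow'.divT_skew ht' hy, h.flow.divT_skew ht' hψy, Matrix.mul_neg, Matrix.neg_mul,
        Matrix.mul_assoc]
      abel)
    (by rw [act_sub_left, e1, sub_self])
  rw [br_sub_right, sub_eq_zero] at e3
  rw [e3, br_conj hJ (h.torEnd_mul_jac ht' hy m) hXJ, br_sum_left]
  exact sum_congr rfl fun b _ => by rw [br_smul_left]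

end FlowChange

end QKFlow

end

noncomputable section

namespace QKFlow

open Matrix Finset

/-! ### Charts of the manifold -/

lemma exists_frame_of_pos {g : Mat} (hg : gᵀ = g) (h : ∀ v : Fin 8 → ℝ, v ≠ 0 → 0 < v ⬝ᵥ g *ᵥ v) :
    ∃ P : Mat, P * g * Pᵀ = 1 := by
  have hh : g.IsHermitian := by rw [Matrix.IsHermitian, Matrix.conjTranspose_eq_transpose_of_trivial, hg]
  have hpd : g.PosDef := Matrix.PosDef.of_dotProduct_mulVec_pos hh fun v hv => by simpa using h v hv
  set V : Mat := (hh.eigenvectorUnitary : Mat) with hV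
  have hVV : Vᵀ * V = 1 := by
    have := (Matrix.mem_unitaryGroup_iff' (A := V)).1 hh.eigenvectorUnitary.2
    rwa [Matrix.star_eq_conjTranspose, Matrix.conjTranspose_eq_transpose_of_trivial] at this
  have hs : g = V * Matrix.diagonal hh.eigenvalues * Vᵀ := by
    have := hh.spectral_theorem
    rw [Unitary.conjStarAlgAut_apply] at this
    simpa [Matrix.star_eq_conjTranspose, Matrix.conjTranspose_eq_transpose_of_trivial] using this
  refine ⟨Matrix.diagonal (fun i => (√(hh.eigenvalues i))⁻¹) * Vᵀ, ?_⟩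
  rw [Matrix.transpose_mul, Matrix.transpose_transpose, Matrix.diagonal_transpose]
  set d : Mat := Matrix.diagonal (fun i => (√(hh.eigenvalues i))⁻¹)
  calc d * Vᵀ * g * (V * d) = d * (Vᵀ * V) * Matrix.diagonal hh.eigenvalues * (Vᵀ * V) * d := by
        conv_lhs => rw [hs]
        simp only [Matrix.mul_assoc]
    _ = 1 := by
        rw [hVV, Matrix.mul_one, Matrix.mul_one, Matrix.diagonal_mul_diagonal,
          Matrix.diagonal_mul_diagonal, ← Matrix.diagonal_one]
        congr 1
        funext i
        have h0 := hpd.eigenvalues_pos i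
        have h1 : √(hh.eigenvalues i) ≠ 0 := (Real.sqrt_pos.2 h0).ne'
        have h2 := Real.mul_self_sqrt h0.le
        field_simp
        rw [pow_two, h2]

lemma ChartMetric.mono {U V : Set E8} {gm : E8 → Mat} (h : ChartMetric U gm) (hV : IsOpen V)
    (hVU : V ⊆ U) : ChartMetric V gm where
  isOpen := hV
  smooth i j := (h.smooth i j).mono hVU
  symm y hy := h.symm y (hVU hy)
  frame y hy := h.frame y (hVU hy)

lemma ChartFlow.mono {U V : Set E8} {gm : E8 → Mat} {t₀ : ℝ} {W : ℝ → E8 → Comp4}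
    (h : ChartFlow U gm t₀ W) (hV : IsOpen V) (hVU : V ⊆ U) : ChartFlow V gm t₀ W where
  metric := h.metric.mono hV hVU
  smooth I := (h.smooth I).mono (Set.prod_mono subset_rfl hVU)
  std t ht y hy := h.std t ht y (hVU hy)
  evol t ht y hy := h.evol t ht y (hVU hy)

section Manifold

variable {M : Type*} [TopologicalSpace M] [ChartedSpace E8 M]

/-- The differential of the inverse of the chart `e`. -/
def coordDeriv (e : OpenPartialHomeomorph M E8) (y : E8) : E8 →L[ℝ] E8 :=
  mfderiv (𝓡 8) (𝓡 8) e.symm y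

/-- The transition map from the chart `e'` to the chart `e`. -/
def transition (e e' : OpenPartialHomeomorph M E8) : E8 → E8 := fun y => e (e'.symm y)

/-- The domain of the transition map from the chart `e'` to the chart `e`. -/
def overlap (e e' : OpenPartialHomeomorph M E8) : Set E8 := e'.target ∩ e'.symm ⁻¹' e.source

omit [ChartedSpace E8 M] in
lemma isOpen_overlap (e e' : OpenPartialHomeomorph M E8) : IsOpen (overlap e e') :=
  e'.symm.isOpen_inter_preimage e.open_source

omit [ChartedSpace E8 M] in
lemma mapsTo_transition (e e' : OpenPartialHomeomorph M E8) :
    Set.MapsTo (transition e e') (overlap e e') (overlap e' e) := fun y hy => by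
  refine ⟨e.map_source hy.2, ?_⟩
  rw [Set.mem_preimage, transition, e.left_inv hy.2]
  exact e'.map_target hy.1

omit [ChartedSpace E8 M] in
lemma symm_transition {e e' : OpenPartialHomeomorph M E8} {y : E8} (hy : y ∈ overlap e e') :
    e.symm (transition e e' y) = e'.symm y := e.left_inv hy.2

omit [ChartedSpace E8 M] in
lemma transition_transition {e e' : OpenPartialHomeomorph M E8} {y : E8}
    (hy : y ∈ overlap e e') : transition e' e (transition e e' y) = y := by
  rw [transition, symm_transition hy, e'.right_inv hy.1]

lemma fourForm_sum (η : E8 [⋀^Fin 4]→ₗ[ℝ] ℝ) (J : Mat) (v : Fin 8 → E8) (I : Fin 4 → Fin 8) :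
    η (fun a => ∑ k, J (I a) k • v k) = pull J (fun A => η fun a => v (A a)) I := by
  have h1 := η.toMultilinearMap.map_sum (fun a k => J (I a) k • v k)
  have h2 : ∀ A : Fin 4 → Fin 8, η.toMultilinearMap (fun a => J (I a) (A a) • v (A a))
      = (∏ a, J (I a) (A a)) * η fun a => v (A a) := fun A =>
    η.toMultilinearMap.map_smul_univ (fun a => J (I a) (A a)) (fun a => v (A a))
  simp only [h2] at h1
  exact h1

lemma bilin_sum (B : E8 →L[ℝ] E8 →L[ℝ] ℝ) (J : Mat) (v : Fin 8 → E8) (i j : Fin 8) :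
    B (∑ k, J i k • v k) (∑ k, J j k • v k)
      = (J * Matrix.of (fun a b => B (v a) (v b)) * Jᵀ) i j := by
  simp only [map_sum, map_smul, _root_.sum_apply, _root_.smul_apply,
    smul_eq_mul, Matrix.mul_apply, Matrix.transpose_apply, Matrix.of_apply, sum_mul, mul_sum]
  exact sum_congr rfl fun a _ => sum_congr rfl fun b _ => by ring

lemma coordDeriv_apply (e : OpenPartialHomeomorph M E8) (y v : E8) :
    coordDeriv e y v = ∑ k, v k • coordDeriv e y (stdVec k) := by
  have hv : v = ∑ i, v i • stdVec i := by
    ext j; simp [Finset.sum_apply, Pi.single_apply]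
  conv_lhs => rw [hv, map_sum]
  simp

variable [IsManifold (𝓡 8) ∞ M] {e e' : OpenPartialHomeomorph M E8}
  (he : e ∈ IsManifold.maximalAtlas (𝓡 8) ∞ M) (he' : e' ∈ IsManifold.maximalAtlas (𝓡 8) ∞ M)

include he

omit [IsManifold (𝓡 8) ∞ M] in
lemma mdifferentiableAt_symm {y : E8} (hy : y ∈ e.target) :
    MDifferentiableAt (𝓡 8) (𝓡 8) e.symm y :=
  ((contMDiffOn_symm_of_mem_maximalAtlas he).contMDiffAt
    (e.open_target.mem_nhds hy)).mdifferentiableAt (by simp)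

omit [IsManifold (𝓡 8) ∞ M] in
lemma mdifferentiableAt_chart {x : M} (hx : x ∈ e.source) :
    MDifferentiableAt (𝓡 8) (𝓡 8) e x :=
  ((contMDiffOn_of_mem_maximalAtlas he).contMDiffAt
    (e.open_source.mem_nhds hx)).mdifferentiableAt (by simp)

omit [IsManifold (𝓡 8) ∞ M] in
lemma coordDeriv_injective {y : E8} (hy : y ∈ e.target) :
    Function.Injective (coordDeriv e y) := by
  have h1 := mfderiv_comp y (mdifferentiableAt_chart he (e.map_target hy))
    (mdifferentiableAt_symm he hy)
  have h2 : mfderiv (𝓡 8) (𝓡 8) (e ∘ e.symm) y = ContinuousLinearMap.id ℝ E8 := by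
    have : (e ∘ e.symm) =ᶠ[nhds y] id :=
      Filter.eventuallyEq_of_mem (e.open_target.mem_nhds hy) fun z hz => e.right_inv hz
    rw [this.mfderiv_eq]
    exact mfderiv_id
  rw [h2] at h1
  intro v w hvw
  have h3 : ∀ v : E8, v = (mfderiv (𝓡 8) (𝓡 8) e (e.symm y) : E8 →L[ℝ] E8) (coordDeriv e y v) :=
    fun v => DFunLike.congr_fun h1 v
  rw [h3 v, h3 w, hvw]

omit [IsManifold (𝓡 8) ∞ M] in
lemma coordDeriv_surjective {y : E8} (hy : y ∈ e.target) :
    Function.Surjective (coordDeriv e y) :=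
  LinearMap.surjective_of_injective (f := (coordDeriv e y : E8 →ₗ[ℝ] E8))
    (coordDeriv_injective he hy)

/-- The coordinate vector fields are smooth sections along the inverse chart, being images of
constant fields under its tangent map; the metric is then contracted with two of them. -/
lemma smooth_metricCoeff (g : SmoothMetric M) : MatSmooth e.target (metricCoeff g e) := by
  intro i j
  have hs := contMDiffOn_symm_of_mem_maximalAtlas he
  have hvec : ∀ i, ContMDiffOn (𝓡 8) ((𝓡 8).prod 𝓘(ℝ, E8)) ∞
      (fun y : E8 => Bundle.TotalSpace.mk' E8 (E := fun x : M => TangentSpace (𝓡 8) x)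
        (e.symm y) (coordVec e y i)) e.target := by
    intro i
    have h1 := hs.contMDiffOn_tangentMapWithin (m := ∞) (by simp)
      e.open_target.uniqueMDiffOn
    have h2 : ContMDiffOn (𝓡 8) ((𝓡 8).prod 𝓘(ℝ, E8)) ∞
        (fun y : E8 => Bundle.TotalSpace.mk' E8 (E := fun x : E8 => TangentSpace (𝓡 8) x) y
          (stdVec i : E8)) e.target := by
      intro y hy
      rw [Bundle.contMDiffWithinAt_totalSpace]
      refine ⟨contMDiffWithinAt_id, ?_⟩
      simp only [mfld_simps]
      exact contMDiffWithinAt_const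
    refine (h1.comp h2 fun y hy => hy).congr fun y hy => ?_
    rw [Function.comp_apply, tangentMapWithin, mfderivWithin_of_mem_nhds
      (e.open_target.mem_nhds hy)]
    rfl
  have h3 : ContMDiffOn (𝓡 8) 𝓘(ℝ) ∞ (fun y => metricCoeff g e y i j) e.target := by
    intro y hy
    have : ContMDiffWithinAt (𝓡 8) ((𝓡 8).prod 𝓘(ℝ)) ∞
        (fun y => Bundle.TotalSpace.mk' ℝ (E := Bundle.Trivial M ℝ) (e.symm y)
          (g.inner (e.symm y) (coordVec e y i) (coordVec e y j))) e.target y := by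
      apply ContMDiffWithinAt.clm_bundle_apply₂ (F₁ := E8) (F₂ := E8)
      · exact ContMDiffAt.comp_contMDiffWithinAt y g.contMDiff.contMDiffAt (hs y hy)
      · exact hvec i y hy
      · exact hvec j y hy
    simp only [Bundle.contMDiffWithinAt_totalSpace] at this
    exact this.2
  exact h3.contDiffOn

lemma chartMetric_metricCoeff (g : SmoothMetric M) : ChartMetric e.target (metricCoeff g e) where
  isOpen := e.open_target
  smooth := smooth_metricCoeff he g
  symm y hy := by
    ext i j
    exact g.symm _ _ _
  frame y hy := by
    refine exists_frame_of_pos ?_ fun v hv => ?_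
    · ext i j
      exact g.symm _ _ _
    · set v' : E8 := WithLp.toLp 2 v with hv'
      have h0 : coordDeriv e y v' ≠ 0 := by
        rw [Ne, ← map_zero (coordDeriv e y), (coordDeriv_injective he hy).eq_iff]
        intro h
        exact hv (by simpa [hv'] using congrArg WithLp.ofLp h)
      have h1 : 0 < g.inner (e.symm y) (coordDeriv e y v') (coordDeriv e y v') := g.pos _ _ h0
      have h2 := bilin_sum (g.inner (e.symm y)) (Matrix.of fun _ k => v k)
        (fun k => coordDeriv e y (stdVec k)) 0 0
      rw [coordDeriv_apply] at h1
      refine lt_of_lt_of_eq h1 (h2.trans ?_)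
      simp only [Matrix.mul_apply, Matrix.transpose_apply, Matrix.of_apply, dotProduct,
        Matrix.mulVec, sum_mul, mul_sum]
      rw [sum_comm]
      exact sum_congr rfl fun a _ => sum_congr rfl fun b _ => by rw [mul_assoc]; rfl

/-- The rows of the matrix are the coordinates of the adapted frame with respect to the coordinate
vectors. -/
lemma exists_isStdFrame {g : SmoothMetric M} {Ω : FourForm M} (h : IsQKStructure g Ω) {y : E8}
    (hy : y ∈ e.target) : ∃ P, IsStdFrame (metricCoeff g e y) (comp4 e Ω y) P := by
  obtain ⟨b, hb, hΩ⟩ := h (e.symm y)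
  choose w hw using fun i => coordDeriv_surjective he hy (b i)
  have hb' : ∀ i, (b i : E8) = ∑ k, (Matrix.of fun i k => w i k : Mat) i k •
      coordDeriv e y (stdVec k) := fun i => by
    rw [← hw i, coordDeriv_apply]; rfl
  refine ⟨Matrix.of fun i k => w i k, ?_, ?_⟩
  · ext i j
    have h1 := bilin_sum (g.inner (e.symm y)) (Matrix.of fun i k => w i k)
      (fun k => coordDeriv e y (stdVec k)) i j
    rw [← hb' i, ← hb' j] at h1
    refine h1.symm.trans ((hb i j).trans ?_)
    rw [Matrix.one_apply]
  · ext I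
    have h1 := fourForm_sum (Ω (e.symm y)) (Matrix.of fun i k => w i k)
      (fun k => coordDeriv e y (stdVec k)) I
    simp only [← hb'] at h1
    exact h1.symm.trans (hΩ I)

lemma IsQKHarmonicFlow.chartFlow {g : SmoothMetric M} {t₀ : ℝ} {Ω : ℝ → FourForm M}
    (h : IsQKHarmonicFlow g t₀ Ω) :
    ChartFlow e.target (metricCoeff g e) t₀ (fun t y => comp4 e (Ω t) y) where
  metric := chartMetric_metricCoeff he g
  smooth I := h.smooth e he I
  std t ht _ hy := exists_isStdFrame he (h.isQK t ht) hy
  evol t ht y hy I := (h.evolution e he t ⟨ht.1.le, ht.2⟩ y hy I).hasDerivAt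
    (Ico_mem_nhds ht.1 ht.2)

include he'

omit [IsManifold (𝓡 8) ∞ M] in
lemma contDiffOn_transition : ContDiffOn ℝ ∞ (transition e e') (overlap e e') := by
  have h1 : ContMDiffOn (𝓡 8) (𝓡 8) ∞ (e ∘ e'.symm) (overlap e e') :=
    (contMDiffOn_of_mem_maximalAtlas he).comp
      ((contMDiffOn_symm_of_mem_maximalAtlas he').mono Set.inter_subset_left) fun y hy => hy.2
  exact h1.contDiffOn

omit [IsManifold (𝓡 8) ∞ M] in
lemma coordDeriv_eq {y : E8} (hy : y ∈ overlap e e') (i : Fin 8) :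
    coordDeriv e' y (stdVec i) = ∑ a, jac (transition e e') y i a •
      coordDeriv e (transition e e' y) (stdVec a) := by
  have hd : DifferentiableAt ℝ (transition e e') y :=
    ((contDiffOn_transition he he').contDiffAt
      ((isOpen_overlap e e').mem_nhds hy)).differentiableAt (by simp)
  have hmd : MDifferentiableAt (𝓡 8) (𝓡 8) (transition e e') y := hd.mdifferentiableAt
  have h1 := mfderiv_comp y (mdifferentiableAt_symm he (mapsTo_transition e e' hy).1) hmd
  have h2 : (e.symm ∘ transition e e') =ᶠ[nhds y] e'.symm :=
    Filter.eventuallyEq_of_mem ((isOpen_overlap e e').mem_nhds hy) fun z hz => symm_transition hz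
  have h3 : ∀ v : E8, coordDeriv e' y v
      = coordDeriv e (transition e e' y) (fderiv ℝ (transition e e') y v) := by
    intro v
    have h4 : (mfderiv (𝓡 8) (𝓡 8) (e.symm ∘ transition e e') y : E8 →L[ℝ] E8)
        = coordDeriv e' y := h2.mfderiv_eq
    rw [← h4, h1, mfderiv_eq_fderiv]
    rfl
  rw [h3, coordDeriv_apply]
  refine sum_congr rfl fun a _ => ?_
  congr 1
  have h5 := ((coordL a).hasFDerivAt (x := transition e e' y)).comp y hd.hasFDerivAt
  have h6 : fderiv ℝ (fun z => transition e e' z a) y = _ := h5.fderiv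
  rw [jac, Matrix.of_apply, pderiv, h6]
  simp

omit [IsManifold (𝓡 8) ∞ M] in
lemma comp4_transition (Ω : FourForm M) {y : E8} (hy : y ∈ overlap e e') :
    comp4 e' Ω y = pull (jac (transition e e') y) (comp4 e Ω (transition e e' y)) := by
  have key : ∀ x x' : M, x = x' → ∀ v : Fin 4 → E8, Ω x v = Ω x' v := by rintro _ _ rfl _; rfl
  ext I
  refine (key _ _ (symm_transition hy).symm _).trans ?_
  have h1 := fourForm_sum (Ω (e.symm (transition e e' y))) (jac (transition e e') y)
    (fun k => coordDeriv e (transition e e' y) (stdVec k)) I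
  simp only [← coordDeriv_eq he he' hy] at h1
  exact h1

lemma metricCoeff_transition (g : SmoothMetric M) {y : E8} (hy : y ∈ overlap e e') :
    metricCoeff g e' y = jac (transition e e') y * metricCoeff g e (transition e e' y)
      * (jac (transition e e') y)ᵀ := by
  have key : ∀ x x' : M, x = x' → ∀ v w : E8, g.inner x v w = g.inner x' v w := by
    rintro _ _ rfl _ _; rfl
  ext i j
  refine (key _ _ (symm_transition hy).symm _ _).trans ?_
  have h1 := bilin_sum (g.inner (e.symm (transition e e' y))) (jac (transition e e') y)
    (fun k => coordDeriv e (transition e e' y) (stdVec k)) i j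
  rw [← coordDeriv_eq he he' hy, ← coordDeriv_eq he he' hy] at h1
  exact h1

lemma chartChange_transition (g : SmoothMetric M) : ChartChange e.target (overlap e e')
    (metricCoeff g e) (metricCoeff g e') (transition e e') where
  metric := chartMetric_metricCoeff he g
  metric' := (chartMetric_metricCoeff he' g).mono (isOpen_overlap e e') Set.inter_subset_left
  smooth := contDiffOn_transition he he'
  maps := fun _ hy => (mapsTo_transition e e' hy).1
  isometry _ hy := metricCoeff_transition he he' g hy

lemma IsQKHarmonicFlow.flowChange {g : SmoothMetric M} {t₀ : ℝ} {Ω : ℝ → FourForm M}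
    (h : IsQKHarmonicFlow g t₀ Ω) : FlowChange e.target (overlap e e')
    (metricCoeff g e) (metricCoeff g e') (transition e e') t₀ (fun t y => comp4 e (Ω t) y)
    (fun t y => comp4 e' (Ω t) y) where
  change := chartChange_transition he he' g
  flow := h.chartFlow he
  flow' := (h.chartFlow he').mono (isOpen_overlap e e') Set.inter_subset_left
  pull_eq t _ _ hy := comp4_transition he he' (Ω t) hy

omit he' in
/-- `|T|²` can be computed in any chart. -/
lemma IsQKHarmonicFlow.torsionNormSq_eq {g : SmoothMetric M} {t₀ : ℝ} {Ω : ℝ → FourForm M}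
    (h : IsQKHarmonicFlow g t₀ Ω) {t : ℝ} (ht : t ∈ Set.Ico 0 t₀) {y : E8} (hy : y ∈ e.target) :
    torsionNormSq g (Ω t) (e.symm y)
      = enDensity (metricCoeff g e) (fun t y => comp4 e (Ω t) y) t y := by
  set x := e.symm y with hx
  have hc : chartAt E8 x ∈ IsManifold.maximalAtlas (𝓡 8) ∞ M :=
    IsManifold.chart_mem_maximalAtlas x
  have hxs : x ∈ (chartAt E8 x).source := mem_chart_source E8 x
  have hy' : y ∈ overlap (chartAt E8 x) e := ⟨hy, hxs⟩
  rw [(h.flowChange hc he).enDensity_eq ht hy', torsionNormSq, torsionIn]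
  exact (h.chartFlow hc).normSq12_eq_enDensity ht ((chartAt E8 x).map_source hxs)

end Manifold

end QKFlow

end

/-! ### Curvature bounds, Riccati comparison, and the geometry of normal coordinates. -/

noncomputable section

namespace QKFlow

open Matrix Finset

/-! ### Quadratic forms -/

/-- The value at `w` of the quadratic form with matrix `A`. -/
def quad (A : Mat) (w : Fin 8 → ℝ) : ℝ := w ⬝ᵥ A *ᵥ w

lemma quad_eq (A : Mat) (w : Fin 8 → ℝ) : quad A w = ∑ i, ∑ j, w i * A i j * w j := by
  simp only [quad, dotProduct, Matrix.mulVec, mul_sum, mul_assoc]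

lemma MatDeriv.quad {F : ℝ → Mat} {F' : Mat} {s : ℝ} (h : MatDeriv F F' s) (w : Fin 8 → ℝ) :
    HasDerivAt (fun r => quad (F r) w) (quad F' w) s := by
  simp only [quad_eq]
  exact HasDerivAt.fun_sum fun i _ => HasDerivAt.fun_sum fun j _ =>
    ((h i j).const_mul (w i)).mul_const (w j)

lemma quad_add (A B : Mat) (w : Fin 8 → ℝ) : quad (A + B) w = quad A w + quad B w := by
  simp [quad, Matrix.add_mulVec]

lemma quad_sub (A B : Mat) (w : Fin 8 → ℝ) : quad (A - B) w = quad A w - quad B w := by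
  simp [quad, Matrix.sub_mulVec]

lemma quad_smul (c : ℝ) (A : Mat) (w : Fin 8 → ℝ) : quad (c • A) w = c * quad A w := by
  simp [quad, Matrix.smul_mulVec]

lemma quad_smul_vec (c : ℝ) (A : Mat) (w : Fin 8 → ℝ) : quad A (c • w) = c ^ 2 * quad A w := by
  simp [quad, Matrix.mulVec_smul]; ring

lemma quad_transpose (A : Mat) (w : Fin 8 → ℝ) : quad Aᵀ w = quad A w := by
  rw [quad, quad, Matrix.mulVec_transpose, dotProduct_comm, Matrix.dotProduct_mulVec]

lemma quad_conj (J A : Mat) (w : Fin 8 → ℝ) : quad (J * A * Jᵀ) w = quad A (w ᵥ* J) := by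
  rw [quad, quad, ← Matrix.mulVec_mulVec, ← Matrix.mulVec_mulVec, Matrix.dotProduct_mulVec,
    Matrix.mulVec_transpose]

lemma quad_eq_frame {A P : Mat} (h : P * A * Pᵀ = 1) (w : Fin 8 → ℝ) :
    quad A w = ∑ i, (w ᵥ* P⁻¹) i ^ 2 := by
  have hP : IsUnit P.det := (frame_mul_inv h).2.2
  have h1 : w = (w ᵥ* P⁻¹) ᵥ* P := by
    rw [Matrix.vecMul_vecMul, Matrix.nonsing_inv_mul _ hP, Matrix.vecMul_one]
  conv_lhs => rw [h1, ← quad_conj, h]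
  simp [quad, dotProduct, pow_two]

lemma quad_nonneg_of_frame {A P : Mat} (h : P * A * Pᵀ = 1) (w : Fin 8 → ℝ) : 0 ≤ quad A w := by
  rw [quad_eq_frame h]; positivity

lemma quad_pos_of_frame {A P : Mat} (h : P * A * Pᵀ = 1) {w : Fin 8 → ℝ} (hw : w ≠ 0) :
    0 < quad A w := by
  refine lt_of_le_of_ne (quad_nonneg_of_frame h w) fun h0 => hw ?_
  have hP : IsUnit P.det := (frame_mul_inv h).2.2
  rw [quad_eq_frame h, eq_comm, sum_eq_zero_iff_of_nonneg fun i _ => sq_nonneg _] at h0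
  have h1 : w ᵥ* P⁻¹ = 0 := funext fun i => by simpa using h0 i (mem_univ i)
  have h2 : w = (w ᵥ* P⁻¹) ᵥ* P := by
    rw [Matrix.vecMul_vecMul, Matrix.nonsing_inv_mul _ hP, Matrix.vecMul_one]
  rw [h2, h1, Matrix.zero_vecMul]

/-- The Cauchy–Schwarz inequality. -/
lemma sq_dotProduct_le {A P : Mat} (h : P * A * Pᵀ = 1) (u w : Fin 8 → ℝ) :
    (u ⬝ᵥ A *ᵥ w) ^ 2 ≤ quad A u * quad A w := by
  have hP : IsUnit P.det := (frame_mul_inv h).2.2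
  have h1 : ∀ w : Fin 8 → ℝ, w = Pᵀ *ᵥ (w ᵥ* P⁻¹) := fun w => by
    rw [Matrix.mulVec_transpose, Matrix.vecMul_vecMul, Matrix.nonsing_inv_mul _ hP,
      Matrix.vecMul_one]
  have h2 : u ⬝ᵥ A *ᵥ w = ∑ i, (u ᵥ* P⁻¹) i * (w ᵥ* P⁻¹) i := by
    conv_lhs => rw [h1 w, h1 u]
    rw [Matrix.mulVec_transpose, ← Matrix.dotProduct_mulVec, Matrix.mulVec_mulVec,
      Matrix.mulVec_mulVec, h, Matrix.one_mulVec]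
    rfl
  rw [h2, quad_eq_frame h, quad_eq_frame h]
  exact sum_mul_sq_le_sq_mul_sq _ _ _

lemma abs_dotProduct_le {A P : Mat} (h : P * A * Pᵀ = 1) (u w : Fin 8 → ℝ) :
    |u ⬝ᵥ A *ᵥ w| ≤ √(quad A u) * √(quad A w) := by
  rw [← Real.sqrt_mul (quad_nonneg_of_frame h u), ← Real.sqrt_sq_eq_abs]
  exact Real.sqrt_le_sqrt (sq_dotProduct_le h u w)

/-- The Cauchy–Schwarz inequality for `A` against the vector `A⁻¹ eₘ`, whose `A`-product with `u` is
`uₘ`. -/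
lemma abs_apply_le {A P : Mat} (h : P * A * Pᵀ = 1) (u : Fin 8 → ℝ) (m : Fin 8) :
    |u m| ≤ √(A⁻¹ m m) * √(quad A u) := by
  have hA := isUnit_det_of_frame h
  have hs : Aᵀ = A := by
    have h1 := inv_eq_of_frame h
    have h2 : (A⁻¹)ᵀ = A⁻¹ := by rw [h1]; simp
    rw [Matrix.transpose_nonsing_inv] at h2
    have := congrArg (·⁻¹) h2
    simpa [Matrix.nonsing_inv_nonsing_inv _ hA,
      Matrix.nonsing_inv_nonsing_inv _ (show IsUnit Aᵀ.det by rwa [Matrix.det_transpose])] using this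
  have h1 := abs_dotProduct_le h (A⁻¹ *ᵥ Pi.single m 1) u
  have h2 : (A⁻¹ *ᵥ Pi.single m 1) ᵥ* A = Pi.single m 1 := by
    rw [← Matrix.mulVec_transpose, hs, Matrix.mulVec_mulVec, Matrix.mul_nonsing_inv _ hA,
      Matrix.one_mulVec]
  have h3 : quad A (A⁻¹ *ᵥ Pi.single m 1) = A⁻¹ m m := by
    rw [quad, Matrix.dotProduct_mulVec, h2]; simp
  rw [h3, Matrix.dotProduct_mulVec, h2] at h1
  simpa using h1

/-! ### The curvature tensor -/

/-- The curvature tensor `R(u, v, w, z)`. -/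
def rm (gm : E8 → Mat) (y : E8) (u v w z : Fin 8 → ℝ) : ℝ :=
  ∑ m, ∑ n, u m * v n * (w ⬝ᵥ (curv gm m n y * gm y) *ᵥ z)

lemma ChartChange.rm_eq {U U' : Set E8} {gm gm' : E8 → Mat} {ψ : E8 → E8}
    (h : ChartChange U U' gm gm' ψ) {y : E8} (hy : y ∈ U') (u v w z : Fin 8 → ℝ) :
    rm gm' y u v w z = rm gm (ψ y) (u ᵥ* jac ψ y) (v ᵥ* jac ψ y) (w ᵥ* jac ψ y) (z ᵥ* jac ψ y) := by
  have e1 : ∀ m n, w ⬝ᵥ (curv gm' m n y * gm' y) *ᵥ z = ∑ a, ∑ b, jac ψ y m a * jac ψ y n b *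
      ((w ᵥ* jac ψ y) ⬝ᵥ (curv gm a b (ψ y) * gm (ψ y)) *ᵥ (z ᵥ* jac ψ y)) := by
    intro m n
    rw [h.isometry y hy, ← Matrix.mul_assoc, ← Matrix.mul_assoc, h.curv_mul_jac hy,
      ← Matrix.mulVec_mulVec, Matrix.mulVec_transpose, Matrix.mul_assoc, ← Matrix.mulVec_mulVec,
      Matrix.dotProduct_mulVec]
    simp only [sum_mul, Matrix.sum_mulVec, dotProduct_sum, Matrix.smul_mul, Matrix.smul_mulVec,
      dotProduct_smul, smul_eq_mul]
  rw [rm, rm]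
  simp only [e1, mul_sum]
  rw [sum_comm_4]
  refine sum_congr rfl fun a _ => sum_congr rfl fun b _ => ?_
  generalize (w ᵥ* jac ψ y) ⬝ᵥ (curv gm a b (ψ y) * gm (ψ y)) *ᵥ (z ᵥ* jac ψ y) = X
  rw [Matrix.vecMul, dotProduct, Matrix.vecMul, dotProduct, sum_mul_sum]
  simp only [sum_mul]
  exact sum_congr rfl fun m _ => sum_congr rfl fun n _ => by ring

lemma ChartMetric.smooth_curv {U : Set E8} {gm : E8 → Mat} (h : ChartMetric U gm) (m n : Fin 8) :
    MatSmooth U (curv gm m n) :=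
  (((h.smooth_gam n).pdMat h.isOpen m).sub ((h.smooth_gam m).pdMat h.isOpen n)).sub
    (((h.smooth_gam m).mul (h.smooth_gam n)).sub ((h.smooth_gam n).mul (h.smooth_gam m)))

/-- The components of the curvature are continuous, hence bounded on a compact set, and coordinates
of vectors are controlled by their metric norms. Stated with metric norms, the bound does not depend
on the chart. -/
lemma ChartMetric.exists_rm_le {U K : Set E8} {gm : E8 → Mat} (h : ChartMetric U gm)
    (hK : IsCompact K) (hKU : K ⊆ U) : ∃ C, ∀ y ∈ K, ∀ u v w z : Fin 8 → ℝ, |rm gm y u v w z|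
      ≤ C * (√(quad (gm y) u) * √(quad (gm y) v) * √(quad (gm y) w) * √(quad (gm y) z)) := by
  have h1 : ∀ m n i j, ∃ C, ∀ y ∈ K, ‖(curv gm m n y * gm y) i j‖ ≤ C := fun m n i j =>
    hK.exists_bound_of_continuousOn
      ((((h.smooth_curv m n).mul h.smooth) i j).continuousOn.mono hKU)
  have h2 : ∀ m, ∃ D, ∀ y ∈ K, ‖√((gm y)⁻¹ m m)‖ ≤ D := fun m =>
    hK.exists_bound_of_continuousOn ((h.smooth_inv m m).continuousOn.mono hKU).sqrt
  choose C hC using h1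
  choose D hD using h2
  refine ⟨∑ m, ∑ n, ∑ i, ∑ j, C m n i j * (D m * D n * D i * D j), fun y hy u v w z => ?_⟩
  obtain ⟨P, hP⟩ := h.frame y (hKU hy)
  have h3 : ∀ (u : Fin 8 → ℝ) m, |u m| ≤ D m * √(quad (gm y) u) := fun u m =>
    (abs_apply_le hP u m).trans (mul_le_mul_of_nonneg_right
      ((le_abs_self _).trans (hD m y hy)) (Real.sqrt_nonneg _))
  have h4 : rm gm y u v w z
      = ∑ m, ∑ n, ∑ i, ∑ j, u m * v n * w i * (curv gm m n y * gm y) i j * z j := by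
    simp only [rm, dotProduct, Matrix.mulVec, mul_sum, mul_assoc]
  rw [h4]
  simp only [sum_mul]
  refine (abs_sum_le_sum_abs _ _).trans (sum_le_sum fun m _ => ?_)
  refine (abs_sum_le_sum_abs _ _).trans (sum_le_sum fun n _ => ?_)
  refine (abs_sum_le_sum_abs _ _).trans (sum_le_sum fun i _ => ?_)
  refine (abs_sum_le_sum_abs _ _).trans (sum_le_sum fun j _ => ?_)
  rw [abs_mul, abs_mul, abs_mul, abs_mul]
  calc |u m| * |v n| * |w i| * |(curv gm m n y * gm y) i j| * |z j|
      ≤ (D m * √(quad (gm y) u)) * (D n * √(quad (gm y) v)) * (D i * √(quad (gm y) w))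
        * C m n i j * (D j * √(quad (gm y) z)) := by
        have := hC m n i j y hy
        rw [Real.norm_eq_abs] at this
        have n1 := (abs_nonneg _).trans (h3 u m)
        have n2 := (abs_nonneg _).trans (h3 v n)
        have n3 := (abs_nonneg _).trans (h3 w i)
        have n4 := (abs_nonneg _).trans this
        exact mul_le_mul (mul_le_mul (mul_le_mul (mul_le_mul (h3 u m) (h3 v n) (abs_nonneg _) n1)
          (h3 w i) (abs_nonneg _) (mul_nonneg n1 n2)) this (abs_nonneg _)
          (mul_nonneg (mul_nonneg n1 n2) n3)) (h3 z j) (abs_nonneg _)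
          (mul_nonneg (mul_nonneg (mul_nonneg n1 n2) n3) n4)
    _ = _ := by ring

section Manifold

variable {M : Type*} [TopologicalSpace M] [ChartedSpace E8 M] [IsManifold (𝓡 8) ∞ M]

/-- The curvature of a compact manifold is bounded. -/
lemma exists_curvature_bound [CompactSpace M] (g : SmoothMetric M) :
    ∃ K, 0 < K ∧ ∀ e ∈ IsManifold.maximalAtlas (𝓡 8) ∞ M, ∀ y ∈ e.target, ∀ u v w z : Fin 8 → ℝ,
      |rm (metricCoeff g e) y u v w z| ≤ K * (√(quad (metricCoeff g e y) u)
        * √(quad (metricCoeff g e y) v) * √(quad (metricCoeff g e y) w)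
        * √(quad (metricCoeff g e y) z)) := by
  have hloc : ∀ x : M, ∃ V ∈ nhds x, ∃ C, ∀ x' ∈ V, x' ∈ (chartAt E8 x).source ∧
      ∀ u v w z : Fin 8 → ℝ, |rm (metricCoeff g (chartAt E8 x)) (chartAt E8 x x') u v w z|
        ≤ C * (√(quad (metricCoeff g (chartAt E8 x) (chartAt E8 x x')) u)
          * √(quad (metricCoeff g (chartAt E8 x) (chartAt E8 x x')) v)
          * √(quad (metricCoeff g (chartAt E8 x) (chartAt E8 x x')) w)
          * √(quad (metricCoeff g (chartAt E8 x) (chartAt E8 x x')) z)) := by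
    intro x
    have hx := mem_chart_source E8 x
    obtain ⟨r, hr, hrt⟩ := Metric.nhds_basis_closedBall.mem_iff.1
      ((chartAt E8 x).open_target.mem_nhds ((chartAt E8 x).map_source hx))
    obtain ⟨C, hC⟩ := (chartMetric_metricCoeff (IsManifold.chart_mem_maximalAtlas x)
      g).exists_rm_le (isCompact_closedBall _ r) hrt
    refine ⟨(chartAt E8 x).source ∩ chartAt E8 x ⁻¹' Metric.closedBall (chartAt E8 x x) r,
      Filter.inter_mem ((chartAt E8 x).open_source.mem_nhds hx)
        (((chartAt E8 x).continuousAt hx).preimage_mem_nhds (Metric.closedBall_mem_nhds _ hr)), C,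
      fun x' hx' => ⟨hx'.1, hC _ hx'.2⟩⟩
  choose V hV C hC using hloc
  obtain ⟨t, -, ht⟩ := isCompact_univ.elim_nhds_subcover V fun x _ => hV x
  refine ⟨1 + ∑ x ∈ t, |C x|, by positivity, fun e he y hy u v w z => ?_⟩
  obtain ⟨x, hxt, hx⟩ := Set.mem_iUnion₂.1 (ht (Set.mem_univ (e.symm y)))
  obtain ⟨h1, h2⟩ := hC x _ hx
  -- In an arbitrary chart the curvature and the norms are those of the finitely many reference
  -- charts, evaluated at transported vectors.
  have hch := chartChange_transition (IsManifold.chart_mem_maximalAtlas x) he g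
  have hyo : y ∈ overlap (chartAt E8 x) e := ⟨hy, h1⟩
  rw [hch.rm_eq hyo]
  simp only [hch.isometry y hyo, quad_conj]
  refine (h2 _ _ _ _).trans (mul_le_mul_of_nonneg_right ?_ (by positivity))
  have h3 := single_le_sum (f := fun x => |C x|) (fun x _ => abs_nonneg _) hxt
  linarith [le_abs_self (C x)]

end Manifold

end QKFlow

end

noncomputable section

namespace QKFlow

open Matrix Finset

/-! ### Scalar Riccati inequalities -/

section Riccati

variable {a b : ℝ → ℝ} {K : ℝ}

/-- For `n = s b / a` the quadratic terms are `-3 s² q / a + 2 n²`. Cauchy–Schwarz, `b² ≤ q a`,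
bounds this by `-n²`, which closes the inequality in `n` alone. -/
lemma riccati_upper_deriv {s : ℝ} (hs : 0 < s) (ha : 0 < a s) {ρ q : ℝ}
    (hda : HasDerivAt a (-2 * b s) s) (hdb : HasDerivAt b (ρ - 2 / s * b s - 3 * q) s)
    (hρ : |ρ| ≤ K * a s) (hq : b s ^ 2 ≤ q * a s) :
    ∃ n', HasDerivAt (fun s => s * b s / a s) n' s ∧
      s * n' ≤ K * s ^ 2 - s * b s / a s - (s * b s / a s) ^ 2 := by
  refine ⟨_, ((hasDerivAt_id s).mul hdb).div hda ha.ne', ?_⟩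
  simp only [Pi.mul_apply, id]
  have h1 : s * (((1 * b s + s * (ρ - 2 / s * b s - 3 * q)) * a s - s * b s * (-2 * b s)) / a s ^ 2)
      = (-s * b s * a s + s ^ 2 * ρ * a s - 3 * s ^ 2 * (q * a s) + 2 * s ^ 2 * b s ^ 2)
        / a s ^ 2 := by
    field_simp; ring
  have h2 : K * s ^ 2 - s * b s / a s - (s * b s / a s) ^ 2
      = (K * s ^ 2 * a s ^ 2 - s * b s * a s - s ^ 2 * b s ^ 2) / a s ^ 2 := by
    field_simp
  rw [h1, h2]
  refine div_le_div_of_nonneg_right ?_ (by positivity)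
  have h3 : ρ * a s ≤ K * a s ^ 2 := by nlinarith [le_abs_self ρ]
  nlinarith [mul_le_mul_of_nonneg_left h3 (sq_nonneg s), mul_le_mul_of_nonneg_left hq (sq_nonneg s)]

/-- As above with opposite signs: `s² q / a - 2 n² ≥ -n²`. -/
lemma riccati_lower_deriv {s : ℝ} (hs : 0 < s) (ha : 0 < a s) {ρ q : ℝ}
    (hda : HasDerivAt a (2 * b s) s) (hdb : HasDerivAt b (ρ - 2 / s * b s + q) s)
    (hρ : |ρ| ≤ K * a s) (hq : b s ^ 2 ≤ q * a s) :
    ∃ m', HasDerivAt (fun s => s * b s / a s) m' s ∧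
      -(K * s ^ 2) - s * b s / a s - (s * b s / a s) ^ 2 ≤ s * m' := by
  refine ⟨_, ((hasDerivAt_id s).mul hdb).div hda ha.ne', ?_⟩
  simp only [Pi.mul_apply, id]
  have h1 : s * (((1 * b s + s * (ρ - 2 / s * b s + q)) * a s - s * b s * (2 * b s)) / a s ^ 2)
      = (-s * b s * a s + s ^ 2 * ρ * a s + s ^ 2 * (q * a s) - 2 * s ^ 2 * b s ^ 2)
        / a s ^ 2 := by
    field_simp; ring
  have h2 : -(K * s ^ 2) - s * b s / a s - (s * b s / a s) ^ 2
      = (-(K * s ^ 2 * a s ^ 2) - s * b s * a s - s ^ 2 * b s ^ 2) / a s ^ 2 := by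
    field_simp
  rw [h1, h2]
  refine div_le_div_of_nonneg_right ?_ (by positivity)
  have h3 : -(K * a s ^ 2) ≤ ρ * a s := by nlinarith [neg_abs_le ρ]
  nlinarith [mul_le_mul_of_nonneg_left h3 (sq_nonneg s), mul_le_mul_of_nonneg_left hq (sq_nonneg s)]

/-- The function `K s³ - s n` vanishes at `0`, and its derivative is at least `2 K s² + n²`. -/
lemma riccati_le {n : ℝ → ℝ} {r : ℝ} (hr : 0 < r) (hK : 0 ≤ K) (hn : ContinuousOn n (Set.Icc 0 r))
    (hd : ∀ s ∈ Set.Ioo 0 r, ∃ n', HasDerivAt n n' s ∧ s * n' ≤ K * s ^ 2 - n s - n s ^ 2) :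
    n r ≤ K * r ^ 2 := by
  have h1 : MonotoneOn (fun s => K * s ^ 3 - s * n s) (Set.Icc 0 r) := by
    choose! n' hn' hle using hd
    refine monotoneOn_of_hasDerivWithinAt_nonneg (convex_Icc 0 r) (by fun_prop)
      (f' := fun s => K * (3 * s ^ 2) - (1 * n s + s * n' s)) (fun s hs => ?_) fun s hs => ?_
    · rw [interior_Icc] at hs
      have := ((hasDerivAt_pow 3 s).const_mul K).sub ((hasDerivAt_id s).mul (hn' s hs))
      exact (this.congr_deriv (by norm_num)).hasDerivWithinAt
    · rw [interior_Icc] at hs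
      nlinarith [hle s hs, sq_nonneg (n s), mul_nonneg hK (sq_nonneg s)]
  have h2 := h1 (Set.left_mem_Icc.2 hr.le) (Set.right_mem_Icc.2 hr.le) hr.le
  simp only [zero_mul, sub_zero, ne_eq, OfNat.ofNat_ne_zero, not_false_eq_true, zero_pow,
    mul_zero] at h2
  by_contra! h3
  nlinarith [mul_lt_mul_of_pos_left h3 hr]

/-- In terms of `σ = (n + 1) / s` the inequality is `σ' ≤ K - σ²`. A very negative `σ` would blow up
before `r₁`, so existence up to `r₁` bounds it below. Quantitatively, `(K + 1) s - (r₁ - s)² σ` is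
monotone, and its second term vanishes at `r₁`. -/
lemma riccati_ge_far {n : ℝ → ℝ} {r r₁ : ℝ} (hr : 0 < r) (hr₁ : r < r₁) (hK : 0 ≤ K)
    (hr1 : r₁ ≤ 1) (hd : ∀ s ∈ Set.Icc r r₁, ∃ n', HasDerivAt n n' s ∧
      s * n' ≤ K * s ^ 2 - n s - n s ^ 2) :
    -((K + 1) / (r₁ - r) + 1) ≤ n r := by
  have h1 : MonotoneOn (fun s => (K + 1) * s - (r₁ - s) ^ 2 * ((n s + 1) / s)) (Set.Icc r r₁) := by
    choose! n' hn' hle using hd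
    have hder : ∀ s ∈ Set.Icc r r₁, HasDerivAt
        (fun s => (K + 1) * s - (r₁ - s) ^ 2 * ((n s + 1) / s))
        ((K + 1) * 1 - (2 * (r₁ - s) * (-1) * ((n s + 1) / s)
          + (r₁ - s) ^ 2 * ((n' s * s - (n s + 1) * 1) / s ^ 2))) s := fun s hs => by
      have hs0 : s ≠ 0 := (hr.trans_le hs.1).ne'
      have := ((hasDerivAt_id s).const_mul (K + 1)).sub ((((hasDerivAt_id s).const_sub r₁).pow 2).mul
        (((hn' s hs).add_const 1).div (hasDerivAt_id s) hs0))
      refine this.congr_deriv ?_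
      simp
    refine monotoneOn_of_hasDerivWithinAt_nonneg (convex_Icc r r₁)
      (fun s hs => (hder s hs).continuousAt.continuousWithinAt)
      (fun s hs => (hder s (interior_subset hs)).hasDerivWithinAt) fun s hs => ?_
    have hs' := interior_subset hs
    have hs0 : 0 < s := hr.trans_le hs'.1
    set σ := (n s + 1) / s with hσ
    have e1 : n s = s * σ - 1 := by rw [hσ]; field_simp; ring
    have e2 : (n' s * s - (n s + 1) * 1) / s ^ 2 ≤ K - σ ^ 2 := by
      rw [div_le_iff₀ (by positivity)]
      have := hle s hs'
      rw [e1] at this ⊢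
      nlinarith
    have e3 : 0 ≤ (r₁ - s) ^ 2 := sq_nonneg _
    have e4 : (r₁ - s) ^ 2 ≤ 1 := by nlinarith [hs'.2]
    nlinarith [mul_le_mul_of_nonneg_left e2 e3, sq_nonneg (1 + (r₁ - s) * σ),
      mul_le_mul_of_nonneg_right e4 hK]
  have h2 := h1 (Set.left_mem_Icc.2 hr₁.le) (Set.right_mem_Icc.2 hr₁.le) hr₁.le
  simp only [sub_self, ne_eq, OfNat.ofNat_ne_zero, not_false_eq_true, zero_pow, zero_mul,
    sub_zero] at h2
  have h3 : 0 < r₁ - r := sub_pos.2 hr₁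
  have h4 : -((K + 1) / (r₁ - r)) ≤ (n r + 1) / r := by
    rw [neg_le, ← neg_div, div_le_iff₀ hr, div_mul_eq_mul_div, le_div_iff₀ h3]
    have e1 : (n r + 1) / r * r = n r + 1 := by field_simp
    have e2 : -((r₁ - r) ^ 2 * ((n r + 1) / r)) * r ≤ (K + 1) * (r₁ - r) * r := by
      apply mul_le_mul_of_nonneg_right _ hr.le
      linarith
    have e3 : (r₁ - r) * (-(n r + 1) * (r₁ - r)) ≤ (r₁ - r) * ((K + 1) * r) := by
      rw [← e1]; nlinarith
    exact le_of_mul_le_mul_left e3 h3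
  have h5 : -((K + 1) / (r₁ - r)) * r ≤ n r + 1 := by
    rwa [le_div_iff₀ hr] at h4
  have h6 : 0 ≤ (K + 1) / (r₁ - r) := by positivity
  nlinarith

/-- A barrier argument for `-s m` against `K s³ + ε s`. At a contact point with `s > 0` one has `m =
-(K s² + ε)`, and the square of this is smaller than its modulus since `K s² ≤ 1/2` and `ε < 1/2`;
so the barrier is strictly steeper there. Then `ε → 0`. Unlike `riccati_ge_far`, this bound is
quadratic at the origin. -/
lemma riccati_ge_near {m : ℝ → ℝ} {r : ℝ} (hr : 0 < r) (hK : 0 ≤ K) (hKr : K * r ^ 2 ≤ 1 / 2)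
    (h0 : m 0 = 0) (hd : ∀ s ∈ Set.Icc 0 r, ∃ m', HasDerivAt m m' s ∧
      -(K * s ^ 2) - m s - m s ^ 2 ≤ s * m') : -(K * r ^ 2) ≤ m r := by
  choose! m' hm' hle using hd
  have key : ∀ ε ∈ Set.Ioo (0 : ℝ) (1 / 2), -(r * m r) ≤ K * r ^ 3 + ε * r := by
    intro ε hε
    have hder : ∀ s ∈ Set.Icc 0 r, HasDerivAt (fun s => -(s * m s)) (-(1 * m s + s * m' s)) s :=
      fun s hs => ((hasDerivAt_id s).mul (hm' s hs)).neg
    have hB : ∀ s, HasDerivAt (fun s : ℝ => K * s ^ 3 + ε * s) (K * (3 * s ^ 2) + ε * 1) s := by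
      intro s
      have := ((hasDerivAt_pow 3 s).const_mul K).add ((hasDerivAt_id s).const_mul ε)
      exact this.congr_deriv (by norm_num)
    refine image_le_of_deriv_right_lt_deriv_boundary (f := fun s => -(s * m s)) (a := 0) (b := r)
      (fun s hs => (hder s hs).continuousAt.continuousWithinAt)
      (fun s hs => (hder s ⟨hs.1, hs.2.le⟩).hasDerivWithinAt)
      (B := fun s => K * s ^ 3 + ε * s) (by simp) (fun s => hB s) (fun s hs heq => ?_)
      (Set.right_mem_Icc.2 hr.le)
    have hle' := hle s ⟨hs.1, hs.2.le⟩
    -- Contact at `s = 0` always happens; there the comparison of slopes is `0 < ε`.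
    have h1 : m s = -(K * s ^ 2 + ε) ∨ m s = 0 ∧ s = 0 := by
      rcases hs.1.eq_or_lt with h | h
      · right; rw [← h]; exact ⟨h0, rfl⟩
      · left
        have : s * (m s + (K * s ^ 2 + ε)) = 0 := by linarith
        rcases mul_eq_zero.1 this with h' | h'
        · exact absurd h' h.ne'
        · linarith
    have hs2 : s ^ 2 ≤ r ^ 2 := pow_le_pow_left₀ hs.1 hs.2.le 2
    have hKs : K * s ^ 2 ≤ 1 / 2 := (mul_le_mul_of_nonneg_left hs2 hK).trans hKr
    have hKs0 : 0 ≤ K * s ^ 2 := mul_nonneg hK (sq_nonneg s)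
    rcases h1 with h1 | ⟨h1, h2⟩
    · rw [h1] at hle' ⊢
      have h3 : (K * s ^ 2 + ε) ^ 2 ≤ K * s ^ 2 + ε := by nlinarith [hε.1, hε.2]
      rcases hs.1.eq_or_lt with h | h
      · exfalso
        rw [← h] at h1
        simp only [h0] at h1
        nlinarith [hε.1]
      · have : 0 < K * s ^ 2 + ε - (K * s ^ 2 + ε) ^ 2 := by nlinarith [hε.1, hε.2]
        nlinarith
    · rw [h1, h2]; simp [hε.1]
  have h1 : -(r * m r) ≤ K * r ^ 3 := by
    refine le_of_forall_pos_le_add fun δ hδ => ?_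
    have := key (min (δ / r) (1 / 4)) ⟨by positivity, by
      exact (min_le_right _ _).trans_lt (by norm_num)⟩
    refine this.trans ?_
    gcongr
    calc min (δ / r) (1 / 4) * r ≤ δ / r * r := by gcongr; exact min_le_left _ _
      _ = δ := by field_simp
  by_contra! h2
  nlinarith [mul_lt_mul_of_pos_left h2 hr]

end Riccati

end QKFlow

end

noncomputable section

namespace QKFlow

open Matrix Finset

/-! ### Matrix Riccati equations -/

lemma quad_inv_mul {A X : Mat} (hA : IsUnit A.det) (hs : Aᵀ = A) (w : Fin 8 → ℝ) :
    quad (A⁻¹ * X) (A *ᵥ w) = quad (X * A) w := by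
  have h1 : (A *ᵥ w) ᵥ* A⁻¹ = w := by
    rw [← Matrix.vecMul_transpose, hs, Matrix.vecMul_vecMul, Matrix.mul_nonsing_inv _ hA,
      Matrix.vecMul_one]
  rw [quad, quad, ← Matrix.mulVec_mulVec, Matrix.dotProduct_mulVec, h1, Matrix.mulVec_mulVec]

lemma symm_of_frame {A P : Mat} (h : P * A * Pᵀ = 1) : Aᵀ = A := by
  obtain ⟨h1, -, h3⟩ := frame_mul_inv h
  have e1 : (P * A * Pᵀ)ᵀ = 1 := by rw [h, Matrix.transpose_one]
  rw [Matrix.transpose_mul, Matrix.transpose_mul, Matrix.transpose_transpose,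
    ← Matrix.mul_assoc] at e1
  have hPt : IsUnit Pᵀ.det := by rwa [Matrix.det_transpose]
  have key : ∀ X : Mat, P * X * Pᵀ = 1 → X = P⁻¹ * (Pᵀ)⁻¹ := fun X hX => by
    calc X = P⁻¹ * (P * X * Pᵀ) * (Pᵀ)⁻¹ := by
          simp only [← Matrix.mul_assoc]
          rw [Matrix.nonsing_inv_mul _ h3, Matrix.one_mul, Matrix.mul_assoc,
            Matrix.mul_nonsing_inv _ hPt, Matrix.mul_one]
      _ = _ := by rw [hX, Matrix.mul_one]
  rw [key _ e1, ← key _ h]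

section MatrixRiccati

variable {A N R : ℝ → Mat} {K s : ℝ} {P : Mat} (hP : P * A s * Pᵀ = 1)
  (hA : MatDeriv A (N s * A s + (N s * A s)ᵀ) s) (hNA : (N s * A s)ᵀ = N s * A s)
  (hN : MatDeriv N (R s - (2 / s) • N s - N s * N s) s)
  (hR : ∀ w, |quad (R s * A s) w| ≤ K * quad (A s) w)

include hP hNA

lemma quad_mul_mul (w : Fin 8 → ℝ) : quad (N s * N s * A s) w = quad (A s) (w ᵥ* N s) := by
  rw [Matrix.mul_assoc, ← hNA, Matrix.transpose_mul, symm_of_frame hP, ← Matrix.mul_assoc,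
    quad_conj]

lemma sq_quad_le (w : Fin 8 → ℝ) :
    quad (N s * A s) w ^ 2 ≤ quad (N s * N s * A s) w * quad (A s) w := by
  rw [quad_mul_mul hP hNA, quad, ← Matrix.mulVec_mulVec, Matrix.dotProduct_mulVec]
  exact sq_dotProduct_le hP _ _

include hA hN hR

/-- Testing on a fixed vector, the derivative of `N A` carries `+N²A`, so Cauchy–Schwarz yields a
lower inequality only. -/
lemma radial_lower (hs : 0 < s) {w : Fin 8 → ℝ} (hw : w ≠ 0) :
    ∃ m', HasDerivAt (fun s => s * quad (N s * A s) w / quad (A s) w) m' s ∧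
      -(K * s ^ 2) - s * quad (N s * A s) w / quad (A s) w
        - (s * quad (N s * A s) w / quad (A s) w) ^ 2 ≤ s * m' := by
  refine riccati_lower_deriv (a := fun s => quad (A s) w) (b := fun s => quad (N s * A s) w) hs
    (quad_pos_of_frame hP hw) (ρ := quad (R s * A s) w) (q := quad (N s * N s * A s) w)
    ((hA.quad w).congr_deriv ?_) (((hN.mul hA).quad w).congr_deriv ?_) (hR w)
    (sq_quad_le hP hNA w)
  · rw [quad_add, quad_transpose]; ring
  · rw [hNA]
    simp only [sub_mul, mul_add, Matrix.smul_mul, quad_add, quad_sub, quad_smul,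
      Matrix.mul_assoc]
    ring

/-- Testing on a fixed covector, `A⁻¹` decreases by `2 A⁻¹ N`, so the quadratic term in the
derivative of `A⁻¹ N` is `-3 A⁻¹ N²`; this gives the upper inequality missing for vectors. -/
lemma radial_upper (hs : 0 < s) {ξ : Fin 8 → ℝ} (hξ : ξ ≠ 0) :
    ∃ n', HasDerivAt (fun s => s * quad ((A s)⁻¹ * N s) ξ / quad (A s)⁻¹ ξ) n' s ∧
      s * n' ≤ K * s ^ 2 - s * quad ((A s)⁻¹ * N s) ξ / quad (A s)⁻¹ ξ
        - (s * quad ((A s)⁻¹ * N s) ξ / quad (A s)⁻¹ ξ) ^ 2 := by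
  have hu := isUnit_det_of_frame hP
  have hsym := symm_of_frame hP
  set w := (A s)⁻¹ *ᵥ ξ with hw
  have hξw : ξ = A s *ᵥ w := by
    rw [hw, Matrix.mulVec_mulVec, Matrix.mul_nonsing_inv _ hu, Matrix.one_mulVec]
  have hw0 : w ≠ 0 := fun h => hξ (by rw [hξw, h, Matrix.mulVec_zero])
  have e0 : quad (A s)⁻¹ ξ = quad (A s) w := by
    have := quad_inv_mul (X := 1) hu hsym w
    rwa [Matrix.mul_one, Matrix.one_mul, ← hξw] at this
  have e1 : ∀ X, quad ((A s)⁻¹ * X) ξ = quad (X * A s) w := fun X => by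
    rw [hξw, quad_inv_mul hu hsym]
  have hAi : MatDeriv (fun s => (A s)⁻¹) ((-2 : ℝ) • ((A s)⁻¹ * N s)) s := by
    have h1 : -((A s)⁻¹ * (N s * A s + (N s * A s)ᵀ) * (A s)⁻¹) = (-2 : ℝ) • ((A s)⁻¹ * N s) := by
      rw [hNA, mul_add, add_mul, Matrix.mul_assoc, Matrix.mul_assoc, Matrix.mul_nonsing_inv _ hu,
        Matrix.mul_one, ← two_smul ℝ, neg_smul]
    rw [← h1]
    exact hA.inv hu
  refine riccati_upper_deriv (a := fun s => quad (A s)⁻¹ ξ) (b := fun s => quad ((A s)⁻¹ * N s) ξ)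
    hs (by rw [e0]; exact quad_pos_of_frame hP hw0) (ρ := quad ((A s)⁻¹ * R s) ξ)
    (q := quad ((A s)⁻¹ * (N s * N s)) ξ) ((hAi.quad ξ).congr_deriv ?_)
    (((hAi.mul hN).quad ξ).congr_deriv ?_) ?_ ?_
  · rw [quad_smul]
  · simp only [mul_sub, Matrix.smul_mul, Matrix.mul_smul, quad_add, quad_sub, quad_smul,
      Matrix.mul_assoc]
    ring
  · rw [e1, e0]; exact hR w
  · rw [e1, e1, e0]; exact sq_quad_le hP hNA w

end MatrixRiccati

/-- The quotient for the vector `w` and that for the covector `ξ = A(s) w` coincide at the single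
point `s`. The upper bound comes from the covector by `riccati_le`, the lower bound from the vector
for small `s` by `riccati_ge_near`, and again from the covector for large `s` by `riccati_ge_far`.
-/
lemma exists_radial_bound {K r₀ : ℝ} (hK : 0 ≤ K) (hr₀ : r₀ < 1) :
    ∃ C, 0 < C ∧ ∀ A N R : ℝ → Mat, (∀ s ∈ Set.Ico (0 : ℝ) 1, ∃ P : Mat, P * A s * Pᵀ = 1) →
      (∀ s ∈ Set.Ico (0 : ℝ) 1, MatDeriv A (N s * A s + (N s * A s)ᵀ) s) →
      (∀ s ∈ Set.Ico (0 : ℝ) 1, ∃ N', MatDeriv N N' s) →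
      (∀ s ∈ Set.Ioo (0 : ℝ) 1, (N s * A s)ᵀ = N s * A s) →
      (∀ s ∈ Set.Ioo (0 : ℝ) 1, MatDeriv N (R s - (2 / s) • N s - N s * N s) s) →
      (∀ s ∈ Set.Ioo (0 : ℝ) 1, ∀ w, |quad (R s * A s) w| ≤ K * quad (A s) w) →
      ∀ s ∈ Set.Ioc 0 r₀, ∀ w, |s * quad (N s * A s) w| ≤ C * s ^ 2 * quad (A s) w := by
  -- Small enough that `K δ² ≤ 1/2`, as `riccati_ge_near` requires; beyond `δ` a constant bound is
  -- as good as a quadratic one, up to the factor `1 / δ²`.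
  set δ : ℝ := 1 / (2 * (K + 1)) with hδ
  have hδ0 : 0 < δ := by positivity
  have hδ1 : δ < 1 := by
    rw [hδ, div_lt_one (by positivity)]; linarith
  have hKδ : K * δ ^ 2 ≤ 1 / 2 := by
    have : K * δ ≤ 1 / 2 := by
      rw [hδ, mul_one_div, div_le_div_iff₀ (by positivity) (by norm_num)]; linarith
    nlinarith
  -- The solution lives on all of `[0, 1)`; the gap between `r₀` and `r₁` is the room used by
  -- `riccati_ge_far`.
  set r₁ : ℝ := (1 + r₀) / 2 with hr₁
  have hr01 : r₀ < r₁ := by linarith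
  have hr11 : r₁ < 1 := by linarith
  set C₂ : ℝ := (K + 1) / (r₁ - r₀) + 1 with hC₂
  have hrr : 0 < r₁ - r₀ := sub_pos.2 hr01
  have hC₂0 : 0 < C₂ := by positivity
  refine ⟨K + C₂ / δ ^ 2, by positivity, fun A N R hP hA hN' hNA hN hR s hs w => ?_⟩
  by_cases hw : w = 0
  · simp [hw, quad]
  have hs1 : s < 1 := hs.2.trans_lt hr₀
  have hIco : ∀ r ∈ Set.Icc 0 s, r ∈ Set.Ico (0 : ℝ) 1 := fun r hr => ⟨hr.1, hr.2.trans_lt hs1⟩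
  obtain ⟨P, hPs⟩ := hP s ⟨hs.1.le, hs1⟩
  have hu := isUnit_det_of_frame hPs
  have hsym := symm_of_frame hPs
  have hpos := quad_pos_of_frame hPs hw
  set ξ := A s *ᵥ w with hξ
  have hξ0 : ξ ≠ 0 := fun h => hw (by
    rw [← Matrix.one_mulVec w, ← Matrix.nonsing_inv_mul _ hu, ← Matrix.mulVec_mulVec, ← hξ, h,
      Matrix.mulVec_zero])
  set n : ℝ → ℝ := fun s => s * quad ((A s)⁻¹ * N s) ξ / quad (A s)⁻¹ ξ with hn
  set m : ℝ → ℝ := fun s => s * quad (N s * A s) w / quad (A s) w with hm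
  have hmn : m s = n s := by
    have e0 : quad (A s)⁻¹ ξ = quad (A s) w := by
      have := quad_inv_mul (X := 1) hu hsym w
      rwa [Matrix.mul_one, Matrix.one_mul] at this
    simp only [hm, hn]
    rw [hξ, quad_inv_mul hu hsym, ← hξ, e0]
  have hn' : ∀ r ∈ Set.Ioo (0 : ℝ) 1, ∃ n', HasDerivAt n n' r ∧
      r * n' ≤ K * r ^ 2 - n r - n r ^ 2 := fun r hr => by
    obtain ⟨P, hPr⟩ := hP r ⟨hr.1.le, hr.2⟩
    exact radial_upper hPr (hA r ⟨hr.1.le, hr.2⟩) (hNA r hr) (hN r hr) (hR r hr) hr.1 hξ0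
  have hm' : ∀ r ∈ Set.Ico (0 : ℝ) 1, ∃ m', HasDerivAt m m' r ∧
      -(K * r ^ 2) - m r - m r ^ 2 ≤ r * m' := fun r hr => by
    obtain ⟨P, hPr⟩ := hP r hr
    -- At `r = 0` the Riccati equation is singular, but the claimed inequality reads `0 ≤ 0`, so
    -- only differentiability is needed.
    rcases hr.1.eq_or_lt with h | h
    · obtain ⟨N', hN'r⟩ := hN' r hr
      refine ⟨_, ((hasDerivAt_id r).mul ((hN'r.mul (hA r hr)).quad w)).div ((hA r hr).quad w)
        (quad_pos_of_frame hPr hw).ne', ?_⟩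
      rw [← h]
      simp [hm]
    · exact radial_lower hPr (hA r hr) (hNA r ⟨h, hr.2⟩) (hN r ⟨h, hr.2⟩) (hR r ⟨h, hr.2⟩) h hw
  have hncont : ContinuousOn n (Set.Icc 0 s) := fun r hr => by
    obtain ⟨P, hPr⟩ := hP r (hIco r hr)
    obtain ⟨N', hN'r⟩ := hN' r (hIco r hr)
    have hur := isUnit_det_of_frame hPr
    have hAi := (hA r (hIco r hr)).inv hur
    have hne : quad (A r)⁻¹ ξ ≠ 0 := by
      have hξr : ξ = A r *ᵥ ((A r)⁻¹ *ᵥ ξ) := by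
        rw [Matrix.mulVec_mulVec, Matrix.mul_nonsing_inv _ hur, Matrix.one_mulVec]
      have h0 : (A r)⁻¹ *ᵥ ξ ≠ 0 := fun h => hξ0 (by rw [hξr, h, Matrix.mulVec_zero])
      have := quad_inv_mul (X := 1) hur (symm_of_frame hPr) ((A r)⁻¹ *ᵥ ξ)
      rw [Matrix.mul_one, Matrix.one_mul, ← hξr] at this
      rw [this]
      exact (quad_pos_of_frame hPr h0).ne'
    exact (((hasDerivAt_id r).mul ((hAi.mul hN'r).quad ξ)).div
      (hAi.quad ξ) hne).continuousAt.continuousWithinAt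
  have hup : m s ≤ K * s ^ 2 := by
    rw [hmn]
    exact riccati_le hs.1 hK hncont fun r hr => hn' r ⟨hr.1, hr.2.trans hs1⟩
  have hlow : -((K + C₂ / δ ^ 2) * s ^ 2) ≤ m s := by
    rcases le_or_gt s δ with hsδ | hsδ
    · have h1 : s ^ 2 ≤ δ ^ 2 := pow_le_pow_left₀ hs.1.le hsδ 2
      have h2 := riccati_ge_near hs.1 hK ((mul_le_mul_of_nonneg_left h1 hK).trans hKδ)
        (by simp [hm]) fun r hr => hm' r (hIco r hr)
      have h3 : 0 ≤ C₂ / δ ^ 2 * s ^ 2 := by positivity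
      linarith
    · have h1 : δ ^ 2 ≤ s ^ 2 := pow_le_pow_left₀ hδ0.le hsδ.le 2
      have h2 := riccati_ge_far hs.1 (hs.2.trans_lt hr01) hK hr11.le fun r hr =>
        hn' r ⟨hs.1.trans_le hr.1, hr.2.trans_lt hr11⟩
      have h3 : (K + 1) / (r₁ - s) + 1 ≤ C₂ := by
        rw [hC₂]; gcongr; exact hs.2
      have h4 : C₂ ≤ C₂ / δ ^ 2 * s ^ 2 := by
        rw [div_mul_eq_mul_div, le_div_iff₀ (by positivity)]
        gcongr
      have h5 : 0 ≤ K * s ^ 2 := by positivity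
      rw [hmn]
      linarith
  have hfin : |m s| ≤ (K + C₂ / δ ^ 2) * s ^ 2 := by
    rw [abs_le]
    refine ⟨hlow, hup.trans ?_⟩
    have : 0 ≤ C₂ / δ ^ 2 * s ^ 2 := by positivity
    linarith
  have he : s * quad (N s * A s) w = m s * quad (A s) w := by
    simp only [hm]; field_simp
  rw [he, abs_mul, abs_of_pos hpos]
  exact mul_le_mul_of_nonneg_right hfin hpos.le

end QKFlow

end

noncomputable section

namespace QKFlow

open Matrix Finset

/-! ### Metrics in geodesic normal coordinates -/

/-- `gm` is a metric on the unit ball for which the standard coordinates are geodesic normal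
coordinates. -/
structure NormalMetric (gm : E8 → Mat) : Prop where
  metric : ChartMetric (Metric.ball (0 : E8) 1) gm
  center : gm 0 = 1
  geodesic : ∀ y ∈ Metric.ball (0 : E8) 1, ∀ k,
    ∑ i, ∑ j, christoffel gm y k i j * y i * y j = 0

lemma hasDerivAt_ray {f : E8 → ℝ} {v : E8} {s : ℝ} (hf : DifferentiableAt ℝ f (s • v)) :
    HasDerivAt (fun r : ℝ => f (r • v)) (∑ m, v m * pderiv m f (s • v)) s := by
  rw [← fderiv_eq_sum_pderiv]
  exact HasFDerivAt.comp_hasDerivAt (l := f) s hf.hasFDerivAt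
    (((hasDerivAt_id s).smul_const v).congr_deriv (one_smul _ _))

lemma matDeriv_ray {F : E8 → Mat} {v : E8} {s : ℝ} (hF : MatDiff F (s • v)) :
    MatDeriv (fun r : ℝ => F (r • v)) (∑ m, v m • pdMat m F (s • v)) s := fun i j => by
  have := hasDerivAt_ray (hF i j)
  refine this.congr_deriv ?_
  rw [Matrix.sum_apply]
  rfl

/-- The connection matrix `Σ yₘ γₘ` in the radial direction. -/
def radGam (gm : E8 → Mat) (y : E8) : Mat := ∑ m, y m • gam gm m y

namespace NormalMetric

variable {gm : E8 → Mat} (h : NormalMetric gm) {y : E8}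

lemma smul_mem_ball {y : E8} (hy : y ∈ Metric.ball (0 : E8) 1) {s : ℝ} (hs : s ∈ Set.Icc (0 : ℝ) 1) :
    s • y ∈ Metric.ball (0 : E8) 1 := by
  rw [mem_ball_zero_iff] at hy ⊢
  rw [norm_smul, Real.norm_eq_abs, abs_of_nonneg hs.1]
  nlinarith [norm_nonneg y, hs.2]

include h

lemma matDiff (hy : y ∈ Metric.ball (0 : E8) 1) : MatDiff gm y :=
  h.metric.smooth.matDiff h.metric.isOpen hy

lemma vecMul_radGam (hy : y ∈ Metric.ball (0 : E8) 1) (k : Fin 8) :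
    ∑ i, y i * radGam gm y i k = 0 := by
  rw [← h.geodesic y hy k]
  simp only [radGam, Matrix.sum_apply, Matrix.smul_apply, smul_eq_mul, mul_sum]
  rw [sum_comm]
  exact sum_congr rfl fun m _ => sum_congr rfl fun i _ => by simp only [gam, Matrix.of_apply]; ring

lemma radGam_apply (hy : y ∈ Metric.ball (0 : E8) 1) (n k : Fin 8) :
    radGam gm y n k = ∑ i, y i * gam gm n y i k := by
  simp only [radGam, Matrix.sum_apply, Matrix.smul_apply, smul_eq_mul]
  exact sum_congr rfl fun i _ => by rw [h.metric.gam_comm hy]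

/-- The geodesic equation `Γᵏₘᵢ yᵐ yⁱ = 0` with its index lowered by Koszul's formula. -/
lemma radial_pderiv (hy : y ∈ Metric.ball (0 : E8) 1) (j : Fin 8) :
    2 * ∑ m, ∑ i, y m * y i * pderiv m (fun z => gm z i j) y
      = ∑ m, ∑ i, y m * y i * pderiv j (fun z => gm z m i) y := by
  have h1 : ∑ m, ∑ i, y m * y i * (gam gm m y * gm y) i j = 0 := by
    have e1 : ∑ m, ∑ i, y m * y i * (gam gm m y * gm y) i j
        = ∑ l, (∑ i, y i * radGam gm y i l) * gm y l j := by
      simp only [radGam, Matrix.sum_apply, Matrix.smul_apply, smul_eq_mul, Matrix.mul_apply,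
        mul_sum, sum_mul]
      calc _ = ∑ m, ∑ l, ∑ i, y m * y i * (gam gm m y i l * gm y l j) :=
            sum_congr rfl fun m _ => sum_comm
        _ = ∑ l, ∑ m, ∑ i, y m * y i * (gam gm m y i l * gm y l j) := sum_comm
        _ = ∑ l, ∑ i, ∑ m, y m * y i * (gam gm m y i l * gm y l j) :=
            sum_congr rfl fun l _ => sum_comm
        _ = _ := sum_congr rfl fun l _ => sum_congr rfl fun i _ => sum_congr rfl fun m _ => by ring
    rw [e1]
    exact sum_eq_zero fun l _ => by rw [h.vecMul_radGam hy, zero_mul]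
  simp only [h.metric.gam_mul hy] at h1
  have h2 : ∑ m, ∑ i, y m * y i * pderiv i (fun z => gm z m j) y
      = ∑ m, ∑ i, y m * y i * pderiv m (fun z => gm z i j) y := by
    rw [sum_comm]
    exact sum_congr rfl fun m _ => sum_congr rfl fun i _ => by ring
  have h3 : ∑ m, ∑ i, y m * y i * (1 / 2 * (pderiv m (fun z => gm z i j) y
      + pderiv i (fun z => gm z m j) y - pderiv j (fun z => gm z m i) y))
      = 1 / 2 * (∑ m, ∑ i, y m * y i * pderiv m (fun z => gm z i j) y
        + ∑ m, ∑ i, y m * y i * pderiv i (fun z => gm z m j) y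
        - ∑ m, ∑ i, y m * y i * pderiv j (fun z => gm z m i) y) := by
    simp only [← sum_add_distrib, ← sum_sub_distrib, mul_sum]
    exact sum_congr rfl fun m _ => sum_congr rfl fun i _ => by ring
  rw [h3, h2] at h1
  linarith

/-- Rays have constant speed: contracting `radial_pderiv` with `y` once more makes the derivative
along the ray equal to twice itself, hence zero, and the value at the centre is Euclidean. -/
lemma quad_self (hy : y ∈ Metric.ball (0 : E8) 1) : quad (gm y) y = ‖y‖ ^ 2 := by
  have hcont : ∀ s ∈ Set.Icc (0 : ℝ) 1, HasDerivAt (fun r : ℝ => quad (gm (r • y)) y)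
      (quad (∑ m, y m • pdMat m gm (s • y)) y) s := fun s hs =>
    (matDeriv_ray (h.matDiff (smul_mem_ball hy hs))).quad _
  have hzero : ∀ s ∈ Set.Ioo (0 : ℝ) 1, quad (∑ m, y m • pdMat m gm (s • y)) y = 0 := by
    intro s hs
    have h1 := h.radial_pderiv (smul_mem_ball hy ⟨hs.1.le, hs.2.le⟩)
    have e1 : quad (∑ m, y m • pdMat m gm (s • y)) y
        = ∑ j, y j * ∑ m, ∑ i, y m * y i * pderiv m (fun z => gm z i j) (s • y) := by
      simp only [quad_eq, Matrix.sum_apply, Matrix.smul_apply, smul_eq_mul, mul_sum, sum_mul, pdMat,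
        Matrix.of_apply]
      calc _ = ∑ j, ∑ i, ∑ m, y i * (y m * pderiv m (fun z => gm z i j) (s • y)) * y j := sum_comm
        _ = ∑ j, ∑ m, ∑ i, y i * (y m * pderiv m (fun z => gm z i j) (s • y)) * y j :=
            sum_congr rfl fun j _ => sum_comm
        _ = _ := sum_congr rfl fun j _ => sum_congr rfl fun m _ => sum_congr rfl fun i _ => by ring
    have e2 : quad (∑ m, y m • pdMat m gm (s • y)) y
        = ∑ j, y j * ∑ m, ∑ i, y m * y i * pderiv j (fun z => gm z m i) (s • y) := by
      simp only [quad_eq, Matrix.sum_apply, Matrix.smul_apply, smul_eq_mul, mul_sum, sum_mul, pdMat,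
        Matrix.of_apply]
      calc _ = ∑ m, ∑ j, ∑ i, y m * (y j * pderiv j (fun z => gm z m i) (s • y)) * y i :=
            sum_congr rfl fun m _ => sum_comm
        _ = ∑ j, ∑ m, ∑ i, y m * (y j * pderiv j (fun z => gm z m i) (s • y)) * y i := sum_comm
        _ = _ := sum_congr rfl fun j _ => sum_congr rfl fun m _ => sum_congr rfl fun i _ => by ring
    have e3 : 2 * quad (∑ m, y m • pdMat m gm (s • y)) y
        = quad (∑ m, y m • pdMat m gm (s • y)) y := by
      conv_lhs => rw [e1]
      rw [e2, mul_sum]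
      refine sum_congr rfl fun j _ => ?_
      have h2 := h1 j
      simp only [PiLp.smul_apply, smul_eq_mul] at h2
      have e4 : ∀ X : Fin 8 → Fin 8 → ℝ, ∑ m, ∑ i, s * y m * (s * y i) * X m i
          = s ^ 2 * ∑ m, ∑ i, y m * y i * X m i := fun X => by
        simp only [mul_sum]
        exact sum_congr rfl fun m _ => sum_congr rfl fun i _ => by ring
      rw [e4, e4, mul_left_comm] at h2
      have h5 := mul_left_cancel₀ (pow_ne_zero 2 hs.1.ne') h2
      rw [← h5]; ring
    linarith
  obtain ⟨ξ, hξ, hξ'⟩ := exists_hasDerivAt_eq_slope (fun r : ℝ => quad (gm (r • y)) y) _ one_pos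
    (fun s hs => (hcont s hs).continuousAt.continuousWithinAt)
    (fun s hs => hcont s ⟨hs.1.le, hs.2.le⟩)
  rw [hzero ξ hξ] at hξ'
  simp only [one_smul, zero_smul, sub_zero, div_one, h.center] at hξ'
  rw [eq_comm, sub_eq_zero] at hξ'
  rw [hξ', EuclideanSpace.norm_sq_eq]
  simp [quad, dotProduct, pow_two]

/-- The Gauss lemma. -/
lemma mulVec_self (hy : y ∈ Metric.ball (0 : E8) 1) (k : Fin 8) : ∑ j, gm y k j * y j = y k := by
  -- Combine `radial_pderiv` with the gradient of the identity `Σ gᵢⱼ zᵢ zⱼ = |z|²`.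
  have hd : ∀ z ∈ Metric.ball (0 : E8) 1, ∀ k : Fin 8,
      (∑ m, ∑ i, z m * z i * pderiv m (fun w => gm w i k) z) + ∑ j, gm z k j * z j = z k := by
    intro z hz k
    have h1 := h.radial_pderiv hz k
    have h2 : pderiv k (fun z => ∑ i, ∑ j, gm z i j * (z i * z j)) z
        = pderiv k (fun z : E8 => ∑ i, z i * z i) z := by
      refine pderiv_congr h.metric.isOpen (fun w hw => ?_) hz k
      have := h.quad_self hw
      rw [quad_eq, EuclideanSpace.norm_sq_eq] at this
      rw [show ∑ i, w i * w i = ∑ i, ‖w i‖ ^ 2 by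
        refine sum_congr rfl fun i _ => ?_
        rw [Real.norm_eq_abs, sq_abs, pow_two], ← this]
      exact sum_congr rfl fun i _ => sum_congr rfl fun j _ => by ring
    have hc : ∀ i : Fin 8, DifferentiableAt ℝ (fun z : E8 => z i) z := fun i =>
      (coordL i).differentiableAt
    have hg := h.matDiff hz
    rw [pderiv_sum (fun i _ => DifferentiableAt.fun_sum fun j _ =>
      (hg i j).fun_mul ((hc i).fun_mul (hc j))), pderiv_sum (fun i _ => (hc i).fun_mul (hc i))] at h2
    have h3 : ∀ i, pderiv k (fun z => ∑ j, gm z i j * (z i * z j)) z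
        = ∑ j, (pderiv k (fun z => gm z i j) z * (z i * z j)
          + gm z i j * ((if k = i then 1 else 0) * z j + z i * (if k = j then 1 else 0))) := by
      intro i
      rw [pderiv_sum (fun j _ => (hg i j).fun_mul ((hc i).fun_mul (hc j)))]
      refine sum_congr rfl fun j _ => ?_
      rw [pderiv_mul (hg i j) ((hc i).fun_mul (hc j)), pderiv_mul (hc i) (hc j), pderiv_coord,
        pderiv_coord]
    have h4 : ∀ i, pderiv k (fun z : E8 => z i * z i) z
        = 2 * ((if k = i then 1 else 0) * z i) := by
      intro i
      rw [pderiv_mul (hc i) (hc i), pderiv_coord]; ring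
    simp only [h3, h4, mul_add, sum_add_distrib, ← mul_sum] at h2
    have e1 : ∑ i, ∑ j, gm z i j * ((if k = i then 1 else 0) * z j) = ∑ j, gm z k j * z j := by
      simp
    have e2 : ∑ i, ∑ j, gm z i j * (z i * (if k = j then 1 else 0)) = ∑ j, gm z k j * z j := by
      simp only [mul_ite, mul_one, mul_zero, sum_ite_eq, mem_univ, if_true]
      refine sum_congr rfl fun i _ => ?_
      conv_lhs => rw [← h.metric.symm z hz]
      rfl
    have e3 : ∑ i, ((if k = i then 1 else 0) * z i) = z k := by simp
    have e4 : ∑ i, ∑ j, pderiv k (fun z => gm z i j) z * (z i * z j)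
        = ∑ m, ∑ i, z m * z i * pderiv k (fun z => gm z m i) z :=
      sum_congr rfl fun i _ => sum_congr rfl fun j _ => by ring
    rw [e1, e2, e3, e4] at h2
    linarith
  -- By `hd` at `s y` the derivative of `r (g(r y) y - y)` vanishes; the function is zero at `r =
  -- 0`, hence also at `r = 1`.
  have hder : ∀ s ∈ Set.Icc (0 : ℝ) 1, HasDerivAt
      (fun r : ℝ => r * (∑ j, gm (r • y) k j * y j - y k))
      (1 * (∑ j, gm (s • y) k j * y j - y k)
        + s * ∑ j, (∑ m, y m • pdMat m gm (s • y)) k j * y j) s := fun s hs => by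
    have h1 := matDeriv_ray (v := y) (h.matDiff (smul_mem_ball hy hs))
    exact (hasDerivAt_id s).mul ((HasDerivAt.fun_sum fun j _ =>
      (h1 k j).mul_const (y j)).sub_const (y k))
  obtain ⟨s, hs, hs'⟩ := exists_hasDerivAt_eq_slope _ _ one_pos
    (fun s hs => (hder s hs).continuousAt.continuousWithinAt)
    (fun s hs => hder s ⟨hs.1.le, hs.2.le⟩)
  have hsy := smul_mem_ball hy ⟨hs.1.le, hs.2.le⟩
  have h1 := hd _ hsy k
  have e1 : ∑ j, (∑ m, y m • pdMat m gm (s • y)) k j * y j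
      = ∑ m, ∑ i, y m * y i * pderiv m (fun w => gm w i k) (s • y) := by
    simp only [Matrix.sum_apply, Matrix.smul_apply, smul_eq_mul, sum_mul, pdMat, Matrix.of_apply]
    rw [sum_comm]
    refine sum_congr rfl fun m _ => sum_congr rfl fun i _ => ?_
    rw [h.metric.pderiv_symm hsy m k i]; ring
  have h2 : s * (1 * (∑ j, gm (s • y) k j * y j - y k)
      + s * ∑ m, ∑ i, y m * y i * pderiv m (fun w => gm w i k) (s • y)) = 0 := by
    simp only [PiLp.smul_apply, smul_eq_mul] at h1
    have e2 : ∑ m, ∑ i, s * y m * (s * y i) * pderiv m (fun w => gm w i k) (s • y)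
        = s * (s * ∑ m, ∑ i, y m * y i * pderiv m (fun w => gm w i k) (s • y)) := by
      simp only [mul_sum]
      exact sum_congr rfl fun m _ => sum_congr rfl fun i _ => by ring
    have e3 : ∑ j, gm (s • y) k j * (s * y j) = s * ∑ j, gm (s • y) k j * y j := by
      simp only [mul_sum]
      exact sum_congr rfl fun m _ => by ring
    rw [e2, e3] at h1
    linear_combination h1
  rw [e1, (mul_eq_zero.1 h2).resolve_left hs.1.ne'] at hs'
  simp only [one_smul, zero_mul, sub_zero, div_one, one_mul] at hs'
  linarith

/-- In Koszul's formula contracted with `y` the last two terms are equal, as differentiating the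
Gauss lemma shows. So the radial connection matrix is half the radial derivative of the metric, and
in particular symmetric after lowering. -/
lemma radGam_mul (hy : y ∈ Metric.ball (0 : E8) 1) (i j : Fin 8) :
    (radGam gm y * gm y) i j = (1 / 2) * ∑ m, y m * pderiv m (fun z => gm z i j) y := by
  have hc : ∀ i : Fin 8, DifferentiableAt ℝ (fun z : E8 => z i) y := fun i =>
    (coordL i).differentiableAt
  have hg := h.matDiff hy
  have h1 : ∀ i j, ∑ m, y m * pderiv i (fun z => gm z m j) y = (if i = j then 1 else 0) - gm y i j := by
    intro i j
    have h2 : pderiv i (fun z => ∑ m, gm z j m * z m) y = pderiv i (fun z : E8 => z j) y :=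
      pderiv_congr h.metric.isOpen (fun z hz => h.mulVec_self hz j) hy i
    rw [pderiv_sum (fun m _ => (hg j m).fun_mul (hc m)), pderiv_coord] at h2
    simp only [pderiv_mul (hg j _) (hc _), pderiv_coord, sum_add_distrib, mul_ite, mul_one,
      mul_zero, sum_ite_eq, mem_univ, if_true] at h2
    have e1 : gm y i j = gm y j i := by
      conv_lhs => rw [← h.metric.symm y hy]
      rfl
    rw [← h2, e1, add_sub_cancel_right]
    exact sum_congr rfl fun m _ => by rw [h.metric.pderiv_symm hy i m j]; ring
  have e2 : gm y i j = gm y j i := by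
    conv_lhs => rw [← h.metric.symm y hy]
    rfl
  have h3 : ∑ m, y m * pderiv i (fun z => gm z m j) y = ∑ m, y m * pderiv j (fun z => gm z m i) y := by
    rw [h1, h1, e2]; simp only [eq_comm]
  simp only [radGam, sum_mul, Matrix.sum_apply, Matrix.smul_mul, Matrix.smul_apply, smul_eq_mul,
    h.metric.gam_mul hy]
  have e3 : ∑ m, y m * (1 / 2 * (pderiv m (fun z => gm z i j) y + pderiv i (fun z => gm z m j) y
      - pderiv j (fun z => gm z m i) y)) = 1 / 2 * (∑ m, y m * pderiv m (fun z => gm z i j) y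
      + ∑ m, y m * pderiv i (fun z => gm z m j) y - ∑ m, y m * pderiv j (fun z => gm z m i) y) := by
    simp only [← sum_add_distrib, ← sum_sub_distrib, mul_sum]
    exact sum_congr rfl fun m _ => by ring
  rw [e3, h3]; ring

lemma radGam_mul_symm (hy : y ∈ Metric.ball (0 : E8) 1) :
    (radGam gm y * gm y)ᵀ = radGam gm y * gm y := by
  ext i j
  rw [Matrix.transpose_apply, h.radGam_mul hy, h.radGam_mul hy]
  simp only [h.metric.pderiv_symm hy _ i j]

/-- The radial Riccati equation. -/
lemma radial_curv (hy : y ∈ Metric.ball (0 : E8) 1) (n k : Fin 8) :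
    ∑ m, ∑ i, y m * y i * curv gm m n y i k
      = (∑ m, ∑ p, y m * y p * pdMat p (gam gm m) y n k) + 2 * radGam gm y n k
        + (radGam gm y * radGam gm y) n k := by
  have hc : ∀ i : Fin 8, DifferentiableAt ℝ (fun z : E8 => z i) y := fun i =>
    (coordL i).differentiableAt
  have hγ := fun m => (h.metric.smooth_gam m).matDiff h.metric.isOpen hy
  -- differentiate the geodesic equation
  have h1 : 2 * radGam gm y n k + ∑ m, ∑ i, y m * y i * pdMat n (gam gm m) y i k = 0 := by
    have h2 : pderiv n (fun z => ∑ i, ∑ m, z i * z m * gam gm m z i k) y = pderiv n (fun _ => 0) y :=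
      pderiv_congr h.metric.isOpen (fun z hz => by
        rw [← h.vecMul_radGam hz k]
        simp only [radGam, Matrix.sum_apply, Matrix.smul_apply, smul_eq_mul, mul_sum, mul_assoc])
        hy n
    rw [pderiv_const, pderiv_sum (fun i _ => DifferentiableAt.fun_sum fun m _ =>
      ((hc i).fun_mul (hc m)).fun_mul (hγ m i k))] at h2
    have h3 : ∀ i, pderiv n (fun z => ∑ m, z i * z m * gam gm m z i k) y
        = ∑ m, (((if n = i then 1 else 0) * y m + y i * (if n = m then 1 else 0)) * gam gm m y i k
          + y i * y m * pdMat n (gam gm m) y i k) := by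
      intro i
      rw [pderiv_sum (fun m _ => ((hc i).fun_mul (hc m)).fun_mul (hγ m i k))]
      refine sum_congr rfl fun m _ => ?_
      rw [pderiv_mul ((hc i).fun_mul (hc m)) (hγ m i k), pderiv_mul (hc i) (hc m), pderiv_coord,
        pderiv_coord]
      rfl
    simp only [h3, add_mul, sum_add_distrib] at h2
    have e1 : ∑ i, ∑ m, (if n = i then 1 else 0) * y m * gam gm m y i k = radGam gm y n k := by
      simp [radGam, Matrix.sum_apply]
    have e2 : ∑ i, ∑ m, y i * (if n = m then 1 else 0) * gam gm m y i k = radGam gm y n k := by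
      rw [h.radGam_apply hy]; simp
    rw [e1, e2, sum_comm (f := fun i m => y i * y m * pdMat n (gam gm m) y i k)] at h2
    rw [← h2, two_mul]
    congr 1
    exact sum_congr rfl fun m _ => sum_congr rfl fun i _ => by ring
  have h4 : ∑ m, ∑ i, y m * y i * pdMat m (gam gm n) y i k
      = ∑ m, ∑ p, y m * y p * pdMat p (gam gm m) y n k := by
    rw [sum_comm]
    refine sum_congr rfl fun i _ => sum_congr rfl fun m _ => ?_
    have : pdMat m (gam gm n) y i k = pdMat m (gam gm i) y n k :=
      pderiv_congr h.metric.isOpen (fun z hz => h.metric.gam_comm hz n i k) hy m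
    rw [this]; ring
  have h5 : ∑ m, ∑ i, y m * y i * (gam gm m y * gam gm n y) i k = 0 := by
    have : ∑ m, ∑ i, y m * y i * (gam gm m y * gam gm n y) i k
        = ∑ l, (∑ i, y i * radGam gm y i l) * gam gm n y l k := by
      simp only [radGam, Matrix.sum_apply, Matrix.smul_apply, smul_eq_mul, Matrix.mul_apply,
        mul_sum, sum_mul]
      calc _ = ∑ m, ∑ l, ∑ i, y m * y i * (gam gm m y i l * gam gm n y l k) :=
            sum_congr rfl fun m _ => sum_comm
        _ = ∑ l, ∑ m, ∑ i, y m * y i * (gam gm m y i l * gam gm n y l k) := sum_comm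
        _ = ∑ l, ∑ i, ∑ m, y m * y i * (gam gm m y i l * gam gm n y l k) :=
            sum_congr rfl fun l _ => sum_comm
        _ = _ := sum_congr rfl fun l _ => sum_congr rfl fun i _ => sum_congr rfl fun m _ => by ring
    rw [this]
    exact sum_eq_zero fun l _ => by rw [h.vecMul_radGam hy, zero_mul]
  have h6 : ∑ m, ∑ i, y m * y i * (gam gm n y * gam gm m y) i k
      = (radGam gm y * radGam gm y) n k := by
    rw [Matrix.mul_apply]
    simp only [h.radGam_apply hy n]
    simp only [radGam, Matrix.sum_apply, Matrix.smul_apply, smul_eq_mul, Matrix.mul_apply,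
      mul_sum, sum_mul]
    calc _ = ∑ m, ∑ l, ∑ i, y m * y i * (gam gm n y i l * gam gm m y l k) :=
          sum_congr rfl fun m _ => sum_comm
      _ = ∑ l, ∑ m, ∑ i, y m * y i * (gam gm n y i l * gam gm m y l k) := sum_comm
      _ = _ := sum_congr rfl fun l _ => sum_congr rfl fun m _ => sum_congr rfl fun i _ => by ring
  have h7 : ∑ m, ∑ i, y m * y i * curv gm m n y i k
      = ∑ m, ∑ i, y m * y i * pdMat m (gam gm n) y i k
        - ∑ m, ∑ i, y m * y i * pdMat n (gam gm m) y i k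
        - (∑ m, ∑ i, y m * y i * (gam gm m y * gam gm n y) i k
          - ∑ m, ∑ i, y m * y i * (gam gm n y * gam gm m y) i k) := by
    simp only [← sum_sub_distrib]
    refine sum_congr rfl fun m _ => sum_congr rfl fun i _ => ?_
    simp only [curv, Matrix.sub_apply]; ring
  rw [h7, h4, h5, h6]
  linarith

end NormalMetric

end QKFlow

end

noncomputable section

namespace QKFlow

open Matrix Finset

/-! ### Bounds in geodesic normal coordinates -/

namespace NormalMetric

variable {gm : E8 → Mat} (h : NormalMetric gm) {y v : E8}

lemma smul_mem_of_norm_eq_one (hv : ‖v‖ = 1) {s : ℝ} (hs : s ∈ Set.Ico (0 : ℝ) 1) :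
    s • v ∈ Metric.ball (0 : E8) 1 := by
  rw [mem_ball_zero_iff, norm_smul, hv, mul_one, Real.norm_eq_abs, abs_of_nonneg hs.1]
  exact hs.2

lemma radGam_smul (v : E8) (s : ℝ) :
    radGam gm (s • v) = s • ∑ m, v m • gam gm m (s • v) := by
  simp only [radGam, smul_sum, smul_smul, PiLp.smul_apply, smul_eq_mul]

include h

lemma matDeriv_metric (hv : ‖v‖ = 1) {s : ℝ} (hs : s ∈ Set.Ico (0 : ℝ) 1) :
    MatDeriv (fun r => gm (r • v)) ((∑ m, v m • gam gm m (s • v)) * gm (s • v)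
      + ((∑ m, v m • gam gm m (s • v)) * gm (s • v))ᵀ) s := by
  have hy := smul_mem_of_norm_eq_one hv hs
  have h1 := matDeriv_ray (v := v) (h.matDiff hy)
  have e : ∑ m, v m • pdMat m gm (s • v) = (∑ m, v m • gam gm m (s • v)) * gm (s • v)
      + ((∑ m, v m • gam gm m (s • v)) * gm (s • v))ᵀ := by
    rw [Matrix.transpose_mul, h.metric.symm _ hy]
    simp only [h.metric.pdMat_metric hy, smul_add, sum_add_distrib, sum_mul, Matrix.smul_mul,
      Matrix.transpose_sum, Matrix.transpose_smul, mul_sum, Matrix.mul_smul]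
  rwa [e] at h1

lemma matDeriv_gam (hv : ‖v‖ = 1) {s : ℝ} (hs : s ∈ Set.Ico (0 : ℝ) 1) :
    MatDeriv (fun r => ∑ m, v m • gam gm m (r • v))
      (∑ m, v m • ∑ p, v p • pdMat p (gam gm m) (s • v)) s := by
  refine MatDeriv.sum fun m _ => ?_
  have h1 := MatDeriv.smul (hasDerivAt_const s (v m)) (matDeriv_ray (v := v)
    ((h.metric.smooth_gam m).matDiff h.metric.isOpen (smul_mem_of_norm_eq_one hv hs)))
  simpa using h1

/-- `radial_curv` at `s v`, where `radGam` is `s` times the connection matrix in direction `v`,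
divided by `s²`; this division produces the coefficient `2 / s`. -/
lemma matDeriv_gam_riccati (hv : ‖v‖ = 1) {s : ℝ} (hs : s ∈ Set.Ioo (0 : ℝ) 1) :
    MatDeriv (fun r => ∑ m, v m • gam gm m (r • v))
      ((Matrix.of fun n k => ∑ m, ∑ i, v m * v i * curv gm m n (s • v) i k)
        - (2 / s) • ∑ m, v m • gam gm m (s • v)
        - (∑ m, v m • gam gm m (s • v)) * ∑ m, v m • gam gm m (s • v)) s := by
  have hs' : s ∈ Set.Ico (0 : ℝ) 1 := ⟨hs.1.le, hs.2⟩
  have h1 := h.matDeriv_gam hv hs'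
  convert h1 using 1
  ext n k
  have h2 := h.radial_curv (smul_mem_of_norm_eq_one hv hs') n k
  rw [radGam_smul] at h2
  set N := ∑ m, v m • gam gm m (s • v)
  have e1 : ∀ X : Fin 8 → Fin 8 → ℝ, ∑ m, ∑ i, (s • v) m * (s • v) i * X m i
      = s ^ 2 * ∑ m, ∑ i, v m * v i * X m i := fun X => by
    simp only [mul_sum, PiLp.smul_apply, smul_eq_mul]
    exact sum_congr rfl fun m _ => sum_congr rfl fun i _ => by ring
  rw [e1, e1] at h2
  simp only [Matrix.smul_mul, Matrix.mul_smul, Matrix.smul_apply, smul_eq_mul] at h2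
  simp only [Matrix.sub_apply, Matrix.of_apply, Matrix.smul_apply, Matrix.sum_apply, smul_eq_mul,
    mul_sum] at h2 ⊢
  have hs0 := hs.1.ne'
  simp only [← mul_assoc] at h2 ⊢
  simp only [mul_assoc (s ^ 2)] at h2
  simp only [← mul_sum] at h2
  field_simp
  have hs2 : s * s ≠ 0 := mul_ne_zero hs0 hs0
  apply mul_left_cancel₀ hs0
  linear_combination h2

omit h in
lemma quad_curv (w : Fin 8 → ℝ) : quad ((Matrix.of fun n k => ∑ m, ∑ i, v m * v i
    * curv gm m n y i k) * gm y) w = rm gm y v w v w := by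
  have key : ∀ n, (((Matrix.of fun n k => ∑ m, ∑ i, v m * v i * curv gm m n y i k) * gm y) *ᵥ w) n
      = ∑ m, v m * (v ⬝ᵥ (curv gm m n y * gm y) *ᵥ w) := by
    intro n
    have e1 : (Matrix.of fun n k => ∑ m, ∑ i, v m * v i * curv gm m n y i k) n
        = ∑ m, v m • (v ᵥ* curv gm m n y) := by
      ext k
      simp only [Matrix.of_apply, Finset.sum_apply, Pi.smul_apply, Matrix.vecMul, dotProduct,
        smul_eq_mul, mul_sum, mul_assoc]
    rw [← Matrix.mulVec_mulVec, Matrix.mulVec, e1, sum_dotProduct]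
    refine sum_congr rfl fun m _ => ?_
    rw [smul_dotProduct, smul_eq_mul, ← Matrix.mulVec_mulVec, ← Matrix.dotProduct_mulVec v.ofLp]
  rw [quad, dotProduct, rm, sum_comm]
  refine sum_congr rfl fun n _ => ?_
  rw [key, mul_sum]
  exact sum_congr rfl fun m _ => by ring

end NormalMetric

/-- In geodesic normal coordinates, the radial derivative of the metric is quadratic. -/
lemma exists_normal_bound {K r₀ : ℝ} (hK : 0 ≤ K) (hr₀ : r₀ < 1) :
    ∃ C, 0 < C ∧ ∀ gm, NormalMetric gm → (∀ y ∈ Metric.ball (0 : E8) 1, ∀ u v w z : Fin 8 → ℝ,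
      |rm gm y u v w z| ≤ K * (√(quad (gm y) u) * √(quad (gm y) v) * √(quad (gm y) w)
        * √(quad (gm y) z))) → ∀ y : E8, ‖y‖ ≤ r₀ → ∀ w,
      |quad (radGam gm y * gm y) w| ≤ C * ‖y‖ ^ 2 * quad (gm y) w := by
  obtain ⟨C, hC, hb⟩ := exists_radial_bound hK hr₀
  refine ⟨C, hC, fun gm h hcurv y hy w => ?_⟩
  rcases eq_or_ne y 0 with rfl | hy0
  · simp [radGam, quad]
  have hs0 : 0 < ‖y‖ := norm_pos_iff.2 hy0
  set v : E8 := ‖y‖⁻¹ • y with hvdef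
  have hv : ‖v‖ = 1 := by rw [hvdef, norm_smul, norm_inv, norm_norm, inv_mul_cancel₀ hs0.ne']
  have hyv : y = ‖y‖ • v := by rw [hvdef, smul_smul, mul_inv_cancel₀ hs0.ne', one_smul]
  have key := hb (fun s => gm (s • v)) (fun s => ∑ m, v m • gam gm m (s • v))
    (fun s => Matrix.of fun n k => ∑ m, ∑ i, v m * v i * curv gm m n (s • v) i k)
    (fun s hs => h.metric.frame _ (NormalMetric.smul_mem_of_norm_eq_one hv hs))
    (fun s hs => h.matDeriv_metric hv hs) (fun s hs => ⟨_, h.matDeriv_gam hv hs⟩)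
    (fun s hs => by
      have h1 := h.radGam_mul_symm (NormalMetric.smul_mem_of_norm_eq_one hv ⟨hs.1.le, hs.2⟩)
      rw [NormalMetric.radGam_smul, Matrix.smul_mul, Matrix.transpose_smul] at h1
      exact smul_right_injective _ hs.1.ne' h1)
    (fun s hs => h.matDeriv_gam_riccati hv hs)
    (fun s hs w => by
      have hsv := NormalMetric.smul_mem_of_norm_eq_one hv ⟨hs.1.le, hs.2⟩
      obtain ⟨P, hP⟩ := h.metric.frame _ hsv
      rw [NormalMetric.quad_curv]
      refine (hcurv _ hsv _ _ _ _).trans (mul_le_mul_of_nonneg_left ?_ hK)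
      have e1 : quad (gm (s • v)) v = 1 := by
        have h1 := h.quad_self hsv
        rw [norm_smul, hv, mul_one, Real.norm_eq_abs, sq_abs] at h1
        have h2 := quad_smul_vec s (gm (s • v)) v
        rw [show (s • v.ofLp : Fin 8 → ℝ) = (s • v).ofLp from rfl, h1] at h2
        have := pow_pos hs.1 2
        nlinarith
      rw [e1, Real.sqrt_one, one_mul, mul_one]
      exact (Real.mul_self_sqrt (quad_nonneg_of_frame hP w)).le)
    ‖y‖ ⟨hs0, hy⟩ w
  rw [← hyv] at key
  have e : quad (radGam gm y * gm y) w = ‖y‖ * quad ((∑ m, v m • gam gm m y) * gm y) w := by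
    conv_lhs => rw [hyv, NormalMetric.radGam_smul, ← hyv]
    rw [Matrix.smul_mul, quad_smul]
  rw [e]
  exact key

/-- Consequence: the metric is comparable to the Euclidean metric. -/
lemma NormalMetric.quad_bounds {gm : E8 → Mat} (h : NormalMetric gm) {C r₀ : ℝ} (hC : 0 ≤ C)
    (hr₀ : r₀ < 1) (hb : ∀ y : E8, ‖y‖ ≤ r₀ → ∀ w,
      |quad (radGam gm y * gm y) w| ≤ C * ‖y‖ ^ 2 * quad (gm y) w) {y : E8} (hy : ‖y‖ ≤ r₀)
    (w : Fin 8 → ℝ) : Real.exp (-2 * C) * (w ⬝ᵥ w) ≤ quad (gm y) w ∧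
      quad (gm y) w ≤ Real.exp (2 * C) * (w ⬝ᵥ w) := by
  have h0 : quad (gm 0) w = w ⬝ᵥ w := by rw [h.center, quad, Matrix.one_mulVec]
  have hww : 0 ≤ w ⬝ᵥ w := sum_nonneg fun i _ => mul_self_nonneg (w i)
  rcases eq_or_ne y 0 with rfl | hy0
  · rw [h0]
    constructor
    · nlinarith [Real.exp_le_one_iff.2 (show -2 * C ≤ 0 by linarith)]
    · nlinarith [Real.one_le_exp (show 0 ≤ 2 * C by linarith)]
  have hs0 : 0 < ‖y‖ := norm_pos_iff.2 hy0
  set v : E8 := ‖y‖⁻¹ • y with hvdef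
  have hv : ‖v‖ = 1 := by rw [hvdef, norm_smul, norm_inv, norm_norm, inv_mul_cancel₀ hs0.ne']
  have hyv : y = ‖y‖ • v := by rw [hvdef, smul_smul, mul_inv_cancel₀ hs0.ne', one_smul]
  have hI : ∀ s ∈ Set.Icc 0 ‖y‖, s ∈ Set.Ico (0 : ℝ) 1 := fun s hs =>
    ⟨hs.1, hs.2.trans_lt (hy.trans_lt hr₀)⟩
  set a' : ℝ → ℝ := fun s => 2 * quad ((∑ m, v m • gam gm m (s • v)) * gm (s • v)) w with ha'
  have hd : ∀ s ∈ Set.Icc 0 ‖y‖, HasDerivAt (fun s : ℝ => quad (gm (s • v)) w) (a' s) s :=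
    fun s hs => ((h.matDeriv_metric hv (hI s hs)).quad w).congr_deriv (by
      rw [quad_add, quad_transpose, ha']; ring)
  have hbd : ∀ s ∈ Set.Ioo 0 ‖y‖, |a' s| ≤ 2 * C * quad (gm (s • v)) w := fun s hs => by
    have hn : ‖s • v‖ = s := by
      rw [norm_smul, hv, mul_one, Real.norm_eq_abs, abs_of_pos hs.1]
    have h1 := hb (s • v) (by rw [hn]; exact hs.2.le.trans hy) w
    rw [NormalMetric.radGam_smul, Matrix.smul_mul, quad_smul, hn, abs_mul, abs_of_pos hs.1] at h1
    obtain ⟨P, hP⟩ := h.metric.frame _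
      (NormalMetric.smul_mem_of_norm_eq_one hv (hI s ⟨hs.1.le, hs.2.le⟩))
    have hq := quad_nonneg_of_frame hP w
    have h2 : |quad ((∑ m, v m • gam gm m (s • v)) * gm (s • v)) w| ≤ C * s * quad (gm (s • v)) w := by
      refine le_of_mul_le_mul_left (h1.trans (le_of_eq ?_)) hs.1
      ring
    have hs1 : s ≤ 1 := (hI s ⟨hs.1.le, hs.2.le⟩).2.le
    rw [ha', abs_mul, abs_two]
    have h3 : C * s * quad (gm (s • v)) w ≤ C * 1 * quad (gm (s • v)) w := by gcongr
    linarith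
  have hexp : ∀ c s : ℝ, HasDerivAt (fun s => Real.exp (c * s)) (Real.exp (c * s) * c) s :=
    fun c s => by simpa using ((hasDerivAt_id s).const_mul c).exp
  have hmono : MonotoneOn (fun s : ℝ => Real.exp (2 * C * s) * quad (gm (s • v)) w)
      (Set.Icc 0 ‖y‖) :=
    monotoneOn_of_hasDerivWithinAt_nonneg (convex_Icc _ _)
      (fun s hs => ((hexp (2 * C) s).mul (hd s hs)).continuousAt.continuousWithinAt)
      (fun s hs => ((hexp (2 * C) s).mul (hd s (interior_subset hs))).hasDerivWithinAt)
      fun s hs => by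
        rw [interior_Icc] at hs
        have := (abs_le.1 (hbd s hs)).1
        have he := Real.exp_pos (2 * C * s)
        nlinarith
  have hanti : AntitoneOn (fun s : ℝ => Real.exp (-(2 * C) * s) * quad (gm (s • v)) w)
      (Set.Icc 0 ‖y‖) :=
    antitoneOn_of_hasDerivWithinAt_nonpos (convex_Icc _ _)
      (fun s hs => ((hexp (-(2 * C)) s).mul (hd s hs)).continuousAt.continuousWithinAt)
      (fun s hs => ((hexp (-(2 * C)) s).mul (hd s (interior_subset hs))).hasDerivWithinAt)
      fun s hs => by
        rw [interior_Icc] at hs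
        have := (abs_le.1 (hbd s hs)).2
        have he := Real.exp_pos (-(2 * C) * s)
        nlinarith
  have h1 := hmono (Set.left_mem_Icc.2 hs0.le) (Set.right_mem_Icc.2 hs0.le) hs0.le
  have h2 := hanti (Set.left_mem_Icc.2 hs0.le) (Set.right_mem_Icc.2 hs0.le) hs0.le
  simp only [mul_zero, Real.exp_zero, one_mul, zero_smul, ← hyv, h0] at h1 h2
  obtain ⟨P, hP⟩ := h.metric.frame y (mem_ball_zero_iff.2 (hy.trans_lt hr₀))
  have hq := quad_nonneg_of_frame hP w
  have hy1 : ‖y‖ ≤ 1 := (hy.trans_lt hr₀).le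
  have hCy : 2 * C * ‖y‖ ≤ 2 * C := by nlinarith
  constructor
  · calc Real.exp (-2 * C) * (w ⬝ᵥ w)
        ≤ Real.exp (-2 * C) * (Real.exp (2 * C * ‖y‖) * quad (gm y) w) := by gcongr
      _ ≤ Real.exp (-2 * C) * (Real.exp (2 * C) * quad (gm y) w) := by gcongr
      _ = quad (gm y) w := by rw [← mul_assoc, ← Real.exp_add]; simp
  · have h3 : quad (gm y) w = Real.exp (2 * C * ‖y‖) * (Real.exp (-(2 * C) * ‖y‖) * quad (gm y) w) := by
      rw [← mul_assoc, ← Real.exp_add]; simp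
    rw [h3]
    gcongr

end QKFlow

end

/-! ### The local monotonicity formula: heat kernel, divergence identity, and pointwise error
bounds. -/

noncomputable section

namespace QKFlow

open Matrix Finset

/-! ### The heat kernel -/

lemma contDiff_heatKernel (t₀ t : ℝ) : ContDiff ℝ ∞ (heatKernel t₀ t) := by
  refine contDiff_const.mul (Real.contDiff_exp.comp ?_)
  exact (contDiff_norm_sq ℝ).neg.div_const _

lemma heatKernel_pos {t₀ t : ℝ} (ht : t < t₀) (y : E8) : 0 < heatKernel t₀ t y := by
  have : 0 < t₀ - t := sub_pos.2 ht
  unfold heatKernel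
  positivity

lemma pderiv_heatKernel {t₀ t : ℝ} (y : E8) (m : Fin 8) :
    pderiv m (heatKernel t₀ t) y = -(heatKernel t₀ t y * (y m / (2 * (t₀ - t)))) := by
  refine pderiv_eq_of_hasDerivAt ((contDiff_heatKernel t₀ t).differentiable (by simp) y) ?_
  have h1 := (hasDerivAt_line y (stdVec m) 0).norm_sq
  have h2 := (((h1.neg).div_const (4 * (t₀ - t))).exp).const_mul
    (1 / (4 * Real.pi * (t₀ - t)) ^ 4)
  refine h2.congr_deriv ?_
  simp only [Pi.neg_apply, zero_smul, add_zero, heatKernel]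
  rw [EuclideanSpace.inner_single_right]
  simp only [starRingEnd_apply, star_trivial, one_mul]
  rcases eq_or_ne (t₀ - t) 0 with h | h
  · simp [h]
  · field_simp; ring

lemma hasDerivAt_heatKernel {t₀ t : ℝ} (ht : t < t₀) (y : E8) :
    HasDerivAt (fun s => heatKernel t₀ s y)
      (heatKernel t₀ t y * (4 / (t₀ - t) - ‖y‖ ^ 2 / (4 * (t₀ - t) ^ 2))) t := by
  have h0 : t₀ - t ≠ 0 := (sub_pos.2 ht).ne'
  have hpi := Real.pi_ne_zero
  have h1 : HasDerivAt (fun s => t₀ - s) (-1) t := (hasDerivAt_id t).const_sub t₀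
  have h2 := (((h1.const_mul (4 * Real.pi)).pow 4).inv
    (pow_ne_zero 4 (mul_ne_zero (by positivity) h0)))
  have h3 := ((h1.const_mul (4 : ℝ)).inv (mul_ne_zero (by norm_num) h0)).const_mul (-‖y‖ ^ 2)
  have h4 := h2.mul h3.exp
  have e : (fun s => heatKernel t₀ s y) = fun s => ((4 * Real.pi * (t₀ - s)) ^ 4)⁻¹
      * Real.exp (-‖y‖ ^ 2 * (4 * (t₀ - s))⁻¹) := by
    funext s
    rw [heatKernel, one_div, div_eq_mul_inv]
  rw [e]
  refine h4.congr_deriv ?_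
  simp only [heatKernel, Pi.pow_apply, Pi.inv_apply, div_eq_mul_inv]
  generalize Real.exp (-‖y‖ ^ 2 * (4 * (t₀ - t))⁻¹) = X
  field_simp
  ring

/-! ### The integrand of the local energy -/

/-- The cut-off heat kernel `G φ²`. -/
def cutKernel (φ : E8 → ℝ) (t₀ t : ℝ) (y : E8) : ℝ := heatKernel t₀ t y * φ y ^ 2

/-- The contraction of `T` with a vector field. -/
def torVec (gm : E8 → Mat) (W : ℝ → E8 → Comp4) (t : ℝ) (X : E8 → Fin 8 → ℝ) (y : E8) : Mat :=
  ∑ n, X y n • torEnd gm W t n y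

/-- The gradient of `φ`. -/
def gradVec (gm : E8 → Mat) (φ : E8 → ℝ) (y : E8) (n : Fin 8) : ℝ :=
  ∑ m, (gm y)⁻¹ m n * pderiv m φ y

/-- The components of the vector field whose divergence is used to compute the derivative of the
local energy. -/
def monoField (gm : E8 → Mat) (W : ℝ → E8 → Comp4) (φ : E8 → ℝ) (t₀ t : ℝ) (m : Fin 8) (y : E8) :
    ℝ :=
  (∑ n, √(gm y).det * (gm y)⁻¹ m n * br (torEnd gm W t n y) (cutKernel φ t₀ t y •
    (torVec gm W t (fun y => y) y - (2 * (t₀ - t)) • divEnd gm W t y)))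
    - (1 / 2) * (√(gm y).det * enDensity gm W t y * cutKernel φ t₀ t y * y m)

lemma contDiff_cutKernel {φ : E8 → ℝ} (hφ : ContDiff ℝ ∞ φ) (t₀ t : ℝ) :
    ContDiff ℝ ∞ (cutKernel φ t₀ t) := (contDiff_heatKernel t₀ t).mul (hφ.pow 2)

lemma pderiv_cutKernel {φ : E8 → ℝ} (hφ : ContDiff ℝ ∞ φ) (t₀ t : ℝ) (y : E8) (m : Fin 8) :
    pderiv m (cutKernel φ t₀ t) y = heatKernel t₀ t y * (2 * φ y * pderiv m φ y
      - φ y ^ 2 * (y m / (2 * (t₀ - t)))) := by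
  have hd := hφ.differentiable (by simp) y
  have hG := (contDiff_heatKernel t₀ t).differentiable (by simp) y
  have e : cutKernel φ t₀ t = fun y => heatKernel t₀ t y * (φ y * φ y) := by
    funext y; rw [cutKernel, pow_two]
  rw [e, pderiv_mul hG (hd.fun_mul hd), pderiv_mul hd hd, pderiv_heatKernel]
  ring

namespace NormalMetric

variable {gm : E8 → Mat} (h : NormalMetric gm) {t₀ t : ℝ} {W : ℝ → E8 → Comp4}
  (hW : ChartFlow (Metric.ball (0 : E8) 1) gm t₀ W) {φ : E8 → ℝ} (hφ : ContDiff ℝ ∞ φ) {y : E8}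

include h

/-- The Gauss lemma for the inverse metric. It makes the Riemannian gradient of the Euclidean heat
kernel equal to the Euclidean one, so that the square can be completed without error. -/
lemma sum_inv_mul_self (hy : y ∈ Metric.ball (0 : E8) 1) (n : Fin 8) :
    ∑ m, (gm y)⁻¹ m n * y m = y n := by
  have h1 : gm y *ᵥ y = y := funext fun k => h.mulVec_self hy k
  have h2 : (gm y)⁻¹ *ᵥ y = y := by
    conv_lhs => rw [← h1]
    rw [Matrix.mulVec_mulVec, Matrix.nonsing_inv_mul _ (h.metric.isUnit_det hy),
      Matrix.one_mulVec]
  have h3 : (y : Fin 8 → ℝ) ᵥ* (gm y)⁻¹ = y := by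
    rw [← Matrix.mulVec_transpose, h.metric.inv_symm hy, h2]
  have h4 := congrFun h3 n
  rw [Matrix.vecMul, dotProduct] at h4
  rw [← h4]
  exact sum_congr rfl fun m _ => by rw [mul_comm]

include hφ

lemma gradVec_cutKernel (hy : y ∈ Metric.ball (0 : E8) 1) :
    torVec gm W t (gradVec gm (cutKernel φ t₀ t)) y
      = (2 * heatKernel t₀ t y * φ y) • torVec gm W t (gradVec gm φ) y
        - (cutKernel φ t₀ t y / (2 * (t₀ - t))) • torVec gm W t (fun y => y) y := by
  have e : ∀ n, gradVec gm (cutKernel φ t₀ t) y n = (2 * heatKernel t₀ t y * φ y) * gradVec gm φ y n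
      - cutKernel φ t₀ t y / (2 * (t₀ - t)) * y n := by
    intro n
    rw [← h.sum_inv_mul_self hy n, gradVec, gradVec, mul_sum, mul_sum, ← sum_sub_distrib]
    refine sum_congr rfl fun m _ => ?_
    rw [pderiv_cutKernel hφ, cutKernel]
    ring
  simp only [torVec, e, sub_smul, sum_sub_distrib, smul_sum, smul_smul]

end NormalMetric

namespace ChartFlow

variable {U : Set E8} {gm : E8 → Mat} {t₀ : ℝ} {W : ℝ → E8 → Comp4} (h : ChartFlow U gm t₀ W)
  {t : ℝ} {y : E8}

omit h in
lemma sum_br_torVec (gm : E8 → Mat) (W : ℝ → E8 → Comp4) (t : ℝ) (f : E8 → ℝ) (y : E8) (b : Mat) :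
    ∑ m, ∑ n, (gm y)⁻¹ m n * (pderiv m f y * br (torEnd gm W t n y) b)
      = br (torVec gm W t (gradVec gm f) y) b := by
  simp only [torVec, br_sum_left, br_smul_left, gradVec, sum_mul]
  rw [sum_comm]
  exact sum_congr rfl fun n _ => sum_congr rfl fun m _ => by ring

include h

lemma smooth_torVec_id (ht : t ∈ Set.Ico 0 t₀) : MatSmooth U (torVec gm W t fun y => y) :=
  MatSmooth.sum fun n _ => MatSmooth.smul (coordL n).contDiff.contDiffOn (h.slice_torEnd ht n)

/-- `covMat` treats the form index of `T` as a label, so the contraction with the coordinates `yᵏ`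
produces no Christoffel term. The price is a derivative of the inverse metric in `pderiv_enDensity`.
-/
lemma covMat_torVec_id (ht : t ∈ Set.Ico 0 t₀) (hy : y ∈ U) (m : Fin 8) :
    covMat gm m (torVec gm W t fun y => y) y
      = torEnd gm W t m y + ∑ k, y k • covMat gm m (torEnd gm W t k) y := by
  have hd := fun n => (h.slice_torEnd ht n).matDiff h.metric.isOpen hy
  have e1 : pdMat m (torVec gm W t fun y => y) y
      = torEnd gm W t m y + ∑ k, y k • pdMat m (torEnd gm W t k) y := by
    ext i j
    have e2 : pdMat m (torVec gm W t fun y => y) y i j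
        = pderiv m (fun z => ∑ n, z n * torEnd gm W t n z i j) y := by
      rw [pdMat, Matrix.of_apply]
      congr 1
    have hc : ∀ i : Fin 8, DifferentiableAt ℝ (fun z : E8 => z i) y := fun i =>
      (coordL i).differentiableAt
    rw [e2, pderiv_sum (fun n _ => (hc n).fun_mul (hd n i j))]
    have e3 : ∀ n, pderiv m (fun z => z n * torEnd gm W t n z i j) y
        = (if m = n then 1 else 0) * torEnd gm W t n y i j
          + y n * pdMat m (torEnd gm W t n) y i j := fun n => by
      rw [pderiv_mul (hc n) (hd n i j), pderiv_coord]
      rfl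
    simp only [e3, sum_add_distrib, Matrix.add_apply, Matrix.sum_apply, Matrix.smul_apply,
      smul_eq_mul]
    simp
  have e4 : ∀ γ : Mat, γ * torVec gm W t (fun y => y) y - torVec gm W t (fun y => y) y * γ
      = ∑ k, y k • (γ * torEnd gm W t k y - torEnd gm W t k y * γ) := fun γ => by
    simp only [torVec, mul_sum, sum_mul, Matrix.mul_smul, Matrix.smul_mul, ← sum_sub_distrib,
      ← smul_sub]
  rw [covMat, e1, e4, add_sub_assoc, ← sum_sub_distrib]
  simp only [← smul_sub]
  rfl

omit h in
lemma covMat_smul {f : E8 → ℝ} {b : E8 → Mat} (hf : DifferentiableAt ℝ f y) (hb : MatDiff b y)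
    (m : Fin 8) : covMat gm m (fun z => f z • b z) y
      = pderiv m f y • b y + f y • covMat gm m b y := by
  have e1 : pdMat m (fun z => f z • b z) y = pderiv m f y • b y + f y • pdMat m b y := by
    ext i j
    exact pderiv_mul hf (hb i j) m
  rw [covMat, covMat, e1, smul_sub, smul_sub, Matrix.mul_smul, Matrix.smul_mul]
  abel

omit h in
lemma covMat_sub_smul {c : ℝ} {a b : E8 → Mat} (ha : MatDiff a y) (hb : MatDiff b y)
    (m : Fin 8) : covMat gm m (fun z => a z - c • b z) y
      = covMat gm m a y - c • covMat gm m b y := by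
  have e1 : pdMat m (fun z => a z - c • b z) y = pdMat m a y - c • pdMat m b y := by
    ext i j
    have := pderiv_sub (ha i j) ((hb i j).const_mul c) m
    rw [pderiv_const_mul (hb i j)] at this
    exact this
  rw [covMat, covMat, covMat, e1]
  simp only [mul_sub, sub_mul, smul_sub, Matrix.mul_smul, Matrix.smul_mul]
  abel

lemma pderiv_enDensity (ht : t ∈ Set.Ico 0 t₀) (hy : y ∈ U) (m : Fin 8) :
    pderiv m (enDensity gm W t) y
      = ∑ k, ∑ l, pderiv m (fun z => (gm z)⁻¹ k l) y * br (torEnd gm W t k y) (torEnd gm W t l y)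
        + 2 * ∑ k, ∑ l, (gm y)⁻¹ k l * br (torEnd gm W t k y) (covMat gm m (torEnd gm W t l) y) := by
  have hd := fun n => (h.slice_torEnd ht n).matDiff h.metric.isOpen hy
  have hi := h.metric.smooth_inv.matDiff h.metric.isOpen hy
  have hbr : ∀ k l, DifferentiableAt ℝ
      (fun z => br (torEnd gm W t k z) (torEnd gm W t l z)) y := fun k l =>
    (((h.slice_torEnd ht k).br (h.slice_torEnd ht l)).contDiffAt
      (h.metric.isOpen.mem_nhds hy)).differentiableAt (by simp)
  have e0 : pderiv m (enDensity gm W t) y = ∑ k, ∑ l,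
      (pderiv m (fun z => (gm z)⁻¹ k l) y * br (torEnd gm W t k y) (torEnd gm W t l y)
        + (gm y)⁻¹ k l * (br (covMat gm m (torEnd gm W t k) y) (torEnd gm W t l y)
          + br (torEnd gm W t k y) (covMat gm m (torEnd gm W t l) y))) := by
    unfold enDensity
    rw [pderiv_sum (fun k _ => DifferentiableAt.fun_sum fun l _ => (hi k l).fun_mul (hbr k l))]
    refine sum_congr rfl fun k _ => ?_
    rw [pderiv_sum (fun l _ => (hi k l).fun_mul (hbr k l))]
    refine sum_congr rfl fun l _ => ?_
    rw [pderiv_mul (hi k l) (hbr k l), pderiv_br (gm := gm) (hd k) (hd l)]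
  have e1 : ∑ k, ∑ l, (gm y)⁻¹ k l * br (covMat gm m (torEnd gm W t k) y) (torEnd gm W t l y)
      = ∑ k, ∑ l, (gm y)⁻¹ k l * br (torEnd gm W t k y) (covMat gm m (torEnd gm W t l) y) := by
    rw [sum_comm]
    refine sum_congr rfl fun k _ => sum_congr rfl fun l _ => ?_
    rw [br_comm]
    congr 1
    conv_lhs => rw [← h.metric.inv_symm hy]
    rfl
  rw [e0]
  simp only [mul_add, sum_add_distrib, e1]
  ring

end ChartFlow

end QKFlow

end

noncomputable section

namespace QKFlow

open Matrix Finset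

/-! ### The divergence identity -/

/-- The contraction of `⟨T, Rm⟩` with the position vector. -/
def curvTerm (gm : E8 → Mat) (W : ℝ → E8 → Comp4) (t : ℝ) (y : E8) : ℝ :=
  ∑ k, y k * ∑ m, ∑ n, (gm y)⁻¹ m n * br (torEnd gm W t m y) (curv gm n k y)

/-- The radial derivative of the inverse metric, paired with `T`. -/
def radialTerm (gm : E8 → Mat) (W : ℝ → E8 → Comp4) (t : ℝ) (y : E8) : ℝ :=
  ∑ m, y m * ∑ k, ∑ l, pderiv m (fun z => (gm z)⁻¹ k l) y
    * br (torEnd gm W t k y) (torEnd gm W t l y)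

namespace ChartFlow

variable {U : Set E8} {gm : E8 → Mat} {t₀ : ℝ} {W : ℝ → E8 → Comp4} (h : ChartFlow U gm t₀ W)
  {t : ℝ} {y : E8}

include h

lemma sum_inv_br_swap (hy : y ∈ U) (b : Fin 8 → Mat) :
    ∑ m, ∑ n, (gm y)⁻¹ m n * br (torEnd gm W t n y) (b m)
      = ∑ m, ∑ n, (gm y)⁻¹ m n * br (torEnd gm W t m y) (b n) := by
  rw [sum_comm]
  refine sum_congr rfl fun n _ => sum_congr rfl fun m _ => ?_
  congr 1
  conv_lhs => rw [← h.metric.inv_symm hy]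
  rfl

lemma contDiffOn_enDensity (ht : t ∈ Set.Ico 0 t₀) : ContDiffOn ℝ ∞ (enDensity gm W t) U :=
  contDiffOn_slice (F := enDensity gm W) h.smooth_enDensity ht

/-- The divergence of `⟨T, b⟩`. -/
lemma sum_pderiv_br_torEnd (ht : t ∈ Set.Ico 0 t₀) {b : E8 → Mat} (hb : MatSmooth U b)
    (hy : y ∈ U) :
    ∑ m, pderiv m (fun z => ∑ n, √(gm z).det * (gm z)⁻¹ m n * br (torEnd gm W t n z) (b z)) y
      = √(gm y).det * (br (divEnd gm W t y) (b y)
        + ∑ m, ∑ n, (gm y)⁻¹ m n * br (torEnd gm W t m y) (covMat gm n b y)) := by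
  rw [← h.sum_inv_br_swap hy fun m => covMat gm m b y]
  exact h.metric.sum_pderiv_br (h.slice_torsion ht) hb hy

/-- After the Bianchi exchange, `⟨Tₙ, yᵏ∇ₙTₖ⟩` becomes `⟨Tₙ, yᵏ∇ₖTₙ⟩`, half the radial derivative of
the density, up to the curvature and the radial derivative of the inverse metric. -/
lemma sum_covMat_radial (ht : t ∈ Set.Ico 0 t₀) (hy : y ∈ U) :
    ∑ m, ∑ n, (gm y)⁻¹ m n * br (torEnd gm W t m y)
        (covMat gm n (torVec gm W t fun y => y) y)
      = enDensity gm W t y + (1 / 2) * ∑ m, y m * pderiv m (enDensity gm W t) y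
        - (1 / 2) * radialTerm gm W t y - curvTerm gm W t y := by
  have e1 : ∑ m, ∑ n, (gm y)⁻¹ m n * br (torEnd gm W t m y)
        (covMat gm n (torVec gm W t fun y => y) y)
      = enDensity gm W t y + ∑ k, y k * ∑ m, ∑ n, (gm y)⁻¹ m n *
          br (torEnd gm W t m y) (covMat gm n (torEnd gm W t k) y) := by
    simp only [h.covMat_torVec_id ht hy, br_add_right, br_sum_right, br_smul_right, mul_add,
      sum_add_distrib, mul_sum]
    congr 1
    refine (sum_congr rfl fun m _ => sum_comm).trans (sum_comm.trans ?_)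
    exact sum_congr rfl fun k _ => sum_congr rfl fun m _ => sum_congr rfl fun n _ => by ring
  have e2 : ∀ k, ∑ m, ∑ n, (gm y)⁻¹ m n *
          br (torEnd gm W t m y) (covMat gm n (torEnd gm W t k) y)
      = ∑ m, ∑ n, (gm y)⁻¹ m n * br (torEnd gm W t m y) (covMat gm k (torEnd gm W t n) y)
        - ∑ m, ∑ n, (gm y)⁻¹ m n * br (torEnd gm W t m y) (curv gm n k y) := fun k => by
    have := h.br_bianchi ht hy k
    simp only [br_sub_right, mul_sub, sum_sub_distrib] at this
    linarith
  have e3 : ∑ m, y m * pderiv m (enDensity gm W t) y = radialTerm gm W t y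
      + 2 * ∑ k, y k * ∑ m, ∑ n, (gm y)⁻¹ m n *
          br (torEnd gm W t m y) (covMat gm k (torEnd gm W t n) y) := by
    rw [radialTerm, mul_sum, ← sum_add_distrib]
    refine sum_congr rfl fun m _ => ?_
    rw [h.pderiv_enDensity ht hy]
    ring
  rw [e1, e3, curvTerm]
  simp only [e2, mul_sub, sum_sub_distrib]
  ring

end ChartFlow

lemma radial_pderiv_sqrt_det {U : Set E8} {gm : E8 → Mat} (h : ChartMetric U gm) {y : E8}
    (hy : y ∈ U) : ∑ m, y m * pderiv m (fun z => √(gm z).det) y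
      = √(gm y).det * (radGam gm y).trace := by
  rw [radGam, Matrix.trace_sum, mul_sum]
  refine sum_congr rfl fun m _ => ?_
  rw [h.pderiv_sqrt_det hy, Matrix.trace_smul, smul_eq_mul]
  ring

namespace NormalMetric

variable {gm : E8 → Mat} (h : NormalMetric gm) {t₀ t : ℝ} {W : ℝ → E8 → Comp4}
  (hW : ChartFlow (Metric.ball (0 : E8) 1) gm t₀ W) {φ : E8 → ℝ} (hφ : ContDiff ℝ ∞ φ) {y : E8}

include h hW hφ

/-- The divergence of `monoField`. -/
lemma sum_pderiv_monoField (ht : t ∈ Set.Ico 0 t₀) (hy : y ∈ Metric.ball (0 : E8) 1) :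
    ∑ m, pderiv m (monoField gm W φ t₀ t m) y = √(gm y).det * (
      cutKernel φ t₀ t y * br (divEnd gm W t y) (torVec gm W t (fun y => y) y
        - (2 * (t₀ - t)) • divEnd gm W t y)
      + br ((2 * heatKernel t₀ t y * φ y) • torVec gm W t (gradVec gm φ) y
        - (cutKernel φ t₀ t y / (2 * (t₀ - t))) • torVec gm W t (fun y => y) y)
          (torVec gm W t (fun y => y) y - (2 * (t₀ - t)) • divEnd gm W t y)
      - 2 * (t₀ - t) * cutKernel φ t₀ t y * ∑ m, ∑ n, (gm y)⁻¹ m n *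
          br (torEnd gm W t m y) (covMat gm n (divEnd gm W t) y)
      - (1 / 2) * cutKernel φ t₀ t y * radialTerm gm W t y
      - cutKernel φ t₀ t y * curvTerm gm W t y
      - (1 / 2) * cutKernel φ t₀ t y * (radGam gm y).trace * enDensity gm W t y
      - 3 * cutKernel φ t₀ t y * enDensity gm W t y
      - heatKernel t₀ t y * φ y * (∑ m, y m * pderiv m φ y) * enDensity gm W t y
      + (1 / 2) * enDensity gm W t y * cutKernel φ t₀ t y * (‖y‖ ^ 2 / (2 * (t₀ - t)))) := by
  have hU := hW.metric.isOpen
  have dAt : ∀ {f : E8 → ℝ}, ContDiffOn ℝ ∞ f (Metric.ball (0 : E8) 1) → DifferentiableAt ℝ f y :=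
    fun hf => (hf.contDiffAt (hU.mem_nhds hy)).differentiableAt (by simp)
  have sψ : ContDiffOn ℝ ∞ (cutKernel φ t₀ t) (Metric.ball (0 : E8) 1) :=
    (contDiff_cutKernel hφ t₀ t).contDiffOn
  have sb : MatSmooth (Metric.ball (0 : E8) 1) (fun z => torVec gm W t (fun y => y) z
      - (2 * (t₀ - t)) • divEnd gm W t z) :=
    (hW.smooth_torVec_id ht).sub (MatSmooth.smul contDiffOn_const (hW.slice_divEnd ht))
  have sb' : MatSmooth (Metric.ball (0 : E8) 1) (fun z => cutKernel φ t₀ t z •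
      (torVec gm W t (fun y => y) z - (2 * (t₀ - t)) • divEnd gm W t z)) := sb.smul sψ
  have sh := hW.contDiffOn_enDensity ht
  have ss := hW.metric.contDiffOn_sqrt_det
  have hc : ∀ i : Fin 8, ContDiffOn ℝ ∞ (fun z : E8 => z i) (Metric.ball (0 : E8) 1) := fun i =>
    (coordL i).contDiff.contDiffOn
  have e0 : ∀ m, pderiv m (monoField gm W φ t₀ t m) y
      = pderiv m (fun z => ∑ n, √(gm z).det * (gm z)⁻¹ m n * br (torEnd gm W t n z)
        (cutKernel φ t₀ t z • (torVec gm W t (fun y => y) z - (2 * (t₀ - t)) • divEnd gm W t z))) y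
        - (1 / 2) * pderiv m (fun z => √(gm z).det * enDensity gm W t z * cutKernel φ t₀ t z * z m)
          y := fun m => by
    have h1 : ContDiffOn ℝ ∞ (fun z => ∑ n, √(gm z).det * (gm z)⁻¹ m n * br (torEnd gm W t n z)
        (cutKernel φ t₀ t z • (torVec gm W t (fun y => y) z - (2 * (t₀ - t)) • divEnd gm W t z)))
        (Metric.ball (0 : E8) 1) := ContDiffOn.sum fun n _ => (ss.mul (hW.metric.smooth_inv m n)).mul
      ((hW.slice_torEnd ht n).br sb')
    have h2 := ((ss.mul sh).mul sψ).mul (hc m)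
    unfold monoField
    rw [pderiv_sub (dAt h1) ((dAt h2).const_mul _), pderiv_const_mul (dAt h2)]
  have e1 : ∀ m, pderiv m (fun z => √(gm z).det * enDensity gm W t z * cutKernel φ t₀ t z * z m) y
      = y m * pderiv m (fun z => √(gm z).det) y * (enDensity gm W t y * cutKernel φ t₀ t y)
        + √(gm y).det * cutKernel φ t₀ t y * (y m * pderiv m (enDensity gm W t) y)
        + √(gm y).det * enDensity gm W t y * (y m * pderiv m (cutKernel φ t₀ t) y)
        + √(gm y).det * enDensity gm W t y * cutKernel φ t₀ t y := fun m => by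
    rw [pderiv_mul (dAt ((ss.mul sh).mul sψ)) (dAt (hc m)), pderiv_mul (dAt (ss.mul sh)) (dAt sψ),
      pderiv_mul (dAt ss) (dAt sh), pderiv_coord]
    simp only [if_true]
    ring
  have e2 : ∑ m, y m * pderiv m (cutKernel φ t₀ t) y
      = 2 * heatKernel t₀ t y * φ y * (∑ m, y m * pderiv m φ y)
        - cutKernel φ t₀ t y * (‖y‖ ^ 2 / (2 * (t₀ - t))) := by
    rw [EuclideanSpace.norm_sq_eq, mul_sum, sum_div, mul_sum, ← sum_sub_distrib]
    refine sum_congr rfl fun m _ => ?_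
    rw [pderiv_cutKernel hφ, Real.norm_eq_abs, sq_abs, cutKernel]
    ring
  have e3 : ∀ n, covMat gm n (fun z => cutKernel φ t₀ t z •
      (torVec gm W t (fun y => y) z - (2 * (t₀ - t)) • divEnd gm W t z)) y
      = pderiv n (cutKernel φ t₀ t) y • (torVec gm W t (fun y => y) y
          - (2 * (t₀ - t)) • divEnd gm W t y)
        + cutKernel φ t₀ t y • (covMat gm n (torVec gm W t fun y => y) y
          - (2 * (t₀ - t)) • covMat gm n (divEnd gm W t) y) := fun n => by
    rw [ChartFlow.covMat_smul (dAt sψ) (sb.matDiff hU hy), ChartFlow.covMat_sub_smul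
      ((hW.smooth_torVec_id ht).matDiff hU hy) ((hW.slice_divEnd ht).matDiff hU hy)]
  have e4 : ∑ m, ∑ n, (gm y)⁻¹ m n * br (torEnd gm W t m y) (covMat gm n (fun z =>
      cutKernel φ t₀ t z • (torVec gm W t (fun y => y) z - (2 * (t₀ - t)) • divEnd gm W t z)) y)
      = br ((2 * heatKernel t₀ t y * φ y) • torVec gm W t (gradVec gm φ) y
        - (cutKernel φ t₀ t y / (2 * (t₀ - t))) • torVec gm W t (fun y => y) y)
          (torVec gm W t (fun y => y) y - (2 * (t₀ - t)) • divEnd gm W t y)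
        + cutKernel φ t₀ t y * (∑ m, ∑ n, (gm y)⁻¹ m n * br (torEnd gm W t m y)
            (covMat gm n (torVec gm W t fun y => y) y))
        - 2 * (t₀ - t) * cutKernel φ t₀ t y * ∑ m, ∑ n, (gm y)⁻¹ m n *
          br (torEnd gm W t m y) (covMat gm n (divEnd gm W t) y) := by
    rw [← h.gradVec_cutKernel hφ hy, ← ChartFlow.sum_br_torVec gm W t (cutKernel φ t₀ t) y]
    simp only [e3, br_add_right, br_sub_right, br_smul_right, mul_sum]
    have e5 := hW.sum_inv_br_swap (t := t) hy fun m => pderiv m (cutKernel φ t₀ t) y •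
      (torVec gm W t (fun y => y) y - (2 * (t₀ - t)) • divEnd gm W t y)
    simp only [br_smul_right, br_sub_right] at e5
    rw [e5, ← sum_add_distrib, ← sum_sub_distrib]
    refine sum_congr rfl fun m _ => ?_
    rw [← sum_add_distrib, ← sum_sub_distrib]
    refine sum_congr rfl fun n _ => ?_
    ring
  -- The coefficient `-3` of the density is `1 - 8/2`: one from the derivative of `y` in `y⌟T`, and
  -- minus half the Euclidean divergence of the position field. The radial derivatives of the
  -- density cancel.
  simp only [e0, sum_sub_distrib, ← mul_sum, e1, sum_add_distrib, ← sum_mul]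
  rw [hW.sum_pderiv_br_torEnd ht sb' hy, e4, hW.sum_covMat_radial ht hy, e2,
    radial_pderiv_sqrt_det hW.metric hy]
  simp only [br_smul_right, sum_const, card_univ, Fintype.card_fin, nsmul_eq_mul]
  ring

end NormalMetric

end QKFlow

end

noncomputable section

namespace QKFlow

open Matrix Finset

/-! ### Pointwise estimates -/

lemma quad_inv_mulVec {A : Mat} (hA : IsUnit A.det) (v : Fin 8 → ℝ) :
    quad A (A⁻¹ *ᵥ v) = quad A⁻¹ v := by
  rw [quad, Matrix.mulVec_mulVec, Matrix.mul_nonsing_inv _ hA, Matrix.one_mulVec, quad,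
    dotProduct_comm]

lemma quad_nonneg_inv {A P : Mat} (h : P * A * Pᵀ = 1) (v : Fin 8 → ℝ) : 0 ≤ quad A⁻¹ v := by
  rw [← quad_inv_mulVec (isUnit_det_of_frame h)]
  exact quad_nonneg_of_frame h _

lemma quad_row {A P : Mat} (h : P * A * Pᵀ = 1) (b : Fin 8) : quad A (P b) = 1 := by
  have h1 := congrFun (congrFun h b) b
  rw [Matrix.one_apply_eq, Matrix.mul_assoc, Matrix.mul_apply] at h1
  rw [← h1, quad, dotProduct]
  exact sum_congr rfl fun i _ => rfl

/-- Sums of inner products of endomorphisms in terms of the frame components. -/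
lemma sum_mul_br {g P : Mat} (h : P * g * Pᵀ = 1) {T : Fin 8 → Mat} (hT : ∀ m, (T m)ᵀ = -T m)
    (S : Mat) : ∑ k, ∑ l, S k l * br (T k * g⁻¹) (T l * g⁻¹)
      = (1 / 2) * ∑ b, ∑ c, quad S fun m => (P * T m * Pᵀ) b c := by
  simp only [br_frame (inv_eq_of_frame h) (hT _), quad_eq, mul_sum]
  rw [sum_comm_4]
  exact sum_congr rfl fun b _ => sum_congr rfl fun c _ => sum_congr rfl fun k _ =>
    sum_congr rfl fun l _ => by ring

lemma sum_abs_le_sqrt {ι : Type*} (u : Finset ι) (f : ι → ℝ) (hf : ∀ i ∈ u, 0 ≤ f i) :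
    ∑ i ∈ u, √(f i) ≤ √(u.card * ∑ i ∈ u, f i) := by
  refine Real.le_sqrt_of_sq_le ?_
  refine (sq_sum_le_card_mul_sum_sq).trans (le_of_eq ?_)
  congr 1
  exact sum_congr rfl fun i hi => Real.sq_sqrt (hf i hi)

namespace ChartFlow

variable {U : Set E8} {gm : E8 → Mat} {t₀ : ℝ} {W : ℝ → E8 → Comp4} (h : ChartFlow U gm t₀ W)
  {t : ℝ} {y : E8} {P : Mat} (ht : t ∈ Set.Ico 0 t₀) (hy : y ∈ U) (hP : P * gm y * Pᵀ = 1)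

include h ht hy hP

lemma enDensity_eq_quad : enDensity gm W t y
    = (1 / 2) * ∑ b, ∑ c, quad (gm y)⁻¹ fun m => (P * torsion gm (W t) y m * Pᵀ) b c :=
  sum_mul_br hP (fun m => h.torsion_skew ht hy m) _

omit hP in
lemma enDensity_nonneg : 0 ≤ enDensity gm W t y := by
  obtain ⟨P, hP⟩ := h.metric.frame y hy
  rw [h.enDensity_eq_quad ht hy hP]
  have : 0 ≤ ∑ b, ∑ c, quad (gm y)⁻¹ fun m => (P * torsion gm (W t) y m * Pᵀ) b c :=
    sum_nonneg fun b _ => sum_nonneg fun c _ => quad_nonneg_inv hP _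
  linarith

/-- In an orthonormal frame both sides are sums over the components of `T` of quadratic forms in the
form index, which are compared one by one. -/
lemma abs_sum_mul_br_le {S : Mat} {C : ℝ}
    (hS : ∀ v, |quad S v| ≤ C * quad (gm y)⁻¹ v) :
    |∑ k, ∑ l, S k l * br (torEnd gm W t k y) (torEnd gm W t l y)| ≤ C * enDensity gm W t y := by
  have e := sum_mul_br hP (fun m => h.torsion_skew ht hy m) S
  change |∑ k, ∑ l, S k l * br (torsion gm (W t) y k * (gm y)⁻¹)
    (torsion gm (W t) y l * (gm y)⁻¹)| ≤ _
  rw [e, h.enDensity_eq_quad ht hy hP, abs_mul, abs_of_pos (by norm_num : (0 : ℝ) < 1 / 2),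
    mul_left_comm]
  refine mul_le_mul_of_nonneg_left ?_ (by norm_num)
  refine (abs_sum_le_sum_abs _ _).trans ?_
  rw [mul_sum]
  refine sum_le_sum fun b _ => (abs_sum_le_sum_abs _ _).trans ?_
  rw [mul_sum]
  exact sum_le_sum fun c _ => hS _

-- Apply the preceding bound to the rank-one form `X ⊗ X`, which Cauchy–Schwarz compares with the
-- inverse metric.
omit hP in
lemma br_torVec_le (X : E8 → Fin 8 → ℝ) :
    br (torVec gm W t X y) (torVec gm W t X y) ≤ quad (gm y) (X y) * enDensity gm W t y := by
  obtain ⟨P, hP⟩ := h.metric.frame y hy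
  have e : br (torVec gm W t X y) (torVec gm W t X y) = ∑ k, ∑ l,
      (Matrix.vecMulVec (X y) (X y)) k l * br (torEnd gm W t k y) (torEnd gm W t l y) := by
    simp only [torVec, br_sum_left, br_sum_right, br_smul_left, br_smul_right, mul_sum,
      Matrix.vecMulVec_apply, mul_assoc]
    exact sum_congr rfl fun k _ => sum_congr rfl fun l _ => by rw [br_comm]
  rw [e]
  refine (le_abs_self _).trans (h.abs_sum_mul_br_le ht hy hP fun v => ?_)
  have hu := h.metric.isUnit_det hy
  have hs := h.metric.symm y hy
  have e1 : quad (Matrix.vecMulVec (X y) (X y)) v = ((X y) ⬝ᵥ v) ^ 2 := by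
    rw [quad_eq, dotProduct, pow_two, sum_mul_sum]
    exact sum_congr rfl fun i _ => sum_congr rfl fun j _ => by
      rw [Matrix.vecMulVec_apply]; ring
  rw [e1, abs_of_nonneg (sq_nonneg _), ← quad_inv_mulVec hu]
  refine le_trans (le_of_eq ?_) (sq_dotProduct_le hP (X y) ((gm y)⁻¹ *ᵥ v))
  rw [Matrix.mulVec_mulVec, Matrix.mul_nonsing_inv _ hu, Matrix.one_mulVec]

-- Nonnegativity of the square which is discarded in the monotonicity formula.
omit hP in
lemma br_smul_add_nonneg (c₁ c₂ : ℝ) (X Y : E8 → Fin 8 → ℝ) :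
    0 ≤ br (c₁ • divEnd gm W t y - c₂ • torVec gm W t X y + torVec gm W t Y y)
      (c₁ • divEnd gm W t y - c₂ • torVec gm W t X y + torVec gm W t Y y) := by
  obtain ⟨P, hP⟩ := h.metric.frame y hy
  have e : ∀ X : E8 → Fin 8 → ℝ, torVec gm W t X y
      = (∑ n, X y n • torsion gm (W t) y n) * (gm y)⁻¹ := fun X => by
    simp only [torVec, torEnd, sum_mul, Matrix.smul_mul]
  have hs : ∀ X : E8 → Fin 8 → ℝ, (∑ n, X y n • torsion gm (W t) y n)ᵀ
      = -∑ n, X y n • torsion gm (W t) y n := fun X => by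
    rw [Matrix.transpose_sum, ← sum_neg_distrib]
    exact sum_congr rfl fun n _ => by
      rw [Matrix.transpose_smul, h.torsion_skew ht hy, smul_neg]
  have e1 : c₁ • divEnd gm W t y - c₂ • torVec gm W t X y + torVec gm W t Y y
      = (c₁ • divT gm (torsion gm (W t)) y - c₂ • (∑ n, X y n • torsion gm (W t) y n)
        + ∑ n, Y y n • torsion gm (W t) y n) * (gm y)⁻¹ := by
    rw [e, e, divEnd, add_mul, sub_mul, Matrix.smul_mul, Matrix.smul_mul]
  rw [e1]
  refine br_self_nonneg (inv_eq_of_frame hP) ?_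
  rw [Matrix.transpose_add, Matrix.transpose_sub, Matrix.transpose_smul, Matrix.transpose_smul,
    hs, hs, h.divT_skew ht hy]
  module

end ChartFlow

namespace NormalMetric

variable {gm : E8 → Mat} (h : NormalMetric gm) {y : E8} (hy : y ∈ Metric.ball (0 : E8) 1)
  {C : ℝ} (hC : ∀ w, |quad (radGam gm y * gm y) w| ≤ C * ‖y‖ ^ 2 * quad (gm y) w)

include h hy hC

/-- The trace is the sum of the quadratic form over the eight unit vectors of an orthonormal frame.
-/
lemma abs_trace_radGam_le : |(radGam gm y).trace| ≤ 8 * C * ‖y‖ ^ 2 := by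
  obtain ⟨P, hP⟩ := h.metric.frame y hy
  obtain ⟨h1, -, h3⟩ := frame_mul_inv hP
  have e : (radGam gm y).trace = ∑ b, quad (radGam gm y * gm y) (P b) := by
    have e1 : (radGam gm y).trace = (P * (radGam gm y * gm y) * Pᵀ).trace := by
      rw [Matrix.mul_assoc, Matrix.mul_assoc, h1, Matrix.trace_mul_comm, Matrix.mul_assoc,
        Matrix.nonsing_inv_mul _ h3, Matrix.mul_one]
    rw [e1, Matrix.trace]
    refine sum_congr rfl fun b _ => ?_
    rw [Matrix.diag_apply, Matrix.mul_assoc, Matrix.mul_apply, quad, dotProduct]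
    rfl
  rw [e]
  refine (abs_sum_le_sum_abs _ _).trans ((sum_le_sum fun b _ => hC (P b)).trans ?_)
  simp only [quad_row hP, sum_const, card_univ, Fintype.card_fin, nsmul_eq_mul]
  norm_num
  linarith

/-- The radial derivative of `g⁻¹` is `-2 g⁻¹ (radGam g) g⁻¹`, so the bound for the metric passes to
the inverse metric. -/
lemma abs_radialTerm_le {t₀ t : ℝ} {W : ℝ → E8 → Comp4}
    (hW : ChartFlow (Metric.ball (0 : E8) 1) gm t₀ W) (ht : t ∈ Set.Ico 0 t₀) :
    |radialTerm gm W t y| ≤ 2 * C * ‖y‖ ^ 2 * enDensity gm W t y := by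
  obtain ⟨P, hP⟩ := h.metric.frame y hy
  have hu := h.metric.isUnit_det hy
  have hs := h.metric.symm y hy
  have e1 : ∀ k l, ∑ m, y m * pderiv m (fun z => (gm z)⁻¹ k l) y
      = (-((2 : ℝ) • ((gm y)⁻¹ * (radGam gm y * gm y) * (gm y)⁻¹))) k l := by
    intro k l
    have h2 : ∑ m, y m • pdMat m (fun z => (gm z)⁻¹) y
        = -((2 : ℝ) • ((gm y)⁻¹ * (radGam gm y * gm y) * (gm y)⁻¹)) := by
      have h3 : (radGam gm y)ᵀ * (gm y)⁻¹ = (gm y)⁻¹ * radGam gm y := by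
        have h4 := h.radGam_mul_symm hy
        rw [Matrix.transpose_mul, hs] at h4
        calc (radGam gm y)ᵀ * (gm y)⁻¹
            = (gm y)⁻¹ * (gm y * (radGam gm y)ᵀ) * (gm y)⁻¹ := by
              rw [← Matrix.mul_assoc, Matrix.nonsing_inv_mul _ hu, Matrix.one_mul]
          _ = _ := by
              rw [h4, Matrix.mul_assoc, Matrix.mul_assoc, Matrix.mul_nonsing_inv _ hu,
                Matrix.mul_one]
      have h5 : ∑ m, y m • pdMat m (fun z => (gm z)⁻¹) y
          = -((gm y)⁻¹ * radGam gm y + (radGam gm y)ᵀ * (gm y)⁻¹) := by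
        simp only [h.metric.pdMat_inv hy, radGam, Matrix.transpose_sum, mul_sum, sum_mul,
          Matrix.transpose_smul, Matrix.mul_smul, Matrix.smul_mul, ← sum_add_distrib,
          ← sum_neg_distrib, smul_neg, smul_add]
      rw [h5, h3, Matrix.mul_assoc, Matrix.mul_assoc, Matrix.mul_nonsing_inv _ hu,
        Matrix.mul_one, two_smul]
    rw [← h2, Matrix.sum_apply]
    rfl
  have e2 : radialTerm gm W t y = ∑ k, ∑ l,
      (-((2 : ℝ) • ((gm y)⁻¹ * (radGam gm y * gm y) * (gm y)⁻¹))) k l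
        * br (torEnd gm W t k y) (torEnd gm W t l y) := by
    simp only [← e1, radialTerm, mul_sum, sum_mul]
    rw [sum_comm]
    refine sum_congr rfl fun k _ => ?_
    rw [sum_comm]
    exact sum_congr rfl fun l _ => sum_congr rfl fun m _ => by ring
  rw [e2]
  refine hW.abs_sum_mul_br_le ht hy hP fun v => ?_
  have e3 : quad (-((2 : ℝ) • ((gm y)⁻¹ * (radGam gm y * gm y) * (gm y)⁻¹))) v
      = -2 * quad (radGam gm y * gm y) ((gm y)⁻¹ *ᵥ v) := by
    have h6 := quad_conj (gm y)⁻¹ (radGam gm y * gm y) v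
    rw [h.metric.inv_symm hy] at h6
    rw [← neg_smul, quad_smul, h6, ← Matrix.mulVec_transpose, h.metric.inv_symm hy]
  rw [e3, abs_mul, ← quad_inv_mulVec hu]
  have := hC ((gm y)⁻¹ *ᵥ v)
  norm_num
  linarith

-- In an orthonormal frame the term is half a sum of 64 curvature components. The Gauss lemma gives
-- the position vector length `‖y‖`, and Cauchy–Schwarz over the 64 components costs `√128 ≤ 16`.
-- Only one factor of `T` occurs, hence the square root: this is the error that is not absorbed by
-- the density itself.
omit hC in
lemma abs_curvTerm_le {t₀ t K : ℝ} {W : ℝ → E8 → Comp4} (hK : 0 ≤ K)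
    (hR : ∀ u v w z : Fin 8 → ℝ, |rm gm y u v w z| ≤ K * (√(quad (gm y) u) * √(quad (gm y) v)
      * √(quad (gm y) w) * √(quad (gm y) z)))
    (hW : ChartFlow (Metric.ball (0 : E8) 1) gm t₀ W) (ht : t ∈ Set.Ico 0 t₀) :
    |curvTerm gm W t y| ≤ 8 * K * ‖y‖ * √(enDensity gm W t y) := by
  obtain ⟨P, hP⟩ := h.metric.frame y hy
  have hu := h.metric.isUnit_det hy
  have hs := h.metric.symm y hy
  set v : Fin 8 → Fin 8 → Fin 8 → ℝ := fun b c m => (P * torsion gm (W t) y m * Pᵀ) b c with hv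
  have e1 : ∀ m n k, br (torEnd gm W t m y) (curv gm n k y)
      = (1 / 2) * ∑ b, ∑ c, v b c m * (P b ⬝ᵥ (curv gm n k y * gm y) *ᵥ P c) := by
    intro m n k
    have h1 := br_frame (α := torsion gm (W t) y m) (inv_eq_of_frame hP)
      (h.metric.curv_skew hy n k)
    rw [Matrix.mul_assoc (curv gm n k y), Matrix.mul_nonsing_inv _ hu, Matrix.mul_one] at h1
    rw [torEnd, h1]
    congr 1
    refine sum_congr rfl fun b _ => sum_congr rfl fun c _ => ?_
    congr 1
    rw [Matrix.mul_assoc, Matrix.mul_apply, dotProduct]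
    rfl
  have e2 : curvTerm gm W t y = (1 / 2) * ∑ b, ∑ c, rm gm y ((gm y)⁻¹ *ᵥ v b c) y (P b) (P c) := by
    have h2 : ∀ b c, rm gm y ((gm y)⁻¹ *ᵥ v b c) y (P b) (P c)
        = ∑ n, ∑ k, ∑ m, (gm y)⁻¹ m n * v b c m * y k
          * (P b ⬝ᵥ (curv gm n k y * gm y) *ᵥ P c) := fun b c => by
      rw [rm]
      refine sum_congr rfl fun n _ => sum_congr rfl fun k _ => ?_
      rw [Matrix.mulVec, dotProduct, sum_mul, sum_mul]
      refine sum_congr rfl fun m _ => ?_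
      have : (gm y)⁻¹ n m = (gm y)⁻¹ m n := by
        conv_lhs => rw [← h.metric.inv_symm hy]
        rfl
      rw [this]
    simp only [curvTerm, e1, h2, mul_sum]
    have h3 : ∀ F : Fin 8 → Fin 8 → Fin 8 → Fin 8 → Fin 8 → ℝ,
        ∑ k, ∑ m, ∑ n, ∑ b, ∑ c, F k m n b c = ∑ b, ∑ c, ∑ n, ∑ k, ∑ m, F k m n b c := by
      intro F
      calc _ = ∑ k, ∑ b, ∑ c, ∑ m, ∑ n, F k m n b c :=
            sum_congr rfl fun k _ => sum_comm_4 _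
        _ = ∑ b, ∑ c, ∑ k, ∑ m, ∑ n, F k m n b c := by
            rw [sum_comm]; exact sum_congr rfl fun b _ => sum_comm
        _ = _ := sum_congr rfl fun b _ => sum_congr rfl fun c _ => by
            rw [sum_congr rfl fun k _ => sum_comm, sum_comm]
    rw [h3]
    exact sum_congr rfl fun b _ => sum_congr rfl fun c _ => sum_congr rfl fun n _ =>
      sum_congr rfl fun k _ => sum_congr rfl fun m _ => by ring
  have e3 : ∀ b c, |rm gm y ((gm y)⁻¹ *ᵥ v b c) y (P b) (P c)|
      ≤ K * ‖y‖ * √(quad (gm y)⁻¹ (v b c)) := fun b c => by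
    refine (hR _ _ _ _).trans (le_of_eq ?_)
    rw [quad_row hP, quad_row hP, h.quad_self hy, quad_inv_mulVec hu,
      Real.sqrt_sq (norm_nonneg y), Real.sqrt_one]
    ring
  have e4 : ∑ b, ∑ c, √(quad (gm y)⁻¹ (v b c)) ≤ √(64 * (2 * enDensity gm W t y)) := by
    have h4 := sum_abs_le_sqrt (univ : Finset (Fin 8 × Fin 8))
      (fun p => quad (gm y)⁻¹ (v p.1 p.2)) fun p _ => quad_nonneg_inv hP _
    rw [Fintype.sum_prod_type, Fintype.sum_prod_type] at h4
    refine h4.trans (Real.sqrt_le_sqrt ?_)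
    rw [hW.enDensity_eq_quad ht hy hP]
    simp only [card_univ, Fintype.card_prod, Fintype.card_fin, hv]
    norm_num
    linarith
  have e5 : √(64 * (2 * enDensity gm W t y)) ≤ 16 * √(enDensity gm W t y) := by
    have hh := hW.enDensity_nonneg ht hy
    rw [Real.sqrt_le_left (by positivity), mul_pow, Real.sq_sqrt hh]
    linarith
  rw [e2, abs_mul, abs_of_pos (by norm_num : (0 : ℝ) < 1 / 2)]
  have e6 : |∑ b, ∑ c, rm gm y ((gm y)⁻¹ *ᵥ v b c) y (P b) (P c)|
      ≤ K * ‖y‖ * ∑ b, ∑ c, √(quad (gm y)⁻¹ (v b c)) := by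
    rw [mul_sum]
    refine (abs_sum_le_sum_abs _ _).trans (sum_le_sum fun b _ => ?_)
    rw [mul_sum]
    exact (abs_sum_le_sum_abs _ _).trans (sum_le_sum fun c _ => e3 b c)
  have e7 : K * ‖y‖ * ∑ b, ∑ c, √(quad (gm y)⁻¹ (v b c))
      ≤ K * ‖y‖ * (16 * √(enDensity gm W t y)) :=
    mul_le_mul_of_nonneg_left (e4.trans e5) (by positivity)
  linarith

end NormalMetric

end QKFlow

end

noncomputable section

namespace QKFlow

open Matrix Finset

/-! ### The differential inequality for the local energy density -/

lemma one_le_four_pi : (1 : ℝ) ≤ 4 * Real.pi := by linarith [Real.pi_gt_three]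

lemma heatKernel_le_of_le {t₀ t : ℝ} (ht : t < t₀) (y : E8) :
    heatKernel t₀ t y ≤ 1 / (t₀ - t) ^ 4 := by
  have h0 : 0 < t₀ - t := sub_pos.2 ht
  have h1 : Real.exp (-‖y‖ ^ 2 / (4 * (t₀ - t))) ≤ 1 := by
    rw [Real.exp_le_one_iff]
    exact div_nonpos_of_nonpos_of_nonneg (by nlinarith [sq_nonneg ‖y‖]) (by positivity)
  have h2 : 1 / (4 * Real.pi * (t₀ - t)) ^ 4 ≤ 1 / (t₀ - t) ^ 4 := by
    refine one_div_le_one_div_of_le (by positivity) (pow_le_pow_left₀ h0.le ?_ 4)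
    nlinarith [one_le_four_pi]
  unfold heatKernel
  calc _ ≤ 1 / (t₀ - t) ^ 4 * 1 := mul_le_mul h2 h1 (Real.exp_pos _).le (by positivity)
    _ = _ := mul_one _

/-- Away from the pole the Gaussian beats the singular factor: `x⁴ / 4! ≤ eˣ` with `x = 1 / (16 (t₀
- t))`. -/
lemma heatKernel_le_of_half_le {t₀ t : ℝ} (ht : t < t₀) {y : E8} (hy : 1 / 2 ≤ ‖y‖) :
    heatKernel t₀ t y ≤ 24 * 16 ^ 4 := by
  have h0 : 0 < t₀ - t := sub_pos.2 ht
  set τ := t₀ - t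
  have h1 : Real.exp (-‖y‖ ^ 2 / (4 * τ)) ≤ 24 * 16 ^ 4 * τ ^ 4 := by
    have h2 : -‖y‖ ^ 2 / (4 * τ) ≤ -(1 / (16 * τ)) := by
      rw [neg_div, neg_le_neg_iff, div_le_div_iff₀ (by positivity) (by positivity)]
      nlinarith [mul_le_mul_of_nonneg_right (pow_le_pow_left₀ (by norm_num) hy 2) h0.le]
    have h3 := Real.pow_div_factorial_le_exp (1 / (16 * τ)) (by positivity) 4
    refine (Real.exp_le_exp.2 h2).trans ?_
    rw [Real.exp_neg, inv_le_comm₀ (Real.exp_pos _) (by positivity)]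
    refine le_trans (le_of_eq ?_) h3
    simp only [Nat.factorial]
    field_simp
    norm_num
  have h2 : 1 / (4 * Real.pi * τ) ^ 4 ≤ 1 / τ ^ 4 := by
    refine one_div_le_one_div_of_le (by positivity) (pow_le_pow_left₀ h0.le ?_ 4)
    nlinarith [one_le_four_pi]
  unfold heatKernel
  calc _ ≤ 1 / τ ^ 4 * (24 * 16 ^ 4 * τ ^ 4) :=
        mul_le_mul h2 h1 (Real.exp_pos _).le (by positivity)
    _ = _ := by field_simp

/-- The integrand of the local energy. -/
def localDensity (gm : E8 → Mat) (W : ℝ → E8 → Comp4) (φ : E8 → ℝ) (t₀ t : ℝ) (y : E8) : ℝ :=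
  (t₀ - t) * (enDensity gm W t y * cutKernel φ t₀ t y * √(gm y).det)

/-- The time derivative of the integrand of the local energy. -/
def localDeriv (gm : E8 → Mat) (W : ℝ → E8 → Comp4) (φ : E8 → ℝ) (t₀ t : ℝ) (y : E8) : ℝ :=
  √(gm y).det * (cutKernel φ t₀ t y * (enDensity gm W t y * (3 - ‖y‖ ^ 2 / (4 * (t₀ - t)))
    + 2 * (t₀ - t) * ∑ m, ∑ n, (gm y)⁻¹ m n *
      br (torEnd gm W t m y) (covMat gm n (divEnd gm W t) y)))

/-- The `3` in `localDeriv` is `4 - 1`, from the power of the kernel and from the factor `t₀ - t`;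
it is cancelled by the `-3` in the divergence of `monoField`. -/
lemma ChartFlow.hasDerivAt_localDensity {U : Set E8} {gm : E8 → Mat} {t₀ : ℝ}
    {W : ℝ → E8 → Comp4} (h : ChartFlow U gm t₀ W) (φ : E8 → ℝ) {t : ℝ} {y : E8}
    (ht : t ∈ Set.Ioo 0 t₀) (hy : y ∈ U) :
    HasDerivAt (fun s => localDensity gm W φ t₀ s y) (localDeriv gm W φ t₀ t y) t := by
  have h0 : t₀ - t ≠ 0 := (sub_pos.2 ht.2).ne'
  have h1 : HasDerivAt (fun s => t₀ - s) (-1) t := (hasDerivAt_id t).const_sub t₀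
  have h2 := h1.mul (((h.hasDerivAt_enDensity ht hy).mul
    ((hasDerivAt_heatKernel ht.2 y).mul_const (φ y ^ 2))).mul_const √(gm y).det)
  refine h2.congr_deriv ?_
  simp only [localDeriv, cutKernel, Pi.mul_apply]
  field_simp
  ring

lemma exists_cutoff_bound {φ : E8 → ℝ} (hφ : ContDiff ℝ ∞ φ)
    (hs : tsupport φ ⊆ Metric.ball (0 : E8) 1) : ∃ B : ℝ, 0 < B ∧ (∀ y, |φ y| ≤ B) ∧
      ∀ y, ∑ m, pderiv m φ y ^ 2 ≤ B ^ 2 := by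
  have hc : HasCompactSupport φ :=
    (isCompact_closedBall (0 : E8) 1).of_isClosed_subset (isClosed_tsupport φ)
      (hs.trans Metric.ball_subset_closedBall)
  obtain ⟨B₁, hB₁⟩ := hc.exists_bound_of_continuous hφ.continuous
  have hp : ∀ m, ∃ B : ℝ, ∀ y, ‖pderiv m φ y‖ ≤ B := fun m => by
    have h1 : HasCompactSupport (fun y => fderiv ℝ φ y) := hc.fderiv (𝕜 := ℝ)
    have h2 : HasCompactSupport (pderiv m φ) :=
      h1.comp_left (g := fun L : E8 →L[ℝ] ℝ => L (EuclideanSpace.single m 1)) rfl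
    refine h2.exists_bound_of_continuous ?_
    exact ((hφ.continuous_fderiv (by simp)).clm_apply continuous_const)
  choose B₂ hB₂ using hp
  have hB2 : 0 ≤ ∑ m, B₂ m ^ 2 := by positivity
  refine ⟨|B₁| + √(∑ m, B₂ m ^ 2) + 1, by positivity, fun y => ?_, fun y => ?_⟩
  · have := hB₁ y
    rw [Real.norm_eq_abs] at this
    linarith [le_abs_self B₁, Real.sqrt_nonneg (∑ m, B₂ m ^ 2)]
  · calc ∑ m, pderiv m φ y ^ 2 ≤ ∑ m, B₂ m ^ 2 := sum_le_sum fun m _ => by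
          rw [← sq_abs]
          exact pow_le_pow_left₀ (abs_nonneg _) (hB₂ m y) 2
      _ = √(∑ m, B₂ m ^ 2) ^ 2 := (Real.sq_sqrt hB2).symm
      _ ≤ _ := pow_le_pow_left₀ (Real.sqrt_nonneg _) (by linarith [abs_nonneg B₁]) 2

lemma pderiv_eq_zero_of_const {φ : E8 → ℝ} {c : ℝ}
    (hc : ∀ y ∈ Metric.ball (0 : E8) (1 / 2), φ y = c) {y : E8}
    (hy : y ∈ Metric.ball (0 : E8) (1 / 2)) (m : Fin 8) : pderiv m φ y = 0 := by
  rw [pderiv_congr Metric.isOpen_ball hc hy, pderiv_const]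

/-- Uniform geometry of a metric in normal coordinates. -/
structure BoundedNormalMetric (K C r₀ : ℝ) (gm : E8 → Mat) : Prop where
  normal : NormalMetric gm
  curvature : ∀ y ∈ Metric.ball (0 : E8) 1, ∀ u v w z : Fin 8 → ℝ, |rm gm y u v w z|
    ≤ K * (√(quad (gm y) u) * √(quad (gm y) v) * √(quad (gm y) w) * √(quad (gm y) z))
  radial : ∀ y : E8, ‖y‖ ≤ r₀ → ∀ w,
    |quad (radGam gm y * gm y) w| ≤ C * ‖y‖ ^ 2 * quad (gm y) w

namespace BoundedNormalMetric

variable {K C r₀ : ℝ} {gm : E8 → Mat} (h : BoundedNormalMetric K C r₀ gm) {t₀ t : ℝ}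
  {W : ℝ → E8 → Comp4} {φ : E8 → ℝ} {y : E8}

include h

/-- The lower bound for `g` at the vector `g⁻¹ d`, together with the Euclidean Cauchy–Schwarz
inequality for `⟨d, g⁻¹ d⟩`. -/
lemma quad_inv_le (hC : 0 ≤ C) (hr₀ : r₀ < 1) (hy : ‖y‖ ≤ r₀) (d : Fin 8 → ℝ) :
    quad (gm y)⁻¹ d ≤ Real.exp (2 * C) * (d ⬝ᵥ d) := by
  have hyb : y ∈ Metric.ball (0 : E8) 1 := mem_ball_zero_iff.2 (hy.trans_lt hr₀)
  have hu := h.normal.metric.isUnit_det hyb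
  obtain ⟨P, hP⟩ := h.normal.metric.frame y hyb
  have h1 := (h.normal.quad_bounds hC hr₀ h.radial hy ((gm y)⁻¹ *ᵥ d)).1
  rw [quad_inv_mulVec hu] at h1
  have hq := quad_nonneg_inv hP d
  have h2 : quad (gm y)⁻¹ d ^ 2 ≤ (d ⬝ᵥ d) * (((gm y)⁻¹ *ᵥ d) ⬝ᵥ ((gm y)⁻¹ *ᵥ d)) := by
    have := sum_mul_sq_le_sq_mul_sq univ d ((gm y)⁻¹ *ᵥ d)
    simpa only [quad, dotProduct, pow_two] using this
  have h3 : ((gm y)⁻¹ *ᵥ d) ⬝ᵥ ((gm y)⁻¹ *ᵥ d) ≤ Real.exp (2 * C) * quad (gm y)⁻¹ d := by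
    have h4 := mul_le_mul_of_nonneg_left h1 (Real.exp_pos (2 * C)).le
    rwa [← mul_assoc, ← Real.exp_add, neg_mul, add_neg_cancel, Real.exp_zero, one_mul] at h4
  have hd : 0 ≤ d ⬝ᵥ d := sum_nonneg fun i _ => mul_self_nonneg (d i)
  rcases hq.eq_or_lt with h0 | h0
  · rw [← h0]; positivity
  · refine le_of_mul_le_mul_right ?_ h0
    calc _ = quad (gm y)⁻¹ d ^ 2 := (pow_two _).symm
      _ ≤ _ := h2
      _ ≤ (d ⬝ᵥ d) * (Real.exp (2 * C) * quad (gm y)⁻¹ d) := mul_le_mul_of_nonneg_left h3 hd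
      _ = _ := by ring

/-- The differential inequality for the local energy density. -/
lemma localDeriv_add_le (hK : 0 ≤ K) (hC : 0 ≤ C) (hr₀ : r₀ < 1)
    (hW : ChartFlow (Metric.ball (0 : E8) 1) gm t₀ W) (hφ : ContDiff ℝ ∞ φ) {B : ℝ}
    (hB : ∀ y, |φ y| ≤ B) (hB' : ∀ y, ∑ m, pderiv m φ y ^ 2 ≤ B ^ 2)
    {c : ℝ} (hc : ∀ y ∈ Metric.ball (0 : E8) (1 / 2), φ y = c)
    (ht : t ∈ Set.Ioo 0 t₀) (h1 : t₀ - t ≤ 1) (hy : ‖y‖ ≤ r₀) :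
    localDeriv gm W φ t₀ t y + ∑ m, pderiv m (monoField gm W φ t₀ t m) y
      ≤ (24 * 16 ^ 4 * B ^ 2 * (2 * Real.exp (2 * C) + 1) + 5 * C + 8 * K) * (√(gm y).det *
        (enDensity gm W t y + ‖y‖ ^ 2 * enDensity gm W t y * cutKernel φ t₀ t y
          + ‖y‖ * √(enDensity gm W t y) * cutKernel φ t₀ t y)) := by
  have hyb : y ∈ Metric.ball (0 : E8) 1 := mem_ball_zero_iff.2 (hy.trans_lt hr₀)
  have ht' : t ∈ Set.Ico 0 t₀ := ⟨ht.1.le, ht.2⟩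
  have hτ : 0 < t₀ - t := sub_pos.2 ht.2
  have hB0 : 0 ≤ B := (abs_nonneg _).trans (hB 0)
  have hh := hW.enDensity_nonneg ht' hyb
  have hG := heatKernel_pos ht.2 y
  have hψ : 0 ≤ cutKernel φ t₀ t y := mul_nonneg hG.le (sq_nonneg _)
  rw [h.normal.sum_pderiv_monoField hW hφ ht' hyb, localDeriv, ← mul_add,
    mul_left_comm _ √(gm y).det]
  refine mul_le_mul_of_nonneg_left ?_ (Real.sqrt_nonneg _)
  -- the square
  have hq := hW.br_smul_add_nonneg ht' hyb (φ y) (φ y / (2 * (t₀ - t))) (fun y => y) (gradVec gm φ)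
  have ha := hW.br_torVec_le ht' hyb (gradVec gm φ)
  have htr := h.normal.abs_trace_radGam_le hyb (h.radial y hy)
  have hrad := h.normal.abs_radialTerm_le hyb (h.radial y hy) hW ht'
  have hcur := h.normal.abs_curvTerm_le hyb hK (h.curvature y hyb) hW ht'
  -- the terms with the derivative of the cutoff function
  have hgrad : quad (gm y) (gradVec gm φ y) ≤ Real.exp (2 * C) * ∑ m, pderiv m φ y ^ 2 := by
    have e : gradVec gm φ y = (gm y)⁻¹ *ᵥ fun m => pderiv m φ y := by
      rw [← Matrix.vecMul_transpose, h.normal.metric.inv_symm hyb]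
      funext n
      rw [gradVec, Matrix.vecMul, dotProduct]
      exact sum_congr rfl fun m _ => mul_comm _ _
    rw [e, quad_inv_mulVec (h.normal.metric.isUnit_det hyb)]
    refine (h.quad_inv_le hC hr₀ hy _).trans (le_of_eq ?_)
    simp only [dotProduct, pow_two]
  -- The gradient of `φ` vanishes for `‖y‖ < 1/2`, and elsewhere the kernel is bounded uniformly in
  -- time.
  have hcut : heatKernel t₀ t y * ∑ m, pderiv m φ y ^ 2 ≤ 24 * 16 ^ 4 * B ^ 2 := by
    rcases lt_or_ge ‖y‖ (1 / 2) with h2 | h2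
    · simp only [pderiv_eq_zero_of_const hc (mem_ball_zero_iff.2 h2)]
      simp only [ne_eq, OfNat.ofNat_ne_zero, not_false_eq_true, zero_pow, sum_const_zero, mul_zero]
      positivity
    · exact mul_le_mul (heatKernel_le_of_half_le ht.2 h2) (hB' y)
        (sum_nonneg fun m _ => sq_nonneg _) (by positivity)
  have hx : |∑ m, y m * pderiv m φ y| ≤ √(∑ m, pderiv m φ y ^ 2) := by
    refine Real.abs_le_sqrt ((sum_mul_sq_le_sq_mul_sq univ (fun m => y m) _).trans ?_)
    have e : ∑ m, y m ^ 2 = ‖y‖ ^ 2 := by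
      rw [EuclideanSpace.norm_sq_eq]
      simp only [Real.norm_eq_abs, sq_abs]
    rw [e]
    have : ‖y‖ ^ 2 ≤ 1 := by nlinarith [norm_nonneg y]
    have h0 : 0 ≤ ∑ m, pderiv m φ y ^ 2 := sum_nonneg fun m _ => sq_nonneg _
    nlinarith
  have hcut' : heatKernel t₀ t y * |∑ m, y m * pderiv m φ y| ≤ 24 * 16 ^ 4 * B := by
    rcases lt_or_ge ‖y‖ (1 / 2) with h2 | h2
    · simp only [pderiv_eq_zero_of_const hc (mem_ball_zero_iff.2 h2), mul_zero, sum_const_zero,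
        abs_zero]
      positivity
    · refine mul_le_mul (heatKernel_le_of_half_le ht.2 h2) (hx.trans ?_)
        (abs_nonneg _) (by positivity)
      rw [Real.sqrt_le_left hB0]
      exact hB' y
  have hT1 : 2 * (t₀ - t) * heatKernel t₀ t y * br (torVec gm W t (gradVec gm φ) y)
      (torVec gm W t (gradVec gm φ) y)
      ≤ 2 * Real.exp (2 * C) * (24 * 16 ^ 4 * B ^ 2) * enDensity gm W t y := by
    have hs0 : 0 ≤ ∑ m, pderiv m φ y ^ 2 := sum_nonneg fun m _ => sq_nonneg _
    have e := Real.exp_pos (2 * C)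
    calc _ ≤ 2 * (t₀ - t) * heatKernel t₀ t y * (Real.exp (2 * C) * (∑ m, pderiv m φ y ^ 2)
          * enDensity gm W t y) := by
          refine mul_le_mul_of_nonneg_left (ha.trans ?_) (by positivity)
          exact mul_le_mul_of_nonneg_right hgrad hh
      _ = (t₀ - t) * (2 * Real.exp (2 * C) * (heatKernel t₀ t y * ∑ m, pderiv m φ y ^ 2)
          * enDensity gm W t y) := by ring
      _ ≤ 1 * (2 * Real.exp (2 * C) * (24 * 16 ^ 4 * B ^ 2) * enDensity gm W t y) := by
          refine mul_le_mul h1 ?_ (by positivity) zero_le_one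
          refine mul_le_mul_of_nonneg_right ?_ hh
          exact mul_le_mul_of_nonneg_left hcut (by positivity)
      _ = _ := one_mul _
  have hT2 : -(heatKernel t₀ t y * φ y * (∑ m, y m * pderiv m φ y) * enDensity gm W t y)
      ≤ 24 * 16 ^ 4 * B ^ 2 * enDensity gm W t y := by
    refine (neg_le_abs _).trans ?_
    rw [abs_mul, abs_mul, abs_mul, abs_of_pos hG, abs_of_nonneg hh]
    refine mul_le_mul_of_nonneg_right ?_ hh
    calc _ = heatKernel t₀ t y * |∑ m, y m * pderiv m φ y| * |φ y| := by ring
      _ ≤ 24 * 16 ^ 4 * B * B := mul_le_mul hcut' (hB y) (abs_nonneg _) (by positivity)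
      _ = _ := by ring
  have hT3 : -(1 / 2 * cutKernel φ t₀ t y * radialTerm gm W t y)
      ≤ C * (‖y‖ ^ 2 * enDensity gm W t y * cutKernel φ t₀ t y) := by
    have := mul_le_mul_of_nonneg_left ((neg_le_abs _).trans hrad) hψ
    linarith
  have hT4 : -(cutKernel φ t₀ t y * curvTerm gm W t y)
      ≤ 8 * K * (‖y‖ * √(enDensity gm W t y) * cutKernel φ t₀ t y) := by
    have := mul_le_mul_of_nonneg_left ((neg_le_abs _).trans hcur) hψ
    linarith
  have hT5 : -(1 / 2 * cutKernel φ t₀ t y * (radGam gm y).trace * enDensity gm W t y)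
      ≤ 4 * C * (‖y‖ ^ 2 * enDensity gm W t y * cutKernel φ t₀ t y) := by
    have := mul_le_mul_of_nonneg_left ((neg_le_abs _).trans htr) (mul_nonneg hψ hh)
    linarith
  -- Completing the square. The terms `⟨T, ∇ div T⟩`, the multiples of the density by `3` and by
  -- `‖y‖² / (4 (t₀ - t))` cancel exactly. Including `∇φ⌟T` in the square leaves only its own square
  -- with a positive sign.
  have key : cutKernel φ t₀ t y * (enDensity gm W t y * (3 - ‖y‖ ^ 2 / (4 * (t₀ - t)))
      + 2 * (t₀ - t) * ∑ m, ∑ n, (gm y)⁻¹ m n *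
        br (torEnd gm W t m y) (covMat gm n (divEnd gm W t) y))
      + (cutKernel φ t₀ t y * br (divEnd gm W t y) (torVec gm W t (fun y => y) y
        - (2 * (t₀ - t)) • divEnd gm W t y)
      + br ((2 * heatKernel t₀ t y * φ y) • torVec gm W t (gradVec gm φ) y
        - (cutKernel φ t₀ t y / (2 * (t₀ - t))) • torVec gm W t (fun y => y) y)
          (torVec gm W t (fun y => y) y - (2 * (t₀ - t)) • divEnd gm W t y)
      - 2 * (t₀ - t) * cutKernel φ t₀ t y * ∑ m, ∑ n, (gm y)⁻¹ m n *
          br (torEnd gm W t m y) (covMat gm n (divEnd gm W t) y)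
      - (1 / 2) * cutKernel φ t₀ t y * radialTerm gm W t y
      - cutKernel φ t₀ t y * curvTerm gm W t y
      - (1 / 2) * cutKernel φ t₀ t y * (radGam gm y).trace * enDensity gm W t y
      - 3 * cutKernel φ t₀ t y * enDensity gm W t y
      - heatKernel t₀ t y * φ y * (∑ m, y m * pderiv m φ y) * enDensity gm W t y
      + (1 / 2) * enDensity gm W t y * cutKernel φ t₀ t y * (‖y‖ ^ 2 / (2 * (t₀ - t))))
      = -(2 * (t₀ - t) * heatKernel t₀ t y) * br
          (φ y • divEnd gm W t y - (φ y / (2 * (t₀ - t))) • torVec gm W t (fun y => y) y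
            + torVec gm W t (gradVec gm φ) y)
          (φ y • divEnd gm W t y - (φ y / (2 * (t₀ - t))) • torVec gm W t (fun y => y) y
            + torVec gm W t (gradVec gm φ) y)
        + 2 * (t₀ - t) * heatKernel t₀ t y * br (torVec gm W t (gradVec gm φ) y)
          (torVec gm W t (gradVec gm φ) y)
        + -(1 / 2 * cutKernel φ t₀ t y * radialTerm gm W t y)
        + -(cutKernel φ t₀ t y * curvTerm gm W t y)
        + -(1 / 2 * cutKernel φ t₀ t y * (radGam gm y).trace * enDensity gm W t y)
        + -(heatKernel t₀ t y * φ y * (∑ m, y m * pderiv m φ y) * enDensity gm W t y) := by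
    have br_sub_left : ∀ a b c : Mat, br (a - b) c = br a c - br b c := fun a b c => by
      rw [br_comm, br_sub_right, br_comm c a, br_comm c b]
    simp only [br_sub_left, br_sub_right, br_add_left, br_add_right, br_smul_left, br_smul_right,
      cutKernel]
    rw [br_comm (torVec gm W t (fun y => y) y) (divEnd gm W t y),
      br_comm (torVec gm W t (gradVec gm φ) y) (divEnd gm W t y),
      br_comm (torVec gm W t (gradVec gm φ) y) (torVec gm W t (fun y => y) y)]
    field_simp
    ring
  rw [key]
  have hsq : -(2 * (t₀ - t) * heatKernel t₀ t y) * br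
          (φ y • divEnd gm W t y - (φ y / (2 * (t₀ - t))) • torVec gm W t (fun y => y) y
            + torVec gm W t (gradVec gm φ) y)
          (φ y • divEnd gm W t y - (φ y / (2 * (t₀ - t))) • torVec gm W t (fun y => y) y
            + torVec gm W t (gradVec gm φ) y) ≤ 0 := by
    rw [neg_mul, neg_nonpos]
    exact mul_nonneg (by positivity) hq
  set X := enDensity gm W t y
  set Y := ‖y‖ ^ 2 * X * cutKernel φ t₀ t y with hY
  set V := ‖y‖ * √X * cutKernel φ t₀ t y with hV
  have hY0 : 0 ≤ Y := by positivity
  have hV0 : 0 ≤ V := by positivity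
  set A₁ := 24 * 16 ^ 4 * B ^ 2 * (2 * Real.exp (2 * C) + 1) with hA₁
  have hA0 : 0 ≤ A₁ := by positivity
  have hfin : A₁ * X + 5 * C * Y + 8 * K * V ≤ (A₁ + 5 * C + 8 * K) * (X + Y + V) := by
    have p1 : 0 ≤ A₁ * (Y + V) := by positivity
    have p2 : 0 ≤ 5 * C * (X + V) := by positivity
    have p3 : 0 ≤ 8 * K * (X + Y) := by positivity
    nlinarith
  refine le_trans ?_ hfin
  have e5 : A₁ * X = 2 * Real.exp (2 * C) * (24 * 16 ^ 4 * B ^ 2) * X + 24 * 16 ^ 4 * B ^ 2 * X := by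
    rw [hA₁]; ring
  linarith

end BoundedNormalMetric

end QKFlow

end

/-! ### Integration: the divergence theorem, the Riemannian integral, and decay of the energy. -/

noncomputable section

namespace QKFlow

open Matrix Finset MeasureTheory

/-! ### Integrals over compact subsets of Euclidean space -/

lemma integral_pderiv_eq_zero {V : E8 → ℝ} (hV : ContDiff ℝ 1 V) (hc : HasCompactSupport V)
    (m : Fin 8) : ∫ y, pderiv m V y = 0 := by
  have h1 : Continuous (pderiv m V) :=
    (hV.continuous_fderiv (by simp)).clm_apply continuous_const
  have h2 : HasCompactSupport (pderiv m V) :=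
    (hc.fderiv (𝕜 := ℝ)).comp_left
      (g := fun L : E8 →L[ℝ] ℝ => L (EuclideanSpace.single m 1)) rfl
  have h3 := integral_mul_fderiv_eq_neg_fderiv_mul_of_integrable (μ := (volume : Measure E8))
    (f := fun _ : E8 => (1 : ℝ)) (g := V) (v := EuclideanSpace.single m 1) (by simp)
    (by simp only [one_mul]; exact h1.integrable_of_hasCompactSupport h2)
    (by simp only [one_mul]; exact hV.continuous.integrable_of_hasCompactSupport hc)
    (fun _ _ => differentiableAt_const _)
    (fun _ _ => hV.differentiable (by simp) _)
  simpa [pderiv] using h3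

/-- The divergence theorem for vector fields with compact support. -/
lemma setIntegral_sum_pderiv_eq_zero {U K : Set E8} (hU : IsOpen U) (hK : IsCompact K)
    (hKU : K ⊆ U) {V : Fin 8 → E8 → ℝ} (hV : ∀ m, ContDiffOn ℝ ∞ (V m) U)
    (h0 : ∀ m, ∀ y ∈ U, y ∉ K → V m y = 0) :
    ∫ y in K, ∑ m, pderiv m (V m) y = 0 := by
  classical
  have hz : ∀ m y, y ∉ K → U.indicator (V m) y = 0 := fun m y hy => by
    by_cases hyU : y ∈ U
    · rw [Set.indicator_of_mem hyU, h0 m y hyU hy]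
    · exact Set.indicator_of_notMem hyU _
  -- The extension by zero is smooth: near points of `K` it equals `V m`, and off the closed set `K`
  -- it vanishes.
  have hs : ∀ m, ContDiff ℝ 1 (U.indicator (V m)) := fun m => by
    rw [contDiff_iff_contDiffAt]
    intro y
    by_cases hy : y ∈ K
    · have h1 : ContDiffAt ℝ 1 (V m) y :=
        ((hV m).contDiffAt (hU.mem_nhds (hKU hy))).of_le (by simp)
      exact h1.congr_of_eventuallyEq (Filter.eventuallyEq_of_mem (hU.mem_nhds (hKU hy))
        fun z hz => Set.indicator_of_mem hz _)
    · exact (contDiffAt_const (c := (0 : ℝ))).congr_of_eventuallyEq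
        (Filter.eventuallyEq_of_mem (hK.isClosed.isOpen_compl.mem_nhds hy) fun z hz' => hz m z hz')
  have hc : ∀ m, HasCompactSupport (U.indicator (V m)) := fun m =>
    HasCompactSupport.intro hK fun y hy => hz m y hy
  have e1 : ∫ y in K, ∑ m, pderiv m (V m) y = ∫ y, ∑ m, pderiv m (U.indicator (V m)) y := by
    rw [← integral_indicator hK.measurableSet]
    congr 1
    funext y
    by_cases hy : y ∈ K
    · rw [Set.indicator_of_mem hy]
      exact sum_congr rfl fun m _ => (pderiv_congr hU
        (fun z hz => Set.indicator_of_mem hz _) (hKU hy) m).symm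
    · rw [Set.indicator_of_notMem hy, eq_comm]
      refine sum_eq_zero fun m _ => ?_
      rw [pderiv_congr hK.isClosed.isOpen_compl (fun z hz' => hz m z hz') hy, pderiv_const]
  rw [e1, integral_finsetSum]
  · exact sum_eq_zero fun m _ => integral_pderiv_eq_zero (hs m) (hc m) m
  · intro m _
    exact ((((hs m).continuous_fderiv (by simp)).clm_apply
      continuous_const).integrable_of_hasCompactSupport (((hc m).fderiv (𝕜 := ℝ)).comp_left
        (g := fun L : E8 →L[ℝ] ℝ => L (EuclideanSpace.single m 1)) rfl))

lemma continuousOn_setIntegral {K : Set E8} (hK : IsCompact K) {S : Set ℝ} (hS : IsCompact S)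
    {F : ℝ → E8 → ℝ} (hF : ContinuousOn (fun q : ℝ × E8 => F q.1 q.2) (S ×ˢ K)) :
    ContinuousOn (fun s => ∫ y in K, F s y) S := by
  obtain ⟨C, hC⟩ := (hS.prod hK).exists_bound_of_continuousOn hF
  have hfin : volume K < ⊤ := hK.measure_lt_top
  refine continuousOn_of_dominated (bound := fun _ => C) (fun s hs => ?_) (fun s hs => ?_) ?_ ?_
  · exact (hF.comp (f := fun y : E8 => (s, y)) (by fun_prop)
      fun y hy => ⟨hs, hy⟩).aestronglyMeasurable hK.measurableSet
  · exact (ae_restrict_iff' hK.measurableSet).2 (Filter.Eventually.of_forall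
      fun y hy => hC (s, y) ⟨hs, hy⟩)
  · exact integrableOn_const hfin.ne
  · exact (ae_restrict_iff' hK.measurableSet).2 (Filter.Eventually.of_forall fun y hy =>
      hF.comp (f := fun s : ℝ => (s, y)) (by fun_prop) fun s hs => ⟨hs, hy⟩)

/-- Differentiation under the integral sign. -/
lemma hasDerivAt_setIntegral {U K : Set E8} (hU : IsOpen U) (hK : IsCompact K) (hKU : K ⊆ U)
    {T : Set ℝ} (hT : IsOpen T) {F : ℝ → E8 → ℝ}
    (hF : ContDiffOn ℝ ∞ (fun q : ℝ × E8 => F q.1 q.2) (T ×ˢ U)) {t : ℝ} (ht : t ∈ T) {F' : E8 → ℝ}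
    (hF' : ∀ y ∈ K, HasDerivAt (fun s => F s y) (F' y) t) :
    HasDerivAt (fun s => ∫ y in K, F s y) (∫ y in K, F' y) t := by
  set f : ℝ × E8 → ℝ := fun q => F q.1 q.2 with hf
  have hTU : IsOpen (T ×ˢ U) := hT.prod hU
  set D : ℝ → E8 → ℝ := fun s y => fderiv ℝ f (s, y) (1, 0) with hD
  have hd : ∀ s ∈ T, ∀ y ∈ U, HasDerivAt (fun s => F s y) (D s y) s := fun s hs y hy => by
    have h1 : HasDerivAt (fun s : ℝ => (s, y)) ((1, 0) : ℝ × E8) s :=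
      (hasDerivAt_id s).prodMk (hasDerivAt_const s y)
    exact HasFDerivAt.comp_hasDerivAt (l := f) s
      ((hF.contDiffAt (hTU.mem_nhds ⟨hs, hy⟩)).differentiableAt (by simp)).hasFDerivAt h1
  have hDc : ContinuousOn (fun q : ℝ × E8 => D q.1 q.2) (T ×ˢ U) :=
    (hF.continuousOn_fderiv_of_isOpen hTU (by simp)).clm_apply continuousOn_const
  obtain ⟨ε, hε, hεT⟩ := Metric.isOpen_iff.1 hT t ht
  have hI : Metric.closedBall t (ε / 2) ⊆ T :=
    (Metric.closedBall_subset_ball (by linarith)).trans hεT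
  obtain ⟨C, hC⟩ := ((isCompact_closedBall t (ε / 2)).prod hK).exists_bound_of_continuousOn
    (hDc.mono (Set.prod_mono hI hKU))
  have hmeas : ∀ s ∈ T, AEStronglyMeasurable (F s) (volume.restrict K) := fun s hs =>
    (hF.continuousOn.comp (f := fun y : E8 => (s, y)) (by fun_prop)
      fun y hy => ⟨hs, hKU hy⟩).aestronglyMeasurable hK.measurableSet
  have hfin : volume K < ⊤ := hK.measure_lt_top
  have h2 := (hasDerivAt_integral_of_dominated_loc_of_deriv_le (μ := volume.restrict K)
    (F := F) (F' := D) (x₀ := t) (bound := fun _ => C) (s := Metric.closedBall t (ε / 2))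
    (Metric.closedBall_mem_nhds t (by linarith))
    (Filter.eventually_of_mem (hT.mem_nhds ht) hmeas)
    ((hF.continuousOn.comp (f := fun y : E8 => (t, y)) (by fun_prop)
      fun y hy => ⟨ht, hKU hy⟩).integrableOn_compact hK)
    ((hDc.comp (f := fun y : E8 => (t, y)) (by fun_prop)
      fun y hy => ⟨ht, hKU hy⟩).aestronglyMeasurable hK.measurableSet)
    ((ae_restrict_iff' hK.measurableSet).2 (Filter.Eventually.of_forall
      fun y hy s hs => hC (s, y) ⟨hs, hy⟩))
    (integrableOn_const hfin.ne)
    ((ae_restrict_iff' hK.measurableSet).2 (Filter.Eventually.of_forall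
      fun y hy s hs => hd s (hI hs) y (hKU hy)))).2
  refine h2.congr_deriv (setIntegral_congr_fun hK.measurableSet fun y hy => ?_)
  exact (hd t ht y (hKU hy)).unique (hF' y hy)

/-! ### Change of charts in integrals -/

lemma det_fderiv_eq (ψ : E8 → E8) {y : E8} (hψ : DifferentiableAt ℝ ψ y) :
    (fderiv ℝ ψ y).det = (jac ψ y).det := by
  have h1 : (jac ψ y)ᵀ = LinearMap.toMatrix (EuclideanSpace.basisFun (Fin 8) ℝ).toBasis
      (EuclideanSpace.basisFun (Fin 8) ℝ).toBasis (fderiv ℝ ψ y : E8 →ₗ[ℝ] E8) := by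
    ext a i
    rw [LinearMap.toMatrix_apply]
    simp only [OrthonormalBasis.coe_toBasis, EuclideanSpace.basisFun_apply, Matrix.transpose_apply,
      OrthonormalBasis.coe_toBasis_repr_apply, EuclideanSpace.basisFun_repr,
      ContinuousLinearMap.coe_coe]
    have h2 : HasFDerivAt (fun z => ψ z a) ((coordL a).comp (fderiv ℝ ψ y)) y :=
      (coordL a).hasFDerivAt.comp y hψ.hasFDerivAt
    change pderiv i (fun z => ψ z a) y = _
    rw [pderiv, h2.fderiv]
    rfl
  rw [← Matrix.det_transpose, h1, LinearMap.det_toMatrix]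

end QKFlow

end

noncomputable section

namespace QKFlow

open Matrix Finset MeasureTheory

/-! ### The Riemannian integral -/

section Manifold

variable {M : Type*} [TopologicalSpace M] [ChartedSpace E8 M] [IsManifold (𝓡 8) ∞ M]
  {e e' : OpenPartialHomeomorph M E8}
  (he : e ∈ IsManifold.maximalAtlas (𝓡 8) ∞ M) (he' : e' ∈ IsManifold.maximalAtlas (𝓡 8) ∞ M)

omit [ChartedSpace E8 M] [IsManifold (𝓡 8) ∞ M] in
lemma image_transition : transition e e' '' overlap e e' = overlap e' e := by
  refine Set.Subset.antisymm (Set.image_subset_iff.2 (mapsTo_transition e e')) fun y hy => ?_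
  exact ⟨transition e' e y, mapsTo_transition e' e hy, transition_transition hy⟩

omit [ChartedSpace E8 M] [IsManifold (𝓡 8) ∞ M] in
lemma continuousOn_comp_symm {f : M → ℝ} (hf : Continuous f) :
    ContinuousOn (fun y => f (e.symm y)) e.target :=
  hf.comp_continuousOn e.continuousOn_symm

include he

lemma continuousOn_sqrt_det (g : SmoothMetric M) :
    ContinuousOn (fun y => √(metricCoeff g e y).det) e.target :=
  (chartMetric_metricCoeff he g).contDiffOn_sqrt_det.continuousOn

include he'

/-- Change of variables: the Jacobian factor is the one by which the volume densities differ. -/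
lemma setIntegral_overlap (g : SmoothMetric M) (f : M → ℝ) :
    ∫ y in overlap e' e, f (e.symm y) * √(metricCoeff g e y).det
      = ∫ y in overlap e e', f (e'.symm y) * √(metricCoeff g e' y).det := by
  have hc := chartChange_transition he he' g
  have hd : ∀ y ∈ overlap e e', HasFDerivWithinAt (transition e e')
      (fderiv ℝ (transition e e') y) (overlap e e') y := fun y hy =>
    (hc.differentiableAt hy).hasFDerivAt.hasFDerivWithinAt
  have hinj : Set.InjOn (transition e e') (overlap e e') := fun x hx y hy hxy => by
    rw [← transition_transition hx, hxy, transition_transition hy]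
  rw [← image_transition, integral_image_eq_integral_abs_det_fderiv_smul volume
    (isOpen_overlap e e').measurableSet hd hinj]
  refine setIntegral_congr_fun (isOpen_overlap e e').measurableSet fun y hy => ?_
  simp only [smul_eq_mul]
  rw [symm_transition hy, hc.sqrt_det hy, det_fderiv_eq _ (hc.differentiableAt hy)]
  ring

/-- Integrals of functions supported in the domains of two charts. -/
lemma setIntegral_target_eq (g : SmoothMetric M) {f : M → ℝ} (hf : ∀ x ∉ e.source, f x = 0)
    (hf' : ∀ x ∉ e'.source, f x = 0) :
    ∫ y in e'.target, f (e'.symm y) * √(metricCoeff g e' y).det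
      = ∫ y in e.target, f (e.symm y) * √(metricCoeff g e y).det := by
  have h1 : ∀ e e' : OpenPartialHomeomorph M E8, (∀ x ∉ e.source, f x = 0) →
      ∫ y in e'.target, f (e'.symm y) * √(metricCoeff g e' y).det
        = ∫ y in overlap e e', f (e'.symm y) * √(metricCoeff g e' y).det := by
    intro e e' hf
    refine setIntegral_eq_of_subset_of_forall_sdiff_eq_zero e'.open_target.measurableSet
      Set.inter_subset_left fun y hy => ?_
    rw [hf _ fun h => hy.2 ⟨hy.1, h⟩, zero_mul]
  rw [h1 e e' hf, h1 e' e hf', setIntegral_overlap he he']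

end Manifold

section Compact

variable {M : Type*} [TopologicalSpace M] [ChartedSpace E8 M] [IsManifold (𝓡 8) ∞ M] [T2Space M]
  [CompactSpace M]

variable (M) in
lemma finite_support_chartPartition :
    {i : M | (Function.support (chartPartition M i)).Nonempty}.Finite :=
  (chartPartition M).locallyFinite.finite_nonempty_of_compact

variable (M) in
/-- The indices of the charts that contribute to the Riemannian integral. -/
def chartSet : Finset M := (finite_support_chartPartition M).toFinset

lemma chartPartition_eq_zero {i : M} (hi : i ∉ chartSet M) (x : M) : chartPartition M i x = 0 := by
  by_contra h
  exact hi ((Set.Finite.mem_toFinset _).2 ⟨x, h⟩)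

lemma sum_chartPartition (x : M) : ∑ i ∈ chartSet M, chartPartition M i x = 1 := by
  have h1 := (chartPartition M).sum_eq_one (Set.mem_univ x)
  rw [finsum_eq_sum_of_support_subset] at h1
  · exact h1
  · intro i hi
    by_contra h
    exact hi (chartPartition_eq_zero h x)

lemma integralVol_eq (g : SmoothMetric M) (h : M → ℝ) : integralVol g h
    = ∑ i ∈ chartSet M, ∫ y in (chartAt E8 i).target,
      chartPartition M i ((chartAt E8 i).symm y) * h ((chartAt E8 i).symm y)
        * √(metricCoeff g (chartAt E8 i) y).det := by
  rw [integralVol, finsum_eq_sum_of_support_subset]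
  intro i hi
  by_contra h
  exact hi (by simp [chartPartition_eq_zero h])

lemma tsupport_chartPartition (i : M) :
    tsupport (chartPartition M i) ⊆ (chartAt E8 i).source :=
  (SmoothPartitionOfUnity.exists_isSubordinate_chartAt_source (𝓡 8) M).choose_spec i

/-- The support of the function `chartPartition M i` in the chart around `i`. -/
def chartSupport (i : M) : Set E8 := chartAt E8 i '' tsupport (chartPartition M i)

lemma isCompact_chartSupport (i : M) : IsCompact (chartSupport i) :=
  (isClosed_tsupport _).isCompact.image_of_continuousOn
    ((chartAt E8 i).continuousOn.mono (tsupport_chartPartition i))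

lemma chartSupport_subset (i : M) : chartSupport i ⊆ (chartAt E8 i).target := by
  rintro _ ⟨x, hx, rfl⟩
  exact (chartAt E8 i).map_source (tsupport_chartPartition i hx)

lemma symm_mem_tsupport_iff {i : M} {y : E8} (hy : y ∈ (chartAt E8 i).target) :
    (chartAt E8 i).symm y ∈ tsupport (chartPartition M i) ↔ y ∈ chartSupport i := by
  refine ⟨fun h => ⟨_, h, (chartAt E8 i).right_inv hy⟩, ?_⟩
  rintro ⟨x, hx, rfl⟩
  rwa [(chartAt E8 i).left_inv (tsupport_chartPartition i hx)]

lemma chartPartition_symm_eq_zero {i : M} {y : E8} (hy : y ∈ (chartAt E8 i).target)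
    (h : y ∉ chartSupport i) : chartPartition M i ((chartAt E8 i).symm y) = 0 :=
  image_eq_zero_of_notMem_tsupport fun h' => h ((symm_mem_tsupport_iff hy).1 h')

lemma continuous_chartPartition (i : M) : Continuous (chartPartition M i) :=
  (chartPartition M i).contMDiff.continuous

lemma integralVol_eq_setIntegral (g : SmoothMetric M) (h : M → ℝ) : integralVol g h
    = ∑ i ∈ chartSet M, ∫ y in chartSupport i,
      chartPartition M i ((chartAt E8 i).symm y) * h ((chartAt E8 i).symm y)
        * √(metricCoeff g (chartAt E8 i) y).det := by
  rw [integralVol_eq]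
  refine sum_congr rfl fun i _ => ?_
  refine setIntegral_eq_of_subset_of_forall_sdiff_eq_zero
    (chartAt E8 i).open_target.measurableSet (chartSupport_subset i) fun y hy => ?_
  rw [chartPartition_symm_eq_zero hy.1 hy.2, zero_mul, zero_mul]

lemma integrableOn_chartSupport (g : SmoothMetric M) {f : M → ℝ} (hf : Continuous f) (i : M) :
    IntegrableOn (fun y => chartPartition M i ((chartAt E8 i).symm y) * f ((chartAt E8 i).symm y)
      * √(metricCoeff g (chartAt E8 i) y).det) (chartSupport i) := by
  refine ContinuousOn.integrableOn_compact (isCompact_chartSupport i) ?_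
  exact (((continuousOn_comp_symm (continuous_chartPartition i)).mul
    (continuousOn_comp_symm hf)).mul (continuousOn_sqrt_det
      (IsManifold.chart_mem_maximalAtlas i) g)).mono (chartSupport_subset i)

lemma integralVol_sum (g : SmoothMetric M) {ι : Type*} (s : Finset ι) {f : ι → M → ℝ}
    (hf : ∀ j ∈ s, Continuous (f j)) :
    integralVol g (fun x => ∑ j ∈ s, f j x) = ∑ j ∈ s, integralVol g (f j) := by
  simp only [integralVol_eq_setIntegral, mul_sum, sum_mul]
  rw [sum_comm]
  refine sum_congr rfl fun i _ => ?_
  exact integral_finsetSum _ fun j hj => integrableOn_chartSupport g (hf j hj) i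

lemma integralVol_mono (g : SmoothMetric M) {f f' : M → ℝ} (hf : ∀ x, 0 ≤ f x)
    (hf' : Continuous f') (h : ∀ x, f x ≤ f' x) : integralVol g f ≤ integralVol g f' := by
  rw [integralVol_eq_setIntegral, integralVol_eq_setIntegral]
  refine sum_le_sum fun i _ => ?_
  refine integral_mono_of_nonneg (Filter.Eventually.of_forall fun y => ?_)
    (integrableOn_chartSupport g hf' i) (Filter.Eventually.of_forall fun y => ?_)
  · exact mul_nonneg (mul_nonneg ((chartPartition M).nonneg i _) (hf _)) (Real.sqrt_nonneg _)
  · exact mul_le_mul_of_nonneg_right (mul_le_mul_of_nonneg_left (h _)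
      ((chartPartition M).nonneg i _)) (Real.sqrt_nonneg _)

lemma integralVol_nonneg (g : SmoothMetric M) {f : M → ℝ} (hf : ∀ x, 0 ≤ f x) :
    0 ≤ integralVol g f := by
  rw [integralVol_eq_setIntegral]
  exact sum_nonneg fun i _ => integral_nonneg fun y =>
    mul_nonneg (mul_nonneg ((chartPartition M).nonneg i _) (hf _)) (Real.sqrt_nonneg _)

/-- The Riemannian integral over a compact subset of a chart domain. -/
lemma integralVol_indicator {e : OpenPartialHomeomorph M E8}
    (he : e ∈ IsManifold.maximalAtlas (𝓡 8) ∞ M) (g : SmoothMetric M) {f : M → ℝ}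
    (hf : Continuous f) {K : Set E8} (hK : IsCompact K) (hKe : K ⊆ e.target) :
    integralVol g ((e.symm '' K).indicator f)
      = ∫ y in K, f (e.symm y) * √(metricCoeff g e y).det := by
  classical
  have hmem : ∀ y ∈ e.target, e.symm y ∈ e.symm '' K ↔ y ∈ K := fun y hy => by
    refine ⟨?_, fun h => ⟨y, h, rfl⟩⟩
    rintro ⟨z, hz, hzy⟩
    rwa [← e.right_inv hy, ← hzy, e.right_inv (hKe hz)]
  have h1 : ∀ i : M, ∫ y in (chartAt E8 i).target, chartPartition M i ((chartAt E8 i).symm y)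
      * (e.symm '' K).indicator f ((chartAt E8 i).symm y) * √(metricCoeff g (chartAt E8 i) y).det
      = ∫ y in K, chartPartition M i (e.symm y) * f (e.symm y) * √(metricCoeff g e y).det := by
    intro i
    have h2 := setIntegral_target_eq he (IsManifold.chart_mem_maximalAtlas i) g
      (f := fun x => chartPartition M i x * (e.symm '' K).indicator f x)
      (fun x hx => by
        rw [Set.indicator_of_notMem, mul_zero]
        rintro ⟨z, hz, rfl⟩
        exact hx (e.map_target (hKe hz)))
      (fun x hx => by
        rw [image_eq_zero_of_notMem_tsupport fun h => hx (tsupport_chartPartition i h), zero_mul])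
    rw [h2]
    refine (setIntegral_eq_of_subset_of_forall_sdiff_eq_zero e.open_target.measurableSet hKe
      fun y hy => ?_).trans (setIntegral_congr_fun hK.measurableSet fun y hy => ?_)
    · rw [Set.indicator_of_notMem fun h => hy.2 ((hmem y hy.1).1 h), mul_zero, zero_mul]
    · rw [Set.indicator_of_mem ((hmem y (hKe hy)).2 hy)]
  rw [integralVol_eq]
  simp only [h1]
  rw [← integral_finsetSum]
  · refine setIntegral_congr_fun hK.measurableSet fun y _ => ?_
    simp only [← sum_mul, sum_chartPartition, one_mul]
  · intro i _
    refine ContinuousOn.integrableOn_compact hK ?_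
    exact (((continuousOn_comp_symm (continuous_chartPartition i)).mul
      (continuousOn_comp_symm hf)).mul (continuousOn_sqrt_det he g)).mono hKe

omit [T2Space M] [CompactSpace M] [IsManifold (𝓡 8) ∞ M] in
lemma continuous_of_charts {f : M → ℝ}
    (h : ∀ i : M, ContinuousOn (fun y => f ((chartAt E8 i).symm y)) (chartAt E8 i).target) :
    Continuous f := by
  rw [continuous_iff_continuousAt]
  intro x
  have hx := mem_chart_source E8 x
  have h1 : ContinuousAt (fun z => f ((chartAt E8 x).symm (chartAt E8 x z))) x :=
    ContinuousAt.comp (f := chartAt E8 x) (g := fun y => f ((chartAt E8 x).symm y))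
      ((h x).continuousAt ((chartAt E8 x).open_target.mem_nhds ((chartAt E8 x).map_source hx)))
      ((chartAt E8 x).continuousAt hx)
  refine h1.congr (Filter.eventuallyEq_of_mem ((chartAt E8 x).open_source.mem_nhds hx)
    fun z hz => ?_)
  simp only [(chartAt E8 x).left_inv hz]

end Compact

end QKFlow

end

noncomputable section

namespace QKFlow

open Matrix Finset MeasureTheory

/-! ### Monotonicity of the energy -/

/-- The derivative of `ρ` along the vector field `⟨T, div T⟩`. -/
def fluxAt (gm : E8 → Mat) (W : ℝ → E8 → Comp4) (t : ℝ) (ρ : E8 → ℝ) (y : E8) : ℝ :=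
  ∑ m, ∑ n, (gm y)⁻¹ m n * (pderiv n ρ y * br (torEnd gm W t m y) (divEnd gm W t y))

lemma FlowChange.fluxAt_eq {U U' : Set E8} {gm gm' : E8 → Mat} {ψ : E8 → E8} {t₀ : ℝ}
    {W W' : ℝ → E8 → Comp4} (h : FlowChange U U' gm gm' ψ t₀ W W') {t : ℝ} {y : E8}
    (ht : t ∈ Set.Ioo 0 t₀) (hy : y ∈ U') {ρ : E8 → ℝ} (hρ : DifferentiableAt ℝ ρ (ψ y)) :
    fluxAt gm' W' t (fun z => ρ (ψ z)) y = fluxAt gm W t ρ (ψ y) := by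
  have e : ∀ m n, pderiv n (fun z => ρ (ψ z)) y * br (torEnd gm' W' t m y) (divEnd gm' W' t y)
      = ∑ a, ∑ b, (jac ψ y m a * jac ψ y n b)
        * (pderiv b ρ (ψ y) * br (torEnd gm W t a (ψ y)) (divEnd gm W t (ψ y))) := by
    intro m n
    rw [pderiv_comp (h.change.differentiableAt hy) hρ, h.br_divEnd_eq ht hy, mul_comm,
      sum_mul_sum]
    exact sum_congr rfl fun a _ => sum_congr rfl fun b _ => by ring
  simp only [fluxAt, e, ← h.change.sum_inv_mul hy, mul_sum, sum_mul]
  rw [sum_comm_4]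
  simp only [mul_assoc]

namespace ChartFlow

variable {U : Set E8} {gm : E8 → Mat} {t₀ : ℝ} {W : ℝ → E8 → Comp4} (h : ChartFlow U gm t₀ W)
  {t : ℝ}

include h

lemma smooth_fluxAt (ht : t ∈ Set.Ico 0 t₀) {ρ : E8 → ℝ} (hρ : ContDiffOn ℝ ∞ ρ U) :
    ContDiffOn ℝ ∞ (fluxAt gm W t ρ) U :=
  ContDiffOn.sum fun m _ => ContDiffOn.sum fun n _ => (h.metric.smooth_inv m n).mul
    ((contDiffOn_pderiv h.metric.isOpen hρ n).mul ((h.slice_torEnd ht m).br (h.slice_divEnd ht)))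

/-- The divergence theorem for `ρ ⟨T, div T⟩`, which is supported in `K`. -/
lemma setIntegral_fluxAt (ht : t ∈ Set.Ico 0 t₀) {ρ : E8 → ℝ} (hρ : ContDiffOn ℝ ∞ ρ U)
    {K : Set E8} (hK : IsCompact K) (hKU : K ⊆ U) (h0 : ∀ y ∈ U, y ∉ K → ρ y = 0) :
    ∫ y in K, √(gm y).det * (ρ y * br (divEnd gm W t y) (divEnd gm W t y) + (fluxAt gm W t ρ y
      + ρ y * ∑ m, ∑ n, (gm y)⁻¹ m n * br (torEnd gm W t m y) (covMat gm n (divEnd gm W t) y)))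
      = 0 := by
  have hb : MatSmooth U (fun z => ρ z • divEnd gm W t z) := MatSmooth.smul hρ (h.slice_divEnd ht)
  have h1 := setIntegral_sum_pderiv_eq_zero h.metric.isOpen hK hKU
    (V := fun m z => ∑ n, √(gm z).det * (gm z)⁻¹ m n *
      br (torEnd gm W t n z) (ρ z • divEnd gm W t z))
    (fun m => ContDiffOn.sum fun n _ => (h.metric.contDiffOn_sqrt_det.mul
      (h.metric.smooth_inv m n)).mul ((h.slice_torEnd ht n).br hb))
    (fun m y hy hyK => sum_eq_zero fun n _ => by
      rw [h0 y hy hyK, br_smul_right, zero_mul, mul_zero])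
  rw [← h1]
  refine setIntegral_congr_fun hK.measurableSet fun y hyK => ?_
  have hy := hKU hyK
  have hdρ : DifferentiableAt ℝ ρ y :=
    (hρ.contDiffAt (h.metric.isOpen.mem_nhds hy)).differentiableAt (by simp)
  rw [h.sum_pderiv_br_torEnd ht hb hy]
  simp only [covMat_smul hdρ ((h.slice_divEnd ht).matDiff h.metric.isOpen hy), br_add_right,
    br_smul_right, mul_add, sum_add_distrib, mul_sum, fluxAt]
  congr 2
  exact sum_congr rfl fun m _ => sum_congr rfl fun n _ => by ring

lemma br_divEnd_self_nonneg (ht : t ∈ Set.Ico 0 t₀) {y : E8} (hy : y ∈ U) :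
    0 ≤ br (divEnd gm W t y) (divEnd gm W t y) := by
  obtain ⟨P, hP⟩ := h.metric.frame y hy
  exact br_self_nonneg (inv_eq_of_frame hP) (h.divT_skew ht hy)

end ChartFlow

section Compact

variable {M : Type*} [TopologicalSpace M] [ChartedSpace E8 M] [IsManifold (𝓡 8) ∞ M]
  {g : SmoothMetric M} {t₀ : ℝ} {Ω : ℝ → FourForm M} {t : ℝ}

omit [IsManifold (𝓡 8) ∞ M] in
lemma contDiffOn_comp_symm {e : OpenPartialHomeomorph M E8}
    (he : e ∈ IsManifold.maximalAtlas (𝓡 8) ∞ M) {ρ : M → ℝ} (hρ : ContMDiff (𝓡 8) 𝓘(ℝ) ∞ ρ) :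
    ContDiffOn ℝ ∞ (fun y => ρ (e.symm y)) e.target :=
  (hρ.comp_contMDiffOn (contMDiffOn_symm_of_mem_maximalAtlas he)).contDiffOn

/-- The derivative of `ρ` along the vector field `⟨T, div T⟩`, as a function on `M`. -/
def flux (g : SmoothMetric M) (Ω : ℝ → FourForm M) (t : ℝ) (ρ : M → ℝ) (x : M) : ℝ :=
  fluxAt (metricCoeff g (chartAt E8 x)) (fun t y => comp4 (chartAt E8 x) (Ω t) y) t
    (fun y => ρ ((chartAt E8 x).symm y)) (chartAt E8 x x)

lemma IsQKHarmonicFlow.flux_eq (h : IsQKHarmonicFlow g t₀ Ω) (ht : t ∈ Set.Ioo 0 t₀)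
    {e : OpenPartialHomeomorph M E8} (he : e ∈ IsManifold.maximalAtlas (𝓡 8) ∞ M) {ρ : M → ℝ}
    (hρ : ContMDiff (𝓡 8) 𝓘(ℝ) ∞ ρ) {y : E8} (hy : y ∈ e.target) :
    flux g Ω t ρ (e.symm y) = fluxAt (metricCoeff g e) (fun t y => comp4 e (Ω t) y) t
      (fun y => ρ (e.symm y)) y := by
  set x := e.symm y with hx
  have hc : chartAt E8 x ∈ IsManifold.maximalAtlas (𝓡 8) ∞ M :=
    IsManifold.chart_mem_maximalAtlas x
  have hxs : x ∈ (chartAt E8 x).source := mem_chart_source E8 x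
  have hy' : y ∈ overlap (chartAt E8 x) e := ⟨hy, hxs⟩
  have h1 := (h.flowChange hc he).fluxAt_eq ht hy'
    (ρ := fun y => ρ ((chartAt E8 x).symm y))
    (((contDiffOn_comp_symm hc hρ).contDiffAt ((chartAt E8 x).open_target.mem_nhds
      ((chartAt E8 x).map_source hxs))).differentiableAt (by simp))
  rw [flux]
  refine h1.symm.trans (sum_congr rfl fun m _ => sum_congr rfl fun n _ => ?_)
  rw [pderiv_congr (isOpen_overlap (chartAt E8 x) e) (fun z hz => by
    rw [symm_transition hz]) hy']

lemma IsQKHarmonicFlow.continuous_flux (h : IsQKHarmonicFlow g t₀ Ω) (ht : t ∈ Set.Ioo 0 t₀)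
    {ρ : M → ℝ} (hρ : ContMDiff (𝓡 8) 𝓘(ℝ) ∞ ρ) : Continuous (flux g Ω t ρ) :=
  continuous_of_charts fun i => by
    have hc := IsManifold.chart_mem_maximalAtlas (I := 𝓡 8) (n := ∞) i
    exact ((h.chartFlow hc).smooth_fluxAt ⟨ht.1.le, ht.2⟩
      (contDiffOn_comp_symm hc hρ)).continuousOn.congr fun y hy => h.flux_eq ht hc hρ hy

lemma IsQKHarmonicFlow.continuous_torsionNormSq (h : IsQKHarmonicFlow g t₀ Ω)
    (ht : t ∈ Set.Ico 0 t₀) : Continuous (torsionNormSq g (Ω t)) :=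
  continuous_of_charts fun i => by
    have hc := IsManifold.chart_mem_maximalAtlas (I := 𝓡 8) (n := ∞) i
    exact ((h.chartFlow hc).contDiffOn_enDensity ht).continuousOn.congr fun y hy =>
      h.torsionNormSq_eq hc ht hy

lemma IsQKHarmonicFlow.torsionNormSq_nonneg (h : IsQKHarmonicFlow g t₀ Ω)
    (ht : t ∈ Set.Ico 0 t₀) (x : M) : 0 ≤ torsionNormSq g (Ω t) x := by
  have hc := IsManifold.chart_mem_maximalAtlas (I := 𝓡 8) (n := ∞) x
  have hx := (chartAt E8 x).map_source (mem_chart_source E8 x)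
  have h1 := h.torsionNormSq_eq hc ht hx
  rw [(chartAt E8 x).left_inv (mem_chart_source E8 x)] at h1
  rw [h1]
  exact (h.chartFlow hc).enDensity_nonneg ht hx

variable [T2Space M] [CompactSpace M]

lemma IsQKHarmonicFlow.energy_nonneg (h : IsQKHarmonicFlow g t₀ Ω) (ht : t ∈ Set.Ico 0 t₀) :
    0 ≤ energy g (Ω t) := by
  have := integralVol_nonneg g (h.torsionNormSq_nonneg ht)
  rw [energy]
  linarith

/-- The density is nonnegative and chart-independent, so an integral over part of a chart is at most
the integral over `M`. -/
lemma IsQKHarmonicFlow.setIntegral_enDensity_le (h : IsQKHarmonicFlow g t₀ Ω)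
    (ht : t ∈ Set.Ico 0 t₀) {e : OpenPartialHomeomorph M E8}
    (he : e ∈ IsManifold.maximalAtlas (𝓡 8) ∞ M) {K : Set E8} (hK : IsCompact K)
    (hKe : K ⊆ e.target) :
    ∫ y in K, enDensity (metricCoeff g e) (fun t y => comp4 e (Ω t) y) t y
      * √(metricCoeff g e y).det ≤ 2 * energy g (Ω t) := by
  have h1 := integralVol_indicator he g (h.continuous_torsionNormSq ht) hK hKe
  have h2 := integralVol_mono g (f := (e.symm '' K).indicator (torsionNormSq g (Ω t)))
    (fun x => Set.indicator_nonneg (fun x _ => h.torsionNormSq_nonneg ht x) x)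
    (h.continuous_torsionNormSq ht)
    (fun x => Set.indicator_le_self' (fun x _ => h.torsionNormSq_nonneg ht x) x)
  rw [h1, setIntegral_congr_fun hK.measurableSet fun y hy => by
    rw [h.torsionNormSq_eq he ht (hKe hy)]] at h2
  rw [energy]
  linarith

/-- The flux is linear in `ρ`, and the partition of unity sums to a constant. Since the flux is a
well-defined function on `M`, the integrals over different charts may be added before this is used.
-/
lemma IsQKHarmonicFlow.sum_setIntegral_flux (h : IsQKHarmonicFlow g t₀ Ω)
    (ht : t ∈ Set.Ioo 0 t₀) :
    ∑ i ∈ chartSet M, ∫ y in chartSupport i, fluxAt (metricCoeff g (chartAt E8 i))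
      (fun t y => comp4 (chartAt E8 i) (Ω t) y) t
      (fun y => chartPartition M i ((chartAt E8 i).symm y)) y
        * √(metricCoeff g (chartAt E8 i) y).det = 0 := by
  have hρ : ∀ i : M, ContMDiff (𝓡 8) 𝓘(ℝ) ∞ (chartPartition M i) := fun i =>
    (chartPartition M i).contMDiff
  have hc : ∀ i : M, chartAt E8 i ∈ IsManifold.maximalAtlas (𝓡 8) ∞ M := fun i =>
    IsManifold.chart_mem_maximalAtlas i
  -- the flux of a function vanishes outside its support
  have h0 : ∀ i x, x ∉ tsupport (chartPartition M i) → flux g Ω t (chartPartition M i) x = 0 := by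
    intro i x hx
    rw [flux, fluxAt]
    refine sum_eq_zero fun m _ => sum_eq_zero fun n _ => ?_
    have hopen : IsOpen ((chartAt E8 x).target ∩
        (chartAt E8 x).symm ⁻¹' (tsupport (chartPartition M i))ᶜ) :=
      (chartAt E8 x).symm.isOpen_inter_preimage (isClosed_tsupport _).isOpen_compl
    have hxs := mem_chart_source E8 x
    rw [pderiv_congr hopen (g := fun _ => (0 : ℝ))
      (fun z hz => image_eq_zero_of_notMem_tsupport hz.2)
      ⟨(chartAt E8 x).map_source hxs, by
        rw [Set.mem_preimage, (chartAt E8 x).left_inv hxs]; exact hx⟩, pderiv_const, zero_mul,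
      mul_zero]
  have h1 : ∀ i : M, ∫ y in chartSupport i, fluxAt (metricCoeff g (chartAt E8 i))
      (fun t y => comp4 (chartAt E8 i) (Ω t) y) t
      (fun y => chartPartition M i ((chartAt E8 i).symm y)) y
        * √(metricCoeff g (chartAt E8 i) y).det
      = integralVol g (flux g Ω t (chartPartition M i)) := by
    intro i
    have h2 := integralVol_indicator (hc i) g (h.continuous_flux ht (hρ i))
      (isCompact_chartSupport i) (chartSupport_subset i)
    have h3 : ((chartAt E8 i).symm '' chartSupport i).indicator
        (flux g Ω t (chartPartition M i)) = flux g Ω t (chartPartition M i) := by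
      refine Set.indicator_eq_self.2 fun x hx => ?_
      have hxs : x ∈ tsupport (chartPartition M i) := by
        by_contra hx'
        exact hx (h0 i x hx')
      exact ⟨chartAt E8 i x, ⟨x, hxs, rfl⟩, (chartAt E8 i).left_inv (tsupport_chartPartition i hxs)⟩
    rw [h3] at h2
    rw [h2]
    refine setIntegral_congr_fun (isCompact_chartSupport i).measurableSet fun y hy => ?_
    rw [h.flux_eq ht (hc i) (hρ i) (chartSupport_subset i hy)]
  simp only [h1]
  rw [← integralVol_sum g _ fun i _ => h.continuous_flux ht (hρ i)]
  have h4 : (fun x => ∑ i ∈ chartSet M, flux g Ω t (chartPartition M i) x) = fun _ => 0 := by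
    funext x
    simp only [flux, fluxAt]
    rw [sum_comm]
    refine sum_eq_zero fun m _ => ?_
    rw [sum_comm]
    refine sum_eq_zero fun n _ => ?_
    rw [← mul_sum, ← sum_mul]
    have hd : ∀ i : M, DifferentiableAt ℝ
        (fun y => chartPartition M i ((chartAt E8 x).symm y)) (chartAt E8 x x) := fun i =>
      ((contDiffOn_comp_symm (hc x) (hρ i)).contDiffAt ((chartAt E8 x).open_target.mem_nhds
        ((chartAt E8 x).map_source (mem_chart_source E8 x)))).differentiableAt (by simp)
    rw [← pderiv_sum (fun i _ => hd i)]
    simp only [sum_chartPartition, pderiv_const, zero_mul, mul_zero]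
  rw [h4]
  simp [integralVol_eq]

/-- The energy is non-increasing. -/
lemma IsQKHarmonicFlow.energy_le (h : IsQKHarmonicFlow g t₀ Ω) (ht : t ∈ Set.Ico 0 t₀) :
    energy g (Ω t) ≤ energy g (Ω 0) := by
  have hc : ∀ i : M, chartAt E8 i ∈ IsManifold.maximalAtlas (𝓡 8) ∞ M := fun i =>
    IsManifold.chart_mem_maximalAtlas i
  have hf := fun i : M => h.chartFlow (hc i)
  have hρ : ∀ i : M, ContDiffOn ℝ ∞ (fun y => chartPartition M i ((chartAt E8 i).symm y))
      (chartAt E8 i).target := fun i =>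
    contDiffOn_comp_symm (hc i) (chartPartition M i).contMDiff
  set F : M → ℝ → E8 → ℝ := fun i s y => chartPartition M i ((chartAt E8 i).symm y)
    * enDensity (metricCoeff g (chartAt E8 i)) (fun t y => comp4 (chartAt E8 i) (Ω t) y) s y
    * √(metricCoeff g (chartAt E8 i) y).det with hF
  have hFs : ∀ i, ContDiffOn ℝ ∞ (fun q : ℝ × E8 => F i q.1 q.2)
      (Set.Ico 0 t₀ ×ˢ (chartAt E8 i).target) := fun i =>
    ((((hρ i).comp contDiffOn_snd fun q hq => hq.2).mul (hf i).smooth_enDensity)).mul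
      ((hf i).metric.contDiffOn_sqrt_det.comp contDiffOn_snd fun q hq => hq.2)
  have hE : ∀ s ∈ Set.Ico 0 t₀, energy g (Ω s)
      = (1 / 2) * ∑ i ∈ chartSet M, ∫ y in chartSupport i, F i s y := fun s hs => by
    rw [energy, integralVol_eq_setIntegral]
    congr 1
    refine sum_congr rfl fun i _ => setIntegral_congr_fun
      (isCompact_chartSupport i).measurableSet fun y hy => ?_
    simp only [hF]
    rw [h.torsionNormSq_eq (hc i) hs (chartSupport_subset i hy)]
  have hI : Set.Icc 0 t ⊆ Set.Ico 0 t₀ := fun s hs => ⟨hs.1, hs.2.trans_lt ht.2⟩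
  have hcont : ContinuousOn (fun s => (1 / 2) * ∑ i ∈ chartSet M, ∫ y in chartSupport i, F i s y)
      (Set.Icc 0 t) := continuousOn_const.mul (continuousOn_finsetSum _ fun i _ =>
    continuousOn_setIntegral (isCompact_chartSupport i) isCompact_Icc
      ((hFs i).continuousOn.mono (Set.prod_mono hI (chartSupport_subset i))))
  set X : M → ℝ → E8 → ℝ := fun i s y => ∑ m, ∑ n, (metricCoeff g (chartAt E8 i) y)⁻¹ m n *
    br (torEnd (metricCoeff g (chartAt E8 i)) (fun t y => comp4 (chartAt E8 i) (Ω t) y) s m y)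
      (covMat (metricCoeff g (chartAt E8 i)) n (divEnd (metricCoeff g (chartAt E8 i))
        (fun t y => comp4 (chartAt E8 i) (Ω t) y) s) y) with hX
  have hder : ∀ s ∈ Set.Ioo 0 t, HasDerivAt
      (fun s => (1 / 2) * ∑ i ∈ chartSet M, ∫ y in chartSupport i, F i s y)
      ((1 / 2) * ∑ i ∈ chartSet M, ∫ y in chartSupport i,
        chartPartition M i ((chartAt E8 i).symm y) * (2 * X i s y)
          * √(metricCoeff g (chartAt E8 i) y).det) s := fun s hs => by
    have hs' : s ∈ Set.Ioo 0 t₀ := ⟨hs.1, hs.2.trans ht.2⟩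
    refine (HasDerivAt.fun_sum fun i _ => ?_).const_mul _
    refine hasDerivAt_setIntegral (chartAt E8 i).open_target (isCompact_chartSupport i)
      (chartSupport_subset i) isOpen_Ioo ((hFs i).mono (Set.prod_mono Set.Ioo_subset_Ico_self
        subset_rfl)) hs' fun y hy => ?_
    exact (((hf i).hasDerivAt_enDensity hs' (chartSupport_subset i hy)).const_mul _).mul_const _
  have hneg : ∀ s ∈ Set.Ioo 0 t, (1 / 2) * ∑ i ∈ chartSet M, ∫ y in chartSupport i,
        chartPartition M i ((chartAt E8 i).symm y) * (2 * X i s y)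
          * √(metricCoeff g (chartAt E8 i) y).det ≤ 0 := fun s hs => by
    have hs' : s ∈ Set.Ioo 0 t₀ := ⟨hs.1, hs.2.trans ht.2⟩
    have hs'' : s ∈ Set.Ico 0 t₀ := ⟨hs'.1.le, hs'.2⟩
    -- Integration by parts in each chart gives `-2 ∫ ρ |div T|²`, which is dropped, and a flux
    -- through the cutoff, which cancels in the sum over charts.
    have key : ∀ i, (∫ y in chartSupport i, chartPartition M i ((chartAt E8 i).symm y)
        * (2 * X i s y) * √(metricCoeff g (chartAt E8 i) y).det)
        ≤ -2 * ∫ y in chartSupport i, fluxAt (metricCoeff g (chartAt E8 i))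
          (fun t y => comp4 (chartAt E8 i) (Ω t) y) s
          (fun y => chartPartition M i ((chartAt E8 i).symm y)) y
            * √(metricCoeff g (chartAt E8 i) y).det := by
      intro i
      have hK := isCompact_chartSupport i
      have hKU := chartSupport_subset i
      have h1 := (hf i).setIntegral_fluxAt hs'' (hρ i) hK hKU
        fun y hy hyK => chartPartition_symm_eq_zero hy hyK
      set D : E8 → ℝ := fun y => br
        (divEnd (metricCoeff g (chartAt E8 i)) (fun t y => comp4 (chartAt E8 i) (Ω t) y) s y)
        (divEnd (metricCoeff g (chartAt E8 i)) (fun t y => comp4 (chartAt E8 i) (Ω t) y) s y)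
        with hD
      have cs := (hf i).metric.contDiffOn_sqrt_det.continuousOn.mono hKU
      have cρ := (hρ i).continuousOn.mono hKU
      have cD : ContinuousOn D (chartSupport i) :=
        (((hf i).slice_divEnd hs'').br ((hf i).slice_divEnd hs'')).continuousOn.mono hKU
      have cf := ((hf i).smooth_fluxAt hs'' (hρ i)).continuousOn.mono hKU
      have cX : ContinuousOn (X i s) (chartSupport i) := by
        refine continuousOn_finsetSum _ fun m _ => continuousOn_finsetSum _ fun n _ => ?_
        exact (((hf i).metric.smooth_inv m n).mul (((hf i).slice_torEnd hs'' m).br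
          (((hf i).slice_divEnd hs'').covMat (hf i).metric n))).continuousOn.mono hKU
      have iX : IntegrableOn (fun y => chartPartition M i ((chartAt E8 i).symm y) * (2 * X i s y)
          * √(metricCoeff g (chartAt E8 i) y).det) (chartSupport i) :=
        ((cρ.mul (continuousOn_const.mul cX)).mul cs).integrableOn_compact hK
      have iD : IntegrableOn (fun y => √(metricCoeff g (chartAt E8 i) y).det
          * (chartPartition M i ((chartAt E8 i).symm y) * D y)) (chartSupport i) :=
        (cs.mul (cρ.mul cD)).integrableOn_compact hK
      have iF : IntegrableOn (fun y => fluxAt (metricCoeff g (chartAt E8 i))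
          (fun t y => comp4 (chartAt E8 i) (Ω t) y) s
          (fun y => chartPartition M i ((chartAt E8 i).symm y)) y
            * √(metricCoeff g (chartAt E8 i) y).det) (chartSupport i) :=
        (cf.mul cs).integrableOn_compact hK
      have hDn : 0 ≤ ∫ y in chartSupport i, √(metricCoeff g (chartAt E8 i) y).det
          * (chartPartition M i ((chartAt E8 i).symm y) * D y) :=
        setIntegral_nonneg hK.measurableSet fun y hy => mul_nonneg (Real.sqrt_nonneg _)
          (mul_nonneg ((chartPartition M).nonneg i _)
            ((hf i).br_divEnd_self_nonneg hs'' (hKU hy)))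
      have e1 : ∫ y in chartSupport i, √(metricCoeff g (chartAt E8 i) y).det *
          (chartPartition M i ((chartAt E8 i).symm y) * D y + (fluxAt (metricCoeff g (chartAt E8 i))
          (fun t y => comp4 (chartAt E8 i) (Ω t) y) s
          (fun y => chartPartition M i ((chartAt E8 i).symm y)) y
          + chartPartition M i ((chartAt E8 i).symm y) * X i s y))
          = (∫ y in chartSupport i, √(metricCoeff g (chartAt E8 i) y).det
            * (chartPartition M i ((chartAt E8 i).symm y) * D y))
          + (∫ y in chartSupport i, fluxAt (metricCoeff g (chartAt E8 i))
          (fun t y => comp4 (chartAt E8 i) (Ω t) y) s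
          (fun y => chartPartition M i ((chartAt E8 i).symm y)) y
            * √(metricCoeff g (chartAt E8 i) y).det)
          + (1 / 2) * ∫ y in chartSupport i, chartPartition M i ((chartAt E8 i).symm y)
            * (2 * X i s y) * √(metricCoeff g (chartAt E8 i) y).det := by
        have iX' : IntegrableOn (fun y => (1 / 2) * (chartPartition M i ((chartAt E8 i).symm y)
          * (2 * X i s y) * √(metricCoeff g (chartAt E8 i) y).det)) (chartSupport i) :=
          iX.const_mul _
        rw [← integral_const_mul, add_assoc, ← integral_add iF iX']
        refine (setIntegral_congr_fun hK.measurableSet fun y _ => ?_).trans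
          (integral_add iD (iF.add iX'))
        ring
      rw [e1] at h1
      linarith
    have h2 := sum_le_sum fun i (_ : i ∈ chartSet M) => key i
    rw [← mul_sum, h.sum_setIntegral_flux hs', mul_zero] at h2
    linarith
  have hanti : AntitoneOn (fun s => (1 / 2) * ∑ i ∈ chartSet M, ∫ y in chartSupport i, F i s y)
      (Set.Icc 0 t) := antitoneOn_of_hasDerivWithinAt_nonpos (convex_Icc _ _) hcont
    (fun s hs => (hder s (by rwa [interior_Icc] at hs)).hasDerivWithinAt)
    (fun s hs => hneg s (by rwa [interior_Icc] at hs))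
  rw [hE t ht, hE 0 ⟨le_rfl, ht.1.trans_lt ht.2⟩]
  exact hanti (Set.left_mem_Icc.2 ht.1) (Set.right_mem_Icc.2 ht.1) ht.1

end Compact

end QKFlow

end

/-! ### Closing the differential inequality: logarithmic kernel estimates and the Gronwall argument.
-/

noncomputable section

namespace QKFlow

open Matrix Finset MeasureTheory

/-! ### Estimates for the heat kernel -/

/-- With `τ = t₀ - t` and `L = log τ` there are three cases. If `L ≥ -1`, the kernel is at most `τ⁻⁴
≤ e⁴`. If `‖y‖² ≤ 16 L² τ`, the first term suffices. Otherwise the exponent is at most `-4 L² ≤ 4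
L`, so the Gaussian factor is at most `τ⁴` and the kernel at most `1`. -/
lemma sq_mul_heatKernel_le {t₀ t : ℝ} (ht : t < t₀) (h1 : t₀ - t ≤ 1) {y : E8} (hy : ‖y‖ ≤ 1) :
    ‖y‖ ^ 2 * heatKernel t₀ t y
      ≤ 16 * Real.log (t₀ - t) ^ 2 * (t₀ - t) * heatKernel t₀ t y + Real.exp 4 := by
  have h0 : 0 < t₀ - t := sub_pos.2 ht
  have hG := heatKernel_pos ht y
  have hle := heatKernel_le_of_le ht y
  have hy2 : ‖y‖ ^ 2 ≤ 1 := by nlinarith [norm_nonneg y]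
  have he4 : (1 : ℝ) ≤ Real.exp 4 := Real.one_le_exp (by norm_num)
  have hL : Real.log (t₀ - t) ≤ 0 := Real.log_nonpos h0.le h1
  have hexp : Real.exp (Real.log (t₀ - t)) = t₀ - t := Real.exp_log h0
  set τ := t₀ - t with hτ
  set L := Real.log τ with hLdef
  set G := heatKernel t₀ t y with hGdef
  rcases le_or_gt (-1) L with hL1 | hL1
  · have h2 : G ≤ Real.exp 4 := by
      refine hle.trans ?_
      rw [← hexp, ← Real.exp_nat_mul, one_div, ← Real.exp_neg, Real.exp_le_exp]
      push_cast
      linarith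
    have h3 : ‖y‖ ^ 2 * G ≤ 1 * G := mul_le_mul_of_nonneg_right hy2 hG.le
    have h4 : 0 ≤ 16 * L ^ 2 * τ * G := by positivity
    linarith
  · rcases le_or_gt (‖y‖ ^ 2) (16 * L ^ 2 * τ) with h2 | h2
    · have := mul_le_mul_of_nonneg_right h2 hG.le
      linarith [Real.exp_pos 4]
    · have h3 : -‖y‖ ^ 2 / (4 * τ) ≤ 4 * L := by
        rw [div_le_iff₀ (by positivity)]
        have : -L ≤ L ^ 2 := by nlinarith
        nlinarith [mul_le_mul_of_nonneg_right this h0.le]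
      have h4 : Real.exp (-‖y‖ ^ 2 / (4 * τ)) ≤ τ ^ 4 := by
        refine (Real.exp_le_exp.2 h3).trans (le_of_eq ?_)
        rw [← hexp, ← Real.exp_nat_mul]
        push_cast
        rfl
      have h5 : 1 / (4 * Real.pi * τ) ^ 4 ≤ 1 / τ ^ 4 := by
        refine one_div_le_one_div_of_le (by positivity) (pow_le_pow_left₀ h0.le ?_ 4)
        nlinarith [one_le_four_pi]
      have h6 : G ≤ 1 := by
        have : G ≤ 1 / τ ^ 4 * τ ^ 4 :=
          mul_le_mul h5 h4 (Real.exp_pos _).le (by positivity)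
        rwa [one_div, inv_mul_cancel₀ (by positivity)] at this
      have h7 : ‖y‖ ^ 2 * G ≤ 1 * 1 := mul_le_mul hy2 h6 hG.le zero_le_one
      have h8 : 0 ≤ 16 * L ^ 2 * τ * G := by positivity
      linarith

/-- Integrability is read off from the value: a non-integrable function would have integral `0`,
whereas the Gaussian integral is positive. -/
lemma integral_exp_neg_norm_sq {b : ℝ} (hb : 0 < b) :
    Integrable (fun y : E8 => Real.exp (-b * ‖y‖ ^ 2)) ∧
      ∫ y : E8, Real.exp (-b * ‖y‖ ^ 2) = (Real.pi / b) ^ 4 := by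
  have h1 := GaussianFourier.integral_rexp_neg_mul_sq_norm (V := E8) hb
  rw [finrank_euclideanSpace, Fintype.card_fin] at h1
  have h2 : (Real.pi / b) ^ (((8 : ℕ) : ℝ) / 2) = (Real.pi / b) ^ 4 := by
    rw [show (((8 : ℕ) : ℝ) / 2) = ((4 : ℕ) : ℝ) by norm_num, Real.rpow_natCast]
  rw [h2] at h1
  refine ⟨?_, h1⟩
  by_contra h
  have h3 := integral_undef h
  rw [h3] at h1
  have : 0 < (Real.pi / b) ^ 4 := by positivity
  linarith

/-- Half of the Gaussian exponent absorbs the factor: `‖y‖² ≤ 4τ exp (‖y‖² / 8τ)`. The remaining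
Gaussian of double width has `2⁴` times the mass of the kernel, and `4 * 16 = 64`. -/
lemma setIntegral_sq_mul_heatKernel_le {t₀ t : ℝ} (ht : t < t₀) {K : Set E8} (hK : IsCompact K) :
    ∫ y in K, ‖y‖ ^ 2 * heatKernel t₀ t y ≤ 64 * (t₀ - t) := by
  have h0 : 0 < t₀ - t := sub_pos.2 ht
  set τ := t₀ - t with hτ
  obtain ⟨hi, he⟩ := integral_exp_neg_norm_sq (b := 1 / (8 * τ)) (by positivity)
  have hb : ∀ y : E8, ‖y‖ ^ 2 * heatKernel t₀ t y
      ≤ 4 * τ * (1 / (4 * Real.pi * τ) ^ 4) * Real.exp (-(1 / (8 * τ)) * ‖y‖ ^ 2) := by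
    intro y
    have h1 : ‖y‖ ^ 2 / (8 * τ) * 2 ≤ Real.exp (‖y‖ ^ 2 / (8 * τ)) := by
      have h2 := Real.quadratic_le_exp_of_nonneg (x := ‖y‖ ^ 2 / (8 * τ)) (by positivity)
      nlinarith [sq_nonneg (‖y‖ ^ 2 / (8 * τ) - 1), sq_nonneg (‖y‖ ^ 2 / (8 * τ) - 2)]
    have h2 : -‖y‖ ^ 2 / (4 * τ) = -(‖y‖ ^ 2 / (8 * τ)) + -(1 / (8 * τ)) * ‖y‖ ^ 2 := by
      field_simp; ring
    have h3 : ‖y‖ ^ 2 ≤ 4 * τ * Real.exp (‖y‖ ^ 2 / (8 * τ)) := by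
      have := mul_le_mul_of_nonneg_left h1 (show 0 ≤ 4 * τ by positivity)
      refine le_trans (le_of_eq ?_) this
      field_simp
      ring
    rw [heatKernel, ← hτ, h2, Real.exp_add]
    have h4 := mul_le_mul_of_nonneg_right h3 (show 0 ≤ 1 / (4 * Real.pi * τ) ^ 4 *
      (Real.exp (-(‖y‖ ^ 2 / (8 * τ))) * Real.exp (-(1 / (8 * τ)) * ‖y‖ ^ 2)) by positivity)
    refine h4.trans (le_of_eq ?_)
    have h5 : Real.exp (‖y‖ ^ 2 / (8 * τ)) * Real.exp (-(‖y‖ ^ 2 / (8 * τ))) = 1 := by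
      rw [← Real.exp_add, add_neg_cancel, Real.exp_zero]
    linear_combination (4 * τ * (1 / (4 * Real.pi * τ) ^ 4)
      * Real.exp (-(1 / (8 * τ)) * ‖y‖ ^ 2)) * h5
  have hc : ContinuousOn (fun y : E8 => ‖y‖ ^ 2 * heatKernel t₀ t y) K :=
    (continuous_norm.pow 2).continuousOn.mul (contDiff_heatKernel t₀ t).continuous.continuousOn
  have hi' := hi.const_mul (4 * τ * (1 / (4 * Real.pi * τ) ^ 4))
  calc _ ≤ ∫ y in K, 4 * τ * (1 / (4 * Real.pi * τ) ^ 4)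
        * Real.exp (-(1 / (8 * τ)) * ‖y‖ ^ 2) :=
        setIntegral_mono_on (hc.integrableOn_compact hK) hi'.integrableOn hK.measurableSet
          fun y _ => hb y
    _ ≤ ∫ y, 4 * τ * (1 / (4 * Real.pi * τ) ^ 4) * Real.exp (-(1 / (8 * τ)) * ‖y‖ ^ 2) :=
        setIntegral_le_integral hi' (Filter.Eventually.of_forall fun y => by positivity)
    _ = _ := by
        rw [integral_const_mul, he]
        field_simp
        ring

/-! ### The weight -/

/-- Writing `f = τ P(L)`, the derivative in `t` is `-(P + P')(L)`; the coefficients of `P` are those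
for which this is `L² + L⁴`. -/
lemma hasDerivAt_logWeight {t₀ t : ℝ} (ht : t < t₀) : HasDerivAt (logWeight t₀)
    (Real.log (t₀ - t) ^ 2 + Real.log (t₀ - t) ^ 4) t := by
  have h0 : t₀ - t ≠ 0 := (sub_pos.2 ht).ne'
  have h1 : HasDerivAt (fun s => t₀ - s) (-1) t := (hasDerivAt_id t).const_sub t₀
  have hL := h1.log h0
  have h2 := h1.mul (((((hL.const_mul 26).const_add (-26)).sub ((hL.pow 2).const_mul 13)).add
    ((hL.pow 3).const_mul 4)).sub (hL.pow 4))
  refine h2.congr_deriv ?_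
  simp only [Pi.add_apply, Pi.sub_apply, Pi.pow_apply]
  field_simp
  push_cast
  ring

lemma logWeight_nonpos {t₀ t : ℝ} (ht : t < t₀) (h1 : t₀ - t ≤ 1) : logWeight t₀ t ≤ 0 := by
  have h0 : 0 < t₀ - t := sub_pos.2 ht
  have hL : Real.log (t₀ - t) ≤ 0 := Real.log_nonpos h0.le h1
  refine mul_nonpos_of_nonneg_of_nonpos h0.le ?_
  have h3 : Real.log (t₀ - t) ^ 3 ≤ 0 := by
    have : Real.log (t₀ - t) ^ 3 = Real.log (t₀ - t) * Real.log (t₀ - t) ^ 2 := by ring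
    rw [this]
    exact mul_nonpos_of_nonpos_of_nonneg hL (sq_nonneg _)
  have h4 : 0 ≤ Real.log (t₀ - t) ^ 4 := by positivity
  nlinarith [sq_nonneg (Real.log (t₀ - t))]

lemma logWeight_mono {t₀ t₁ t₂ : ℝ} (h12 : t₁ ≤ t₂) (h2 : t₂ < t₀) :
    logWeight t₀ t₁ ≤ logWeight t₀ t₂ := by
  have hd : ∀ s ∈ Set.Icc t₁ t₂, HasDerivAt (logWeight t₀)
      (Real.log (t₀ - s) ^ 2 + Real.log (t₀ - s) ^ 4) s := fun s hs =>
    hasDerivAt_logWeight (hs.2.trans_lt h2)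
  have hm : MonotoneOn (logWeight t₀) (Set.Icc t₁ t₂) :=
    monotoneOn_of_hasDerivWithinAt_nonneg (convex_Icc _ _)
      (fun s hs => (hd s hs).continuousAt.continuousWithinAt)
      (fun s hs => (hd s (interior_subset hs)).hasDerivWithinAt)
      fun s _ => by positivity
  exact hm (Set.left_mem_Icc.2 h12) (Set.right_mem_Icc.2 h12) h12

/-- The weight increases in `t`, and its value at `t₀ - t = 1`, where the logarithm vanishes, is
`-26`. -/
lemma neg_le_logWeight {t₀ t : ℝ} (ht : t < t₀) (h1 : t₀ - t ≤ 1) : -26 ≤ logWeight t₀ t := by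
  refine le_trans (le_of_eq ?_) (logWeight_mono (t₁ := t₀ - 1) (by linarith) ht)
  simp [logWeight]

/-- A Gronwall inequality with the weight `logWeight`. -/
lemma le_of_hasDerivAt_le_logWeight {t₀ t₁ t₂ a R : ℝ} (ha : 0 ≤ a) (hR : 0 ≤ R) (h1 : t₀ - t₁ ≤ 1)
    (h12 : t₁ ≤ t₂) (h2 : t₂ < t₀) {Z Z' : ℝ → ℝ} (hZ : ∀ t ∈ Set.Icc t₁ t₂, HasDerivAt Z (Z' t) t)
    (hZ' : ∀ t ∈ Set.Icc t₁ t₂, Z' t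
      ≤ a * (Real.log (t₀ - t) ^ 2 + Real.log (t₀ - t) ^ 4) * Z t + a * R) :
    Z t₂ ≤ Real.exp (a * (logWeight t₀ t₂ - logWeight t₀ t₁)) * Z t₁
      + a * Real.exp (26 * a) * R * (t₂ - t₁) := by
  set Y : ℝ → ℝ := fun t => Real.exp (-a * logWeight t₀ t) * Z t - a * Real.exp (26 * a) * R * t
    with hY
  have hd : ∀ t ∈ Set.Icc t₁ t₂, HasDerivAt Y (Real.exp (-a * logWeight t₀ t)
      * (Z' t - a * (Real.log (t₀ - t) ^ 2 + Real.log (t₀ - t) ^ 4) * Z t)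
      - a * Real.exp (26 * a) * R) t := fun t ht => by
    have e1 := ((hasDerivAt_logWeight (ht.2.trans_lt h2)).const_mul (-a)).exp
    have e2 := (e1.mul (hZ t ht)).sub ((hasDerivAt_id t).const_mul (a * Real.exp (26 * a) * R))
    refine e2.congr_deriv ?_
    ring
  have hneg : ∀ t ∈ Set.Icc t₁ t₂, Real.exp (-a * logWeight t₀ t)
      * (Z' t - a * (Real.log (t₀ - t) ^ 2 + Real.log (t₀ - t) ^ 4) * Z t)
      - a * Real.exp (26 * a) * R ≤ 0 := fun t ht => by
    have e1 : Real.exp (-a * logWeight t₀ t) ≤ Real.exp (26 * a) := by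
      rw [Real.exp_le_exp]
      have := neg_le_logWeight (ht.2.trans_lt h2) (by linarith [ht.1])
      nlinarith
    have e2 : Real.exp (-a * logWeight t₀ t)
        * (Z' t - a * (Real.log (t₀ - t) ^ 2 + Real.log (t₀ - t) ^ 4) * Z t)
        ≤ Real.exp (-a * logWeight t₀ t) * (a * R) :=
      mul_le_mul_of_nonneg_left (by linarith [hZ' t ht]) (Real.exp_pos _).le
    have e3 : Real.exp (-a * logWeight t₀ t) * (a * R) ≤ Real.exp (26 * a) * (a * R) :=
      mul_le_mul_of_nonneg_right e1 (by positivity)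
    linarith
  have hanti : AntitoneOn Y (Set.Icc t₁ t₂) := antitoneOn_of_hasDerivWithinAt_nonpos (convex_Icc _ _)
    (fun s hs => (hd s hs).continuousAt.continuousWithinAt)
    (fun s hs => (hd s (interior_subset hs)).hasDerivWithinAt)
    (fun s hs => hneg s (interior_subset hs))
  have h3 := hanti (Set.left_mem_Icc.2 h12) (Set.right_mem_Icc.2 h12) h12
  simp only [hY] at h3
  have h4 : Real.exp (a * logWeight t₀ t₂) ≤ 1 := by
    rw [Real.exp_le_one_iff]
    exact mul_nonpos_of_nonneg_of_nonpos ha (logWeight_nonpos h2 (by linarith))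
  have h5 : Real.exp (-a * logWeight t₀ t₂) * Z t₂ ≤ Real.exp (-a * logWeight t₀ t₁) * Z t₁
      + a * Real.exp (26 * a) * R * (t₂ - t₁) := by linarith
  have h6 := mul_le_mul_of_nonneg_left h5 (Real.exp_pos (a * logWeight t₀ t₂)).le
  rw [mul_add, ← mul_assoc, ← mul_assoc, ← Real.exp_add, ← Real.exp_add] at h6
  rw [show a * logWeight t₀ t₂ + -a * logWeight t₀ t₂ = 0 by ring, Real.exp_zero, one_mul,
    show a * logWeight t₀ t₂ + -a * logWeight t₀ t₁
      = a * (logWeight t₀ t₂ - logWeight t₀ t₁) by ring] at h6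
  refine h6.trans (add_le_add le_rfl ?_)
  have h7 : 0 ≤ a * Real.exp (26 * a) * R * (t₂ - t₁) :=
    mul_nonneg (by positivity) (by linarith)
  nlinarith

end QKFlow

end

noncomputable section

namespace QKFlow

open Matrix Finset MeasureTheory

/-! ### The differential inequality for the local energy -/

/-- Comparison with the Euclidean metric bounds all entries, and the Leibniz expansion of the
determinant has `8!` terms. -/
lemma BoundedNormalMetric.sqrt_det_le {K C r₀ : ℝ} {gm : E8 → Mat}
    (h : BoundedNormalMetric K C r₀ gm) (hC : 0 ≤ C) (hr₀ : r₀ < 1) {y : E8} (hy : ‖y‖ ≤ r₀) :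
    √(gm y).det ≤ √((Nat.factorial 8 : ℝ) * Real.exp (2 * C) ^ 8) := by
  obtain ⟨P, hP⟩ := h.normal.metric.frame y (mem_ball_zero_iff.2 (hy.trans_lt hr₀))
  have h1 : ∀ i : Fin 8, quad (gm y) (Pi.single i 1) ≤ Real.exp (2 * C) := fun i => by
    have := (h.normal.quad_bounds hC hr₀ h.radial hy (Pi.single i 1)).2
    simpa using this
  have h2 : ∀ i j, |gm y i j| ≤ Real.exp (2 * C) := fun i j => by
    have h3 := abs_dotProduct_le hP (Pi.single i 1) (Pi.single j 1)
    simp only [Matrix.mulVec_single_one, single_one_dotProduct, Matrix.col_apply] at h3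
    refine h3.trans ?_
    calc _ ≤ √(Real.exp (2 * C)) * √(Real.exp (2 * C)) :=
          mul_le_mul (Real.sqrt_le_sqrt (h1 i)) (Real.sqrt_le_sqrt (h1 j)) (Real.sqrt_nonneg _)
            (Real.sqrt_nonneg _)
      _ = _ := Real.mul_self_sqrt (Real.exp_pos _).le
  refine Real.sqrt_le_sqrt ?_
  have h3 := Matrix.det_le (abv := AbsoluteValue.abs) (A := gm y) h2
  rw [Fintype.card_fin, nsmul_eq_mul] at h3
  exact (le_abs_self _).trans h3

/-- Young's inequality `√h ≤ l h / 2 + 1 / (2 l)` is integrated with a free parameter `l`; the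
choice `l = 1 / √E` gives the bound, and for `E = 0` one lets `l` tend to infinity. -/
lemma setIntegral_sqrt_mul_le {K : Set E8} (hK : IsCompact K) {h s : E8 → ℝ}
    (hc : ContinuousOn h K) (sc : ContinuousOn s K) (h0 : ∀ y ∈ K, 0 ≤ h y)
    (s0 : ∀ y ∈ K, 0 ≤ s y) {E V : ℝ} (hE : 0 ≤ E) (hV : 0 ≤ V)
    (h1 : ∫ y in K, h y * s y ≤ 2 * E) (h2 : ∫ y in K, s y ≤ V) :
    ∫ y in K, √(h y) * s y ≤ (1 + V / 2) * √E := by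
  have key : ∀ l : ℝ, 0 < l → ∫ y in K, √(h y) * s y ≤ l * E + V / (2 * l) := fun l hl => by
    have hb : ∀ y ∈ K, √(h y) * s y ≤ l / 2 * (h y * s y) + 1 / (2 * l) * s y := fun y hy => by
      have e1 : √(h y) ≤ l / 2 * h y + 1 / (2 * l) := by
        have e2 := Real.sq_sqrt (h0 y hy)
        have e3 : 0 ≤ (l * √(h y) - 1) ^ 2 / (2 * l) := by positivity
        have e4 : (l * √(h y) - 1) ^ 2 / (2 * l) = l / 2 * √(h y) ^ 2 - √(h y) + 1 / (2 * l) := by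
          field_simp; ring
        rw [e4, e2] at e3
        linarith
      have := mul_le_mul_of_nonneg_right e1 (s0 y hy)
      linarith
    have i1 : IntegrableOn (fun y => l / 2 * (h y * s y)) K :=
      ((hc.mul sc).integrableOn_compact hK).const_mul _
    have i2 : IntegrableOn (fun y => 1 / (2 * l) * s y) K := (sc.integrableOn_compact hK).const_mul _
    have e5 := setIntegral_mono_on ((hc.sqrt.mul sc).integrableOn_compact hK) (i1.add i2)
      hK.measurableSet hb
    refine e5.trans ?_
    have e6 := integral_add i1 i2
    refine (le_of_eq e6).trans ?_
    rw [integral_const_mul, integral_const_mul]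
    have e7 := mul_le_mul_of_nonneg_left h1 (show 0 ≤ l / 2 by positivity)
    have e8 := mul_le_mul_of_nonneg_left h2 (show 0 ≤ 1 / (2 * l) by positivity)
    calc _ ≤ l / 2 * (2 * E) + 1 / (2 * l) * V := add_le_add e7 e8
      _ = _ := by ring
  rcases hE.eq_or_lt with h3 | h3
  · rw [← h3, Real.sqrt_zero, mul_zero]
    refine le_of_forall_pos_le_add fun ε hε => ?_
    have h4 := key ((V + 1) / (2 * ε)) (by positivity)
    rw [← h3, mul_zero, zero_add] at h4
    refine h4.trans ?_
    rw [zero_add, div_le_iff₀ (by positivity)]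
    have : ε * (2 * ((V + 1) / (2 * ε))) = V + 1 := by field_simp
    linarith
  · have h4 := key (1 / √E) (by positivity)
    refine h4.trans (le_of_eq ?_)
    have h5 : √E ≠ 0 := (Real.sqrt_pos.2 h3).ne'
    have h6 := Real.mul_self_sqrt hE
    field_simp
    nlinarith

namespace ChartFlow

variable {gm : E8 → Mat} {t₀ : ℝ} {W : ℝ → E8 → Comp4}
  (h : ChartFlow (Metric.ball (0 : E8) 1) gm t₀ W) {φ : E8 → ℝ} (hφ : ContDiff ℝ ∞ φ) {t : ℝ}

include h hφ

lemma smooth_localDensity : ContDiffOn ℝ ∞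
    (fun q : ℝ × E8 => localDensity gm W φ t₀ q.1 q.2) (Set.Ioo 0 t₀ ×ˢ Metric.ball (0 : E8) 1) := by
  have h1 : ContDiffOn ℝ ∞ (fun q : ℝ × E8 => t₀ - q.1) (Set.Ioo 0 t₀ ×ˢ Metric.ball (0 : E8) 1) :=
    contDiffOn_const.sub contDiffOn_fst
  have hne : ∀ q ∈ Set.Ioo 0 t₀ ×ˢ Metric.ball (0 : E8) 1, t₀ - q.1 ≠ 0 := fun q hq =>
    (sub_pos.2 hq.1.2).ne'
  have h2 : ContDiffOn ℝ ∞ (fun q : ℝ × E8 => heatKernel t₀ q.1 q.2)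
      (Set.Ioo 0 t₀ ×ˢ Metric.ball (0 : E8) 1) := by
    refine (contDiffOn_const.div ((contDiffOn_const.mul h1).pow 4) fun q hq => ?_).mul
      (Real.contDiff_exp.comp_contDiffOn ((((contDiff_norm_sq ℝ).comp_contDiffOn
        contDiffOn_snd).neg).div (contDiffOn_const.mul h1) fun q hq => ?_))
    · have := hne q hq
      positivity
    · exact mul_ne_zero (by norm_num) (hne q hq)
  have h3 : ContDiffOn ℝ ∞ (fun q : ℝ × E8 => enDensity gm W q.1 q.2)
      (Set.Ioo 0 t₀ ×ˢ Metric.ball (0 : E8) 1) :=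
    h.smooth_enDensity.mono (Set.prod_mono Set.Ioo_subset_Ico_self subset_rfl)
  exact h1.mul ((h3.mul (h2.mul ((hφ.comp_contDiffOn contDiffOn_snd).pow 2))).mul
    (h.metric.contDiffOn_sqrt_det.comp contDiffOn_snd fun q hq => hq.2))

lemma continuousOn_localDensity (ht : t ∈ Set.Ico 0 t₀) :
    ContinuousOn (localDensity gm W φ t₀ t) (Metric.ball (0 : E8) 1) :=
  continuousOn_const.mul (((h.contDiffOn_enDensity ht).continuousOn.mul
    (contDiff_cutKernel hφ t₀ t).continuous.continuousOn).mul
      h.metric.contDiffOn_sqrt_det.continuousOn)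

lemma continuousOn_localDeriv (ht : t ∈ Set.Ico 0 t₀) :
    ContinuousOn (localDeriv gm W φ t₀ t) (Metric.ball (0 : E8) 1) := by
  have hX : ContinuousOn (fun y => ∑ m, ∑ n, (gm y)⁻¹ m n *
      br (torEnd gm W t m y) (covMat gm n (divEnd gm W t) y)) (Metric.ball (0 : E8) 1) := by
    refine continuousOn_finsetSum _ fun m _ => continuousOn_finsetSum _ fun n _ => ?_
    exact ((h.metric.smooth_inv m n).mul ((h.slice_torEnd ht m).br
      ((h.slice_divEnd ht).covMat h.metric n))).continuousOn
  refine h.metric.contDiffOn_sqrt_det.continuousOn.mul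
    ((contDiff_cutKernel hφ t₀ t).continuous.continuousOn.mul (ContinuousOn.add ?_ ?_))
  · exact (h.contDiffOn_enDensity ht).continuousOn.mul (continuousOn_const.sub
      ((continuous_norm.pow 2).continuousOn.div_const _))
  · exact continuousOn_const.mul hX

lemma smooth_monoField (ht : t ∈ Set.Ico 0 t₀) (m : Fin 8) :
    ContDiffOn ℝ ∞ (monoField gm W φ t₀ t m) (Metric.ball (0 : E8) 1) := by
  have sψ : ContDiffOn ℝ ∞ (cutKernel φ t₀ t) (Metric.ball (0 : E8) 1) :=
    (contDiff_cutKernel hφ t₀ t).contDiffOn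
  have sb : MatSmooth (Metric.ball (0 : E8) 1) (fun z => cutKernel φ t₀ t z •
      (torVec gm W t (fun y => y) z - (2 * (t₀ - t)) • divEnd gm W t z)) :=
    ((h.smooth_torVec_id ht).sub (MatSmooth.smul contDiffOn_const (h.slice_divEnd ht))).smul sψ
  refine ContDiffOn.sub (ContDiffOn.sum fun n _ => (h.metric.contDiffOn_sqrt_det.mul
    (h.metric.smooth_inv m n)).mul ((h.slice_torEnd ht n).br sb)) ?_
  exact contDiffOn_const.mul (((h.metric.contDiffOn_sqrt_det.mul (h.contDiffOn_enDensity ht)).mul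
    sψ).mul (coordL m).contDiff.contDiffOn)

end ChartFlow

/-- For the curvature term: `r = ‖y‖` and `q = |T|`. The first summand is absorbed into `Z`; in the
second the factor `r²` is kept, since `∫ r² G` is of order `t₀ - t`. -/
lemma young_weighted_le {r q ψ s l D G b : ℝ} (hψ : 0 ≤ ψ)
    (hψG : ψ ≤ G * b) (hs : 0 ≤ s) (hsD : s ≤ D) (hl : 0 < l) :
    s * (r * q * ψ) ≤ l / 2 * (q ^ 2 * ψ * s) + b * D / (2 * l) * (r ^ 2 * G) := by
  have f1 : r * q ≤ l / 2 * q ^ 2 + r ^ 2 / (2 * l) := by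
    have e3 : 0 ≤ (l * q - r) ^ 2 / (2 * l) := by positivity
    have e4 : (l * q - r) ^ 2 / (2 * l) = l / 2 * q ^ 2 - r * q + r ^ 2 / (2 * l) := by
      field_simp; ring
    rw [e4] at e3
    linarith
  have f2 := mul_le_mul_of_nonneg_right f1 (mul_nonneg hψ hs)
  have f3 : r ^ 2 / (2 * l) * (ψ * s) ≤ r ^ 2 / (2 * l) * (G * b * D) :=
    mul_le_mul_of_nonneg_left (mul_le_mul hψG hsD hs (hψ.trans hψG)) (by positivity)
  have f4 : r ^ 2 / (2 * l) * (G * b * D) = b * D / (2 * l) * (r ^ 2 * G) := by ring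
  linarith

/-- One constant dominates every coefficient. It is applied with `n = N⁴`, `e = √E`, `M = 1 / log²
N` and `x = e⁴`; the `19` covers both the `16 + 1/2` in front of `L² Z` and the `2` in front of the
energy. -/
lemma sum_le_const_mul {A B D V E e L Z n M X₁ X₂ x : ℝ} (hA0 : 0 ≤ A) (hD0 : 0 ≤ D) (hV0 : 0 ≤ V)
    (hE0 : 0 ≤ E) (he : 0 ≤ e) (hZ0 : 0 ≤ Z) (hn : 1 ≤ n) (hM : 0 ≤ M) (hx : 0 ≤ x)
    (hX₁ : X₁ ≤ 32 * B ^ 2 * D * M) (hX₂ : X₂ ≤ n * B ^ 2 * ((1 + V / 2) * e)) :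
    A * ((1 + x * B ^ 2) * (2 * E) + (16 * L ^ 2 + L ^ 2 / 2) * Z + X₁ + X₂)
      ≤ A * (19 + 2 * x * B ^ 2 + 32 * B ^ 2 * D + B ^ 2 * (1 + V / 2)) * (L ^ 2 + L ^ 4) * Z
        + A * (19 + 2 * x * B ^ 2 + 32 * B ^ 2 * D + B ^ 2 * (1 + V / 2))
          * (n * (E + e) + M) := by
  set S := 19 + 2 * x * B ^ 2 + 32 * B ^ 2 * D + B ^ 2 * (1 + V / 2) with hS
  have q1 : (16 * L ^ 2 + L ^ 2 / 2) * Z ≤ S * ((L ^ 2 + L ^ 4) * Z) := by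
    have : 0 ≤ L ^ 2 * Z := by positivity
    have : 0 ≤ L ^ 4 * Z := by positivity
    have hS17 : 17 ≤ S := by
      have : 0 ≤ 2 * x * B ^ 2 + 32 * B ^ 2 * D + B ^ 2 * (1 + V / 2) := by positivity
      linarith
    nlinarith
  have q2 : (1 + x * B ^ 2) * (2 * E) ≤ (2 + 2 * x * B ^ 2) * (n * E) := by
    have : E ≤ n * E := by nlinarith
    have := mul_le_mul_of_nonneg_left this (show 0 ≤ 2 + 2 * x * B ^ 2 by positivity)
    linarith
  have q3 := hM
  have q4 : 0 ≤ n * E := by positivity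
  have q5 : 0 ≤ n * e := by positivity
  have q6 : (2 + 2 * x * B ^ 2) * (n * E)
      + 32 * B ^ 2 * D * (M) + B ^ 2 * (1 + V / 2) * (n * e)
      ≤ S * (n * E + n * e + M) := by
    have r1 : 2 + 2 * x * B ^ 2 ≤ S := by
      have : 0 ≤ 32 * B ^ 2 * D + B ^ 2 * (1 + V / 2) := by positivity
      linarith
    have r2 : 32 * B ^ 2 * D ≤ S := by
      have : 0 ≤ 2 * x * B ^ 2 + B ^ 2 * (1 + V / 2) := by positivity
      linarith
    have r3 : B ^ 2 * (1 + V / 2) ≤ S := by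
      have : 0 ≤ 2 * x * B ^ 2 + 32 * B ^ 2 * D := by positivity
      linarith
    have := mul_le_mul_of_nonneg_right r1 q4
    have := mul_le_mul_of_nonneg_right r2 q3
    have := mul_le_mul_of_nonneg_right r3 q5
    linarith
  have q7 : (1 + x * B ^ 2) * (2 * E) + (16 * L ^ 2 + L ^ 2 / 2) * Z + X₁ + X₂
      ≤ S * ((L ^ 2 + L ^ 4) * Z) + S * (n * E + n * e + M) := by
    linarith
  have := mul_le_mul_of_nonneg_left q7 hA0
  linarith

/-- The integrated form of `BoundedNormalMetric.localDeriv_add_le`. -/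
lemma BoundedNormalMetric.setIntegral_localDeriv_le {K C r₀ : ℝ} {gm : E8 → Mat}
    (hg : BoundedNormalMetric K C r₀ gm) (hK : 0 ≤ K) (hC : 0 ≤ C) (hr₀ : r₀ < 1) {φ : E8 → ℝ}
    (hφ : ContDiff ℝ ∞ φ) (hs : tsupport φ ⊆ Metric.closedBall (0 : E8) r₀) {c : ℝ}
    (hc : ∀ y ∈ Metric.ball (0 : E8) (1 / 2), φ y = c) {B A D V : ℝ} (hB : ∀ y, |φ y| ≤ B)
    (hB' : ∀ y, ∑ m, pderiv m φ y ^ 2 ≤ B ^ 2)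
    (hA : A = 24 * 16 ^ 4 * B ^ 2 * (2 * Real.exp (2 * C) + 1) + 5 * C + 8 * K) (hA0 : 0 < A)
    (hD : D = √((Nat.factorial 8 : ℝ) * Real.exp (2 * C) ^ 8))
    (hV : V = D * (volume (Metric.closedBall (0 : E8) r₀)).toReal) {t₀ : ℝ}
    {W : ℝ → E8 → Comp4} (hW : ChartFlow (Metric.ball (0 : E8) 1) gm t₀ W) {E : ℝ} (hE0 : 0 ≤ E)
    {t : ℝ} (ht : t ∈ Set.Ioo 0 t₀) (h1 : t₀ - t ≤ 1)
    (hE : ∫ y in Metric.closedBall (0 : E8) r₀, enDensity gm W t y * √(gm y).det ≤ 2 * E)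
    {γ δ : ℝ} (hγ : 0 ≤ γ) (hδ : 0 ≤ δ)
    (hpt : ∀ y ∈ Metric.closedBall (0 : E8) r₀, √(gm y).det *
      (‖y‖ * √(enDensity gm W t y) * cutKernel φ t₀ t y)
        ≤ Real.log (t₀ - t) ^ 2 / 2 * localDensity gm W φ t₀ t y
        + γ * (‖y‖ ^ 2 * heatKernel t₀ t y) + δ * (√(enDensity gm W t y) * √(gm y).det)) :
    ∫ y in Metric.closedBall (0 : E8) r₀, localDeriv gm W φ t₀ t y
      ≤ A * ((1 + Real.exp 4 * B ^ 2) * (2 * E)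
        + (16 * Real.log (t₀ - t) ^ 2 + Real.log (t₀ - t) ^ 2 / 2)
          * (∫ y in Metric.closedBall (0 : E8) r₀, localDensity gm W φ t₀ t y)
        + γ * (64 * (t₀ - t)) + δ * ((1 + V / 2) * √E)) := by
  have hKU : Metric.closedBall (0 : E8) r₀ ⊆ Metric.ball (0 : E8) 1 :=
    Metric.closedBall_subset_ball hr₀
  have hcomp := isCompact_closedBall (0 : E8) r₀
  have hD0 : 0 ≤ D := hD ▸ Real.sqrt_nonneg _
  have hV0 : 0 ≤ V := hV ▸ mul_nonneg hD0 ENNReal.toReal_nonneg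
  have ht' : t ∈ Set.Ico 0 t₀ := ⟨ht.1.le, ht.2⟩
  have hτ : 0 < t₀ - t := sub_pos.2 ht.2
  have ch : ContinuousOn (enDensity gm W t) (Metric.closedBall (0 : E8) r₀) :=
    (hW.contDiffOn_enDensity ht').continuousOn.mono hKU
  have cs : ContinuousOn (fun y => √(gm y).det) (Metric.closedBall (0 : E8) r₀) :=
    hW.metric.contDiffOn_sqrt_det.continuousOn.mono hKU
  have cψ : ContinuousOn (cutKernel φ t₀ t) (Metric.closedBall (0 : E8) r₀) :=
    (contDiff_cutKernel hφ t₀ t).continuous.continuousOn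
  have cG : ContinuousOn (fun y => ‖y‖ ^ 2 * heatKernel t₀ t y) (Metric.closedBall (0 : E8) r₀) :=
    (continuous_norm.pow 2).continuousOn.mul (contDiff_heatKernel t₀ t).continuous.continuousOn
  have cr : ContinuousOn (fun y : E8 => ‖y‖) (Metric.closedBall (0 : E8) r₀) :=
    continuous_norm.continuousOn
  have h0 : ∀ y ∈ Metric.closedBall (0 : E8) r₀, 0 ≤ enDensity gm W t y := fun y hy =>
    hW.enDensity_nonneg ht' (hKU hy)
  have hsD : ∀ y ∈ Metric.closedBall (0 : E8) r₀, √(gm y).det ≤ D := fun y hy =>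
    hD ▸ hg.sqrt_det_le hC hr₀ (mem_closedBall_zero_iff.1 hy)
  have hdiv := setIntegral_sum_pderiv_eq_zero Metric.isOpen_ball hcomp hKU
    (V := fun m => monoField gm W φ t₀ t m) (hW.smooth_monoField hφ ht') fun m y _ hy => by
      have e : cutKernel φ t₀ t y = 0 := by
        rw [cutKernel, image_eq_zero_of_notMem_tsupport fun h => hy (hs h)]
        ring
      simp only [monoField, e, zero_smul, mul_zero, zero_mul, sub_zero]
      exact sum_eq_zero fun n _ => by rw [← zero_smul ℝ (0 : Mat), br_smul_right]; ring
  have idiv : IntegrableOn (fun y => ∑ m, pderiv m (monoField gm W φ t₀ t m) y)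
      (Metric.closedBall (0 : E8) r₀) := by
    refine ContinuousOn.integrableOn_compact hcomp (continuousOn_finsetSum _ fun m _ => ?_)
    exact (contDiffOn_pderiv Metric.isOpen_ball
      (hW.smooth_monoField hφ ht' m) m).continuousOn.mono hKU
  have ider : IntegrableOn (localDeriv gm W φ t₀ t) (Metric.closedBall (0 : E8) r₀) :=
    ((hW.continuousOn_localDeriv hφ ht').mono hKU).integrableOn_compact hcomp
  have iden : IntegrableOn (localDensity gm W φ t₀ t) (Metric.closedBall (0 : E8) r₀) :=
    ((hW.continuousOn_localDensity hφ ht').mono hKU).integrableOn_compact hcomp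
  have ihs : IntegrableOn (fun y => enDensity gm W t y * √(gm y).det)
      (Metric.closedBall (0 : E8) r₀) := (ch.mul cs).integrableOn_compact hcomp
  have iG : IntegrableOn (fun y : E8 => ‖y‖ ^ 2 * heatKernel t₀ t y)
      (Metric.closedBall (0 : E8) r₀) := cG.integrableOn_compact hcomp
  have iq : IntegrableOn (fun y => √(enDensity gm W t y) * √(gm y).det)
      (Metric.closedBall (0 : E8) r₀) := (ch.sqrt.mul cs).integrableOn_compact hcomp
  have hfin : volume (Metric.closedBall (0 : E8) r₀) < ⊤ := hcomp.measure_lt_top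
  have hvol : ∫ y in Metric.closedBall (0 : E8) r₀, √(gm y).det ≤ V := by
    have e1 := setIntegral_mono_on (cs.integrableOn_compact hcomp)
      (integrableOn_const (C := D) hfin.ne) hcomp.measurableSet hsD
    refine e1.trans (le_of_eq ?_)
    rw [setIntegral_const, smul_eq_mul, mul_comm]
    exact hV.symm
  have hq := setIntegral_sqrt_mul_le hcomp ch cs h0 (fun y _ => Real.sqrt_nonneg _) hE0 hV0
    (hE) hvol
  set L := Real.log (t₀ - t) with hL
  set Z := ∫ y in Metric.closedBall (0 : E8) r₀, localDensity gm W φ t₀ t y with hZ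
  have j1 := ihs.const_mul (1 + Real.exp 4 * B ^ 2)
  have j2 := iden.const_mul (16 * L ^ 2 + L ^ 2 / 2)
  have j3 := iG.const_mul γ
  have j4 := iq.const_mul δ
  have j := (((j1.add j2).add j3).add j4).const_mul A
  have hb : ∀ y ∈ Metric.closedBall (0 : E8) r₀, localDeriv gm W φ t₀ t y
      + ∑ m, pderiv m (monoField gm W φ t₀ t m) y
      ≤ A * ((1 + Real.exp 4 * B ^ 2) * (enDensity gm W t y * √(gm y).det)
        + (16 * L ^ 2 + L ^ 2 / 2) * localDensity gm W φ t₀ t y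
        + γ * (‖y‖ ^ 2 * heatKernel t₀ t y) + δ * (√(enDensity gm W t y) * √(gm y).det)) := by
    intro y hy
    have hyr : ‖y‖ ≤ r₀ := mem_closedBall_zero_iff.1 hy
    refine (hA ▸ hg.localDeriv_add_le hK hC hr₀ hW hφ hB hB' hc ht h1 hyr).trans ?_
    refine mul_le_mul_of_nonneg_left ?_ hA0.le
    have e1 := mul_le_mul_of_nonneg_right (sq_mul_heatKernel_le ht.2 h1 (hyr.trans hr₀.le))
      (show 0 ≤ φ y ^ 2 * enDensity gm W t y * √(gm y).det from
        mul_nonneg (mul_nonneg (sq_nonneg _) (h0 y hy)) (Real.sqrt_nonneg _))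
    have e2 : Real.exp 4 * (φ y ^ 2 * enDensity gm W t y * √(gm y).det)
        ≤ Real.exp 4 * (B ^ 2 * enDensity gm W t y * √(gm y).det) := by
      have : φ y ^ 2 ≤ B ^ 2 := by
        rw [← sq_abs]
        exact pow_le_pow_left₀ (abs_nonneg _) (hB y) 2
      have := h0 y hy
      gcongr
    have e3 := hpt y hy
    have e4 : √(gm y).det * (‖y‖ ^ 2 * enDensity gm W t y * cutKernel φ t₀ t y)
        = ‖y‖ ^ 2 * heatKernel t₀ t y * (φ y ^ 2 * enDensity gm W t y * √(gm y).det) := by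
      rw [cutKernel]; ring
    have e5 : 16 * L ^ 2 * localDensity gm W φ t₀ t y = 16 * L ^ 2 * (t₀ - t)
        * heatKernel t₀ t y * (φ y ^ 2 * enDensity gm W t y * √(gm y).det) := by
      rw [localDensity, cutKernel]; ring
    rw [mul_add, mul_add, e4]
    rw [add_mul] at e1
    linarith
  have e6 := setIntegral_mono_on (ider.add idiv) j hcomp.measurableSet hb
  have e7 := integral_add ider idiv
  rw [hdiv, add_zero] at e7
  rw [← e7]
  refine e6.trans ?_
  have e8 : ∫ y in Metric.closedBall (0 : E8) r₀,
      A * ((1 + Real.exp 4 * B ^ 2) * (enDensity gm W t y * √(gm y).det)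
        + (16 * L ^ 2 + L ^ 2 / 2) * localDensity gm W φ t₀ t y
        + γ * (‖y‖ ^ 2 * heatKernel t₀ t y) + δ * (√(enDensity gm W t y) * √(gm y).det))
      = A * ((1 + Real.exp 4 * B ^ 2) * (∫ y in Metric.closedBall (0 : E8) r₀,
          enDensity gm W t y * √(gm y).det)
        + (16 * L ^ 2 + L ^ 2 / 2) * Z
        + γ * (∫ y in Metric.closedBall (0 : E8) r₀, ‖y‖ ^ 2 * heatKernel t₀ t y)
        + δ * ∫ y in Metric.closedBall (0 : E8) r₀, √(enDensity gm W t y) * √(gm y).det) := by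
    rw [integral_const_mul]
    congr 1
    refine (integral_add ((j1.add j2).add j3) j4).trans ?_
    rw [integral_const_mul]
    congr 1
    refine (integral_add (j1.add j2) j3).trans ?_
    rw [integral_const_mul]
    congr 1
    refine (integral_add j1 j2).trans ?_
    rw [integral_const_mul, integral_const_mul]
  refine (le_of_eq e8).trans (mul_le_mul_of_nonneg_left ?_ hA0.le)
  have p1 := mul_le_mul_of_nonneg_left hE
    (show 0 ≤ 1 + Real.exp 4 * B ^ 2 by positivity)
  have p2 := mul_le_mul_of_nonneg_left (setIntegral_sq_mul_heatKernel_le ht.2 hcomp) hγ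
  have p3 := mul_le_mul_of_nonneg_left hq hδ
  linarith

/-- The constant `a` is fixed before the metric, the flow and `N`, which is the uniformity claimed
in the theorem. The only error not covered by `Z` and the energy is the curvature term, treated
according to whether `t₀ - t` is smaller than `1 / N`. -/
lemma exists_deriv_le {K C r₀ : ℝ} (hK : 0 ≤ K) (hC : 0 ≤ C) (hr₀ : r₀ < 1) {φ : E8 → ℝ}
    (hφ : ContDiff ℝ ∞ φ) (hs : tsupport φ ⊆ Metric.closedBall (0 : E8) r₀) {c : ℝ}
    (hc : ∀ y ∈ Metric.ball (0 : E8) (1 / 2), φ y = c) :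
    ∃ a, 0 < a ∧ ∀ gm, BoundedNormalMetric K C r₀ gm → ∀ (t₀ : ℝ) (W : ℝ → E8 → Comp4),
      ChartFlow (Metric.ball (0 : E8) 1) gm t₀ W → ∀ E, 0 ≤ E →
      (∀ t ∈ Set.Ico 0 t₀, ∫ y in Metric.closedBall (0 : E8) r₀,
        enDensity gm W t y * √(gm y).det ≤ 2 * E) →
      ∀ N : ℝ, 1 < N → ∀ t ∈ Set.Ioo 0 t₀, t₀ - t ≤ 1 →
      HasDerivAt (fun s => ∫ y in Metric.closedBall (0 : E8) r₀, localDensity gm W φ t₀ s y)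
        (∫ y in Metric.closedBall (0 : E8) r₀, localDeriv gm W φ t₀ t y) t ∧
      ∫ y in Metric.closedBall (0 : E8) r₀, localDeriv gm W φ t₀ t y
        ≤ a * (Real.log (t₀ - t) ^ 2 + Real.log (t₀ - t) ^ 4)
            * (∫ y in Metric.closedBall (0 : E8) r₀, localDensity gm W φ t₀ t y)
          + a * (N ^ 4 * (E + √E) + 1 / Real.log N ^ 2) := by
  have hKU : Metric.closedBall (0 : E8) r₀ ⊆ Metric.ball (0 : E8) 1 :=
    Metric.closedBall_subset_ball hr₀
  have hcomp := isCompact_closedBall (0 : E8) r₀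
  obtain ⟨B, hB0, hB, hB'⟩ := exists_cutoff_bound hφ (hs.trans hKU)
  set A := 24 * 16 ^ 4 * B ^ 2 * (2 * Real.exp (2 * C) + 1) + 5 * C + 8 * K with hA
  set D := √((Nat.factorial 8 : ℝ) * Real.exp (2 * C) ^ 8) with hD
  set V := D * (volume (Metric.closedBall (0 : E8) r₀)).toReal with hV
  have hA0 : 0 < A := by positivity
  have hD0 : 0 ≤ D := Real.sqrt_nonneg _
  have hV0 : 0 ≤ V := mul_nonneg hD0 ENNReal.toReal_nonneg
  refine ⟨A * (19 + 2 * Real.exp 4 * B ^ 2 + 32 * B ^ 2 * D + B ^ 2 * (1 + V / 2)), by positivity,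
    fun gm hg t₀ W hW E hE0 hE N hN t ht h1 => ?_⟩
  have ht' : t ∈ Set.Ico 0 t₀ := ⟨ht.1.le, ht.2⟩
  have hτ : 0 < t₀ - t := sub_pos.2 ht.2
  refine ⟨hasDerivAt_setIntegral Metric.isOpen_ball hcomp hKU isOpen_Ioo (hW.smooth_localDensity hφ)
    ht fun y hy => hW.hasDerivAt_localDensity φ ht (hKU hy), ?_⟩
  have h0 : ∀ y ∈ Metric.closedBall (0 : E8) r₀, 0 ≤ enDensity gm W t y := fun y hy =>
    hW.enDensity_nonneg ht' (hKU hy)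
  have hsD : ∀ y ∈ Metric.closedBall (0 : E8) r₀, √(gm y).det ≤ D := fun y hy =>
    hg.sqrt_det_le hC hr₀ (mem_closedBall_zero_iff.1 hy)
  have hZ0 : 0 ≤ ∫ y in Metric.closedBall (0 : E8) r₀, localDensity gm W φ t₀ t y :=
    setIntegral_nonneg hcomp.measurableSet fun y hy => mul_nonneg hτ.le (mul_nonneg (mul_nonneg
      (h0 y hy) (mul_nonneg (heatKernel_pos ht.2 y).le (sq_nonneg _))) (Real.sqrt_nonneg _))
  set L := Real.log (t₀ - t) with hL
  set Z := ∫ y in Metric.closedBall (0 : E8) r₀, localDensity gm W φ t₀ t y with hZ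
  have hψ0 : ∀ y, 0 ≤ cutKernel φ t₀ t y := fun y =>
    mul_nonneg (heatKernel_pos ht.2 y).le (sq_nonneg _)
  have hψG : ∀ y, cutKernel φ t₀ t y ≤ heatKernel t₀ t y * B ^ 2 := fun y => by
    refine mul_le_mul_of_nonneg_left ?_ (heatKernel_pos ht.2 y).le
    rw [← sq_abs]
    exact pow_le_pow_left₀ (abs_nonneg _) (hB y) 2
  have hN4 : 1 ≤ N ^ 4 := one_le_pow₀ hN.le
  have hlogN : 0 < Real.log N := Real.log_pos hN
  have hL4 : 0 ≤ L ^ 4 := by positivity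
  have hsqE := Real.sqrt_nonneg E
  have hM : 0 ≤ 1 / Real.log N ^ 2 := by positivity
  -- Close to `t₀` the logarithm is large, `log² N ≤ L²`; away from `t₀` the kernel is at most `N⁴`.
  rcases lt_or_ge (t₀ - t) (1 / N) with h2 | h2
  · have hLN : Real.log N ≤ -L := by
      have := Real.log_le_log hτ h2.le
      rw [one_div, Real.log_inv] at this
      linarith
    have hL2 : Real.log N ^ 2 ≤ L ^ 2 := pow_le_pow_left₀ hlogN.le hLN 2 |>.trans_eq (neg_sq L)
    have hL2p : 0 < L ^ 2 := lt_of_lt_of_le (by positivity) hL2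
    -- The value of `γ` comes from Young's inequality with `l = L² (t₀ - t)`: the quadratic part is
    -- then `L² / 2` times the integrand of `Z`, and the other part integrates to a multiple of `1 /
    -- L²`.
    refine (hg.setIntegral_localDeriv_le hK hC hr₀ hφ hs hc hB hB' hA hA0 hD hV hW hE0 ht h1
      (hE t ht') (γ := B ^ 2 * D / (2 * (L ^ 2 * (t₀ - t)))) (δ := 0) (by positivity) le_rfl
      fun y hy => ?_).trans (sum_le_const_mul hA0.le hD0 hV0 hE0 hsqE hZ0 hN4 hM
        (Real.exp_pos 4).le ?_ ?_)
    · refine (young_weighted_le (hψ0 y) (hψG y) (Real.sqrt_nonneg _) (hsD y hy)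
        (mul_pos hL2p hτ)).trans (le_of_eq ?_)
      rw [Real.sq_sqrt (h0 y hy), localDensity]
      ring
    · have e1 : B ^ 2 * D / (2 * (L ^ 2 * (t₀ - t))) * (64 * (t₀ - t))
          = 32 * B ^ 2 * D * (1 / L ^ 2) := by
        rw [div_mul_eq_mul_div, mul_one_div, div_eq_div_iff (by positivity) (by positivity)]
        ring
      rw [e1]
      exact mul_le_mul_of_nonneg_left (one_div_le_one_div_of_le (by positivity) hL2) (by positivity)
    · rw [zero_mul]; positivity
  -- Here `ψ ≤ N⁴ B²` and `‖y‖ ≤ 1`, so the curvature term is bounded by a multiple of `|T|` alone,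
  -- whose integral is at most a multiple of `√E`.
  · refine (hg.setIntegral_localDeriv_le hK hC hr₀ hφ hs hc hB hB' hA hA0 hD hV hW hE0 ht h1
      (hE t ht') (γ := 0) (δ := N ^ 4 * B ^ 2) le_rfl (by positivity)
      fun y hy => ?_).trans (sum_le_const_mul hA0.le hD0 hV0 hE0 hsqE hZ0 hN4 hM
        (Real.exp_pos 4).le ?_ le_rfl)
    · have hyr : ‖y‖ ≤ 1 := (mem_closedBall_zero_iff.1 hy).trans hr₀.le
      have hG := heatKernel_pos ht.2 y
      have g1 : heatKernel t₀ t y ≤ N ^ 4 := by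
        refine (heatKernel_le_of_le ht.2 y).trans ?_
        rw [div_le_iff₀ (by positivity), ← mul_pow]
        refine one_le_pow₀ ?_
        rw [div_le_iff₀ (by linarith)] at h2
        linarith
      have g2 : cutKernel φ t₀ t y ≤ N ^ 4 * B ^ 2 :=
        (hψG y).trans (mul_le_mul_of_nonneg_right g1 (sq_nonneg B))
      have g3 : ‖y‖ * cutKernel φ t₀ t y ≤ 1 * (N ^ 4 * B ^ 2) :=
        mul_le_mul hyr g2 (hψ0 y) zero_le_one
      have g4 := mul_le_mul_of_nonneg_right g3 (mul_nonneg (Real.sqrt_nonneg (enDensity gm W t y))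
        (Real.sqrt_nonneg (gm y).det))
      have g5 : 0 ≤ L ^ 2 / 2 * localDensity gm W φ t₀ t y := by
        refine mul_nonneg (by positivity) (mul_nonneg hτ.le (mul_nonneg (mul_nonneg (h0 y hy)
          (hψ0 y)) (Real.sqrt_nonneg _)))
      linarith
    · rw [zero_mul]; positivity

end QKFlow

end

/-! ### Assembly: from normal charts and flows on `M` to the estimates in the unit ball. -/

noncomputable section

namespace QKFlow

open Matrix Finset MeasureTheory

variable {M : Type*} [TopologicalSpace M] [ChartedSpace E8 M] [IsManifold (𝓡 8) ∞ M]

/-- The geodesic equation for the line `s ↦ s y` at `s = 1`: the second derivative vanishes and the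
velocity is `y`. -/
lemma IsNormalChart.normalMetric {g : SmoothMetric M} {p : M} {e : OpenPartialHomeomorph M E8}
    (h : IsNormalChart g p 1 e) : NormalMetric (metricCoeff g e) where
  metric := h.target_eq ▸ chartMetric_metricCoeff h.mem_atlas g
  center := h.orthonormal
  geodesic y hy k := by
    have h1 := h.geodesic y 1 (by simpa using hy) k
    have hd : ∀ i, deriv (fun r : ℝ => (r • y) i) = fun _ => y i := fun i => by
      funext s
      exact (((hasDerivAt_id s).mul_const (y i)).congr_deriv (one_mul _)).deriv
    rw [iteratedDeriv_succ, iteratedDeriv_one, hd k, deriv_const, zero_add] at h1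
    simpa only [hd, one_smul] using h1

lemma IsQKHarmonicFlow.localEnergy_eq [T2Space M] [CompactSpace M] {g : SmoothMetric M}
    {e : OpenPartialHomeomorph M E8} (he : e ∈ IsManifold.maximalAtlas (𝓡 8) ∞ M)
    (ht : e.target = Metric.ball (0 : E8) 1) {φ : E8 → ℝ} {r₀ : ℝ} (hr₀ : r₀ < 1)
    (hs : tsupport φ ⊆ Metric.closedBall (0 : E8) r₀) {t₀ : ℝ} {Ω : ℝ → FourForm M}
    (h : IsQKHarmonicFlow g t₀ Ω) {t : ℝ} (htt : t ∈ Set.Ico 0 t₀) :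
    localEnergy g e φ t₀ Ω t = ∫ y in Metric.closedBall (0 : E8) r₀,
      localDensity (metricCoeff g e) (fun t y => comp4 e (Ω t) y) φ t₀ t y := by
  rw [localEnergy, ← integral_const_mul]
  rw [setIntegral_congr_fun measurableSet_ball (g := fun y =>
    localDensity (metricCoeff g e) (fun t y => comp4 e (Ω t) y) φ t₀ t y) fun y hy => ?_]
  · refine setIntegral_eq_of_subset_of_forall_sdiff_eq_zero measurableSet_ball
      (Metric.closedBall_subset_ball hr₀) fun y hy => ?_
    rw [localDensity, cutKernel, image_eq_zero_of_notMem_tsupport fun h => hy.2 (hs h)]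
    ring
  · have := h.torsionNormSq_eq he htt (ht ▸ hy)
    simp only [localDensity, cutKernel, this]
    ring

end QKFlow

end

theorem mainTheorem8 {M : Type*} [TopologicalSpace M] [ChartedSpace QKFlow.E8 M]
    [IsManifold (𝓡 8) ∞ M] [T2Space M] [CompactSpace M]
    (g : QKFlow.SmoothMetric M) (hinj : QKFlow.InjRadiusGE g 1)
    (φ : QKFlow.E8 → ℝ) (hφ : ContDiff ℝ ∞ φ)
    (hφ_supp : tsupport φ ⊆ Metric.ball (0 : QKFlow.E8) 1)
    (hφ_const : ∃ c : ℝ, ∀ y ∈ Metric.ball (0 : QKFlow.E8) (1 / 2), φ y = c) :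
    ∃ C : ℝ, 0 < C ∧
      ∀ (p : M) (e : OpenPartialHomeomorph M QKFlow.E8), QKFlow.IsNormalChart g p 1 e →
      ∀ (t₀ : ℝ) (Ω : ℝ → QKFlow.FourForm M), QKFlow.IsQKHarmonicFlow g t₀ Ω →
      ∀ N : ℝ, 1 < N → ∀ t₁ t₂ : ℝ, t₀ - min 1 t₀ < t₁ → t₁ ≤ t₂ → t₂ < t₀ →
        QKFlow.localEnergy g e φ t₀ Ω t₂
          ≤ Real.exp (C * (QKFlow.logWeight t₀ t₂ - QKFlow.logWeight t₀ t₁))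
              * QKFlow.localEnergy g e φ t₀ Ω t₁
            + C * (N ^ 4 * (QKFlow.energy g (Ω 0) + √(QKFlow.energy g (Ω 0)))
                + 1 / Real.log N ^ 2) * (t₂ - t₁) := by
  obtain ⟨c, hc⟩ := hφ_const
  -- The support of `φ` stays in a ball of radius `r₀ < 1`, which depends on `φ` only. This gives
  -- compact domains of integration and the margin needed by the Riccati comparison.
  obtain ⟨r₀, hr₀, hs'⟩ := exists_lt_subset_ball (isClosed_tsupport φ) hφ_supp
  have hs := hs'.trans Metric.ball_subset_closedBall
  obtain ⟨K, hK, hcurv⟩ := QKFlow.exists_curvature_bound g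
  obtain ⟨C, hC, hrad⟩ := QKFlow.exists_normal_bound hK.le hr₀
  obtain ⟨a, ha, hder⟩ := QKFlow.exists_deriv_le hK.le hC.le hr₀ hφ hs hc
  -- The Gronwall argument yields `a` in the exponent and `a exp (26 a)` in front of the remainder;
  -- the larger of the two serves for both.
  refine ⟨a * Real.exp (26 * a), by positivity,
    fun p e he t₀ Ω hΩ N hN t₁ t₂ h1 h12 h2 => ?_⟩
  have hea : e.target = Metric.ball (0 : QKFlow.E8) 1 := he.target_eq
  have hpos : 0 < t₁ := by linarith [min_le_right 1 t₀]
  have hone : t₀ - t₁ ≤ 1 := by linarith [min_le_left 1 t₀]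
  have ht₀ : (0 : ℝ) ∈ Set.Ico 0 t₀ := ⟨le_rfl, by linarith⟩
  have hIcc : ∀ t ∈ Set.Icc t₁ t₂, t ∈ Set.Ioo 0 t₀ := fun t ht =>
    ⟨hpos.trans_le ht.1, ht.2.trans_lt h2⟩
  have hcurv' := hea ▸ hcurv e he.mem_atlas
  have hflow := hea ▸ hΩ.chartFlow he.mem_atlas
  have hE0 := hΩ.energy_nonneg ht₀
  have hN0 : 0 ≤ N ^ 4 * (QKFlow.energy g (Ω 0) + √(QKFlow.energy g (Ω 0)))
      + 1 / Real.log N ^ 2 := by positivity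
  have hZ : ∀ t ∈ Set.Icc t₁ t₂, _ := fun t ht =>
    hder (QKFlow.metricCoeff g e) ⟨he.normalMetric, hcurv', hrad _ he.normalMetric hcurv'⟩ t₀ _
      hflow (QKFlow.energy g (Ω 0)) hE0 (fun s hs =>
        (hΩ.setIntegral_enDensity_le hs he.mem_atlas (isCompact_closedBall _ _)
          (hea ▸ Metric.closedBall_subset_ball hr₀)).trans
          (mul_le_mul_of_nonneg_left (hΩ.energy_le hs) zero_le_two))
      N hN t (hIcc t ht) (by linarith [ht.1])
  have hfin := QKFlow.le_of_hasDerivAt_le_logWeight ha.le hN0 hone h12 h2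
    (fun t ht => (hZ t ht).1) fun t ht => (hZ t ht).2
  have ht1 : t₁ ∈ Set.Ico 0 t₀ := ⟨hpos.le, h12.trans_lt h2⟩
  have ht2 : t₂ ∈ Set.Ico 0 t₀ := ⟨(hpos.trans_le h12).le, h2⟩
  rw [hΩ.localEnergy_eq he.mem_atlas hea hr₀ hs ht1, hΩ.localEnergy_eq he.mem_atlas hea hr₀ hs ht2]
  -- Enlarging the constant in the exponent is allowed because the weight is increasing and `Z t₁`
  -- is nonnegative.
  refine hfin.trans (add_le_add_left (mul_le_mul_of_nonneg_right (Real.exp_le_exp.2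
    (mul_le_mul_of_nonneg_right ?_ (sub_nonneg.2 (QKFlow.logWeight_mono h12 h2)))) ?_) _)
  · exact le_mul_of_one_le_right ha.le (Real.one_le_exp (by positivity))
  · refine MeasureTheory.setIntegral_nonneg measurableSet_closedBall fun y hy => ?_
    have hy' : y ∈ Metric.ball (0 : QKFlow.E8) 1 := Metric.closedBall_subset_ball hr₀ hy
    exact mul_nonneg (sub_nonneg.2 ht1.2.le) (mul_nonneg (mul_nonneg (hflow.enDensity_nonneg ht1 hy')
      (mul_nonneg (QKFlow.heatKernel_pos ht1.2 y).le (sq_nonneg _))) (Real.sqrt_nonneg _))
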